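/- For a Borel measure $\mu$ on $\mathbb{R}^2$ and $0\le\alpha\le 2$ put $[\mu]_\alpha=\sup_{z\in\mathbb{R}^2,\ \rho>0}\rho^{-\alpha}\mu(B_\rho(z))$, where $B_\rho(z)$ is the Euclidean ball of radius $\rho$ centred at $z$. For a Schwartz function $f$ on $\mathbb{R}$ let $e^{it\partial_x^2}f(x)=(2\pi)^{-1}\int_{\mathbb{R}} e^{ix\xi}e^{it\xi^2}\widehat f(\xi)\,d\xi$ with $\widehat f(\xi)=\int_{\mathbb{R}} e^{-ix\xi}f(x)\,dx$. For $1\le p<\infty$ and $\gamma\in\mathbb{R}$ let $L^p_\gamma(\mathbb{R})$ be the space of tempered distributions $f$ with $\|f\|_{L^p_\gamma(\mathbb{R})}=\|(1-\partial_x^2)^{\gamma/2}f\|_{L^p(\mathbb{R})}<\infty$. Consider the estimate $$\|e^{it\partial_x^2}f\|_{L^p(\mathbb{R}\times[0,1],\,\mu)}\le C\,[\mu]_\alpha^{1/p}\,\|f\|_{L^p_\gamma(\mathbb{R})},\qquad(\ast)$$ with a constant $C$ that may depend on $\alpha,p,\gamma$ but not on $\mu$ or $f$. (i) (Sufficiency)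 Let $2\le p\le 4$ and suppose that $$\gamma>\begin{cases}\frac{2-\alpha}{2},&\alpha\in[1,2],\\[2pt] \frac{2-\alpha}{2}+\frac{\alpha-1}{p},&\alpha\in[0,1].\end{cases}$$ Then there is $C$ such that $(\ast)$ holds for every Borel measure $\mu$ with $[\mu]_\alpha\le 1$ and every $f\in L^p_\gamma(\mathbb{R})$, where $e^{it\partial_x^2}f\in L^p(\mathbb{R}\times[0,1],\mu)$ is defined as the continuous extension from Schwartz functions: it is the limit in $L^p(\mathbb{R}\times[0,1],\mu)$ of $e^{it\partial_x^2}\varphi_n$ for every sequence of Schwartz functions $\varphi_n\to f$ in $L^p_\gamma(\mathbb{R})$, and such sequences exist. (ii) (Necessity) Conversely, let $1\le p<\infty$ and $\gamma\in\mathbb{R}$, and suppose that there is $C$ such that $(\ast)$ holds for every Borel measure $\mu$ with $[\mu]_\alpha\le 1$ and every Schwartz function $f$. Then $$\gamma\ge\begin{cases}\max\bigl(1-\frac{2\alpha}{p},\ \frac{2-\alpha}{p}\bigr),&\alpha\in[1,2],\\[2pt] \max\bigl(1-\frac{\alpha+1}{p},\ \frac{\alpha}{p}\bigr),&\alpha\in[0,1].\end{cases}$$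 -/

import Mathlib

open MeasureTheory Filter Topology TemperedDistribution
open scoped ENNReal NNReal SchwartzMap FourierTransform

noncomputable section

/-- Space-time `ℝ × ℝ` with the Euclidean distance; a point `z` has space coordinate `z 0` and
time coordinate `z 1`. -/
abbrev SpaceTime : Type := EuclideanSpace ℝ (Fin 2)

/-- The slab `ℝ × [0, 1]`. -/
def unitTimeSlab : Set SpaceTime := {z | z 1 ∈ Set.Icc (0 : ℝ) 1}

/-- `[μ]_α = sup_{z, ρ > 0} ρ ^ (-α) μ(B_ρ(z))`, the balls being Euclidean. -/
def ballConst (α : ℝ) (μ : Measure SpaceTime) : ℝ≥0∞ :=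
  ⨆ (z : SpaceTime) (ρ : ℝ) (_ : 0 < ρ), ENNReal.ofReal (ρ ^ (-α)) * μ (Metric.ball z ρ)

/-- The free evolution `e^{it∂_x²} φ (x) = (2π)⁻¹ ∫ e^{ixξ} e^{itξ²} φ̂(ξ) dξ` of a Schwartz
function, at the point `z = (x, t)`, where `φ̂(ξ) = ∫ e^{-ixξ} φ(x) dx`. Mathlib's `𝓕` has the
kernel `e^{-2πixξ}`, so that `φ̂(ξ) = 𝓕 φ (ξ / 2π)`. -/
def freeEvolution (φ : 𝓢(ℝ, ℂ)) (z : SpaceTime) : ℂ :=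
  (2 * Real.pi : ℂ)⁻¹ * ∫ ξ : ℝ, Complex.exp (Complex.I * z 0 * ξ) *
    Complex.exp (Complex.I * z 1 * (ξ : ℂ) ^ 2) * 𝓕 φ (ξ / (2 * Real.pi))

/-- The symbol of `(1 - ∂_x²)^{γ/2}` in the frequency variable of Mathlib's `𝓕`. -/
def besselSymbol (γ : ℝ) (ξ : ℝ) : ℝ := (1 + ‖2 * Real.pi * ξ‖ ^ 2) ^ (γ / 2)

theorem besselSymbol_hasTemperateGrowth (γ : ℝ) :
    Function.HasTemperateGrowth (fun ξ ↦ (besselSymbol γ ξ : ℂ)) := by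
  unfold besselSymbol
  have h := Function.hasTemperateGrowth_one_add_norm_sq_rpow ℝ (γ / 2)
  have h2 : Function.HasTemperateGrowth (fun x : ℝ ↦ 2 * Real.pi * x) := by fun_prop
  have := h.comp h2
  simp only [Function.comp_def] at this
  fun_prop

/-- `(1 - ∂_x²)^{γ/2}` on tempered distributions. -/
def bessel (γ : ℝ) : 𝓢'(ℝ, ℂ) →L[ℂ] 𝓢'(ℝ, ℂ) :=
  fourierMultiplierCLM ℂ (fun ξ ↦ (besselSymbol γ ξ : ℂ))

/-- The norm `‖(1 - ∂_x²)^{γ/2} f‖_{L^p(ℝ)}` of the Sobolev space `L^p_γ(ℝ)`; it is `∞` when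
the tempered distribution `f` does not belong to `L^p_γ(ℝ)`. -/
def sobolevNorm (p : ℝ≥0∞) [Fact (1 ≤ p)] (γ : ℝ) (f : 𝓢'(ℝ, ℂ)) : ℝ≥0∞ :=
  ⨅ (g : Lp ℂ p (volume : Measure ℝ)) (_ : bessel γ f = (g : 𝓢'(ℝ, ℂ))), ‖g‖ₑ

/-- `u` is `e^{it∂_x²} f` as an element of `L^p(ν)`, for `f ∈ L^p_γ(ℝ)`: the free evolution is
extended from the Schwartz functions, where it is given by the integral formula, to `L^p_γ(ℝ)`
by continuity. There are Schwartz functions that converge to `f` in `L^p_γ(ℝ)`, and for each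
such sequence the evolutions converge to `u` in `L^p(ν)`. -/
structure IsFreeEvolution (p : ℝ≥0∞) [Fact (1 ≤ p)] (γ : ℝ) (ν : Measure SpaceTime)
    (f : 𝓢'(ℝ, ℂ)) (u : SpaceTime → ℂ) : Prop where
  memLp : MemLp u p ν
  exists_approx : ∃ φ : ℕ → 𝓢(ℝ, ℂ),
    Tendsto (fun n ↦ sobolevNorm p γ (f - (φ n : 𝓢'(ℝ, ℂ)))) atTop (𝓝 0)
  tendsto : ∀ φ : ℕ → 𝓢(ℝ, ℂ),
    Tendsto (fun n ↦ sobolevNorm p γ (f - (φ n : 𝓢'(ℝ, ℂ)))) atTop (𝓝 0) →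
    Tendsto (fun n ↦ eLpNorm (u - freeEvolution (φ n)) p ν) atTop (𝓝 0)

/-- The estimate `‖e^{it∂_x²} f‖_{L^p(ℝ × [0,1], μ)} ≤ C [μ]_α^{1/p} ‖f‖_{L^p_γ(ℝ)}` for all
`f ∈ L^p_γ(ℝ)` and all Borel measures `μ` with `[μ]_α ≤ 1`, with `C` independent of `μ`, `f`. -/
def FractalLocalSmoothing (α : ℝ) (p : ℝ≥0∞) [Fact (1 ≤ p)] (γ : ℝ) : Prop :=
  ∃ C : ℝ≥0, ∀ μ : Measure SpaceTime, ballConst α μ ≤ 1 →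
    ∀ f : 𝓢'(ℝ, ℂ), sobolevNorm p γ f < ∞ →
      ∃ u : SpaceTime → ℂ, IsFreeEvolution p γ (μ.restrict unitTimeSlab) f u ∧
        eLpNorm u p (μ.restrict unitTimeSlab) ≤
          C * ballConst α μ ^ (1 / p.toReal) * sobolevNorm p γ f

/-- The same estimate, for Schwartz functions `f` only. -/
def FractalLocalSmoothingSchwartz (α : ℝ) (p : ℝ≥0∞) [Fact (1 ≤ p)] (γ : ℝ) : Prop :=
  ∃ C : ℝ≥0, ∀ μ : Measure SpaceTime, ballConst α μ ≤ 1 →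
    ∀ f : 𝓢(ℝ, ℂ), eLpNorm (freeEvolution f) p (μ.restrict unitTimeSlab) ≤
      C * ballConst α μ ^ (1 / p.toReal) * sobolevNorm p γ (f : 𝓢'(ℝ, ℂ))

end

/-! Sufficiency. Put `g = (1-∂²)^{γ/2} f` and split the frequencies of `g` into dyadic shells of
size N = 2^n. On such a shell the Bessel symbol contributes N^{-γ}, so it is enough to bound the
evolution in L^p(μ) with a loss N^{s+δ}, where s is `criticalExponent` and δ > 0 is arbitrary; the
shells then sum like a geometric series. The loss for 2 ≤ p ≤ 4 comes from Marcinkiewicz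
interpolation between an L² and an L⁴ bound for linear operators on Schwartz functions.

Both endpoint bounds use wave packets at unit frequency scale. For times in [0,1] the part of the
solution with frequencies near an integer k is dominated by a unit-scale average of the
corresponding piece of `g`, transported along the lines x + 4πkt = const (`exists_norm_oscInt_le`).
Products of two packets are almost orthogonal on space-time boxes, because ξ₁+ξ₂ and ξ₁²+ξ₂²
determine the pair {ξ₁,ξ₂} (`lintegral_boxWeight_sum_mul_sum_le`). Finally, a solution with
frequencies at most M is essentially constant on boxes M⁻¹ × M⁻², so μ may be replaced by its
averages over such boxes.

For L⁴ this is applied to the square of the whole block with M = N. Pairs of packets are summed with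
a loss N^ε, a pointwise square function bound (`exists_sum_enorm_latticePiece_sq_le`) returns from
the packets to `g`, and the μ-measure of an N⁻¹ × N⁻² box gives the power of N.

For L² the square of the block is decomposed, in the manner of Whitney, into products of clusters of
size M at distance about M, for dyadic M ≤ N. A Galilean transformation moves the pair of clusters
to the origin and shears μ. The clusters have transversal velocities, which gives a bilinear L¹(μ)
bound (`exists_lintegral_bilinear_sq_le`). The measures of sheared boxes that enter it combine to a
bound uniform in M (`exists_shearMeasure_bounds`), so the dyadic scales cost only a factor log N.

Necessity. The estimate is tested with normalised Lebesgue measure on a plate where a solution is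
large. A packet of frequency n, living on a tube along its ray, gives (2-α)/p or α/p (`tube_le`). A
chirped Gaussian that focuses at time one on an n⁻¹ × n⁻² rectangle gives 1-2α/p or 1-(α+1)/p
(`focus_le`). -/

/-! ### The free evolution as an oscillatory integral -/

/-- The character `e(r) = exp(2πir)`. -/
noncomputable def unitExp (r : ℝ) : ℂ := Complex.exp ((2 * Real.pi * r : ℝ) * Complex.I)

theorem norm_unitExp (r : ℝ) : ‖unitExp r‖ = 1 := Complex.norm_exp_ofReal_mul_I _

theorem unitExp_add (r s : ℝ) : unitExp (r + s) = unitExp r * unitExp s := by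
  simp only [unitExp, ← Complex.exp_add]
  congr 1
  push_cast
  ring

theorem conj_unitExp (r : ℝ) : (starRingEnd ℂ) (unitExp r) = unitExp (-r) := by
  simp only [unitExp, ← Complex.exp_conj, map_mul, Complex.conj_ofReal, Complex.conj_I]
  congr 1
  push_cast
  ring

theorem contDiff_unitExp {n : WithTop ℕ∞} : ContDiff ℝ n unitExp := by
  unfold unitExp
  apply ContDiff.cexp
  apply ContDiff.mul _ contDiff_const
  exact Complex.ofRealCLM.contDiff.comp (contDiff_const.mul contDiff_id)

@[fun_prop]
theorem continuous_unitExp : Continuous unitExp := contDiff_unitExp (n := 0).continuous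

theorem hasDerivAt_unitExp (r : ℝ) :
    HasDerivAt unitExp (2 * Real.pi * Complex.I * unitExp r) r := by
  have h1 : HasDerivAt (fun r : ℝ ↦ ((2 * Real.pi * r : ℝ) : ℂ) * Complex.I)
      (2 * Real.pi * Complex.I) r := by
    have := ((hasDerivAt_id r).const_mul (2 * Real.pi)).ofReal_comp.mul_const Complex.I
    simpa using this
  have := h1.cexp
  unfold unitExp
  convert this using 1
  ring_nf

theorem fourier_eq_integral_unitExp (f : ℝ → ℂ) (w : ℝ) :
    𝓕 f w = ∫ v, unitExp (-(v * w)) * f v := by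
  rw [Real.fourier_real_eq_integral_exp_smul]
  congr 1
  ext v
  rw [smul_eq_mul, unitExp]
  congr 3
  ring_nf

theorem fourierInv_eq_integral_unitExp (f : ℝ → ℂ) (w : ℝ) :
    𝓕⁻ f w = ∫ v, unitExp (v * w) * f v := by
  rw [Real.fourierInv_eq_fourier_neg, fourier_eq_integral_unitExp]
  simp

/-- The free evolution with frequency profile `h`, in the normalization of Mathlib's `𝓕`. -/
noncomputable def oscInt (h : ℝ → ℂ) (x t : ℝ) : ℂ :=
  ∫ ξ, unitExp (x * ξ + 2 * Real.pi * t * ξ ^ 2) * h ξ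

/-- The substitution ξ → 2πξ turns the phase into xξ + 2πtξ² in the units of `unitExp`. Its
ξ-derivative is x + 4πtξ, which is the source of the velocities 4πk below. -/
theorem freeEvolution_eq_oscInt (φ : 𝓢(ℝ, ℂ)) (z : SpaceTime) :
    freeEvolution φ z = oscInt (𝓕 φ : 𝓢(ℝ, ℂ)) (z 0) (z 1) := by
  have hpi : (0 : ℝ) < 2 * Real.pi := by positivity
  unfold freeEvolution oscInt
  have h := Measure.integral_comp_div (fun ξ : ℝ ↦
    unitExp (z 0 * ξ + 2 * Real.pi * z 1 * ξ ^ 2) * 𝓕 φ ξ) (2 * Real.pi)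
  rw [abs_of_pos hpi] at h
  have h2 : (∫ ξ : ℝ, unitExp (z 0 * ξ + 2 * Real.pi * z 1 * ξ ^ 2) * 𝓕 φ ξ) =
      (2 * Real.pi : ℂ)⁻¹ * ∫ ξ : ℝ, unitExp (z 0 * (ξ / (2 * Real.pi)) +
        2 * Real.pi * z 1 * (ξ / (2 * Real.pi)) ^ 2) * 𝓕 φ (ξ / (2 * Real.pi)) := by
    rw [h, Complex.real_smul, ← mul_assoc]
    have : (2 * Real.pi : ℂ) ≠ 0 := by exact_mod_cast hpi.ne'
    push_cast
    rw [inv_mul_cancel₀ this, one_mul]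
  rw [h2]
  congr 2
  ext ξ
  rw [← Complex.exp_add, unitExp]
  congr 2
  have : (Real.pi : ℂ) ≠ 0 := by exact_mod_cast Real.pi_ne_zero
  push_cast
  field_simp

theorem integrand_aestronglyMeasurable {h : ℝ → ℂ} (hh : Integrable h) (x t : ℝ) :
    AEStronglyMeasurable (fun ξ ↦ unitExp (x * ξ + 2 * Real.pi * t * ξ ^ 2) * h ξ) volume := by
  apply AEStronglyMeasurable.mul _ hh.1
  exact Continuous.aestronglyMeasurable (by fun_prop)

theorem integrable_oscInt_integrand {h : ℝ → ℂ} (hh : Integrable h) (x t : ℝ) :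
    Integrable (fun ξ ↦ unitExp (x * ξ + 2 * Real.pi * t * ξ ^ 2) * h ξ) := by
  refine hh.mono (integrand_aestronglyMeasurable hh x t) (ae_of_all _ fun ξ ↦ ?_)
  rw [norm_mul, norm_unitExp, one_mul]

theorem norm_oscInt_le (h : ℝ → ℂ) (x t : ℝ) : ‖oscInt h x t‖ ≤ ∫ ξ, ‖h ξ‖ := by
  refine (norm_integral_le_integral_norm _).trans (le_of_eq ?_)
  simp [norm_unitExp]

theorem continuous_oscInt {h : ℝ → ℂ} (hh : Integrable h) :
    Continuous (fun z : ℝ × ℝ ↦ oscInt h z.1 z.2) := by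
  refine continuous_of_dominated (fun z ↦ integrand_aestronglyMeasurable hh z.1 z.2)
    (bound := fun ξ ↦ ‖h ξ‖) (fun z ↦ ae_of_all _ fun ξ ↦ ?_) hh.norm (ae_of_all _ fun ξ ↦ ?_)
  · rw [norm_mul, norm_unitExp, one_mul]
  · fun_prop

theorem oscInt_add {h₁ h₂ : ℝ → ℂ} (hh₁ : Integrable h₁) (hh₂ : Integrable h₂) (x t : ℝ) :
    oscInt (h₁ + h₂) x t = oscInt h₁ x t + oscInt h₂ x t := by
  unfold oscInt
  rw [← integral_add (integrable_oscInt_integrand hh₁ x t) (integrable_oscInt_integrand hh₂ x t)]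
  simp [mul_add]

theorem oscInt_sum {ι : Type*} (S : Finset ι) {h : ι → ℝ → ℂ} (hh : ∀ i ∈ S, Integrable (h i))
    (x t : ℝ) : oscInt (fun ξ ↦ ∑ i ∈ S, h i ξ) x t = ∑ i ∈ S, oscInt (h i) x t := by
  unfold oscInt
  rw [← integral_finsetSum S (fun i hi ↦ integrable_oscInt_integrand (hh i hi) x t)]
  simp [Finset.mul_sum]

theorem oscInt_const_mul (c : ℂ) (h : ℝ → ℂ) (x t : ℝ) :
    oscInt (fun ξ ↦ c * h ξ) x t = c * oscInt h x t := by
  unfold oscInt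
  rw [← integral_const_mul]
  congr 1
  ext ξ
  ring

/-- Galilean invariance. -/
theorem oscInt_shift (h : ℝ → ℂ) (ζ x t : ℝ) :
    oscInt h x t = unitExp (x * ζ + 2 * Real.pi * t * ζ ^ 2) *
      oscInt (fun ξ ↦ h (ξ + ζ)) (x + 4 * Real.pi * ζ * t) t := by
  unfold oscInt
  rw [← integral_const_mul, ← integral_add_right_eq_self _ ζ]
  congr 1
  ext ξ
  rw [← mul_assoc, ← unitExp_add]
  congr 2
  ring

/-- Up to a unimodular factor, moving the frequency ζ to the origin costs only the shear x ↦ x +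
4πζt. Each cluster of frequencies is recentred in this way, at the price of shearing the measure. -/
theorem norm_oscInt_shift (h : ℝ → ℂ) (ζ x t : ℝ) :
    ‖oscInt h x t‖ = ‖oscInt (fun ξ ↦ h (ξ + ζ)) (x + 4 * Real.pi * ζ * t) t‖ := by
  rw [oscInt_shift h ζ, norm_mul, norm_unitExp, one_mul]

theorem hasDerivAt_oscInt_fst {h : ℝ → ℂ} (hh : Integrable h)
    (hh' : Integrable (fun ξ : ℝ ↦ (ξ : ℂ) * h ξ)) (x t : ℝ) :
    HasDerivAt (fun x ↦ oscInt h x t)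
      (2 * Real.pi * Complex.I * oscInt (fun ξ ↦ (ξ : ℂ) * h ξ) x t) x := by
  rw [← oscInt_const_mul]
  have h2 : Integrable (fun ξ : ℝ ↦ 2 * Real.pi * Complex.I * ((ξ : ℂ) * h ξ)) :=
    hh'.const_mul _
  refine (hasDerivAt_integral_of_dominated_loc_of_deriv_le (s := Set.univ)
    (bound := fun ξ : ℝ ↦ ‖2 * Real.pi * Complex.I * ((ξ : ℂ) * h ξ)‖)
    (F' := fun x ξ ↦ unitExp (x * ξ + 2 * Real.pi * t * ξ ^ 2) *
      (2 * Real.pi * Complex.I * ((ξ : ℂ) * h ξ))) univ_mem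
    (Eventually.of_forall fun x ↦ integrand_aestronglyMeasurable hh x t)
    (integrable_oscInt_integrand hh x t)
    (integrand_aestronglyMeasurable h2 x t)
    (ae_of_all _ fun ξ y _ ↦ ?_) h2.norm (ae_of_all _ fun ξ y _ ↦ ?_)).2
  · rw [norm_mul, norm_unitExp, one_mul]
  · have h3 : HasDerivAt (fun y : ℝ ↦ y * ξ + 2 * Real.pi * t * ξ ^ 2) ξ y := by
      simpa using ((hasDerivAt_id y).mul_const ξ).add_const (2 * Real.pi * t * ξ ^ 2)
    have := ((hasDerivAt_unitExp _).scomp y h3).mul_const (h ξ)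
    refine this.congr_deriv ?_
    simp
    ring_nf

theorem hasDerivAt_oscInt_snd {h : ℝ → ℂ} (hh : Integrable h)
    (hh' : Integrable (fun ξ : ℝ ↦ (ξ : ℂ) ^ 2 * h ξ)) (x t : ℝ) :
    HasDerivAt (fun t ↦ oscInt h x t)
      (4 * Real.pi ^ 2 * Complex.I * oscInt (fun ξ ↦ (ξ : ℂ) ^ 2 * h ξ) x t) t := by
  rw [← oscInt_const_mul]
  have h2 : Integrable (fun ξ : ℝ ↦ 4 * Real.pi ^ 2 * Complex.I * ((ξ : ℂ) ^ 2 * h ξ)) :=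
    hh'.const_mul _
  refine (hasDerivAt_integral_of_dominated_loc_of_deriv_le (s := Set.univ)
    (bound := fun ξ : ℝ ↦ ‖4 * Real.pi ^ 2 * Complex.I * ((ξ : ℂ) ^ 2 * h ξ)‖)
    (F' := fun t ξ ↦ unitExp (x * ξ + 2 * Real.pi * t * ξ ^ 2) *
      (4 * Real.pi ^ 2 * Complex.I * ((ξ : ℂ) ^ 2 * h ξ))) univ_mem
    (Eventually.of_forall fun t ↦ integrand_aestronglyMeasurable hh x t)
    (integrable_oscInt_integrand hh x t)
    (integrand_aestronglyMeasurable h2 x t)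
    (ae_of_all _ fun ξ y _ ↦ ?_) h2.norm (ae_of_all _ fun ξ y _ ↦ ?_)).2
  · rw [norm_mul, norm_unitExp, one_mul]
  · have h3 : HasDerivAt (fun y : ℝ ↦ x * ξ + 2 * Real.pi * y * ξ ^ 2)
        (2 * Real.pi * ξ ^ 2) y := by
      have := (((hasDerivAt_id y).const_mul (2 * Real.pi)).mul_const (ξ ^ 2)).const_add (x * ξ)
      simpa using this
    have := ((hasDerivAt_unitExp _).scomp y h3).mul_const (h ξ)
    refine this.congr_deriv ?_
    simp
    ring_nf

/-! ### Amplitudes with two bounded derivatives and the decay of wave packets -/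

/-- `m` is of class `C²`, and its derivatives up to order two are bounded by `B` on `s`. -/
structure SymbolBound (m : ℝ → ℂ) (s : Set ℝ) (B : ℝ) : Prop where
  contDiff : ContDiff ℝ 2 m
  bound : ∀ j ≤ 2, ∀ ξ ∈ s, ‖iteratedDeriv j m ξ‖ ≤ B

theorem SymbolBound.mono {m : ℝ → ℂ} {s s' : Set ℝ} {B B' : ℝ} (h : SymbolBound m s B)
    (hs : s' ⊆ s) (hB : B ≤ B') : SymbolBound m s' B' :=
  ⟨h.contDiff, fun j hj ξ hξ ↦ (h.bound j hj ξ (hs hξ)).trans hB⟩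

/-- By the Leibniz rule the derivative of order j costs the sum of the binomial coefficients, 2^j ≤
4. -/
theorem SymbolBound.mul {m m' : ℝ → ℂ} {s : Set ℝ} {B B' : ℝ} (h : SymbolBound m s B)
    (h' : SymbolBound m' s B') (hB : 0 ≤ B) :
    SymbolBound (fun ξ ↦ m ξ * m' ξ) s (4 * (B * B')) := by
  refine ⟨h.contDiff.mul h'.contDiff, fun j hj ξ hξ ↦ ?_⟩
  have hB' : 0 ≤ B' := (norm_nonneg _).trans (h'.bound 0 (by norm_num) ξ hξ)
  rw [← norm_iteratedFDeriv_eq_norm_iteratedDeriv]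
  have h1 := norm_iteratedFDeriv_mul_le h.contDiff h'.contDiff ξ (n := j) (by exact_mod_cast hj)
  refine h1.trans ?_
  simp only [norm_iteratedFDeriv_eq_norm_iteratedDeriv]
  calc _ ≤ ∑ i ∈ Finset.range (j + 1), (j.choose i : ℝ) * B * B' := by
        refine Finset.sum_le_sum fun i hi ↦ ?_
        rw [Finset.mem_range] at hi
        gcongr
        · exact h.bound i (by omega) ξ hξ
        · exact h'.bound (j - i) (by omega) ξ hξ
    _ = 2 ^ j * (B * B') := by
        rw [← Finset.sum_mul, ← Finset.sum_mul, mul_assoc]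
        congr 1
        exact_mod_cast Nat.sum_range_choose j
    _ ≤ 4 * (B * B') := by
        gcongr
        calc (2 : ℝ) ^ j ≤ 2 ^ 2 := pow_le_pow_right₀ (by norm_num) hj
          _ = 4 := by norm_num

theorem SymbolBound.comp_add {m : ℝ → ℂ} {s : Set ℝ} {B : ℝ} (h : SymbolBound m s B) (a : ℝ) :
    SymbolBound (fun ξ ↦ m (a + ξ)) ((fun ξ ↦ a + ξ) ⁻¹' s) B := by
  refine ⟨h.contDiff.comp (contDiff_const.add contDiff_id), fun j hj ξ hξ ↦ ?_⟩
  rw [iteratedDeriv_comp_const_add]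
  exact h.bound j hj _ hξ

theorem SymbolBound.of_hasDerivAt {m m' m'' : ℝ → ℂ} {s : Set ℝ} {B : ℝ}
    (h' : ∀ ξ, HasDerivAt m (m' ξ) ξ) (h'' : ∀ ξ, HasDerivAt m' (m'' ξ) ξ)
    (hc : Continuous m'') (b : ∀ ξ ∈ s, ‖m ξ‖ ≤ B) (b' : ∀ ξ ∈ s, ‖m' ξ‖ ≤ B)
    (b'' : ∀ ξ ∈ s, ‖m'' ξ‖ ≤ B) : SymbolBound m s B := by
  have e1 : deriv m = m' := funext fun ξ ↦ (h' ξ).deriv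
  have e2 : deriv m' = m'' := funext fun ξ ↦ (h'' ξ).deriv
  refine ⟨?_, fun j hj ξ hξ ↦ ?_⟩
  · rw [show (2 : WithTop ℕ∞) = 1 + 1 by norm_num, contDiff_succ_iff_deriv]
    refine ⟨fun ξ ↦ (h' ξ).differentiableAt, by simp, ?_⟩
    rw [e1, contDiff_one_iff_deriv, e2]
    exact ⟨fun ξ ↦ (h'' ξ).differentiableAt, hc⟩
  · interval_cases j
    · simpa using b ξ hξ
    · rw [iteratedDeriv_one, e1]
      exact b' ξ hξ
    · rw [iteratedDeriv_succ, iteratedDeriv_one, e1, e2]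
      exact b'' ξ hξ

/-- The partition of unity function on the integer lattice. -/
noncomputable def latticeBump (ξ : ℝ) : ℝ :=
  Real.smoothTransition (ξ + 1) - Real.smoothTransition ξ

theorem contDiff_latticeBump {n : ℕ∞} : ContDiff ℝ n latticeBump := by
  unfold latticeBump
  exact (Real.smoothTransition.contDiff.comp (contDiff_id.add contDiff_const)).sub
    Real.smoothTransition.contDiff

theorem latticeBump_eq_zero {ξ : ℝ} (h : ξ ∉ Set.Ioo (-1 : ℝ) 1) : latticeBump ξ = 0 := by
  rw [Set.mem_Ioo, not_and_or, not_lt, not_lt] at h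
  unfold latticeBump
  rcases h with h | h
  · rw [Real.smoothTransition.zero_of_nonpos (by linarith),
      Real.smoothTransition.zero_of_nonpos (by linarith), sub_zero]
  · rw [Real.smoothTransition.one_of_one_le (by linarith),
      Real.smoothTransition.one_of_one_le h, sub_self]

theorem latticeBump_nonneg (ξ : ℝ) : 0 ≤ latticeBump ξ :=
  sub_nonneg.2 (Real.smoothTransition.monotone (by linarith))

/-- The sum telescopes, since the bump is the difference of two unit translates of a single smooth
step. -/
theorem sum_latticeBump (ξ : ℝ) (a : ℤ) (n : ℕ) :
    ∑ j ∈ Finset.range n, latticeBump (ξ - (a + j : ℤ)) =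
      Real.smoothTransition (ξ - a + 1) - Real.smoothTransition (ξ - a - n + 1) := by
  induction n with
  | zero => simp
  | succ n ih =>
    rw [Finset.sum_range_succ, ih, latticeBump]
    push_cast
    rw [show ξ - (a + n) + 1 = ξ - a - n + 1 by ring,
      show ξ - (a + n) = ξ - a - (n + 1) + 1 by ring]
    ring

/-- A smooth function equal to one on `[-1, 1]` and supported in `[-2, 2]`. -/
noncomputable def wideBump : ContDiffBump (0 : ℝ) := ⟨1, 2, by norm_num, by norm_num⟩

theorem wideBump_eq_one {η : ℝ} (h : |η| ≤ 1) : wideBump η = 1 :=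
  wideBump.one_of_mem_closedBall (by simpa [wideBump] using h)

theorem wideBump_eq_zero {η : ℝ} (h : 2 ≤ |η|) : wideBump η = 0 :=
  wideBump.zero_of_le_dist (by simpa [wideBump] using h)

theorem exists_symbolBound_wideBump :
    ∃ B, 0 < B ∧ SymbolBound (fun η ↦ (wideBump η : ℂ)) (Set.Icc (-2) 2) B := by
  have hc : ContDiff ℝ 2 (fun η : ℝ ↦ (wideBump η : ℂ)) :=
    Complex.ofRealCLM.contDiff.comp wideBump.contDiff
  have : ∀ j : ℕ, j ≤ 2 → ∃ C, ∀ η ∈ Set.Icc (-2 : ℝ) 2,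
      ‖iteratedDeriv j (fun η ↦ (wideBump η : ℂ)) η‖ ≤ C := fun j hj ↦
    isCompact_Icc.exists_bound_of_continuousOn
      (hc.continuous_iteratedDeriv j (by exact_mod_cast hj)).continuousOn
  obtain ⟨C0, h0⟩ := this 0 (by norm_num)
  obtain ⟨C1, h1⟩ := this 1 (by norm_num)
  obtain ⟨C2, h2⟩ := this 2 (by norm_num)
  refine ⟨|C0| + |C1| + |C2| + 1, by positivity, hc, fun j hj ξ hξ ↦ ?_⟩
  interval_cases j
  · linarith [h0 ξ hξ, le_abs_self C0, abs_nonneg C1, abs_nonneg C2]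
  · linarith [h1 ξ hξ, le_abs_self C1, abs_nonneg C0, abs_nonneg C2]
  · linarith [h2 ξ hξ, le_abs_self C2, abs_nonneg C1, abs_nonneg C0]

theorem symbolBound_unitExp_sq (t : ℝ) :
    SymbolBound (fun η ↦ unitExp (2 * Real.pi * t * η ^ 2)) (Set.Icc (-2) 2)
      (10 ^ 5 * (1 + |t|) ^ 2) := by
  have hd : ∀ η : ℝ, HasDerivAt (fun η : ℝ ↦ unitExp (2 * Real.pi * t * η ^ 2))
      ((8 * Real.pi ^ 2 * t * Complex.I) * (η * unitExp (2 * Real.pi * t * η ^ 2))) η := by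
    intro η
    have h1 : HasDerivAt (fun η : ℝ ↦ 2 * Real.pi * t * η ^ 2) (2 * Real.pi * t * (2 * η)) η := by
      simpa using ((hasDerivAt_id η).pow 2).const_mul (2 * Real.pi * t)
    refine ((hasDerivAt_unitExp _).scomp η h1).congr_deriv ?_
    simp
    ring
  have hd2 : ∀ η : ℝ, HasDerivAt
      (fun η : ℝ ↦ (8 * Real.pi ^ 2 * t * Complex.I) * (η * unitExp (2 * Real.pi * t * η ^ 2)))
      ((8 * Real.pi ^ 2 * t * Complex.I) * (unitExp (2 * Real.pi * t * η ^ 2) +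
        η * ((8 * Real.pi ^ 2 * t * Complex.I) * (η * unitExp (2 * Real.pi * t * η ^ 2))))) η := by
    intro η
    have h1 : HasDerivAt (fun η : ℝ ↦ (η : ℂ)) 1 η := by
      simpa using (hasDerivAt_id η).ofReal_comp
    have := (h1.mul (hd η)).const_mul (8 * Real.pi ^ 2 * t * Complex.I)
    simpa using this
  have hpi : Real.pi ^ 2 ≤ 10 := by nlinarith [Real.pi_lt_d2, Real.pi_pos]
  have ht := abs_nonneg t
  -- With X = 1 + |t| and |η| ≤ 2, the second derivative is at most 80X(1 + 320X) ≤ 25680X², which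
  -- fits under 10⁵X².
  have hA : ‖(8 * Real.pi ^ 2 * t * Complex.I : ℂ)‖ ≤ 80 * (1 + |t|) := by
    simp only [norm_mul, norm_pow, Complex.norm_real, Complex.norm_I, Real.norm_eq_abs,
      Complex.norm_ofNat, mul_one, abs_of_pos Real.pi_pos]
    nlinarith
  have hη : ∀ η ∈ Set.Icc (-2 : ℝ) 2, ‖(η : ℂ)‖ ≤ 2 := fun η h ↦ by
    rw [Complex.norm_real, Real.norm_eq_abs, abs_le]
    exact h
  generalize (8 * Real.pi ^ 2 * t * Complex.I : ℂ) = A at *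
  refine SymbolBound.of_hasDerivAt hd hd2 ?_ (fun η _ ↦ ?_) (fun η h ↦ ?_) (fun η h ↦ ?_)
  · fun_prop
  · rw [norm_unitExp]
    nlinarith
  · rw [norm_mul, norm_mul, norm_unitExp, mul_one]
    calc _ ≤ 80 * (1 + |t|) * 2 := by gcongr; exact hη η h
      _ ≤ _ := by nlinarith
  · rw [norm_mul]
    calc _ ≤ (80 * (1 + |t|)) * (1 + 2 * ((80 * (1 + |t|)) * (2 * 1))) := by
          gcongr
          refine (norm_add_le _ _).trans ?_
          rw [norm_unitExp, norm_mul, norm_mul, norm_mul, norm_unitExp]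
          gcongr
          · exact hη η h
          · exact hη η h
      _ ≤ _ := by nlinarith

/-- Decay of an oscillatory integral with a `C²` amplitude supported in `[-2, 2]`. -/
theorem norm_integral_unitExp_mul_le {σ : ℝ → ℂ} {B : ℝ} (h : SymbolBound σ (Set.Icc (-2) 2) B)
    (hs : ∀ η, 2 ≤ |η| → σ η = 0) (z : ℝ) :
    ‖∫ η, unitExp (z * η) * σ η‖ ≤ 8 * B * (1 + z ^ 2)⁻¹ := by
  have hsupp : ∀ η, η ∉ Set.Icc (-2 : ℝ) 2 → σ =ᶠ[𝓝 η] 0 := by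
    intro η hη
    have : (Set.Icc (-2 : ℝ) 2)ᶜ ∈ 𝓝 η := isClosed_Icc.isOpen_compl.mem_nhds hη
    filter_upwards [this] with x hx
    refine hs x ?_
    by_contra hlt
    rw [not_le, abs_lt] at hlt
    exact hx ⟨hlt.1.le, hlt.2.le⟩
  have hts : tsupport σ ⊆ Set.Icc (-2 : ℝ) 2 := by
    intro η hη
    by_contra hh
    exact (notMem_tsupport_iff_eventuallyEq.2 (hsupp η hh)) hη
  have hcs : HasCompactSupport σ := isCompact_Icc.of_isClosed_subset (isClosed_tsupport _) hts
  have hz : ∀ j ≤ 2, ∀ η, η ∉ Set.Icc (-2 : ℝ) 2 → iteratedDeriv j σ η = 0 := by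
    intro j _ η hη
    rw [(hsupp η hη).iteratedDeriv_eq]
    simp
  have hB : 0 ≤ B := (norm_nonneg _).trans (h.bound 0 (by norm_num) 0 (by norm_num))
  have hint : ∀ j : ℕ, j ≤ 2 → Integrable (iteratedDeriv j σ) ∧
      ∫ η, ‖iteratedDeriv j σ η‖ ≤ 4 * B := by
    intro j hj
    have hcont : Continuous (iteratedDeriv j σ) :=
      h.contDiff.continuous_iteratedDeriv j (by exact_mod_cast hj)
    have hi : Integrable (iteratedDeriv j σ) := by
      apply hcont.integrable_of_hasCompactSupport
      exact HasCompactSupport.intro isCompact_Icc (hz j hj)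
    refine ⟨hi, ?_⟩
    have : (fun η ↦ ‖iteratedDeriv j σ η‖) ≤ (Set.Icc (-2 : ℝ) 2).indicator fun _ ↦ B := by
      intro η
      by_cases hη : η ∈ Set.Icc (-2 : ℝ) 2
      · rw [Set.indicator_of_mem hη]
        exact h.bound j hj η hη
      · rw [Set.indicator_of_notMem hη]
        simp [hz j hj η hη]
    refine (integral_mono hi.norm ?_ this).trans ?_
    · exact (integrable_indicator_iff measurableSet_Icc).2 (by simp)
    · rw [integral_indicator measurableSet_Icc]
      simp
      linarith
  have e : (∫ η, unitExp (z * η) * σ η) = 𝓕 σ (-z) := by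
    rw [fourier_eq_integral_unitExp]
    congr 1
    ext η
    rw [show -(η * -z) = z * η by ring]
  have h1 : ‖𝓕 σ (-z)‖ ≤ 4 * B := by
    rw [← e]
    refine (norm_integral_le_integral_norm _).trans ?_
    simp only [norm_mul, norm_unitExp, one_mul]
    simpa using (hint 0 (by norm_num)).2
  -- Two integrations by parts. Each of `h1` and `h2` costs B times the length 4 of the support, and
  -- their sum gives 8B.
  have h2 : (2 * Real.pi * z) ^ 2 * ‖𝓕 σ (-z)‖ ≤ 4 * B := by
    have := congrFun (Real.fourier_iteratedDeriv (f := σ) (N := 2) (n := 2)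
      (by exact_mod_cast h.contDiff)
      (fun n hn ↦ (hint n (by exact_mod_cast hn)).1) (by norm_num)) (-z)
    have h3 : ‖𝓕 (iteratedDeriv 2 σ) (-z)‖ ≤ 4 * B := by
      rw [fourier_eq_integral_unitExp]
      refine (norm_integral_le_integral_norm _).trans ?_
      simp only [norm_mul, norm_unitExp, one_mul]
      exact (hint 2 le_rfl).2
    rw [this, norm_smul] at h3
    refine le_of_eq_of_le ?_ h3
    congr 1
    simp [mul_pow]
  rw [e, ← div_eq_mul_inv, le_div_iff₀ (by positivity)]
  have hpi : (1 : ℝ) ≤ (2 * Real.pi) ^ 2 := by nlinarith [Real.pi_gt_three]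
  have hz2 : z ^ 2 ≤ (2 * Real.pi * z) ^ 2 := by
    rw [mul_pow]
    nlinarith [sq_nonneg z]
  nlinarith [norm_nonneg (𝓕 σ (-z)), mul_le_mul_of_nonneg_right hz2 (norm_nonneg (𝓕 σ (-z)))]

theorem integral_fourier_mul_eq_of_integrable {f g : ℝ → ℂ} (hf : Integrable f)
    (hg : Integrable g) : ∫ ξ, 𝓕 f ξ * g ξ = ∫ x, f x * 𝓕 g x := by
  simpa using! VectorFourier.integral_fourierIntegral_smul_eq_flip (L := innerₗ ℝ)
    Real.continuous_fourierChar continuous_inner hf hg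

/-- Pointwise bound for a wave packet at unit frequency scale. -/
theorem exists_norm_oscInt_le : ∃ C, 0 < C ∧ ∀ (m : ℝ → ℂ) (k B : ℝ),
    SymbolBound m (Set.Icc (k - 2) (k + 2)) B → ∀ G : 𝓢(ℝ, ℂ),
    (∀ ξ, 1 < |ξ - k| → (𝓕 G) ξ = 0) → ∀ x t : ℝ,
    ‖oscInt (fun ξ ↦ m ξ * (𝓕 G) ξ) x t‖ ≤
      C * B * (1 + |t|) ^ 2 * ∫ y, (1 + (x + 4 * Real.pi * k * t - y) ^ 2)⁻¹ * ‖G y‖ := by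
  obtain ⟨Cw, hCw, hw⟩ := exists_symbolBound_wideBump
  refine ⟨8 * (4 * (10 ^ 5 * (4 * Cw))), by positivity, fun m k B hm G hG x t ↦ ?_⟩
  have hB : 0 ≤ B := (norm_nonneg _).trans (hm.bound 0 (by norm_num) k (by constructor <;> linarith))
  have hm' : SymbolBound (fun η ↦ m (k + η)) (Set.Icc (-2) 2) B := by
    refine (hm.comp_add k).mono (fun η hη ↦ ?_) le_rfl
    constructor <;> linarith [hη.1, hη.2]
  -- After recentring at k, the remaining quadratic phase is counted as part of the amplitude: for
  -- |η| ≤ 2 it costs only (1+|t|)². The wide bump may be inserted because it equals one on the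
  -- frequency support of `G`.
  set σ : ℝ → ℂ := fun η ↦ unitExp (2 * Real.pi * t * η ^ 2) * (m (k + η) * wideBump η) with hσdef
  have hσ : SymbolBound σ (Set.Icc (-2) 2)
      (4 * (10 ^ 5 * (1 + |t|) ^ 2 * (4 * (B * Cw)))) :=
    (symbolBound_unitExp_sq t).mul (hm'.mul hw hB) (by positivity)
  have hσ0 : ∀ η, 2 ≤ |η| → σ η = 0 := fun η hη ↦ by simp [hσdef, wideBump_eq_zero hη]
  have hσi : Integrable σ := by
    apply hσ.contDiff.continuous.integrable_of_hasCompactSupport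
    refine HasCompactSupport.intro (isCompact_Icc (a := (-2 : ℝ)) (b := 2)) fun η hη ↦ hσ0 η ?_
    by_contra h
    rw [not_le, abs_lt] at h
    exact hη ⟨h.1.le, h.2.le⟩
  set c : ℂ := unitExp (x * k + 2 * Real.pi * t * k ^ 2) with hc
  set f : ℝ → ℂ := fun ξ ↦ unitExp (x * ξ + 2 * Real.pi * t * ξ ^ 2) * (m ξ * wideBump (ξ - k))
    with hf
  have hfσ : ∀ η, f (η + k) = c * (unitExp ((x + 4 * Real.pi * k * t) * η) * σ η) := by
    intro η
    simp only [hf, hσdef, hc]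
    rw [add_sub_cancel_right, ← mul_assoc (unitExp ((x + 4 * Real.pi * k * t) * η)), ← unitExp_add,
      ← mul_assoc (unitExp (x * k + _)), ← unitExp_add, add_comm η k]
    congr 2
    ring
  have hfi : Integrable f := by
    have : Integrable (fun η ↦ f (η + k)) := by
      simp_rw [hfσ]
      apply Integrable.const_mul
      refine hσi.mono (Continuous.aestronglyMeasurable ?_) (ae_of_all _ fun η ↦ ?_)
      · have := hσ.contDiff.continuous
        fun_prop
      · rw [norm_mul, norm_unitExp, one_mul]
    simpa using this.comp_sub_right k
  -- The multiplication formula moves the transform to the kernel, which by `e2` is concentrated at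
  -- unit distance from y = x + 4πkt.
  have e1 : oscInt (fun ξ ↦ m ξ * (𝓕 G) ξ) x t = ∫ y, 𝓕 f y * G y := by
    rw [integral_fourier_mul_eq_of_integrable hfi G.integrable]
    unfold oscInt
    congr 1
    ext ξ
    simp only [hf]
    rw [← SchwartzMap.fourier_coe]
    by_cases h : 1 < |ξ - k|
    · rw [hG ξ h]
      simp
    · rw [wideBump_eq_one (not_lt.1 h)]
      push_cast
      ring
  have e2 : ∀ y, ‖𝓕 f y‖ ≤ 8 * (4 * (10 ^ 5 * (1 + |t|) ^ 2 * (4 * (B * Cw)))) *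
      (1 + (x + 4 * Real.pi * k * t - y) ^ 2)⁻¹ := by
    intro y
    refine le_of_eq_of_le ?_ (norm_integral_unitExp_mul_le hσ hσ0 (x + 4 * Real.pi * k * t - y))
    rw [fourier_eq_integral_unitExp, ← integral_add_right_eq_self _ k]
    have : ∀ η, unitExp (-((η + k) * y)) * f (η + k) = (unitExp (-(k * y)) * c) *
        (unitExp ((x + 4 * Real.pi * k * t - y) * η) * σ η) := by
      intro η
      rw [hfσ, show -((η + k) * y) = -(k * y) + -(y * η) by ring, unitExp_add,
        show (x + 4 * Real.pi * k * t - y) * η = -(y * η) + (x + 4 * Real.pi * k * t) * η by ring,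
        unitExp_add]
      ring
    simp_rw [this]
    rw [integral_const_mul, norm_mul, norm_mul, norm_unitExp, hc, norm_unitExp, one_mul, one_mul]
  rw [e1, ← integral_const_mul]
  refine norm_integral_le_of_norm_le ?_ (ae_of_all _ fun y ↦ ?_)
  · apply Integrable.const_mul
    refine G.integrable.norm.mono (Continuous.aestronglyMeasurable ?_) (ae_of_all _ fun y ↦ ?_)
    · have : Continuous fun y ↦ (1 + (x + 4 * Real.pi * k * t - y) ^ 2)⁻¹ :=
        Continuous.inv₀ (by fun_prop) (fun y ↦ by positivity)
      exact this.mul G.continuous.norm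
    · rw [norm_mul, norm_norm, Real.norm_of_nonneg (by positivity)]
      refine mul_le_of_le_one_left (norm_nonneg _) (inv_le_one_of_one_le₀ ?_)
      nlinarith [sq_nonneg (x + 4 * Real.pi * k * t - y)]
  · rw [norm_mul]
    refine (mul_le_mul_of_nonneg_right (e2 y) (norm_nonneg _)).trans (le_of_eq ?_)
    ring

/-- The weight `(1 + y²)⁻¹`. -/
noncomputable def cauchyWeight (y : ℝ) : ℝ≥0∞ := ENNReal.ofReal ((1 + y ^ 2)⁻¹)

@[fun_prop]
theorem measurable_cauchyWeight : Measurable cauchyWeight := by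
  unfold cauchyWeight
  fun_prop

theorem lintegral_cauchyWeight : ∫⁻ y, cauchyWeight y = ENNReal.ofReal Real.pi := by
  unfold cauchyWeight
  rw [← ofReal_integral_eq_lintegral_ofReal integrable_inv_one_add_sq
    (ae_of_all _ fun y ↦ by positivity), integral_univ_inv_one_add_sq]

/-- The average of `‖G‖²` at unit scale. -/
noncomputable def unitAvg (G : ℝ → ℂ) (u : ℝ) : ℝ≥0∞ :=
  ∫⁻ y, cauchyWeight (u - y) * ‖G y‖ₑ ^ 2

theorem lintegral_mul_sq_le {X : Type*} [MeasurableSpace X] (μ : Measure X) {f g : X → ℝ≥0∞}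
    (hf : AEMeasurable f μ) (hg : AEMeasurable g μ) :
    (∫⁻ x, f x * g x ∂μ) ^ 2 ≤ (∫⁻ x, f x ∂μ) * ∫⁻ x, f x * g x ^ 2 ∂μ := by
  have h := ENNReal.lintegral_mul_le_Lp_mul_Lq μ Real.HolderConjugate.two_two
    (f := fun x ↦ f x ^ (1 / 2 : ℝ)) (g := fun x ↦ f x ^ (1 / 2 : ℝ) * g x)
    (hf.pow_const _) ((hf.pow_const _).mul hg)
  have e : ∀ a : ℝ≥0∞, a ^ (1 / 2 : ℝ) * a ^ (1 / 2 : ℝ) = a := fun a ↦ by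
    rw [← ENNReal.rpow_add_of_nonneg _ _ (by norm_num) (by norm_num)]
    norm_num
  have e2 : ∀ a : ℝ≥0∞, (a ^ (1 / 2 : ℝ)) ^ (2 : ℝ) = a := fun a ↦ by
    rw [← ENNReal.rpow_mul]
    norm_num
  simp only [Pi.mul_apply, ← mul_assoc, e] at h
  calc _ ≤ (_ : ℝ≥0∞) ^ 2 := pow_le_pow_left' h 2
    _ = _ := by
      rw [mul_pow, ← ENNReal.rpow_two, ← ENNReal.rpow_two, e2, e2]
      congr 1
      · simp only [e2]
      · congr 1
        ext x
        rw [ENNReal.mul_rpow_of_nonneg _ _ (by norm_num), e2, ENNReal.rpow_two]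

theorem exists_enorm_oscInt_sq_le : ∃ C : ℝ, 0 < C ∧ ∀ (m : ℝ → ℂ) (k B : ℝ),
    SymbolBound m (Set.Icc (k - 2) (k + 2)) B → ∀ G : 𝓢(ℝ, ℂ),
    (∀ ξ, 1 < |ξ - k| → (𝓕 G) ξ = 0) → ∀ x t : ℝ,
    ‖oscInt (fun ξ ↦ m ξ * (𝓕 G) ξ) x t‖ₑ ^ 2 ≤
      ENNReal.ofReal (C * B ^ 2 * (1 + |t|) ^ 4) * unitAvg G (x + 4 * Real.pi * k * t) := by
  obtain ⟨C, hC, h⟩ := exists_norm_oscInt_le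
  refine ⟨C ^ 2 * Real.pi, by positivity, fun m k B hm G hG x t ↦ ?_⟩
  have hB : 0 ≤ B := (norm_nonneg _).trans (hm.bound 0 (by norm_num) k (by constructor <;> linarith))
  set u := x + 4 * Real.pi * k * t
  have h1 : ‖oscInt (fun ξ ↦ m ξ * (𝓕 G) ξ) x t‖ₑ ≤
      ENNReal.ofReal (C * B * (1 + |t|) ^ 2) * ∫⁻ y, cauchyWeight (u - y) * ‖G y‖ₑ := by
    rw [← ofReal_norm]
    refine (ENNReal.ofReal_le_ofReal (h m k B hm G hG x t)).trans ?_
    rw [ENNReal.ofReal_mul (by positivity)]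
    gcongr
    rw [ofReal_integral_eq_lintegral_ofReal]
    · refine le_of_eq (lintegral_congr fun y ↦ ?_)
      rw [ENNReal.ofReal_mul (by positivity), ofReal_norm]
      rfl
    · refine G.integrable.norm.mono (Continuous.aestronglyMeasurable ?_) (ae_of_all _ fun y ↦ ?_)
      · have : Continuous fun y ↦ (1 + (u - y) ^ 2)⁻¹ :=
          Continuous.inv₀ (by fun_prop) (fun y ↦ by positivity)
        exact this.mul G.continuous.norm
      · rw [norm_mul, norm_norm, Real.norm_of_nonneg (by positivity)]
        refine mul_le_of_le_one_left (norm_nonneg _) (inv_le_one_of_one_le₀ ?_)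
        nlinarith [sq_nonneg (u - y)]
    · exact ae_of_all _ fun y ↦ by positivity
  have hGm : Measurable fun y ↦ ‖G y‖ₑ := G.continuous.measurable.enorm
  calc _ ≤ (_ : ℝ≥0∞) ^ 2 := pow_le_pow_left' h1 2
    _ ≤ ENNReal.ofReal (C * B * (1 + |t|) ^ 2) ^ 2 * (ENNReal.ofReal Real.pi * unitAvg G u) := by
      rw [mul_pow]
      gcongr
      refine (lintegral_mul_sq_le volume (by fun_prop) hGm.aemeasurable).trans ?_
      gcongr
      · rw [lintegral_sub_left_eq_self cauchyWeight u, lintegral_cauchyWeight]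
      · exact le_rfl
    _ = _ := by
      rw [← mul_assoc, ← ENNReal.ofReal_pow (by positivity), ← ENNReal.ofReal_mul (by positivity)]
      congr 2
      ring

/-! ### Band-limited weights and biorthogonality of products of packets -/

/-- A rapidly decaying nonnegative weight, at least one on `[-2, 2]`, with Fourier transform
supported in `[-1, 1]`. -/
structure IsBandWeight (η : ℝ → ℝ) : Prop where
  continuous : Continuous η
  nonneg : ∀ t, 0 ≤ η t
  one_le : ∀ t, |t| ≤ 2 → 1 ≤ η t
  integrable : Integrable η
  decay : ∃ C, 0 < C ∧ ∀ t, η t ≤ C * ((1 + |t|) ^ 12)⁻¹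
  vanish : ∀ ω, 1 ≤ |ω| → ∫ t, unitExp (t * ω) * (η t : ℂ) = 0

theorem re_unitExp (r : ℝ) : (unitExp r).re = Real.cos (2 * Real.pi * r) := by
  rw [unitExp, Complex.exp_ofReal_mul_I_re]

theorem norm_sq_eq_mul_conj (z : ℂ) : ((‖z‖ ^ 2 : ℝ) : ℂ) = z * (starRingEnd ℂ) z := by
  rw [Complex.mul_conj, Complex.normSq_eq_norm_sq]

/-- Take the normalised squared modulus of the transform of a narrow bump. It is nonnegative, and
its own transform is an autocorrelation of the bump, hence supported near zero. Since the bump lives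
in |v| ≤ 1/16, the phase 2πvt is at most π/4 < 1 for |t| ≤ 2, so its cosine is at least 1/2 and the
transform is at least half the mass there. The decay of order 12 is a decay of order 6, squared. -/
theorem exists_isBandWeight : ∃ η, IsBandWeight η := by
  let φ : ContDiffBump (0 : ℝ) := ⟨1 / 32, 1 / 16, by norm_num, by norm_num⟩
  have hφ0 : ∀ x, 1 / 16 ≤ |x| → φ x = 0 := fun x hx ↦
    φ.zero_of_le_dist (by rwa [dist_zero_right, Real.norm_eq_abs])
  have hcs : HasCompactSupport (fun x ↦ (φ x : ℂ)) :=
    φ.hasCompactSupport.comp_left (g := fun x : ℝ ↦ (x : ℂ)) (by simp)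
  let Φ : 𝓢(ℝ, ℂ) := hcs.toSchwartzMap (Complex.ofRealCLM.contDiff.comp φ.contDiff)
  have hΦ : ∀ x, Φ x = φ x := fun x ↦ rfl
  have hF : ∀ t, (𝓕 Φ) t = ∫ v, unitExp (-(v * t)) * φ v := fun t ↦ by
    rw [SchwartzMap.fourier_coe, fourier_eq_integral_unitExp]
    rfl
  set c : ℝ := (∫ v, φ v) / 2 with hc
  have hcpos : 0 < c := by
    have := φ.integral_pos (μ := volume)
    positivity
  have hlow : ∀ t, |t| ≤ 2 → c ≤ ‖(𝓕 Φ) t‖ := by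
    intro t ht
    refine le_trans ?_ (Complex.re_le_norm _)
    have hi : Integrable fun v ↦ unitExp (-(v * t)) * (φ v : ℂ) := by
      refine Φ.integrable.mono (Continuous.aestronglyMeasurable ?_) (ae_of_all _ fun v ↦ ?_)
      · have := φ.continuous
        fun_prop
      · rw [norm_mul, norm_unitExp, one_mul, hΦ]
    have e : ((𝓕 Φ) t).re = ∫ v, Real.cos (2 * Real.pi * -(v * t)) * φ v := by
      rw [hF]
      refine (integral_re hi).symm.trans ?_
      congr 1
      ext v
      simp [re_unitExp]
    rw [e, hc, div_eq_mul_inv, ← integral_mul_const]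
    refine integral_mono (φ.integrable.mul_const _) ?_ fun v ↦ ?_
    · have := hi.re
      refine this.congr (ae_of_all _ fun v ↦ ?_)
      simp [re_unitExp]
    · by_cases hv : 1 / 16 ≤ |v|
      · simp [hφ0 v hv]
      · have h1 : |2 * Real.pi * -(v * t)| ≤ Real.pi / 4 := by
          rw [not_le] at hv
          rw [abs_mul, abs_neg, abs_of_pos (by positivity : 0 < 2 * Real.pi), abs_mul]
          have : |v| * |t| ≤ 1 / 16 * 2 := by gcongr
          nlinarith [Real.pi_pos]
        have h2 : 1 / 2 ≤ Real.cos (2 * Real.pi * -(v * t)) := by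
          have h3 := Real.one_sub_sq_div_two_le_cos (x := 2 * Real.pi * -(v * t))
          have h4 : |2 * Real.pi * -(v * t)| ≤ 1 := by
            linarith [Real.pi_lt_d2]
          have := (sq_le_one_iff_abs_le_one _).2 h4
          linarith
        have := φ.nonneg (x := v)
        nlinarith
  set η : ℝ → ℝ := fun t ↦ (c ^ 2)⁻¹ * ‖(𝓕 Φ) t‖ ^ 2 with hη
  have hdec : ∃ C, 0 < C ∧ ∀ t, η t ≤ C * ((1 + |t|) ^ 12)⁻¹ := by
    obtain ⟨C, hC⟩ : ∃ C, ∀ t, (1 + |t|) ^ 6 * ‖(𝓕 Φ) t‖ ≤ C := by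
      have h := SchwartzMap.one_add_le_sup_seminorm_apply (𝕜 := ℝ) (m := (6, 0)) (k := 6) (n := 0)
        le_rfl le_rfl (𝓕 Φ)
      simp only [norm_iteratedFDeriv_zero, Real.norm_eq_abs] at h
      exact ⟨_, h⟩
    have hC0 : 0 ≤ C := le_trans (by positivity) (hC 0)
    refine ⟨(c ^ 2)⁻¹ * (C ^ 2 + 1), by positivity, fun t ↦ ?_⟩
    rw [hη, mul_assoc]
    refine mul_le_mul_of_nonneg_left ?_ (by positivity)
    rw [← div_eq_mul_inv, le_div_iff₀ (by positivity)]
    calc ‖(𝓕 Φ) t‖ ^ 2 * (1 + |t|) ^ 12 = ((1 + |t|) ^ 6 * ‖(𝓕 Φ) t‖) ^ 2 := by ring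
      _ ≤ C ^ 2 := pow_le_pow_left₀ (by positivity) (hC t) 2
      _ ≤ _ := by linarith
  have hcont : Continuous η := by
    have := (𝓕 Φ).continuous
    fun_prop
  have hint : Integrable fun t ↦ ‖(𝓕 Φ) t‖ ^ 2 := by
    have := ((𝓕 Φ).memLp 2 volume).integrable_norm_pow (by norm_num)
    simpa using this
  refine ⟨η, hcont, fun t ↦ by positivity, fun t ht ↦ ?_, hint.const_mul _, hdec, fun ω hω ↦ ?_⟩
  · change 1 ≤ (c ^ 2)⁻¹ * ‖(𝓕 Φ) t‖ ^ 2
    rw [← div_eq_inv_mul, one_le_div (by positivity)]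
    exact pow_le_pow_left₀ hcpos.le (hlow t ht) 2
  · have hz := SchwartzMap.integral_inner_fourier_fourier
      (SchwartzMap.compSubConstCLM ℂ ω Φ) Φ
    have e1 : ∫ x, inner ℂ ((SchwartzMap.compSubConstCLM ℂ ω Φ) x) (Φ x) = 0 := by
      rw [← integral_zero ℝ ℂ]
      congr 1
      ext x
      rw [SchwartzMap.compSubConstCLM_apply, hΦ, hΦ]
      by_cases hx : 1 / 16 ≤ |x|
      · simp [hφ0 x hx]
      · have : 1 / 16 ≤ |x - ω| := by
          have := abs_sub_abs_le_abs_sub ω x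
          rw [abs_sub_comm ω x] at this
          linarith [not_le.1 hx]
        simp [hφ0 _ this]
    rw [e1] at hz
    have hs : ∀ t, (𝓕 (SchwartzMap.compSubConstCLM ℂ ω Φ)) t = unitExp (-(t * ω)) * (𝓕 Φ) t := by
      intro t
      rw [SchwartzMap.fourier_coe, SchwartzMap.fourier_coe, fourier_eq_integral_unitExp,
        fourier_eq_integral_unitExp, ← integral_const_mul, ← integral_add_right_eq_self _ ω]
      congr 1
      ext v
      rw [SchwartzMap.compSubConstCLM_apply, add_sub_cancel_right, ← mul_assoc, ← unitExp_add]
      congr 2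
      ring
    calc ∫ t, unitExp (t * ω) * (η t : ℂ)
        = ∫ t, ((c ^ 2)⁻¹ : ℝ) * inner ℂ ((𝓕 (SchwartzMap.compSubConstCLM ℂ ω Φ)) t) ((𝓕 Φ) t) := by
          congr 1
          ext t
          rw [hs, RCLike.inner_apply, map_mul, conj_unitExp, hη, Complex.ofReal_mul,
            norm_sq_eq_mul_conj]
          ring_nf
      _ = 0 := by rw [integral_const_mul, hz, mul_zero]

/-- A bound for sums of functions that are mostly orthogonal. -/
theorem lintegral_enorm_sum_sq_le_of_orthogonal {X ι : Type*} [MeasurableSpace X] (μ : Measure X)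
    (S : Finset ι) (Φ : ι → X → ℂ) (R : ι → ι → Prop) [DecidableRel R] (hR : ∀ p q, R p q → R q p)
    (D : ℕ) (hD : ∀ p ∈ S, (S.filter (R p)).card ≤ D) (hΦ : ∀ p ∈ S, MemLp (Φ p) 2 μ)
    (h0 : ∀ p ∈ S, ∀ q ∈ S, ¬ R p q → ∫ x, Φ p x * (starRingEnd ℂ) (Φ q x) ∂μ = 0) :
    ∫⁻ x, ‖∑ p ∈ S, Φ p x‖ₑ ^ 2 ∂μ ≤ D * ∑ p ∈ S, ∫⁻ x, ‖Φ p x‖ₑ ^ 2 ∂μ := by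
  have hi : ∀ p ∈ S, ∀ q ∈ S, Integrable (fun x ↦ Φ p x * (starRingEnd ℂ) (Φ q x)) μ :=
    fun p hp q hq ↦ by
      have := (hΦ p hp).integrable_mul (hΦ q hq).star
      exact this
  have hsq : ∀ f : X → ℂ, MemLp f 2 μ → ∫⁻ x, ‖f x‖ₑ ^ 2 ∂μ = ENNReal.ofReal (∫ x, ‖f x‖ ^ 2 ∂μ) := by
    intro f hf
    rw [ofReal_integral_eq_lintegral_ofReal]
    · refine lintegral_congr fun x ↦ ?_
      rw [ENNReal.ofReal_pow (norm_nonneg _), ofReal_norm]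
    · simpa using hf.integrable_norm_pow (by norm_num)
    · exact ae_of_all _ fun x ↦ by positivity
  have hS : MemLp (fun x ↦ ∑ p ∈ S, Φ p x) 2 μ := memLp_finsetSum S hΦ
  rw [hsq _ hS, Finset.sum_congr rfl fun p hp ↦ hsq _ (hΦ p hp),
    ← ENNReal.ofReal_sum_of_nonneg (fun p _ ↦ integral_nonneg fun x ↦ by positivity),
    ← ENNReal.ofReal_natCast, ← ENNReal.ofReal_mul (by positivity)]
  apply ENNReal.ofReal_le_ofReal
  set n : ι → ℝ := fun p ↦ ∫ x, ‖Φ p x‖ ^ 2 ∂μ with hn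
  have hnn : ∀ p, 0 ≤ n p := fun p ↦ integral_nonneg fun x ↦ by positivity
  have hni : ∀ p ∈ S, Integrable (fun x ↦ ‖Φ p x‖ ^ 2) μ := fun p hp ↦ by
    simpa using (hΦ p hp).integrable_norm_pow (by norm_num)
  have e1 : ∫ x, ‖∑ p ∈ S, Φ p x‖ ^ 2 ∂μ =
      ∑ p ∈ S, ∑ q ∈ S, (∫ x, Φ p x * (starRingEnd ℂ) (Φ q x) ∂μ).re := by
    have : ((∫ x, ‖∑ p ∈ S, Φ p x‖ ^ 2 ∂μ : ℝ) : ℂ) =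
        ∑ p ∈ S, ∑ q ∈ S, ∫ x, Φ p x * (starRingEnd ℂ) (Φ q x) ∂μ := by
      rw [← integral_complex_ofReal]
      have e : ∀ x, ((‖∑ p ∈ S, Φ p x‖ ^ 2 : ℝ) : ℂ) =
          ∑ p ∈ S, ∑ q ∈ S, Φ p x * (starRingEnd ℂ) (Φ q x) := fun x ↦ by
        rw [norm_sq_eq_mul_conj, map_sum, Finset.sum_mul_sum]
      refine (integral_congr_ae (ae_of_all _ e)).trans ?_
      rw [integral_finsetSum _ fun p hp ↦ integrable_finsetSum _ fun q hq ↦ hi p hp q hq]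
      exact Finset.sum_congr rfl fun p hp ↦ integral_finsetSum _ fun q hq ↦ hi p hp q hq
    have h2 := congrArg Complex.re this
    rw [Complex.ofReal_re] at h2
    simpa using h2
  rw [e1]
  -- The inequality between the arithmetic and geometric mean charges half of each related pair to
  -- either member. Symmetry of the relation allows the second charge to be counted from the side of
  -- q.
  have hle : ∀ p ∈ S, ∀ q ∈ S, (∫ x, Φ p x * (starRingEnd ℂ) (Φ q x) ∂μ).re ≤
      (if R p q then n p / 2 else 0) + (if R q p then n q / 2 else 0) := by
    intro p hp q hq
    by_cases h : R p q
    · rw [if_pos h, if_pos (hR p q h)]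
      refine (Complex.re_le_norm _).trans ((norm_integral_le_integral_norm _).trans ?_)
      rw [← add_div, hn, ← integral_add (hni p hp) (hni q hq), ← integral_div]
      refine integral_mono (hi p hp q hq).norm (((hni p hp).add (hni q hq)).div_const _) fun x ↦ ?_
      simp only [norm_mul, RCLike.norm_conj]
      nlinarith [sq_nonneg (‖Φ p x‖ - ‖Φ q x‖)]
    · rw [h0 p hp q hq h, if_neg h, if_neg (fun h' ↦ h (hR q p h'))]
      simp
  have hcount : ∑ p ∈ S, ∑ q ∈ S, (if R p q then n p / 2 else 0) ≤ D * (∑ p ∈ S, n p) / 2 := by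
    rw [Finset.mul_sum, Finset.sum_div]
    refine Finset.sum_le_sum fun p hp ↦ ?_
    rw [← Finset.sum_filter, Finset.sum_const, nsmul_eq_mul, mul_div_assoc]
    have : ((S.filter (R p)).card : ℝ) ≤ D := by exact_mod_cast hD p hp
    have := hnn p
    gcongr
  calc _ ≤ ∑ p ∈ S, ∑ q ∈ S, ((if R p q then n p / 2 else 0) + (if R q p then n q / 2 else 0)) :=
        Finset.sum_le_sum fun p hp ↦ Finset.sum_le_sum fun q hq ↦ hle p hp q hq
    _ = (∑ p ∈ S, ∑ q ∈ S, (if R p q then n p / 2 else 0)) +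
        ∑ q ∈ S, ∑ p ∈ S, (if R q p then n q / 2 else 0) := by
        simp only [Finset.sum_add_distrib]
        congr 1
        exact Finset.sum_comm
    _ ≤ _ := by linarith

theorem conj_oscInt (h : ℝ → ℂ) (x t : ℝ) : (starRingEnd ℂ) (oscInt h x t) =
    ∫ ξ, unitExp (-(x * ξ + 2 * Real.pi * t * ξ ^ 2)) * (starRingEnd ℂ) (h ξ) := by
  unfold oscInt
  rw [← integral_conj]
  simp [conj_unitExp]

/-- The weight `η(t) η((y - c) / M)` adapted to the space-time box of width `M` around `c`. -/
noncomputable def boxWeight (η : ℝ → ℝ) (M c : ℝ) (z : ℝ × ℝ) : ℝ := η ((z.1 - c) / M) * η z.2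

theorem IsBandWeight.vanish_scaled {η : ℝ → ℝ} (hη : IsBandWeight η) {M : ℝ} (hM : 0 < M)
    (c a : ℝ) (ha : 1 ≤ M * |a|) : ∫ y, unitExp (y * a) * (η ((y - c) / M) : ℂ) = 0 := by
  have h := hη.vanish (M * a) (by rwa [abs_mul, abs_of_pos hM])
  rw [← integral_add_right_eq_self _ c]
  simp only [add_sub_cancel_right]
  have e : ∀ y, unitExp ((y + c) * a) * (η (y / M) : ℂ) =
      unitExp (c * a) * (unitExp ((y / M) * (M * a)) * η (y / M)) := by
    intro y
    rw [← mul_assoc, ← unitExp_add]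
    congr 2
    field_simp
    ring
  simp_rw [e]
  rw [integral_const_mul,
    Measure.integral_comp_div (fun s ↦ unitExp (s * (M * a)) * (η s : ℂ)) M, h]
  simp

/-- A quadruple of free evolutions with non-resonant frequencies has vanishing weighted
integral. -/
theorem integral_boxWeight_mul_oscInt_eq_zero {η : ℝ → ℝ} (hη : IsBandWeight η) {M : ℝ}
    (hM : 0 < M) (c : ℝ) {h₁ h₂ h₃ h₄ : ℝ → ℂ} (i₁ : Integrable h₁) (i₂ : Integrable h₂)
    (i₃ : Integrable h₃) (i₄ : Integrable h₄)
    (h0 : ∀ ξ₁ ξ₂ ξ₃ ξ₄, h₁ ξ₁ ≠ 0 → h₂ ξ₂ ≠ 0 → h₃ ξ₃ ≠ 0 → h₄ ξ₄ ≠ 0 →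
      1 ≤ M * |ξ₁ + ξ₂ - ξ₃ - ξ₄| ∨ 1 ≤ |ξ₁ ^ 2 + ξ₂ ^ 2 - ξ₃ ^ 2 - ξ₄ ^ 2|) :
    ∫ z : ℝ × ℝ, (boxWeight η M c z : ℂ) * (oscInt h₁ z.1 z.2 * oscInt h₂ z.1 z.2 *
      (starRingEnd ℂ) (oscInt h₃ z.1 z.2 * oscInt h₄ z.1 z.2)) = 0 := by
  set H : (ℝ × ℝ) × (ℝ × ℝ) → ℂ := fun ω ↦ (h₁ ω.1.1 * h₂ ω.1.2) *
    ((starRingEnd ℂ) (h₃ ω.2.1) * (starRingEnd ℂ) (h₄ ω.2.2)) with hH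
  set A : (ℝ × ℝ) × (ℝ × ℝ) → ℝ := fun ω ↦ ω.1.1 + ω.1.2 - ω.2.1 - ω.2.2 with hA
  set B : (ℝ × ℝ) × (ℝ × ℝ) → ℝ := fun ω ↦ ω.1.1 ^ 2 + ω.1.2 ^ 2 - ω.2.1 ^ 2 - ω.2.2 ^ 2 with hB
  have c₃ : Integrable fun ξ ↦ (starRingEnd ℂ) (h₃ ξ) :=
    (Complex.conjLIE.toLinearIsometry.toContinuousLinearMap.integrable_comp i₃)
  have c₄ : Integrable fun ξ ↦ (starRingEnd ℂ) (h₄ ξ) :=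
    (Complex.conjLIE.toLinearIsometry.toContinuousLinearMap.integrable_comp i₄)
  have hHi : Integrable H (volume.prod volume) := (i₁.mul_prod i₂).mul_prod (c₃.mul_prod c₄)
  have hWi : Integrable (fun z : ℝ × ℝ ↦ (boxWeight η M c z : ℂ)) (volume.prod volume) := by
    have h1 : Integrable (fun y ↦ η ((y - c) / M)) :=
      (hη.integrable.comp_div hM.ne').comp_sub_right c
    exact (h1.mul_prod hη.integrable).ofReal
  -- The product is a superposition of plane waves with space frequency A and time frequency 2πB.
  -- Integrating against the weight produces transforms of η at MA and at 2πB, and one of them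
  -- vanishes.
  have e1 : ∀ z : ℝ × ℝ, oscInt h₁ z.1 z.2 * oscInt h₂ z.1 z.2 *
      (starRingEnd ℂ) (oscInt h₃ z.1 z.2 * oscInt h₄ z.1 z.2) =
      ∫ ω, unitExp (z.1 * A ω + z.2 * (2 * Real.pi * B ω)) * H ω := by
    intro z
    rw [map_mul, conj_oscInt, conj_oscInt]
    unfold oscInt
    rw [← integral_prod_mul, ← integral_prod_mul, ← integral_prod_mul]
    congr 1
    ext ω
    rw [hH, hA, hB, show ∀ a b c d e f g h : ℂ, a * b * (c * d) * (e * f * (g * h)) =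
      (a * c * e * g) * (b * d * (f * h)) by intros; ring, ← unitExp_add, ← unitExp_add,
      ← unitExp_add]
    congr 2
    ring
  simp_rw [e1, ← integral_const_mul]
  rw [integral_integral_swap]
  · rw [← integral_zero ((ℝ × ℝ) × (ℝ × ℝ)) ℂ]
    congr 1
    ext ω
    have e2 : ∀ z : ℝ × ℝ, (boxWeight η M c z : ℂ) *
        (unitExp (z.1 * A ω + z.2 * (2 * Real.pi * B ω)) * H ω) =
        H ω * ((unitExp (z.1 * A ω) * (η ((z.1 - c) / M) : ℂ)) *
          (unitExp (z.2 * (2 * Real.pi * B ω)) * (η z.2 : ℂ))) := by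
      intro z
      rw [unitExp_add, boxWeight]
      push_cast
      ring
    simp_rw [e2]
    rw [integral_const_mul]
    rw [show (∫ z : ℝ × ℝ, (unitExp (z.1 * A ω) * (η ((z.1 - c) / M) : ℂ)) *
          (unitExp (z.2 * (2 * Real.pi * B ω)) * (η z.2 : ℂ))) = _ from
      integral_prod_mul (fun y ↦ unitExp (y * A ω) * (η ((y - c) / M) : ℂ))
        (fun t ↦ unitExp (t * (2 * Real.pi * B ω)) * (η t : ℂ))]
    by_cases hz : h₁ ω.1.1 ≠ 0 ∧ h₂ ω.1.2 ≠ 0 ∧ h₃ ω.2.1 ≠ 0 ∧ h₄ ω.2.2 ≠ 0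
    · rcases h0 _ _ _ _ hz.1 hz.2.1 hz.2.2.1 hz.2.2.2 with h | h
      · rw [hη.vanish_scaled hM c _ h]
        simp
      · rw [hη.vanish]
        · simp
        · rw [abs_mul, abs_of_pos (by positivity : 0 < 2 * Real.pi)]
          have := Real.pi_gt_three
          nlinarith
    · have : H ω = 0 := by
        simp only [hH, mul_eq_zero, map_eq_zero]
        tauto
      rw [this, zero_mul]
  · have := hWi.mul_prod hHi
    refine this.mono (Continuous.aestronglyMeasurable ?_ |>.mul this.1) (ae_of_all _ fun p ↦ ?_) |>.congr
      (f := fun p : (ℝ × ℝ) × ((ℝ × ℝ) × (ℝ × ℝ)) ↦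
        unitExp (p.1.1 * A p.2 + p.1.2 * (2 * Real.pi * B p.2)) *
        ((boxWeight η M c p.1 : ℂ) * H p.2)) (ae_of_all _ fun p ↦ ?_)
    · simp only [hA, hB]
      fun_prop
    · rw [Pi.mul_apply, norm_mul, norm_unitExp, one_mul]
    · simp only [Function.uncurry]
      ring

/-- Near resonance of two pairs of lattice frequencies. -/
def PairResonant (p q : ℤ × ℤ) : Prop :=
  |p.1 + p.2 - q.1 - q.2| ≤ 5 ∧ |(|p.1 - p.2| - |q.1 - q.2|)| ≤ 9

theorem PairResonant.symm {p q : ℤ × ℤ} (h : PairResonant p q) : PairResonant q p := by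
  obtain ⟨h1, h2⟩ := h
  refine ⟨?_, by rwa [abs_sub_comm]⟩
  rw [← abs_neg]
  convert h1 using 2
  ring

open Classical in
-- A pair is determined by its sum and difference. There are 11 admissible sums, and 19 differences
-- near each of d and -d: 418 = 11 · 38.
theorem card_filter_pairResonant_le (S : Finset (ℤ × ℤ)) (p : ℤ × ℤ) :
    (S.filter (PairResonant p)).card ≤ 418 := by
  set d := |p.1 - p.2| with hd
  set T : Finset (ℤ × ℤ) := Finset.Icc (p.1 + p.2 - 5) (p.1 + p.2 + 5) ×ˢ
    (Finset.Icc (d - 9) (d + 9) ∪ Finset.Icc (-d - 9) (-d + 9)) with hT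
  have hcard : T.card ≤ 418 := by
    rw [hT, Finset.card_product]
    have h1 : (Finset.Icc (p.1 + p.2 - 5) (p.1 + p.2 + 5)).card = 11 := by
      rw [Int.card_Icc]
      omega
    have h2 := Finset.card_union_le (Finset.Icc (d - 9) (d + 9)) (Finset.Icc (-d - 9) (-d + 9))
    have h3 : (Finset.Icc (d - 9) (d + 9)).card = 19 := by
      rw [Int.card_Icc]
      omega
    have h4 : (Finset.Icc (-d - 9) (-d + 9)).card = 19 := by
      rw [Int.card_Icc]
      omega
    rw [h1]
    omega
  refine (Finset.card_le_card_of_injOn (fun q ↦ (q.1 + q.2, q.1 - q.2)) (fun q hq ↦ ?_)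
    (fun q _ q' _ h ↦ ?_)).trans hcard
  · rw [Finset.mem_coe, Finset.mem_filter] at hq
    obtain ⟨-, h1, h2⟩ := hq
    rw [abs_le] at h1 h2
    simp only [hT, Finset.coe_product, Set.mem_prod, Finset.mem_coe, Finset.mem_Icc,
      Finset.mem_union]
    refine ⟨by omega, ?_⟩
    rcases abs_cases (q.1 - q.2) with h | h <;> omega
  · simp only [Prod.mk.injEq] at h
    ext <;> omega

/-- Twice a sum of squares is the square of the sum plus the square of the difference. The sums
agree to within 1/M and the four frequencies add up to at most 20M, so the squares of the sums
differ by at most 20 and those of the differences by at most 2 + 20 = 22. As 22 < 5², the absolute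
differences are within 5 of each other. Rounding the four frequencies to lattice points costs 4
more, which gives 5 = 1 + 4 and 9 = 5 + 4 in `PairResonant`. The accuracy 1/M, due to boxes of width
M, is essential here. -/
theorem pairResonant_of_frequencies {M : ℝ} (hM : 1 ≤ M) {p q : ℤ × ℤ}
    (hp1 : |(p.1 : ℝ)| ≤ 4 * M) (hp2 : |(p.2 : ℝ)| ≤ 4 * M) (hq1 : |(q.1 : ℝ)| ≤ 4 * M)
    (hq2 : |(q.2 : ℝ)| ≤ 4 * M) {ξ₁ ξ₂ ξ₃ ξ₄ : ℝ} (h₁ : |ξ₁ - p.1| ≤ 1) (h₂ : |ξ₂ - p.2| ≤ 1)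
    (h₃ : |ξ₃ - q.1| ≤ 1) (h₄ : |ξ₄ - q.2| ≤ 1) (hA : M * |ξ₁ + ξ₂ - ξ₃ - ξ₄| < 1)
    (hB : |ξ₁ ^ 2 + ξ₂ ^ 2 - ξ₃ ^ 2 - ξ₄ ^ 2| < 1) : PairResonant p q := by
  have hA1 : |ξ₁ + ξ₂ - ξ₃ - ξ₄| < 1 := by nlinarith [abs_nonneg (ξ₁ + ξ₂ - ξ₃ - ξ₄)]
  have hS : |ξ₁ + ξ₂ + ξ₃ + ξ₄| ≤ 20 * M := by
    rw [abs_le] at *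
    constructor <;> linarith [hp1.1, hp1.2]
  have hAS : |(ξ₁ + ξ₂ - ξ₃ - ξ₄) * (ξ₁ + ξ₂ + ξ₃ + ξ₄)| ≤ 20 := by
    rw [abs_mul]
    have := mul_le_mul_of_nonneg_left hS (abs_nonneg (ξ₁ + ξ₂ - ξ₃ - ξ₄))
    nlinarith
  have hD : |(|ξ₁ - ξ₂| - |ξ₃ - ξ₄|)| < 5 := by
    have h1 : |(|ξ₁ - ξ₂| - |ξ₃ - ξ₄|)| ≤ |ξ₁ - ξ₂| + |ξ₃ - ξ₄| := by
      rw [abs_le]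
      constructor <;> linarith [abs_nonneg (ξ₁ - ξ₂), abs_nonneg (ξ₃ - ξ₄)]
    have h2 : |(|ξ₁ - ξ₂| - |ξ₃ - ξ₄|)| * (|ξ₁ - ξ₂| + |ξ₃ - ξ₄|) ≤ 22 := by
      rw [← abs_of_nonneg (by positivity : 0 ≤ |ξ₁ - ξ₂| + |ξ₃ - ξ₄|), ← abs_mul,
        show (|ξ₁ - ξ₂| - |ξ₃ - ξ₄|) * (|ξ₁ - ξ₂| + |ξ₃ - ξ₄|) =
          |ξ₁ - ξ₂| ^ 2 - |ξ₃ - ξ₄| ^ 2 by ring, sq_abs, sq_abs,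
        show (ξ₁ - ξ₂) ^ 2 - (ξ₃ - ξ₄) ^ 2 = 2 * (ξ₁ ^ 2 + ξ₂ ^ 2 - ξ₃ ^ 2 - ξ₄ ^ 2) -
          (ξ₁ + ξ₂ - ξ₃ - ξ₄) * (ξ₁ + ξ₂ + ξ₃ + ξ₄) by ring]
      rw [abs_lt] at hB
      rw [abs_le] at hAS ⊢
      constructor <;> linarith [hB.1, hB.2, hAS.1, hAS.2]
    nlinarith [abs_nonneg (|ξ₁ - ξ₂| - |ξ₃ - ξ₄|)]
  have hp : |(|ξ₁ - ξ₂| - |(p.1 : ℝ) - p.2|)| ≤ 2 := by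
    refine (abs_abs_sub_abs_le _ _).trans ?_
    rw [abs_le] at *
    constructor <;> linarith [h₁.1, h₁.2]
  have hq : |(|ξ₃ - ξ₄| - |(q.1 : ℝ) - q.2|)| ≤ 2 := by
    refine (abs_abs_sub_abs_le _ _).trans ?_
    rw [abs_le] at *
    constructor <;> linarith [h₃.1, h₃.2]
  constructor
  · have : |((p.1 + p.2 - q.1 - q.2 : ℤ) : ℝ)| ≤ 5 := by
      push_cast
      rw [abs_le] at *
      rw [abs_lt] at hA1
      constructor <;> linarith [h₁.1, h₁.2, hA1.1, hA1.2]
    exact_mod_cast this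
  · have : |((|p.1 - p.2| - |q.1 - q.2| : ℤ) : ℝ)| ≤ 9 := by
      push_cast
      rw [abs_le] at hp hq ⊢
      rw [abs_lt] at hD
      constructor <;> linarith [hp.1, hp.2, hq.1, hq.2, hD.1, hD.2]
    exact_mod_cast this

/-- A lattice family of profiles: continuous and supported within distance one of the
frequency. -/
structure IsLatticeProfile (h : ℤ → ℝ → ℂ) : Prop where
  continuous : ∀ k, Continuous (h k)
  support : ∀ (k : ℤ) (ξ : ℝ), 1 < |ξ - k| → h k ξ = 0

theorem IsLatticeProfile.hasCompactSupport {h : ℤ → ℝ → ℂ} (hh : IsLatticeProfile h) (k : ℤ) :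
    HasCompactSupport (h k) := by
  refine HasCompactSupport.intro (isCompact_Icc (a := (k : ℝ) - 1) (b := k + 1)) fun ξ hξ ↦
    hh.support k ξ ?_
  by_contra hle
  rw [not_lt, abs_le] at hle
  exact hξ ⟨by linarith [hle.1], by linarith [hle.2]⟩

theorem IsLatticeProfile.integrable {h : ℤ → ℝ → ℂ} (hh : IsLatticeProfile h) (k : ℤ) :
    Integrable (h k) :=
  (hh.continuous k).integrable_of_hasCompactSupport (hh.hasCompactSupport k)

theorem IsLatticeProfile.mul {h : ℤ → ℝ → ℂ} (hh : IsLatticeProfile h) {m : ℝ → ℂ}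
    (hm : Continuous m) : IsLatticeProfile (fun k ξ ↦ m ξ * h k ξ) :=
  ⟨fun k ↦ hm.mul (hh.continuous k), fun k ξ hξ ↦ by rw [hh.support k ξ hξ, mul_zero]⟩

theorem IsLatticeProfile.shift {h : ℤ → ℝ → ℂ} (hh : IsLatticeProfile h) (ζ : ℤ) :
    IsLatticeProfile (fun k ξ ↦ h (k + ζ) (ξ + ζ)) := by
  refine ⟨fun k ↦ (hh.continuous _).comp (by fun_prop), fun k ξ hξ ↦ hh.support _ _ ?_⟩
  convert hξ using 2
  push_cast
  ring

open Classical in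
/-- Biorthogonality of the products of unit scale wave packets. -/
theorem lintegral_boxWeight_sum_mul_sum_le {η : ℝ → ℝ} (hη : IsBandWeight η) {M : ℝ}
    (hM : 1 ≤ M) (c : ℝ) (S T : Finset ℤ) (hS : ∀ k ∈ S, |(k : ℝ)| ≤ 4 * M)
    (hT : ∀ k ∈ T, |(k : ℝ)| ≤ 4 * M) {h h' : ℤ → ℝ → ℂ} (hh : IsLatticeProfile h)
    (hh' : IsLatticeProfile h') :
    ∫⁻ z : ℝ × ℝ, ENNReal.ofReal (boxWeight η M c z) *
      ‖(∑ k ∈ S, oscInt (h k) z.1 z.2) * ∑ l ∈ T, oscInt (h' l) z.1 z.2‖ₑ ^ 2 ≤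
    418 * ∑ k ∈ S, ∑ l ∈ T, ∫⁻ z : ℝ × ℝ, ENNReal.ofReal (boxWeight η M c z) *
      (‖oscInt (h k) z.1 z.2‖ₑ ^ 2 * ‖oscInt (h' l) z.1 z.2‖ₑ ^ 2) := by
  have hM0 : 0 < M := by linarith
  have hW0 : ∀ z, 0 ≤ boxWeight η M c z := fun z ↦ mul_nonneg (hη.nonneg _) (hη.nonneg _)
  have hWc : Continuous (boxWeight η M c) := by
    have := hη.continuous
    unfold boxWeight
    fun_prop
  have hWi : Integrable (boxWeight η M c) (volume.prod volume) :=
    ((hη.integrable.comp_div hM0.ne').comp_sub_right c).mul_prod hη.integrable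
  -- With the root of the weight in each factor, plain L² orthogonality is the vanishing of the
  -- weighted quadrilinear integral.
  set Φ : ℤ × ℤ → ℝ × ℝ → ℂ := fun p z ↦ (√(boxWeight η M c z) : ℂ) *
    (oscInt (h p.1) z.1 z.2 * oscInt (h' p.2) z.1 z.2) with hΦ
  have hsq : ∀ z (w : ℂ), ‖(√(boxWeight η M c z) : ℂ) * w‖ₑ ^ 2 =
      ENNReal.ofReal (boxWeight η M c z) * ‖w‖ₑ ^ 2 := by
    intro z w
    rw [enorm_mul, mul_pow]
    congr 1
    rw [← ofReal_norm, Complex.norm_real, Real.norm_of_nonneg (Real.sqrt_nonneg _),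
      ← ENNReal.ofReal_pow (Real.sqrt_nonneg _), Real.sq_sqrt (hW0 z)]
  have hmem : ∀ p, MemLp (Φ p) 2 (volume.prod volume) := by
    intro p
    have hc : Continuous (Φ p) := by
      have h1 := continuous_oscInt (hh.integrable p.1)
      have h2 := continuous_oscInt (hh'.integrable p.2)
      have h3 : Continuous fun z ↦ (√(boxWeight η M c z) : ℂ) :=
        Complex.continuous_ofReal.comp (Real.continuous_sqrt.comp hWc)
      exact h3.mul (h1.mul h2)
    rw [memLp_two_iff_integrable_sq_norm hc.aestronglyMeasurable]
    refine (hWi.mul_const (((∫ ξ, ‖h p.1 ξ‖) * ∫ ξ, ‖h' p.2 ξ‖) ^ 2)).mono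
      (hc.norm.pow 2).aestronglyMeasurable (ae_of_all _ fun z ↦ ?_)
    rw [Real.norm_of_nonneg (by positivity), Real.norm_of_nonneg (mul_nonneg (hW0 z) (by positivity)),
      hΦ, norm_mul, mul_pow, Complex.norm_real, Real.norm_of_nonneg (Real.sqrt_nonneg _),
      Real.sq_sqrt (hW0 z), norm_mul]
    gcongr
    · exact hW0 z
    · exact norm_oscInt_le _ _ _
    · exact norm_oscInt_le _ _ _
  have key := lintegral_enorm_sum_sq_le_of_orthogonal (volume.prod volume) (S ×ˢ T) Φ PairResonant
    (fun p q h ↦ h.symm) 418 (fun p _ ↦ card_filter_pairResonant_le _ p) (fun p _ ↦ hmem p) ?_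
  · rw [Finset.sum_product] at key
    refine le_of_eq_of_le ?_ (key.trans (le_of_eq ?_))
    · refine lintegral_congr fun z ↦ ?_
      rw [← hsq, Finset.sum_mul_sum, Finset.mul_sum, Finset.sum_product]
      simp only [hΦ, Finset.mul_sum]
    · simp only [hΦ, hsq]
      simp only [enorm_mul, mul_pow]
      rfl
  · intro p hp q hq hpq
    rw [Finset.mem_product] at hp hq
    have := integral_boxWeight_mul_oscInt_eq_zero hη hM0 c (hh.integrable p.1) (hh'.integrable p.2)
      (hh.integrable q.1) (hh'.integrable q.2) fun ξ₁ ξ₂ ξ₃ ξ₄ h₁ h₂ h₃ h₄ ↦ by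
        by_contra! hcon
        refine hpq (pairResonant_of_frequencies hM (hS _ hp.1) (hT _ hp.2) (hS _ hq.1) (hT _ hq.2)
          (ξ₁ := ξ₁) (ξ₂ := ξ₂) (ξ₃ := ξ₃) (ξ₄ := ξ₄) ?_ ?_ ?_ ?_ hcon.1 hcon.2)
        · exact not_lt.1 fun h ↦ h₁ (hh.support _ _ h)
        · exact not_lt.1 fun h ↦ h₂ (hh'.support _ _ h)
        · exact not_lt.1 fun h ↦ h₃ (hh.support _ _ h)
        · exact not_lt.1 fun h ↦ h₄ (hh'.support _ _ h)
    rw [← this]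
    refine integral_congr_ae (ae_of_all _ fun z ↦ ?_)
    simp only [hΦ, map_mul, Complex.conj_ofReal]
    have e : ((boxWeight η M c z : ℝ) : ℂ) =
        (√(boxWeight η M c z) : ℂ) * (√(boxWeight η M c z) : ℂ) := by
      rw [← Complex.ofReal_mul, Real.mul_self_sqrt (hW0 z)]
    rw [e]
    ring

/-! ### Local constancy at the scale of the frequency -/

/-- Average the fundamental theorem of calculus over the interval of length L to the right of `a`.
For a function of frequency M the choice L = 1/M makes both terms comparable. -/
theorem enorm_le_lintegral_of_hasDerivAt {f f' : ℝ → ℂ} (hf : ∀ x, HasDerivAt f (f' x) x)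
    (hf' : Continuous f') {L : ℝ} (hL : 0 < L) (a : ℝ) :
    ‖f a‖ₑ ≤ ∫⁻ r in Set.Icc 0 L, (ENNReal.ofReal L⁻¹ * ‖f (a + r)‖ₑ + ‖f' (a + r)‖ₑ) := by
  have hfc : Continuous f := continuous_iff_continuousAt.2 fun x ↦ (hf x).continuousAt
  set J := ∫⁻ r in Set.Icc 0 L, ‖f' (a + r)‖ₑ with hJ
  have h1 : ∀ r ∈ Set.Icc 0 L, ‖f a‖ₑ ≤ ‖f (a + r)‖ₑ + J := by
    intro r hr
    have h2 : ∫ s in (0 : ℝ)..r, f' (a + s) = f (a + r) - f a := by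
      have := intervalIntegral.integral_eq_sub_of_hasDerivAt (f := fun s ↦ f (a + s))
        (f' := fun s ↦ f' (a + s)) (a := 0) (b := r)
        (fun s _ ↦ by simpa using (hf (a + s)).comp_const_add a s)
        ((hf'.comp (by fun_prop)).intervalIntegrable _ _)
      simpa using this
    have h3 : f a = f (a + r) - ∫ s in (0 : ℝ)..r, f' (a + s) := by rw [h2]; ring
    rw [h3]
    refine (enorm_sub_le).trans (add_le_add le_rfl ?_)
    rw [intervalIntegral.integral_of_le hr.1]
    refine (enorm_integral_le_lintegral_enorm _).trans ?_
    exact lintegral_mono_set fun s hs ↦ ⟨hs.1.le, hs.2.trans hr.2⟩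
  have hv : ENNReal.ofReal L⁻¹ * volume (Set.Icc 0 L) = 1 := by
    rw [Real.volume_Icc, sub_zero, ← ENNReal.ofReal_mul (by positivity), inv_mul_cancel₀ hL.ne',
      ENNReal.ofReal_one]
  calc ‖f a‖ₑ = ENNReal.ofReal L⁻¹ * ∫⁻ _ in Set.Icc 0 L, ‖f a‖ₑ := by
        rw [setLIntegral_const, mul_left_comm, hv, mul_one]
    _ ≤ ENNReal.ofReal L⁻¹ * ∫⁻ r in Set.Icc 0 L, (‖f (a + r)‖ₑ + J) := by
        exact mul_le_mul' le_rfl (setLIntegral_mono' measurableSet_Icc h1)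
    _ = _ := by
        have hm : Measurable fun r ↦ ‖f (a + r)‖ₑ :=
          (hfc.comp (by fun_prop)).measurable.enorm
        rw [lintegral_add_left hm, setLIntegral_const, mul_add, mul_left_comm, hv, mul_one,
          lintegral_add_left (hm.const_mul _), lintegral_const_mul _ hm]

/-- The profile `(ξ / M) ^ i h(ξ)`. -/
noncomputable def scaledProfile (M : ℝ) (i : ℕ) (h : ℝ → ℂ) (ξ : ℝ) : ℂ := (((ξ / M) ^ i : ℝ) : ℂ) * h ξ

theorem scaledProfile_zero (M : ℝ) (h : ℝ → ℂ) : scaledProfile M 0 h = h := by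
  ext ξ
  simp [scaledProfile]

theorem Continuous.scaledProfile {M : ℝ} {h : ℝ → ℂ} (hh : Continuous h) (i : ℕ) :
    Continuous (scaledProfile M i h) := by
  unfold _root_.scaledProfile
  fun_prop

theorem HasCompactSupport.scaledProfile {M : ℝ} {h : ℝ → ℂ} (hh : HasCompactSupport h) (i : ℕ) :
    HasCompactSupport (scaledProfile M i h) := by
  have : HasCompactSupport ((fun ξ : ℝ ↦ (((ξ / M) ^ i : ℝ) : ℂ)) * h) := hh.mul_left
  exact this

theorem integrable_scaledProfile {M : ℝ} {h : ℝ → ℂ} (hc : Continuous h)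
    (hs : HasCompactSupport h) (i : ℕ) : Integrable (scaledProfile M i h) :=
  (hc.scaledProfile i).integrable_of_hasCompactSupport (hs.scaledProfile i)

theorem hasDerivAt_oscInt_scaledProfile_fst {M : ℝ} (hM : 0 < M) {h : ℝ → ℂ} (hc : Continuous h)
    (hs : HasCompactSupport h) (i : ℕ) (y t : ℝ) :
    HasDerivAt (fun y ↦ oscInt (scaledProfile M i h) y t)
      (2 * Real.pi * Complex.I * M * oscInt (scaledProfile M (i + 1) h) y t) y := by
  have e : (fun ξ : ℝ ↦ (ξ : ℂ) * scaledProfile M i h ξ) =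
      fun ξ ↦ (M : ℂ) * scaledProfile M (i + 1) h ξ := by
    ext ξ
    have : (M : ℂ) ≠ 0 := by exact_mod_cast hM.ne'
    simp only [scaledProfile]
    push_cast
    field_simp
    simp only [pow_succ]
    field_simp
  have hi : Integrable (fun ξ : ℝ ↦ (ξ : ℂ) * scaledProfile M i h ξ) := by
    rw [e]
    exact (integrable_scaledProfile hc hs _).const_mul _
  refine (hasDerivAt_oscInt_fst (integrable_scaledProfile hc hs i) hi y t).congr_deriv ?_
  rw [e, oscInt_const_mul]
  ring

theorem hasDerivAt_oscInt_scaledProfile_snd {M : ℝ} (hM : 0 < M) {h : ℝ → ℂ} (hc : Continuous h)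
    (hs : HasCompactSupport h) (i : ℕ) (y t : ℝ) :
    HasDerivAt (fun t ↦ oscInt (scaledProfile M i h) y t)
      (4 * Real.pi ^ 2 * Complex.I * M ^ 2 * oscInt (scaledProfile M (i + 2) h) y t) t := by
  have e : (fun ξ : ℝ ↦ (ξ : ℂ) ^ 2 * scaledProfile M i h ξ) =
      fun ξ ↦ (M ^ 2 : ℂ) * scaledProfile M (i + 2) h ξ := by
    ext ξ
    have : (M : ℂ) ≠ 0 := by exact_mod_cast hM.ne'
    simp only [scaledProfile]
    push_cast
    field_simp
    simp only [pow_succ]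
    field_simp
  have hi : Integrable (fun ξ : ℝ ↦ (ξ : ℂ) ^ 2 * scaledProfile M i h ξ) := by
    rw [e]
    exact (integrable_scaledProfile hc hs _).const_mul _
  refine (hasDerivAt_oscInt_snd (integrable_scaledProfile hc hs i) hi y t).congr_deriv ?_
  rw [e, oscInt_const_mul]
  ring

/-- The sum of the moduli of the first four rescaled derivatives. -/
noncomputable def jetSize (M : ℝ) (h : ℝ → ℂ) (z : ℝ × ℝ) : ℝ≥0∞ :=
  ∑ i ∈ Finset.range 4, ‖oscInt (scaledProfile M i h) z.1 z.2‖ₑ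

theorem measurable_enorm_oscInt {h : ℝ → ℂ} (hh : Integrable h) :
    Measurable fun z : ℝ × ℝ ↦ ‖oscInt h z.1 z.2‖ₑ :=
  (continuous_oscInt hh).measurable.enorm

theorem measurable_jetSize {M : ℝ} {h : ℝ → ℂ} (hc : Continuous h) (hs : HasCompactSupport h) :
    Measurable (jetSize M h) := by
  unfold jetSize
  exact Finset.measurable_fun_sum _ fun i _ ↦ measurable_enorm_oscInt (integrable_scaledProfile hc hs i)

/-- Local constancy of products of free evolutions at the scale of their frequencies. -/
theorem enorm_oscInt_mul_oscInt_le {M : ℝ} (hM : 0 < M) {h g : ℝ → ℂ} (hc : Continuous h)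
    (hs : HasCompactSupport h) (gc : Continuous g) (gs : HasCompactSupport g) (y t : ℝ) :
    ‖oscInt h y t * oscInt g y t‖ₑ ≤ ENNReal.ofReal (280 * M ^ 3) *
      ∫⁻ s in Set.Icc 0 (M ^ 2)⁻¹, ∫⁻ r in Set.Icc 0 M⁻¹,
        jetSize M h (y + r, t + s) * jetSize M g (y + r, t + s) := by
  set u : ℕ → ℝ × ℝ → ℂ := fun i z ↦ oscInt (scaledProfile M i h) z.1 z.2 with hu
  set v : ℕ → ℝ × ℝ → ℂ := fun i z ↦ oscInt (scaledProfile M i g) z.1 z.2 with hv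
  have uc : ∀ i, Continuous (u i) := fun i ↦ continuous_oscInt (integrable_scaledProfile hc hs i)
  have vc : ∀ i, Continuous (v i) := fun i ↦ continuous_oscInt (integrable_scaledProfile gc gs i)
  have hpi2 : Real.pi ^ 2 ≤ 10 := by nlinarith [Real.pi_lt_d2, Real.pi_pos]
  -- From 2π ≤ 7 and 4π² ≤ 40; the two steps together give the constant 280 = 7 · 40.
  have n1 : ‖(2 * Real.pi * Complex.I * M : ℂ)‖ₑ ≤ ENNReal.ofReal (7 * M) := by
    rw [← ofReal_norm]
    apply ENNReal.ofReal_le_ofReal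
    simp only [norm_mul, Complex.norm_ofNat, Complex.norm_real, Complex.norm_I, mul_one,
      Real.norm_eq_abs, abs_of_pos Real.pi_pos, abs_of_pos hM]
    nlinarith [Real.pi_lt_d2]
  have n2 : ‖(4 * Real.pi ^ 2 * Complex.I * M ^ 2 : ℂ)‖ₑ ≤ ENNReal.ofReal (40 * M ^ 2) := by
    rw [← ofReal_norm]
    apply ENNReal.ofReal_le_ofReal
    simp only [norm_mul, norm_pow, Complex.norm_ofNat, Complex.norm_real, Complex.norm_I, mul_one,
      Real.norm_eq_abs, abs_of_pos Real.pi_pos, abs_of_pos hM]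
    nlinarith [sq_nonneg M]
  have stepY : ∀ i j, ∀ y t, ‖u i (y, t)‖ₑ * ‖v j (y, t)‖ₑ ≤ ENNReal.ofReal (7 * M) *
      ∫⁻ r in Set.Icc 0 M⁻¹, (‖u i (y + r, t)‖ₑ * ‖v j (y + r, t)‖ₑ +
        ‖u (i + 1) (y + r, t)‖ₑ * ‖v j (y + r, t)‖ₑ +
        ‖u i (y + r, t)‖ₑ * ‖v (j + 1) (y + r, t)‖ₑ) := by
    intro i j y t
    have hd : ∀ x, HasDerivAt (fun y ↦ u i (y, t) * v j (y, t))
        (2 * Real.pi * Complex.I * M * u (i + 1) (x, t) * v j (x, t) +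
          u i (x, t) * (2 * Real.pi * Complex.I * M * v (j + 1) (x, t))) x := fun x ↦
      (hasDerivAt_oscInt_scaledProfile_fst hM hc hs i x t).mul
        (hasDerivAt_oscInt_scaledProfile_fst hM gc gs j x t)
    rw [← enorm_mul, ← lintegral_const_mul' _ _ ENNReal.ofReal_ne_top]
    refine (enorm_le_lintegral_of_hasDerivAt hd ?_ (inv_pos.2 hM) y).trans ?_
    · have := uc i; have := uc (i + 1); have := vc j; have := vc (j + 1)
      fun_prop
    · refine lintegral_mono fun r ↦ ?_
      rw [inv_inv, mul_add, mul_add, add_assoc]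
      refine add_le_add ?_ ?_
      · rw [enorm_mul]
        gcongr
        linarith
      · refine (enorm_add_le _ _).trans (add_le_add ?_ ?_)
        · rw [enorm_mul, enorm_mul, mul_assoc]
          gcongr
        · rw [enorm_mul, enorm_mul, mul_left_comm]
          gcongr
  have stepT : ∀ y t, ‖u 0 (y, t)‖ₑ * ‖v 0 (y, t)‖ₑ ≤ ENNReal.ofReal (40 * M ^ 2) *
      ∫⁻ s in Set.Icc 0 (M ^ 2)⁻¹, (‖u 0 (y, t + s)‖ₑ * ‖v 0 (y, t + s)‖ₑ +
        ‖u 2 (y, t + s)‖ₑ * ‖v 0 (y, t + s)‖ₑ +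
        ‖u 0 (y, t + s)‖ₑ * ‖v 2 (y, t + s)‖ₑ) := by
    intro y t
    have hd : ∀ x, HasDerivAt (fun t ↦ u 0 (y, t) * v 0 (y, t))
        (4 * Real.pi ^ 2 * Complex.I * M ^ 2 * u (0 + 2) (y, x) * v 0 (y, x) +
          u 0 (y, x) * (4 * Real.pi ^ 2 * Complex.I * M ^ 2 * v (0 + 2) (y, x))) x := fun x ↦
      (hasDerivAt_oscInt_scaledProfile_snd hM hc hs 0 y x).mul
        (hasDerivAt_oscInt_scaledProfile_snd hM gc gs 0 y x)
    rw [← enorm_mul, ← lintegral_const_mul' _ _ ENNReal.ofReal_ne_top]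
    refine (enorm_le_lintegral_of_hasDerivAt hd ?_ (by positivity : 0 < (M ^ 2)⁻¹) t).trans ?_
    · have := uc 0; have := uc (0 + 2); have := vc 0; have := vc (0 + 2)
      fun_prop
    · refine lintegral_mono fun r ↦ ?_
      rw [inv_inv, mul_add, mul_add, add_assoc]
      refine add_le_add ?_ ?_
      · rw [enorm_mul]
        gcongr
        nlinarith [sq_nonneg M]
      · refine (enorm_add_le _ _).trans (add_le_add ?_ ?_)
        · rw [enorm_mul, enorm_mul, mul_assoc]
          gcongr
        · rw [enorm_mul, enorm_mul, mul_left_comm]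
          gcongr
  -- A time derivative raises the power of ξ/M by two and a space derivative by one. One of each is
  -- used, so orders 0 to 3 occur; this is why `jetSize` has four terms.
  have hfin : ∀ z : ℝ × ℝ,
      (‖u 0 z‖ₑ * ‖v 0 z‖ₑ + ‖u 1 z‖ₑ * ‖v 0 z‖ₑ + ‖u 0 z‖ₑ * ‖v 1 z‖ₑ) +
      (‖u 2 z‖ₑ * ‖v 0 z‖ₑ + ‖u 3 z‖ₑ * ‖v 0 z‖ₑ + ‖u 2 z‖ₑ * ‖v 1 z‖ₑ) +
      (‖u 0 z‖ₑ * ‖v 2 z‖ₑ + ‖u 1 z‖ₑ * ‖v 2 z‖ₑ + ‖u 0 z‖ₑ * ‖v 3 z‖ₑ) ≤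
      jetSize M h z * jetSize M g z := by
    intro z
    change _ ≤ (∑ i ∈ Finset.range 4, ‖u i z‖ₑ) * ∑ i ∈ Finset.range 4, ‖v i z‖ₑ
    simp only [Finset.sum_range_succ, Finset.sum_range_zero, zero_add]
    generalize ‖u 0 z‖ₑ = a0, ‖u 1 z‖ₑ = a1, ‖u 2 z‖ₑ = a2, ‖u 3 z‖ₑ = a3,
      ‖v 0 z‖ₑ = b0, ‖v 1 z‖ₑ = b1, ‖v 2 z‖ₑ = b2, ‖v 3 z‖ₑ = b3
    rw [show (a0 + a1 + a2 + a3) * (b0 + b1 + b2 + b3) =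
      ((a0 * b0 + a1 * b0 + a0 * b1) + (a2 * b0 + a3 * b0 + a2 * b1) +
      (a0 * b2 + a1 * b2 + a0 * b3)) + (a1 * b1 + a3 * b1 + a2 * b2 + a3 * b2 +
        a1 * b3 + a2 * b3 + a3 * b3) by ring]
    exact le_self_add
  have um : ∀ i t, Measurable fun r ↦ ‖u i (y + r, t)‖ₑ := fun i t ↦
    ((uc i).comp (by fun_prop : Continuous fun r : ℝ ↦ (y + r, t))).measurable.enorm
  have vm : ∀ i t, Measurable fun r ↦ ‖v i (y + r, t)‖ₑ := fun i t ↦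
    ((vc i).comp (by fun_prop : Continuous fun r : ℝ ↦ (y + r, t))).measurable.enorm
  have hm : ∀ i j t, Measurable fun r ↦ ‖u i (y + r, t)‖ₑ * ‖v j (y + r, t)‖ₑ +
      ‖u (i + 1) (y + r, t)‖ₑ * ‖v j (y + r, t)‖ₑ +
      ‖u i (y + r, t)‖ₑ * ‖v (j + 1) (y + r, t)‖ₑ := fun i j t ↦
    (((um i t).mul (vm j t)).add ((um (i + 1) t).mul (vm j t))).add
      ((um i t).mul (vm (j + 1) t))
  calc ‖oscInt h y t * oscInt g y t‖ₑ = ‖u 0 (y, t)‖ₑ * ‖v 0 (y, t)‖ₑ := by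
        simp only [enorm_mul, hu, hv, scaledProfile_zero]
    _ ≤ _ := stepT y t
    _ ≤ ENNReal.ofReal (40 * M ^ 2) * ∫⁻ s in Set.Icc 0 (M ^ 2)⁻¹, (ENNReal.ofReal (7 * M) *
          ∫⁻ r in Set.Icc 0 M⁻¹, jetSize M h (y + r, t + s) * jetSize M g (y + r, t + s)) := by
        gcongr with s
        refine (add_le_add (add_le_add (stepY 0 0 y (t + s)) (stepY 2 0 y (t + s)))
          (stepY 0 2 y (t + s))).trans ?_
        rw [← mul_add, ← mul_add, ← lintegral_add_left (hm 0 0 _),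
          ← lintegral_add_right _ (hm 0 2 _)]
        exact mul_le_mul' le_rfl (lintegral_mono fun r ↦ hfin (y + r, t + s))
    _ = _ := by
        rw [lintegral_const_mul' _ _ ENNReal.ofReal_ne_top, ← mul_assoc,
          ← ENNReal.ofReal_mul (by positivity)]
        congr 2
        ring

/-! ### The bilinear estimate for transversal clusters -/

theorem lintegral_comp_mul_left_real (f : ℝ → ℝ≥0∞) {b : ℝ} (hb : b ≠ 0) :
    ∫⁻ t, f (b * t) = ENNReal.ofReal |b⁻¹| * ∫⁻ t, f t := by
  have h := (Homeomorph.mulLeft₀ b hb).measurableEmbedding.lintegral_map (μ := volume) f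
  simp only [Homeomorph.coe_mulLeft₀] at h
  rw [← h, Real.map_volume_mul_left hb, lintegral_smul_measure, smul_eq_mul]

theorem lintegral_sub_mul_left_real (f : ℝ → ℝ≥0∞) {b : ℝ} (hb : b ≠ 0) (u : ℝ) :
    ∫⁻ t, f (u - b * t) = ENNReal.ofReal |b⁻¹| * ∫⁻ t, f t := by
  rw [lintegral_comp_mul_left_real (fun s ↦ f (u - s)) hb, lintegral_sub_left_eq_self]

/-- A lattice family of profiles on `S`, with envelopes `a k` of the corresponding wave packets
and of their first derivatives at frequency scale `M`. -/
structure IsPacketFamily (M : ℝ) (S : Finset ℤ) (h : ℤ → ℝ → ℂ) (a : ℤ → ℝ → ℝ≥0∞) : Prop where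
  profile : IsLatticeProfile h
  freq : ∀ k ∈ S, |(k : ℝ)| ≤ 4 * M
  measurable : ∀ k, Measurable (a k)
  bound : ∀ k ∈ S, ∀ i < 4, ∀ y t, ‖oscInt (scaledProfile M i (h k)) y t‖ₑ ^ 2 ≤
    ENNReal.ofReal ((1 + |t|) ^ 4) * a k (y + 4 * Real.pi * k * t)

/-- The total profile of a lattice family. -/
def sumProfile (S : Finset ℤ) (h : ℤ → ℝ → ℂ) (ξ : ℝ) : ℂ := ∑ k ∈ S, h k ξ

theorem IsLatticeProfile.continuous_sum {h : ℤ → ℝ → ℂ} (hh : IsLatticeProfile h)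
    (S : Finset ℤ) : Continuous (sumProfile S h) :=
  continuous_finsetSum S fun k _ ↦ hh.continuous k

theorem IsLatticeProfile.hasCompactSupport_sum {h : ℤ → ℝ → ℂ} (hh : IsLatticeProfile h)
    (S : Finset ℤ) : HasCompactSupport (sumProfile S h) := by
  have hb : ∀ k ∈ S, ∃ r : ℝ, ∀ ξ, r < |ξ| → h k ξ = 0 := by
    intro k _
    refine ⟨|(k : ℝ)| + 1, fun ξ hξ ↦ hh.support k ξ ?_⟩
    have := abs_sub_abs_le_abs_sub ξ k
    linarith
  choose! r hr using hb
  have : ∃ R, ∀ k ∈ S, r k ≤ R := by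
    obtain ⟨R, hR⟩ := (S.image r).bddAbove
    exact ⟨R, fun k hk ↦ hR (Finset.mem_coe.2 (Finset.mem_image_of_mem r hk))⟩
  obtain ⟨R, hR⟩ := this
  refine HasCompactSupport.intro (isCompact_Icc (a := -R) (b := R)) fun ξ hξ ↦ ?_
  refine Finset.sum_eq_zero fun k hk ↦ hr k hk ξ ((hR k hk).trans_lt ?_)
  by_contra hle
  exact hξ (abs_le.1 (not_lt.1 hle))

theorem oscInt_scaledProfile_sumProfile {h : ℤ → ℝ → ℂ} (hh : IsLatticeProfile h)
    (S : Finset ℤ) (M : ℝ) (i : ℕ) (y t : ℝ) :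
    oscInt (scaledProfile M i (sumProfile S h)) y t =
      ∑ k ∈ S, oscInt (scaledProfile M i (h k)) y t := by
  rw [← oscInt_sum S fun k _ ↦ integrable_scaledProfile (hh.continuous k) (hh.hasCompactSupport k) i]
  congr 1
  ext ξ
  simp [scaledProfile, sumProfile, Finset.mul_sum]

theorem sq_sum_range_four_le (f : ℕ → ℝ≥0∞) :
    (∑ i ∈ Finset.range 4, f i) ^ 2 ≤ 4 * ∑ i ∈ Finset.range 4, f i ^ 2 := by
  have := ENNReal.rpow_sum_le_const_mul_sum_rpow (Finset.range 4) f (p := 2) (by norm_num)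
  simp only [Finset.card_range, ENNReal.rpow_two] at this
  refine this.trans (le_of_eq ?_)
  norm_num

/-- The `L²` bound for a product of two packet sums on a box of width `M`. -/
theorem lintegral_box_jetSize_le {η : ℝ → ℝ} (hη : IsBandWeight η) {M : ℝ} (hM : 1 ≤ M)
    {S T : Finset ℤ} {h g : ℤ → ℝ → ℂ} {a b : ℤ → ℝ → ℝ≥0∞} (hS : IsPacketFamily M S h a)
    (hT : IsPacketFamily M T g b) (c : ℝ) :
    ∫⁻ z in Set.Icc (c - M) (c + M) ×ˢ Set.Icc 0 2,
      (jetSize M (sumProfile S h) z * jetSize M (sumProfile T g) z) ^ 2 ≤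
    107008 * ∑ k ∈ S, ∑ l ∈ T, ∫⁻ z : ℝ × ℝ,
      ENNReal.ofReal (boxWeight η M c z * (1 + |z.2|) ^ 8) *
        (a k (z.1 + 4 * Real.pi * k * z.2) * b l (z.1 + 4 * Real.pi * l * z.2)) := by
  have hM0 : 0 < M := by linarith
  set Q := Set.Icc (c - M) (c + M) ×ˢ Set.Icc (0 : ℝ) 2 with hQ
  have hQm : MeasurableSet Q := measurableSet_Icc.prod measurableSet_Icc
  have hW0 : ∀ z, 0 ≤ boxWeight η M c z := fun z ↦ mul_nonneg (hη.nonneg _) (hη.nonneg _)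
  have hWQ : ∀ z ∈ Q, 1 ≤ boxWeight η M c z := by
    rintro z ⟨hz1, hz2⟩
    have h1 : 1 ≤ η ((z.1 - c) / M) := by
      refine hη.one_le _ ?_
      rw [abs_div, abs_of_pos hM0, div_le_iff₀ hM0, abs_le]
      constructor <;> linarith [hz1.1, hz1.2]
    have h2 : 1 ≤ η z.2 := hη.one_le _ (by rw [abs_le]; constructor <;> linarith [hz2.1, hz2.2])
    exact one_le_mul_of_one_le_of_one_le h1 h2
  have mi : ∀ i, Measurable fun z : ℝ × ℝ ↦ ‖oscInt (scaledProfile M i (sumProfile S h)) z.1 z.2‖ₑ :=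
    fun i ↦ measurable_enorm_oscInt (integrable_scaledProfile (hS.profile.continuous_sum S)
      (hS.profile.hasCompactSupport_sum S) i)
  have ni : ∀ i, Measurable fun z : ℝ × ℝ ↦ ‖oscInt (scaledProfile M i (sumProfile T g)) z.1 z.2‖ₑ :=
    fun i ↦ measurable_enorm_oscInt (integrable_scaledProfile (hT.profile.continuous_sum T)
      (hT.profile.hasCompactSupport_sum T) i)
  have hWm : Measurable fun z ↦ ENNReal.ofReal (boxWeight η M c z) := by
    have := hη.continuous
    unfold boxWeight
    fun_prop
  -- Each jet squared is at most four times the sum of its four squares, whence 16. The 16 pairs (i,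
  -- j) and the constant 418 of biorthogonality complete 107008 = 16 · 16 · 418.
  have step1 : ∀ z ∈ Q, (jetSize M (sumProfile S h) z * jetSize M (sumProfile T g) z) ^ 2 ≤
      16 * ∑ i ∈ Finset.range 4, ∑ j ∈ Finset.range 4, ENNReal.ofReal (boxWeight η M c z) *
        ‖oscInt (scaledProfile M i (sumProfile S h)) z.1 z.2 *
          oscInt (scaledProfile M j (sumProfile T g)) z.1 z.2‖ₑ ^ 2 := by
    intro z hz
    rw [mul_pow]
    refine (mul_le_mul' (sq_sum_range_four_le _) (sq_sum_range_four_le _)).trans ?_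
    rw [mul_mul_mul_comm, Finset.sum_mul_sum]
    norm_num only [mul_one]
    refine mul_le_mul' le_rfl (Finset.sum_le_sum fun i _ ↦ Finset.sum_le_sum fun j _ ↦ ?_)
    rw [enorm_mul, mul_pow]
    refine le_mul_of_one_le_left' ?_
    rw [← ENNReal.ofReal_one]
    exact ENNReal.ofReal_le_ofReal (hWQ z hz)
  have step2 : ∀ i < 4, ∀ j < 4, ∫⁻ z : ℝ × ℝ, ENNReal.ofReal (boxWeight η M c z) *
        ‖oscInt (scaledProfile M i (sumProfile S h)) z.1 z.2 *
          oscInt (scaledProfile M j (sumProfile T g)) z.1 z.2‖ₑ ^ 2 ≤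
      418 * ∑ k ∈ S, ∑ l ∈ T, ∫⁻ z : ℝ × ℝ,
      ENNReal.ofReal (boxWeight η M c z * (1 + |z.2|) ^ 8) *
        (a k (z.1 + 4 * Real.pi * k * z.2) * b l (z.1 + 4 * Real.pi * l * z.2)) := by
    intro i hi j hj
    simp only [oscInt_scaledProfile_sumProfile hS.profile, oscInt_scaledProfile_sumProfile hT.profile]
    have p1 : IsLatticeProfile fun k ↦ scaledProfile M i (h k) :=
      hS.profile.mul (m := fun ξ ↦ (((ξ / M) ^ i : ℝ) : ℂ)) (by fun_prop)
    have p2 : IsLatticeProfile fun k ↦ scaledProfile M j (g k) :=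
      hT.profile.mul (m := fun ξ ↦ (((ξ / M) ^ j : ℝ) : ℂ)) (by fun_prop)
    refine (lintegral_boxWeight_sum_mul_sum_le hη hM c S T hS.freq hT.freq p1 p2).trans ?_
    refine mul_le_mul' le_rfl (Finset.sum_le_sum fun k hk ↦ Finset.sum_le_sum fun l hl ↦
      lintegral_mono fun z ↦ ?_)
    refine (mul_le_mul' le_rfl (mul_le_mul' (hS.bound k hk i hi z.1 z.2)
      (hT.bound l hl j hj z.1 z.2))).trans (le_of_eq ?_)
    rw [mul_mul_mul_comm, ← mul_assoc, ← ENNReal.ofReal_mul (by positivity),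
      ← ENNReal.ofReal_mul (hW0 z)]
    congr 3
    ring
  calc _ ≤ ∫⁻ z in Q, 16 * ∑ i ∈ Finset.range 4, ∑ j ∈ Finset.range 4,
        ENNReal.ofReal (boxWeight η M c z) *
        ‖oscInt (scaledProfile M i (sumProfile S h)) z.1 z.2 *
          oscInt (scaledProfile M j (sumProfile T g)) z.1 z.2‖ₑ ^ 2 :=
        setLIntegral_mono' hQm step1
    _ ≤ ∫⁻ z, 16 * ∑ i ∈ Finset.range 4, ∑ j ∈ Finset.range 4,
        ENNReal.ofReal (boxWeight η M c z) *
        ‖oscInt (scaledProfile M i (sumProfile S h)) z.1 z.2 *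
          oscInt (scaledProfile M j (sumProfile T g)) z.1 z.2‖ₑ ^ 2 := setLIntegral_le_lintegral _ _
    _ = 16 * ∑ i ∈ Finset.range 4, ∑ j ∈ Finset.range 4, ∫⁻ z : ℝ × ℝ,
        ENNReal.ofReal (boxWeight η M c z) *
        ‖oscInt (scaledProfile M i (sumProfile S h)) z.1 z.2 *
          oscInt (scaledProfile M j (sumProfile T g)) z.1 z.2‖ₑ ^ 2 := by
        have hm : ∀ i j, Measurable fun z : ℝ × ℝ ↦ ENNReal.ofReal (boxWeight η M c z) *
            ‖oscInt (scaledProfile M i (sumProfile S h)) z.1 z.2 *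
            oscInt (scaledProfile M j (sumProfile T g)) z.1 z.2‖ₑ ^ 2 := by
          intro i j
          simp only [enorm_mul]
          exact hWm.mul (((mi i).mul (ni j)).pow_const 2)
        rw [lintegral_const_mul' _ _ (by norm_num), lintegral_finsetSum _ fun i _ ↦
          Finset.measurable_fun_sum _ fun j _ ↦ hm i j]
        congr 1
        exact Finset.sum_congr rfl fun i _ ↦ lintegral_finsetSum _ fun j _ ↦ hm i j
    _ ≤ 16 * ∑ i ∈ Finset.range 4, ∑ j ∈ Finset.range 4, (418 * ∑ k ∈ S, ∑ l ∈ T, ∫⁻ z : ℝ × ℝ,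
      ENNReal.ofReal (boxWeight η M c z * (1 + |z.2|) ^ 8) *
        (a k (z.1 + 4 * Real.pi * k * z.2) * b l (z.1 + 4 * Real.pi * l * z.2))) := by
        gcongr with i hi j hj
        exact step2 i (Finset.mem_range.1 hi) j (Finset.mem_range.1 hj)
    _ = _ := by
        simp only [Finset.sum_const, Finset.card_range, nsmul_eq_mul, ← mul_assoc]
        norm_num

/-- Integration along two transversal families of lines. -/
theorem lintegral_mul_transversal {f g : ℝ → ℝ≥0∞} (hf : Measurable f) (hg : Measurable g)
    {k l : ℝ} (hkl : k ≠ l) :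
    ∫⁻ z : ℝ × ℝ, f (z.1 + k * z.2) * g (z.1 + l * z.2) =
      ENNReal.ofReal |(k - l)⁻¹| * ((∫⁻ u, f u) * ∫⁻ u, g u) := by
  rw [Measure.volume_eq_prod, lintegral_prod_symm' _ (by fun_prop)]
  have e : ∀ t, ∫⁻ y, f (y + k * t) * g (y + l * t) = ∫⁻ u, f u * g (u - (k - l) * t) := by
    intro t
    rw [← lintegral_add_right_eq_self (fun u ↦ f u * g (u - (k - l) * t)) (k * t)]
    refine lintegral_congr fun y ↦ ?_
    congr 2
    ring
  simp_rw [e]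
  rw [lintegral_lintegral_swap (by fun_prop)]
  have e2 : ∀ u, ∫⁻ t, f u * g (u - (k - l) * t) = f u * (ENNReal.ofReal |(k - l)⁻¹| * ∫⁻ t, g t) := by
    intro u
    rw [lintegral_const_mul _ (by fun_prop), lintegral_sub_mul_left_real g (sub_ne_zero.2 hkl)]
  simp_rw [e2]
  rw [lintegral_mul_const _ hf]
  ring

/-- The weight localises each packet in its own moving coordinate. As |k| ≤ 4M and 16π ≤ 51, the
moving coordinate divided by M is at most |Y| + 51|t|. The two Cauchy factors cost (1+|Y|)⁴(1+|t|)⁴,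
and together with (1+|t|)⁸ this is exactly what decay of order 12 in t can absorb. -/
theorem exists_boxWeight_le {η : ℝ → ℝ} (hη : IsBandWeight η) : ∃ C, 0 < C ∧
    ∀ (M c : ℝ), 1 ≤ M → ∀ k l : ℤ, |(k : ℝ)| ≤ 4 * M → |(l : ℝ)| ≤ 4 * M → ∀ z : ℝ × ℝ,
    boxWeight η M c z * (1 + |z.2|) ^ 8 ≤ C *
      ((1 + ((z.1 + 4 * Real.pi * k * z.2 - c) / M) ^ 2)⁻¹ *
       (1 + ((z.1 + 4 * Real.pi * l * z.2 - c) / M) ^ 2)⁻¹) := by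
  obtain ⟨C, hC, hd⟩ := hη.decay
  refine ⟨C ^ 2 * 52 ^ 4, by positivity, fun M c hM k l hk hl z ↦ ?_⟩
  have hM0 : 0 < M := by linarith
  set Y := (z.1 - c) / M with hY
  set t := z.2 with ht
  have hU : ∀ k : ℤ, |(k : ℝ)| ≤ 4 * M →
      1 + ((z.1 + 4 * Real.pi * k * t - c) / M) ^ 2 ≤ (52 * ((1 + |Y|) * (1 + |t|))) ^ 2 := by
    intro k hk
    have e : (z.1 + 4 * Real.pi * k * t - c) / M = Y + 4 * Real.pi * (k / M) * t := by
      rw [hY]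
      ring
    have h1 : |4 * Real.pi * (k / M) * t| ≤ 51 * |t| := by
      rw [abs_mul, abs_mul, abs_of_pos (by positivity : 0 < 4 * Real.pi), abs_div, abs_of_pos hM0]
      have h2 : |(k : ℝ)| / M ≤ 4 := by
        rw [div_le_iff₀ hM0]
        exact hk
      have h3 : 0 ≤ |(k : ℝ)| / M := by positivity
      refine mul_le_mul_of_nonneg_right ?_ (abs_nonneg t)
      nlinarith [Real.pi_lt_d2, Real.pi_pos]
    have h4 : |(z.1 + 4 * Real.pi * k * t - c) / M| ≤ |Y| + 51 * |t| := by
      rw [e]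
      exact (abs_add_le _ _).trans (by linarith)
    rw [← sq_abs ((z.1 + 4 * Real.pi * k * t - c) / M)]
    have hY0 := abs_nonneg Y
    have ht0 := abs_nonneg t
    have h5 : 1 + (|Y| + 51 * |t|) ≤ 52 * ((1 + |Y|) * (1 + |t|)) := by nlinarith
    calc _ ≤ (1 + |(z.1 + 4 * Real.pi * k * t - c) / M|) ^ 2 := by
          nlinarith [abs_nonneg ((z.1 + 4 * Real.pi * k * t - c) / M)]
      _ ≤ _ := by
          refine pow_le_pow_left₀ (by positivity) ?_ 2
          linarith
  rw [← mul_inv, ← div_eq_mul_inv, le_div_iff₀ (by positivity)]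
  have hYp : 0 < 1 + |Y| := by positivity
  have htp : 0 < 1 + |t| := by positivity
  calc boxWeight η M c z * (1 + |t|) ^ 8 * ((1 + ((z.1 + 4 * Real.pi * k * t - c) / M) ^ 2) *
        (1 + ((z.1 + 4 * Real.pi * l * t - c) / M) ^ 2))
      ≤ ((C * ((1 + |Y|) ^ 12)⁻¹) * (C * ((1 + |t|) ^ 12)⁻¹)) * (1 + |t|) ^ 8 *
        ((52 * ((1 + |Y|) * (1 + |t|))) ^ 2 * (52 * ((1 + |Y|) * (1 + |t|))) ^ 2) := by
        gcongr
        · exact mul_le_mul (hd Y) (hd t) (hη.nonneg _) (by positivity)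
        · exact hU k hk
        · exact hU l hl
    _ = C ^ 2 * 52 ^ 4 * ((1 + |Y|) ^ 8)⁻¹ := by
        field_simp
    _ ≤ C ^ 2 * 52 ^ 4 * 1 := by
        gcongr
        exact inv_le_one_of_one_le₀ (one_le_pow₀ (by linarith [abs_nonneg Y]))
    _ = _ := mul_one _

/-- Cauchy–Schwarz for lower Lebesgue integrals. -/
theorem lintegral_sq_le_of_sq_le {X : Type*} [MeasurableSpace X] {μ : Measure X}
    {f g h : X → ℝ≥0∞} (hg : AEMeasurable g μ) (hh : AEMeasurable h μ)
    (hf : ∀ᵐ x ∂μ, f x ^ 2 ≤ g x * h x) : (∫⁻ x, f x ∂μ) ^ 2 ≤ (∫⁻ x, g x ∂μ) * ∫⁻ x, h x ∂μ := by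
  have h1 : ∫⁻ x, f x ∂μ ≤ ∫⁻ x, g x ^ (1 / 2 : ℝ) * h x ^ (1 / 2 : ℝ) ∂μ := by
    refine lintegral_mono_ae ?_
    filter_upwards [hf] with x hx
    rw [← ENNReal.mul_rpow_of_nonneg _ _ (by norm_num)]
    calc f x = (f x ^ 2) ^ (1 / 2 : ℝ) := by
          rw [← ENNReal.rpow_two, ← ENNReal.rpow_mul]
          norm_num
      _ ≤ _ := ENNReal.rpow_le_rpow hx (by norm_num)
  have h2 := ENNReal.lintegral_mul_le_Lp_mul_Lq μ (p := 2) (q := 2)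
    (Real.holderConjugate_iff.2 (by norm_num)) (hg.pow_const (1 / 2 : ℝ))
    (hh.pow_const (1 / 2 : ℝ))
  simp only [Pi.mul_apply, ← ENNReal.rpow_mul] at h2
  norm_num only [ENNReal.rpow_one] at h2
  calc _ ≤ ((∫⁻ x, g x ∂μ) ^ (1 / 2 : ℝ) * (∫⁻ x, h x ∂μ) ^ (1 / 2 : ℝ)) ^ 2 :=
        pow_le_pow_left' (h1.trans h2) 2
    _ = _ := by
        rw [mul_pow, ← ENNReal.rpow_two, ← ENNReal.rpow_two, ← ENNReal.rpow_mul, ← ENNReal.rpow_mul]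
        norm_num

/-- The parabolic box of dimensions `M⁻¹ × M⁻²` with upper right corner `z`. -/
def scaleBox (M : ℝ) (z : ℝ × ℝ) : Set (ℝ × ℝ) :=
  Set.Icc (z.1 - M⁻¹) z.1 ×ˢ Set.Icc (z.2 - (M ^ 2)⁻¹) z.2

theorem measurableSet_scaleBox (M : ℝ) (z : ℝ × ℝ) : MeasurableSet (scaleBox M z) :=
  measurableSet_Icc.prod measurableSet_Icc

theorem sub_mem_box_iff {M : ℝ} {z x : ℝ × ℝ} :
    x - z ∈ Set.Icc 0 M⁻¹ ×ˢ Set.Icc 0 (M ^ 2)⁻¹ ↔ z ∈ scaleBox M x := by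
  simp only [scaleBox, Set.mem_prod, Set.mem_Icc, Prod.fst_sub, Prod.snd_sub]
  constructor <;> rintro ⟨⟨h1, h2⟩, h3, h4⟩ <;> refine ⟨⟨?_, ?_⟩, ?_, ?_⟩ <;> linarith

theorem measurable_measure_scaleBox (ν : Measure (ℝ × ℝ)) [SFinite ν] (M : ℝ) :
    Measurable fun z ↦ ν (scaleBox M z) := by
  have hs : MeasurableSet {q : (ℝ × ℝ) × (ℝ × ℝ) | q.1 - q.2 ∈
      Set.Icc 0 M⁻¹ ×ˢ Set.Icc 0 (M ^ 2)⁻¹} :=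
    measurableSet_preimage (by fun_prop) (measurableSet_Icc.prod measurableSet_Icc)
  have := measurable_measure_prodMk_left (ν := ν) hs
  have e : (fun z ↦ ν (scaleBox M z)) = fun z ↦ ν (Prod.mk z ⁻¹' {q : (ℝ × ℝ) × (ℝ × ℝ) |
      q.1 - q.2 ∈ Set.Icc 0 M⁻¹ ×ˢ Set.Icc 0 (M ^ 2)⁻¹}) := by
    ext1 z
    congr 1
    ext x
    exact sub_mem_box_iff.symm
  rwa [e]

/-- Tonelli: averaging the integrand over a translate of B amounts to smoothing the measure.
Lebesgue estimates are transferred to ν through this identity. -/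
theorem lintegral_setLIntegral_translate (ν : Measure (ℝ × ℝ)) [SFinite ν] {J : ℝ × ℝ → ℝ≥0∞}
    (hJ : Measurable J) {B : Set (ℝ × ℝ)} (hB : MeasurableSet B) :
    ∫⁻ z, (∫⁻ x in B, J (z + x)) ∂ν = ∫⁻ x, J x * ν {z | x - z ∈ B} := by
  have h1 : ∀ z, ∫⁻ x in B, J (z + x) = ∫⁻ x, B.indicator (fun _ ↦ 1) (x - z) * J x := by
    intro z
    rw [← lintegral_indicator hB,
      ← lintegral_sub_right_eq_self (fun x ↦ B.indicator (fun a ↦ J (z + a)) x) z]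
    refine lintegral_congr fun x ↦ ?_
    by_cases hx : x - z ∈ B <;> simp [hx]
  simp_rw [h1]
  have hind : Measurable (B.indicator fun _ ↦ (1 : ℝ≥0∞)) := measurable_const.indicator hB
  rw [lintegral_lintegral_swap (by fun_prop)]
  refine lintegral_congr fun x ↦ ?_
  rw [lintegral_mul_const _ (by fun_prop), mul_comm]
  congr 1
  have hm : MeasurableSet {z | x - z ∈ B} := measurableSet_preimage (by fun_prop) hB
  rw [← lintegral_indicator_one hm]
  rfl

theorem lintegral_setLIntegral_box (ν : Measure (ℝ × ℝ)) [SFinite ν] {J : ℝ × ℝ → ℝ≥0∞}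
    (hJ : Measurable J) (M : ℝ) :
    ∫⁻ z, (∫⁻ x in Set.Icc 0 M⁻¹ ×ˢ Set.Icc 0 (M ^ 2)⁻¹, J (z + x)) ∂ν =
      ∫⁻ x, J x * ν (scaleBox M x) := by
  rw [lintegral_setLIntegral_translate ν hJ (measurableSet_Icc.prod measurableSet_Icc)]
  simp only [sub_mem_box_iff, Set.ofPred_mem_eq]

/-- Smoothing delays times by at most M⁻² ≤ 1. Hence the interval [0, 2] for the smoothed measure,
on which the band weight is still at least one. -/
theorem measure_scaleBox_eq_zero {ν : Measure (ℝ × ℝ)} (hν : ν {z | z.2 ∉ Set.Icc (0 : ℝ) 1} = 0)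
    {M : ℝ} (hM : 1 ≤ M) {z : ℝ × ℝ} (hz : z.2 ∉ Set.Icc (0 : ℝ) 2) : ν (scaleBox M z) = 0 := by
  refine measure_mono_null (t := {z | z.2 ∉ Set.Icc (0 : ℝ) 1}) (fun x hx ↦ ?_) hν
  intro hx2
  refine hz ?_
  have : (M ^ 2)⁻¹ ≤ 1 := inv_le_one_of_one_le₀ (one_le_pow₀ hM)
  exact ⟨hx2.1.trans hx.2.2, by linarith [hx.2.1, hx2.2]⟩

theorem lintegral_mul_measure_scaleBox {ν : Measure (ℝ × ℝ)}
    (hν : ν {z | z.2 ∉ Set.Icc (0 : ℝ) 1} = 0) {M : ℝ} (hM : 1 ≤ M) (J : ℝ × ℝ → ℝ≥0∞) :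
    ∫⁻ x, J x * ν (scaleBox M x) = ∫⁻ x in Set.univ ×ˢ Set.Icc 0 2, J x * ν (scaleBox M x) := by
  rw [← lintegral_indicator (MeasurableSet.univ.prod measurableSet_Icc)]
  refine lintegral_congr fun x ↦ ?_
  by_cases hx : x.2 ∈ Set.Icc (0 : ℝ) 2
  · rw [Set.indicator_of_mem (by simpa using hx)]
  · rw [Set.indicator_of_notMem (by simpa using hx), measure_scaleBox_eq_zero hν hM hx, mul_zero]

/-- Integration over the centre c replaces a partition of the line into intervals: every point is
counted for a set of centres of length 2M. -/
theorem lintegral_box_average {F : ℝ × ℝ → ℝ≥0∞} (hF : Measurable F) (M : ℝ) :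
    ∫⁻ c, ∫⁻ z in Set.Icc (c - M) (c + M) ×ˢ Set.Icc 0 2, F z =
      ENNReal.ofReal (2 * M) * ∫⁻ z in Set.univ ×ˢ Set.Icc 0 2, F z := by
  have h1 : ∀ c, ∫⁻ z in Set.Icc (c - M) (c + M) ×ˢ Set.Icc 0 2, F z =
      ∫⁻ z in Set.univ ×ˢ Set.Icc 0 2, (Set.Icc (-M) M).indicator (fun _ ↦ 1) (z.1 - c) * F z := by
    intro c
    rw [← lintegral_indicator (measurableSet_Icc.prod measurableSet_Icc),
      ← lintegral_indicator (MeasurableSet.univ.prod measurableSet_Icc)]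
    refine lintegral_congr fun z ↦ ?_
    have h2 : z.1 - c ∈ Set.Icc (-M) M ↔ z.1 ∈ Set.Icc (c - M) (c + M) := by
      simp only [Set.mem_Icc]
      constructor <;> rintro ⟨a, b⟩ <;> constructor <;> linarith
    by_cases hz : z.2 ∈ Set.Icc (0 : ℝ) 2 <;> by_cases hz1 : z.1 ∈ Set.Icc (c - M) (c + M) <;>
      simp only [Set.indicator, Set.mem_prod, hz, hz1, h2, Set.mem_univ, and_true,
        and_false, if_true, if_false, one_mul, zero_mul]
  simp_rw [h1]
  have hind : Measurable ((Set.Icc (-M) M).indicator fun _ ↦ (1 : ℝ≥0∞)) :=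
    measurable_const.indicator measurableSet_Icc
  rw [lintegral_lintegral_swap (by fun_prop), ← lintegral_const_mul _ hF]
  refine lintegral_congr fun z ↦ ?_
  rw [lintegral_mul_const _ (by fun_prop),
    lintegral_sub_left_eq_self (fun c ↦ (Set.Icc (-M) M).indicator (fun _ ↦ (1 : ℝ≥0∞)) c) z.1,
    lintegral_indicator_const measurableSet_Icc, Real.volume_Icc, one_mul]
  congr 2
  ring

/-- Local constancy, integrated against a measure. -/
theorem enorm_oscInt_mul_oscInt_le_box {M : ℝ} (hM : 0 < M) {h g : ℝ → ℂ} (hc : Continuous h)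
    (hs : HasCompactSupport h) (gc : Continuous g) (gs : HasCompactSupport g) (z : ℝ × ℝ) :
    ‖oscInt h z.1 z.2 * oscInt g z.1 z.2‖ₑ ≤ ENNReal.ofReal (280 * M ^ 3) *
      ∫⁻ x in Set.Icc 0 M⁻¹ ×ˢ Set.Icc 0 (M ^ 2)⁻¹, jetSize M h (z + x) * jetSize M g (z + x) := by
  refine (enorm_oscInt_mul_oscInt_le hM hc hs gc gs z.1 z.2).trans (le_of_eq ?_)
  congr 1
  have mh := measurable_jetSize (M := M) hc hs
  have mg := measurable_jetSize (M := M) gc gs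
  rw [Measure.volume_eq_prod, ← Measure.prod_restrict, lintegral_prod_symm' _ (by fun_prop)]
  rfl

/-- The product of the jets of two packet sums. -/
noncomputable def jetProd (M : ℝ) (S T : Finset ℤ) (h g : ℤ → ℝ → ℂ) (z : ℝ × ℝ) : ℝ≥0∞ :=
  jetSize M (sumProfile S h) z * jetSize M (sumProfile T g) z

theorem measurable_jetProd {M : ℝ} {S T : Finset ℤ} {h g : ℤ → ℝ → ℂ} (hh : IsLatticeProfile h)
    (hg : IsLatticeProfile g) : Measurable (jetProd M S T h g) :=
  (measurable_jetSize (hh.continuous_sum S) (hh.hasCompactSupport_sum S)).mul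
    (measurable_jetSize (hg.continuous_sum T) (hg.hasCompactSupport_sum T))

theorem lintegral_enorm_mul_le (ν : Measure (ℝ × ℝ)) [SFinite ν]
    (hν : ν {z | z.2 ∉ Set.Icc (0 : ℝ) 1} = 0) {M : ℝ} (hM : 1 ≤ M) (S T : Finset ℤ)
    {h g : ℤ → ℝ → ℂ} (hh : IsLatticeProfile h) (hg : IsLatticeProfile g) :
    ∫⁻ z, ‖oscInt (sumProfile S h) z.1 z.2 * oscInt (sumProfile T g) z.1 z.2‖ₑ ∂ν ≤
      ENNReal.ofReal (280 * M ^ 3) * ∫⁻ z in Set.univ ×ˢ Set.Icc 0 2,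
        jetProd M S T h g z * ν (scaleBox M z) := by
  have hJ := measurable_jetProd (M := M) (S := S) (T := T) hh hg
  rw [← lintegral_mul_measure_scaleBox hν hM, ← lintegral_setLIntegral_box ν hJ,
    ← lintegral_const_mul' _ _ ENNReal.ofReal_ne_top]
  exact lintegral_mono fun z ↦ enorm_oscInt_mul_oscInt_le_box (by linarith)
    (hh.continuous_sum S) (hh.hasCompactSupport_sum S) (hg.continuous_sum T)
    (hg.hasCompactSupport_sum T) z

/-- One factor is at most w. The other integrates, by Tonelli, to the volume M⁻³ of the box times
the ν-mass of a horizontal enlargement by M⁻¹ ≤ M. -/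
theorem lintegral_box_measure_scaleBox_le (ν : Measure (ℝ × ℝ)) [SFinite ν] {M : ℝ} (hM : 1 ≤ M)
    {w W : ℝ≥0∞} (hw : ∀ z, ν (scaleBox M z) ≤ w) (c : ℝ)
    (hW : ν (Set.Icc (c - 2 * M) (c + 2 * M) ×ˢ Set.univ) ≤ W) :
    ∫⁻ z in Set.Icc (c - M) (c + M) ×ˢ Set.Icc 0 2, ν (scaleBox M z) ^ 2 ≤
      w * (ENNReal.ofReal ((M ^ 3)⁻¹) * W) := by
  have hM0 : 0 < M := by linarith
  set Q := Set.Icc (c - M) (c + M) ×ˢ Set.Icc (0 : ℝ) 2 with hQ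
  have hQm : MeasurableSet Q := measurableSet_Icc.prod measurableSet_Icc
  set R := Set.Icc (c - 2 * M) (c + 2 * M) ×ˢ (Set.univ : Set ℝ) with hR
  have hRm : MeasurableSet R := measurableSet_Icc.prod MeasurableSet.univ
  calc _ ≤ ∫⁻ z in Q, w * ν (scaleBox M z) := by
        refine lintegral_mono fun z ↦ ?_
        rw [sq]
        exact mul_le_mul' (hw z) le_rfl
    _ = w * ∫⁻ z, Q.indicator 1 z * ν (scaleBox M z) := by
        rw [lintegral_const_mul _ (measurable_measure_scaleBox ν M), ← lintegral_indicator hQm]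
        congr 1
        refine lintegral_congr fun z ↦ ?_
        by_cases hz : z ∈ Q <;> simp [hz]
    _ = w * ∫⁻ z, (∫⁻ x in Set.Icc 0 M⁻¹ ×ˢ Set.Icc 0 (M ^ 2)⁻¹, Q.indicator 1 (z + x)) ∂ν := by
        rw [lintegral_setLIntegral_box ν (measurable_one.indicator hQm)]
    _ ≤ w * ∫⁻ z, ENNReal.ofReal ((M ^ 3)⁻¹) * R.indicator 1 z ∂ν := by
        refine mul_le_mul' le_rfl (lintegral_mono fun z ↦ ?_)
        have hinv : M⁻¹ ≤ M := (inv_le_one_of_one_le₀ hM).trans hM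
        by_cases hz : z ∈ R
        · calc _ ≤ ∫⁻ x in Set.Icc 0 M⁻¹ ×ˢ Set.Icc 0 (M ^ 2)⁻¹, (1 : ℝ≥0∞) := by
                refine lintegral_mono fun x ↦ ?_
                exact Set.indicator_le_self' (fun _ _ ↦ zero_le) _
            _ = _ := by
                rw [lintegral_one, Measure.restrict_apply_univ, Measure.volume_eq_prod,
                  Measure.prod_prod, Real.volume_Icc, Real.volume_Icc,
                  ← ENNReal.ofReal_mul (by rw [sub_zero]; positivity), Set.indicator_of_mem hz,
                  Pi.one_apply, mul_one, sub_zero, sub_zero]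
                congr 1
                rw [← mul_inv]
                congr 1
                ring
        · rw [setLIntegral_congr_fun (g := fun _ ↦ 0) (measurableSet_Icc.prod measurableSet_Icc)]
          · simp
          · intro x hx
            refine Set.indicator_of_notMem (fun hzx ↦ hz ?_) _
            have h1 := hzx.1
            simp only [Prod.fst_add, Set.mem_Icc] at h1
            refine ⟨⟨?_, ?_⟩, trivial⟩ <;> linarith [hx.1.1, hx.1.2]
    _ ≤ _ := by
        rw [lintegral_const_mul _ (measurable_one.indicator hRm), lintegral_indicator_one hRm]
        exact mul_le_mul' le_rfl (mul_le_mul' le_rfl hW)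

/-- The mass of the envelopes, localised at scale `M` around `c`. -/
noncomputable def localMass (M c : ℝ) (S : Finset ℤ) (a : ℤ → ℝ → ℝ≥0∞) : ℝ≥0∞ :=
  ∑ k ∈ S, ∫⁻ u, cauchyWeight ((u - c) / M) * a k u

theorem measurable_localMass (M : ℝ) (S : Finset ℤ) {a : ℤ → ℝ → ℝ≥0∞}
    (ha : ∀ k, Measurable (a k)) : Measurable fun c ↦ localMass M c S a := by
  have := measurable_cauchyWeight
  exact Finset.measurable_fun_sum S fun k _ ↦ Measurable.lintegral_prod_right'
    (f := fun q : ℝ × ℝ ↦ cauchyWeight ((q.2 - q.1) / M) * a k q.2) (by fun_prop)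

theorem lintegral_localMass {M : ℝ} (hM : 0 < M) (S : Finset ℤ) {a : ℤ → ℝ → ℝ≥0∞}
    (ha : ∀ k, Measurable (a k)) :
    ∫⁻ c, localMass M c S a = ENNReal.ofReal (Real.pi * M) * ∑ k ∈ S, ∫⁻ u, a k u := by
  have hc := measurable_cauchyWeight
  unfold localMass
  rw [lintegral_finsetSum S fun k _ ↦ Measurable.lintegral_prod_right'
    (f := fun q : ℝ × ℝ ↦ cauchyWeight ((q.2 - q.1) / M) * a k q.2) (by fun_prop), Finset.mul_sum]
  refine Finset.sum_congr rfl fun k _ ↦ ?_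
  rw [lintegral_lintegral_swap (by fun_prop), ← lintegral_const_mul _ (ha k)]
  refine lintegral_congr fun u ↦ ?_
  change ∫⁻ c, cauchyWeight ((u - c) / M) * a k u = _
  rw [lintegral_mul_const _ (by fun_prop)]
  congr 1
  rw [lintegral_sub_left_eq_self (fun c ↦ cauchyWeight (c / M)) u]
  simp_rw [div_eq_inv_mul]
  rw [lintegral_comp_mul_left_real _ (by positivity), lintegral_cauchyWeight, inv_inv,
    abs_of_pos hM, ← ENNReal.ofReal_mul hM.le, mul_comm]

/-- Biorthogonality reduces the integral to single pairs of packets. The characteristics of such a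
pair cross with relative velocity 4π|k-l| ≥ M, so the integral factorises in the two moving
coordinates with Jacobian at most M⁻¹. This is the gain from transversality. -/
theorem exists_lintegral_box_jetProd_sq_le {η : ℝ → ℝ} (hη : IsBandWeight η) :
    ∃ C : ℝ, 0 < C ∧ ∀ (M : ℝ), 1 ≤ M → ∀ (S T : Finset ℤ) (h g : ℤ → ℝ → ℂ)
    (a b : ℤ → ℝ → ℝ≥0∞), IsPacketFamily M S h a → IsPacketFamily M T g b →
    (∀ k ∈ S, ∀ l ∈ T, M ≤ |(k : ℝ) - l|) → ∀ c,
    ∫⁻ z in Set.Icc (c - M) (c + M) ×ˢ Set.Icc 0 2, jetProd M S T h g z ^ 2 ≤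
      ENNReal.ofReal (C * M⁻¹) * (localMass M c S a * localMass M c T b) := by
  obtain ⟨C, hC, hb⟩ := exists_boxWeight_le hη
  refine ⟨107008 * C, by positivity, fun M hM S T h g a b hS hT hsep c ↦ ?_⟩
  have hM0 : 0 < M := by linarith
  have hcm := measurable_cauchyWeight
  refine (lintegral_box_jetSize_le hη hM hS hT c).trans ?_
  have key : ∀ k ∈ S, ∀ l ∈ T, ∫⁻ z : ℝ × ℝ,
      ENNReal.ofReal (boxWeight η M c z * (1 + |z.2|) ^ 8) *
        (a k (z.1 + 4 * Real.pi * k * z.2) * b l (z.1 + 4 * Real.pi * l * z.2)) ≤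
      ENNReal.ofReal (C * M⁻¹) * ((∫⁻ u, cauchyWeight ((u - c) / M) * a k u) *
        ∫⁻ u, cauchyWeight ((u - c) / M) * b l u) := by
    intro k hk l hl
    have am := hS.measurable k
    have bm := hT.measurable l
    have hne : (4 * Real.pi * k : ℝ) ≠ 4 * Real.pi * l := by
      intro he
      have := mul_left_cancel₀ (by positivity) he
      have h1 := hsep k hk l hl
      rw [this, sub_self, abs_zero] at h1
      linarith
    calc _ ≤ ∫⁻ z : ℝ × ℝ, ENNReal.ofReal C *
        ((cauchyWeight ((z.1 + 4 * Real.pi * k * z.2 - c) / M) *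
            a k (z.1 + 4 * Real.pi * k * z.2)) *
          (cauchyWeight ((z.1 + 4 * Real.pi * l * z.2 - c) / M) *
            b l (z.1 + 4 * Real.pi * l * z.2))) := by
          refine lintegral_mono fun z ↦ ?_
          refine (mul_le_mul' (ENNReal.ofReal_le_ofReal
            (hb M c hM k l (hS.freq k hk) (hT.freq l hl) z)) le_rfl).trans (le_of_eq ?_)
          rw [ENNReal.ofReal_mul hC.le, ENNReal.ofReal_mul (by positivity), mul_assoc,
            mul_mul_mul_comm]
          rfl
      _ = ENNReal.ofReal C * (ENNReal.ofReal |(4 * Real.pi * k - 4 * Real.pi * l)⁻¹| *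
          ((∫⁻ u, cauchyWeight ((u - c) / M) * a k u) *
            ∫⁻ u, cauchyWeight ((u - c) / M) * b l u)) := by
          rw [lintegral_const_mul _ (by fun_prop),
            lintegral_mul_transversal (f := fun u ↦ cauchyWeight ((u - c) / M) * a k u)
              (g := fun u ↦ cauchyWeight ((u - c) / M) * b l u) (by fun_prop) (by fun_prop) hne]
      _ ≤ _ := by
          rw [ENNReal.ofReal_mul hC.le, mul_assoc (ENNReal.ofReal C)]
          refine mul_le_mul' le_rfl (mul_le_mul' (ENNReal.ofReal_le_ofReal ?_) le_rfl)
          rw [abs_inv]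
          refine inv_anti₀ hM0 ?_
          rw [← mul_sub, abs_mul, abs_of_pos (by positivity)]
          nlinarith [hsep k hk l hl, Real.pi_gt_three]
  refine (mul_le_mul' le_rfl (Finset.sum_le_sum fun k hk ↦ Finset.sum_le_sum fun l hl ↦
    key k hk l hl)).trans (le_of_eq ?_)
  simp only [← Finset.mul_sum]
  rw [localMass, localMass, mul_assoc (107008 : ℝ), ENNReal.ofReal_mul
    (by norm_num : (0 : ℝ) ≤ 107008), ← Finset.sum_mul, mul_assoc]
  simp

/-- Bilinear estimate: the product of two transversal packet sums with respect to a measure. -/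
theorem exists_lintegral_bilinear_sq_le : ∃ C : ℝ, 0 < C ∧ ∀ (M : ℝ), 1 ≤ M →
    ∀ (S T : Finset ℤ) (h g : ℤ → ℝ → ℂ)
    (a b : ℤ → ℝ → ℝ≥0∞), IsPacketFamily M S h a → IsPacketFamily M T g b →
    (∀ k ∈ S, ∀ l ∈ T, M ≤ |(k : ℝ) - l|) →
    ∀ (ν : Measure (ℝ × ℝ)) [SFinite ν], ν {z | z.2 ∉ Set.Icc (0 : ℝ) 1} = 0 →
    ∀ w W : ℝ≥0∞, (∀ z, ν (scaleBox M z) ≤ w) →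
    (∀ c, ν (Set.Icc (c - 2 * M) (c + 2 * M) ×ˢ Set.univ) ≤ W) →
    (∫⁻ z, ‖oscInt (sumProfile S h) z.1 z.2 * oscInt (sumProfile T g) z.1 z.2‖ₑ ∂ν) ^ 2 ≤
      ENNReal.ofReal (C * M ^ 2) * (w * W) * ((∑ k ∈ S, ∫⁻ u, a k u) * ∑ k ∈ T, ∫⁻ u, b k u) := by
  obtain ⟨η, hη⟩ := exists_isBandWeight
  obtain ⟨C, hC, hb⟩ := exists_lintegral_box_jetProd_sq_le hη
  refine ⟨280 ^ 2 * C * Real.pi ^ 2 / 4, by positivity, ?_⟩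
  intro M hM S T h g a b hS hT hsep ν _ hν w W hw hW
  have hM0 : 0 < M := by linarith
  have hJ := measurable_jetProd (M := M) (S := S) (T := T) hS.profile hT.profile
  have hn := measurable_measure_scaleBox ν M
  set I := ∫⁻ z in Set.univ ×ˢ Set.Icc 0 2, jetProd M S T h g z * ν (scaleBox M z) with hI
  have h1 := lintegral_enorm_mul_le ν hν hM S T hS.profile hT.profile
  have h2 := lintegral_box_average (hJ.mul hn) M
  -- Cauchy–Schwarz on one box: the jets in L² against the smoothed measure in L².
  have h3 : ∀ c, (∫⁻ z in Set.Icc (c - M) (c + M) ×ˢ Set.Icc 0 2,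
      (jetProd M S T h g * fun z ↦ ν (scaleBox M z)) z) ^ 2 ≤
      (ENNReal.ofReal (C * M⁻¹) * (w * (ENNReal.ofReal ((M ^ 3)⁻¹) * W)) * localMass M c S a) *
        localMass M c T b := by
    intro c
    refine (lintegral_sq_le_of_sq_le (hJ.pow_const 2).aemeasurable (hn.pow_const 2).aemeasurable
      (ae_of_all _ fun z ↦ (mul_pow _ _ _).le)).trans ?_
    refine (mul_le_mul' (hb M hM S T h g a b hS hT hsep c)
      (lintegral_box_measure_scaleBox_le ν hM hw c (hW c))).trans (le_of_eq ?_)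
    ring
  have m1 := measurable_localMass M S hS.measurable
  have m2 := measurable_localMass M T hT.measurable
  -- A second Cauchy–Schwarz, in c, separates the local masses, each of which integrates to πM times
  -- the total mass. The powers of M are (M²)² · M⁻¹ · M⁻³ · M² = M².
  have h4 := lintegral_sq_le_of_sq_le (μ := volume) (m1.const_mul _).aemeasurable m2.aemeasurable
    (ae_of_all _ h3)
  rw [h2, lintegral_const_mul _ m1, lintegral_localMass hM0 S hS.measurable,
    lintegral_localMass hM0 T hT.measurable] at h4
  have e1 : ENNReal.ofReal (280 * M ^ 3) * I =
      ENNReal.ofReal (140 * M ^ 2) * (ENNReal.ofReal (2 * M) * I) := by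
    rw [← mul_assoc, ← ENNReal.ofReal_mul (by positivity)]
    congr 2
    ring
  calc _ ≤ (ENNReal.ofReal (140 * M ^ 2) * (ENNReal.ofReal (2 * M) * I)) ^ 2 :=
        pow_le_pow_left' (h1.trans_eq e1) 2
    _ ≤ _ := by
        rw [mul_pow]
        refine (mul_le_mul' le_rfl h4).trans (le_of_eq ?_)
        have e2 : ENNReal.ofReal (280 ^ 2 * C * Real.pi ^ 2 / 4 * M ^ 2) =
            ENNReal.ofReal (140 * M ^ 2) ^ 2 * (ENNReal.ofReal (C * M⁻¹) *
              ENNReal.ofReal ((M ^ 3)⁻¹) * ENNReal.ofReal (Real.pi * M) ^ 2) := by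
          rw [← ENNReal.ofReal_pow (by positivity), ← ENNReal.ofReal_pow (by positivity),
            ← ENNReal.ofReal_mul (by positivity), ← ENNReal.ofReal_mul (by positivity),
            ← ENNReal.ofReal_mul (by positivity)]
          congr 1
          field_simp
          norm_num
        rw [e2]
        ring

/-! ### The quartic estimate -/

/-- The two moving coordinates u, v serve as variables on space-time; time is then (u-v)/(k-l). -/
theorem lintegral_weight_mul_transversal {φ f g : ℝ → ℝ≥0∞} (hφ : Measurable φ) (hf : Measurable f)
    (hg : Measurable g) {k l : ℝ} (hkl : k ≠ l) :
    ∫⁻ z : ℝ × ℝ, φ z.2 * (f (z.1 + k * z.2) * g (z.1 + l * z.2)) =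
      ENNReal.ofReal |(k - l)⁻¹| * ∫⁻ u, ∫⁻ v, φ ((u - v) / (k - l)) * (f u * g v) := by
  rw [Measure.volume_eq_prod, lintegral_prod_symm' _ (by fun_prop)]
  have e : ∀ t, ∫⁻ y, φ t * (f (y + k * t) * g (y + l * t)) =
      ∫⁻ u, φ t * (f u * g (u - (k - l) * t)) := by
    intro t
    rw [← lintegral_add_right_eq_self (fun u ↦ φ t * (f u * g (u - (k - l) * t))) (k * t)]
    refine lintegral_congr fun y ↦ ?_
    congr 3
    ring
  simp_rw [e]
  rw [lintegral_lintegral_swap (by fun_prop), ← lintegral_const_mul' _ _ ENNReal.ofReal_ne_top]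
  refine lintegral_congr fun u ↦ ?_
  rw [← lintegral_sub_mul_left_real _ (sub_ne_zero.2 hkl) u]
  refine lintegral_congr fun t ↦ ?_
  rw [sub_sub_cancel, mul_div_cancel_left₀ _ (sub_ne_zero.2 hkl)]

theorem lintegral_weight_mul_parallel {φ f : ℝ → ℝ≥0∞} (hφ : Measurable φ) (hf : Measurable f)
    (k : ℝ) :
    ∫⁻ z : ℝ × ℝ, φ z.2 * f (z.1 + k * z.2) = (∫⁻ t, φ t) * ∫⁻ u, f u := by
  rw [Measure.volume_eq_prod, lintegral_prod_symm' _ (by fun_prop), ← lintegral_mul_const _ hφ]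
  refine lintegral_congr fun t ↦ ?_
  change ∫⁻ y, φ t * f (y + k * t) = _
  rw [lintegral_const_mul _ (by fun_prop), lintegral_add_right_eq_self]

/-- The summable kernel `(1 + |s|) ^ (-(1 + ε))`. -/
noncomputable def tailKernel (ε s : ℝ) : ℝ≥0∞ := ENNReal.ofReal ((1 + |s|) ^ (-(1 + ε)))

theorem measurable_tailKernel (ε : ℝ) : Measurable (tailKernel ε) := by
  unfold tailKernel
  fun_prop

theorem lintegral_tailKernel_lt_top {ε : ℝ} (hε : 0 < ε) : ∫⁻ s, tailKernel ε s < ∞ := by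
  have h := integrable_one_add_norm (E := ℝ) (μ := volume) (r := 1 + ε) (by simp; linarith)
  have := h.lintegral_lt_top
  simpa [tailKernel] using this

/-- The kernel on the left has a width depending on the relative velocity D. A single integrable
kernel dominates all of them at the price L^ε, so the sums over packets can be taken inside the
integral. -/
theorem ofReal_inv_mul_cauchyWeight_le {ε D L : ℝ} (hε : 0 < ε) (hD : 1 ≤ |D|) (hL : |D| ≤ L)
    (s : ℝ) (hε1 : ε ≤ 1) :
    ENNReal.ofReal |D⁻¹| * cauchyWeight (s / D) ≤ ENNReal.ofReal (2 * L ^ ε) * tailKernel ε s := by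
  rw [cauchyWeight, tailKernel, ← ENNReal.ofReal_mul (abs_nonneg _),
    ← ENNReal.ofReal_mul (by have : 0 ≤ L := (abs_nonneg D).trans hL; positivity)]
  refine ENNReal.ofReal_le_ofReal ?_
  have hD0 : 0 < |D| := by linarith
  have hs := abs_nonneg s
  rw [abs_inv, ← sq_abs (s / D), abs_div]
  set d := |D|
  set r := |s|
  have h1 : d⁻¹ * (1 + (r / d) ^ 2)⁻¹ ≤ 2 * (d / (d + r) ^ 2) := by
    rw [← mul_inv, inv_eq_one_div, ← mul_div_assoc, div_le_div_iff₀ (by positivity) (by positivity)]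
    have : 2 * d * (d * (1 + (r / d) ^ 2)) = 2 * (d ^ 2 + r ^ 2) := by
      field_simp
    rw [this]
    nlinarith [sq_nonneg (d - r)]
  have h2 : d / (d + r) ^ 2 ≤ d ^ ε * (1 + r) ^ (-(1 + ε)) := by
    have hdr : 0 < d + r := by linarith
    have e : d / (d + r) ^ 2 = d ^ ε * (d ^ (1 - ε) * (d + r) ^ (-(2 : ℝ))) := by
      rw [← mul_assoc, ← Real.rpow_add hD0, add_sub_cancel, Real.rpow_one, Real.rpow_neg hdr.le,
        Real.rpow_two, div_eq_mul_inv]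
    rw [e]
    refine mul_le_mul_of_nonneg_left ?_ (by positivity)
    calc d ^ (1 - ε) * (d + r) ^ (-(2 : ℝ)) ≤ (d + r) ^ (1 - ε) * (d + r) ^ (-(2 : ℝ)) := by
          refine mul_le_mul_of_nonneg_right ?_ (by positivity)
          exact Real.rpow_le_rpow hD0.le (by linarith) (by linarith)
      _ = (d + r) ^ (-(1 + ε)) := by
          rw [← Real.rpow_add hdr]
          congr 1
          ring
      _ ≤ (1 + r) ^ (-(1 + ε)) :=
          Real.rpow_le_rpow_of_nonpos (by linarith) (by linarith) (by linarith)
  calc _ ≤ 2 * (d ^ ε * (1 + r) ^ (-(1 + ε))) := h1.trans (by linarith)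
    _ ≤ _ := by
      rw [← mul_assoc]
      refine mul_le_mul_of_nonneg_right ?_ (by positivity)
      have := Real.rpow_le_rpow hD0.le hL hε.le
      linarith

theorem lintegral_kernel_mul_le {κ A : ℝ → ℝ≥0∞} (hκ : Measurable κ) (hA : Measurable A) :
    ∫⁻ u, ∫⁻ v, κ (u - v) * (A u * A v) ≤ 2 * ((∫⁻ s, κ s) * ∫⁻ u, A u ^ 2) := by
  have h : ∀ x y : ℝ≥0∞, x * y ≤ x ^ 2 + y ^ 2 := by
    intro x y
    rcases le_total x y with hxy | hxy
    · exact (mul_le_mul' hxy le_rfl).trans ((sq y).symm.le.trans le_add_self)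
    · exact (mul_le_mul' le_rfl hxy).trans ((sq x).symm.le.trans le_self_add)
  calc _ ≤ ∫⁻ u, ∫⁻ v, (κ (u - v) * A u ^ 2 + κ (u - v) * A v ^ 2) := by
        refine lintegral_mono fun u ↦ lintegral_mono fun v ↦ ?_
        rw [← mul_add]
        exact mul_le_mul' le_rfl (h _ _)
    _ = (∫⁻ u, ∫⁻ v, κ (u - v) * A u ^ 2) + ∫⁻ u, ∫⁻ v, κ (u - v) * A v ^ 2 := by
        rw [← lintegral_add_left]
        · refine lintegral_congr fun u ↦ ?_
          rw [lintegral_add_left (by fun_prop)]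
        · exact Measurable.lintegral_prod_right' (f := fun q : ℝ × ℝ ↦ κ (q.1 - q.2) * A q.1 ^ 2)
            (by fun_prop)
    _ = _ := by
        rw [two_mul]
        congr 1
        · rw [← lintegral_const_mul _ (by fun_prop)]
          refine lintegral_congr fun u ↦ ?_
          rw [lintegral_mul_const _ (by fun_prop), lintegral_sub_left_eq_self κ u]
        · rw [lintegral_lintegral_swap (by fun_prop), ← lintegral_const_mul _ (by fun_prop)]
          refine lintegral_congr fun v ↦ ?_
          rw [lintegral_mul_const _ (by fun_prop), lintegral_sub_right_eq_self κ v]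

/-- Summation over all pairs of packets. -/
theorem exists_sum_lintegral_cauchyWeight_le {ε : ℝ} (hε : 0 < ε) (hε1 : ε ≤ 1) :
    ∃ C : ℝ, 0 < C ∧ ∀ (M : ℝ), 1 ≤ M → ∀ (S : Finset ℤ), (∀ k ∈ S, |(k : ℝ)| ≤ 4 * M) →
    ∀ a : ℤ → ℝ → ℝ≥0∞, (∀ k, Measurable (a k)) →
    ∑ k ∈ S, ∑ l ∈ S, ∫⁻ z : ℝ × ℝ, cauchyWeight z.2 *
      (a k (z.1 + 4 * Real.pi * k * z.2) * a l (z.1 + 4 * Real.pi * l * z.2)) ≤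
      ENNReal.ofReal (C * M ^ ε) * ∫⁻ u, (∑ k ∈ S, a k u) ^ 2 := by
  have hcm := measurable_cauchyWeight
  have hκ := measurable_tailKernel ε
  set K := ∫⁻ s, tailKernel ε s with hK
  have hKt : K ≠ ∞ := (lintegral_tailKernel_lt_top hε).ne
  refine ⟨Real.pi + 2 * (102 : ℝ) ^ ε * (2 * K.toReal), by positivity, ?_⟩
  intro M hM S hS a ha
  have hM0 : 0 < M := by linarith
  set A : ℝ → ℝ≥0∞ := fun u ↦ ∑ k ∈ S, a k u with hA
  have hAm : Measurable A := Finset.measurable_fun_sum S fun k _ ↦ ha k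
  -- Packets of equal frequency are parallel and the time weight alone supplies π. For distinct ones
  -- the relative velocity lies between 1 and 32πM ≤ 102M.
  have key : ∀ k ∈ S, ∀ l ∈ S, ∫⁻ z : ℝ × ℝ, cauchyWeight z.2 *
      (a k (z.1 + 4 * Real.pi * k * z.2) * a l (z.1 + 4 * Real.pi * l * z.2)) ≤
      (if k = l then ENNReal.ofReal Real.pi * ∫⁻ u, a k u ^ 2 else 0) +
      ENNReal.ofReal (2 * (102 * M) ^ ε) *
        ∫⁻ u, ∫⁻ v, tailKernel ε (u - v) * (a k u * a l v) := by
    intro k hk l hl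
    have hak := ha k
    have hal := ha l
    rcases eq_or_ne k l with rfl | hkl
    · rw [if_pos rfl]
      refine le_add_right (le_of_eq ?_)
      rw [← lintegral_cauchyWeight, ← lintegral_weight_mul_parallel hcm (by fun_prop)
        (4 * Real.pi * k)]
      exact lintegral_congr fun z ↦ by rw [sq]
    · rw [if_neg hkl, zero_add]
      have hd : (1 : ℝ) ≤ |(k : ℝ) - l| := by
        exact_mod_cast Int.one_le_abs (sub_ne_zero.2 hkl)
      have hne : (4 * Real.pi * k : ℝ) ≠ 4 * Real.pi * l := by
        intro he
        exact hkl (by exact_mod_cast mul_left_cancel₀ (by positivity) he)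
      rw [lintegral_weight_mul_transversal hcm hak hal hne,
        ← lintegral_const_mul' _ _ ENNReal.ofReal_ne_top,
        ← lintegral_const_mul' _ _ ENNReal.ofReal_ne_top]
      refine lintegral_mono fun u ↦ ?_
      rw [← lintegral_const_mul' _ _ ENNReal.ofReal_ne_top,
        ← lintegral_const_mul' _ _ ENNReal.ofReal_ne_top]
      refine lintegral_mono fun v ↦ ?_
      rw [← mul_assoc, ← mul_assoc (ENNReal.ofReal (2 * (102 * M) ^ ε))]
      refine mul_le_mul' (ofReal_inv_mul_cauchyWeight_le hε ?_ ?_ _ hε1) le_rfl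
      · rw [← mul_sub, abs_mul, abs_of_pos (by positivity)]
        nlinarith [Real.pi_gt_three]
      · rw [← mul_sub, abs_mul, abs_of_pos (by positivity)]
        have h8 : |(k : ℝ) - l| ≤ 8 * M := (abs_sub _ _).trans (by linarith [hS k hk, hS l hl])
        nlinarith [Real.pi_lt_d2, Real.pi_pos, abs_nonneg ((k : ℝ) - l)]
  refine (Finset.sum_le_sum fun k hk ↦ Finset.sum_le_sum fun l hl ↦ key k hk l hl).trans ?_
  simp only [Finset.sum_add_distrib, ← Finset.mul_sum]
  have hdiag : ∑ k ∈ S, ∑ l ∈ S, (if k = l then ENNReal.ofReal Real.pi * ∫⁻ u, a k u ^ 2 else 0) ≤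
      ENNReal.ofReal Real.pi * ∫⁻ u, A u ^ 2 := by
    calc _ = ∑ k ∈ S, ENNReal.ofReal Real.pi * ∫⁻ u, a k u ^ 2 :=
          Finset.sum_congr rfl fun k hk ↦ by rw [Finset.sum_ite_eq, if_pos hk]
      _ = ENNReal.ofReal Real.pi * ∫⁻ u, ∑ k ∈ S, a k u ^ 2 := by
          rw [← Finset.mul_sum, lintegral_finsetSum S fun k _ ↦ (ha k).pow_const 2]
      _ ≤ _ := by
          refine mul_le_mul' le_rfl (lintegral_mono fun u ↦ ?_)
          change ∑ k ∈ S, a k u ^ 2 ≤ (∑ k ∈ S, a k u) ^ 2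
          rw [sq (∑ k ∈ S, a k u), Finset.sum_mul]
          refine Finset.sum_le_sum fun k hk ↦ ?_
          rw [sq]
          exact mul_le_mul' le_rfl (Finset.single_le_sum (f := fun k ↦ a k u)
            (fun _ _ ↦ zero_le) hk)
  -- The kernel no longer depends on k and l, so the double sum becomes a quadratic form in the
  -- total envelope A, to which Schur's bound applies.
  have hoff : ∑ k ∈ S, ∑ l ∈ S, ∫⁻ u, ∫⁻ v, tailKernel ε (u - v) * (a k u * a l v) =
      ∫⁻ u, ∫⁻ v, tailKernel ε (u - v) * (A u * A v) := by
    have m1 : ∀ k l, Measurable fun u ↦ ∫⁻ v, tailKernel ε (u - v) * (a k u * a l v) := by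
      intro k l
      have hak := ha k
      have hal := ha l
      exact Measurable.lintegral_prod_right' (f := fun q : ℝ × ℝ ↦ tailKernel ε (q.1 - q.2) *
        (a k q.1 * a l q.2)) (by fun_prop)
    have m2 : ∀ k l u, Measurable fun v ↦ tailKernel ε (u - v) * (a k u * a l v) := by
      intro k l u
      have hal := ha l
      fun_prop
    have e : ∀ u, ∫⁻ v, tailKernel ε (u - v) * (A u * A v) =
        ∑ k ∈ S, ∑ l ∈ S, ∫⁻ v, tailKernel ε (u - v) * (a k u * a l v) := by
      intro u
      simp_rw [hA, Finset.sum_mul_sum, Finset.mul_sum]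
      rw [lintegral_finsetSum S fun k _ ↦ Finset.measurable_fun_sum S fun l _ ↦ m2 k l u]
      exact Finset.sum_congr rfl fun k _ ↦ lintegral_finsetSum S fun l _ ↦ m2 k l u
    simp_rw [e]
    rw [lintegral_finsetSum S fun k _ ↦ Finset.measurable_fun_sum S fun l _ ↦ m1 k l]
    exact Finset.sum_congr rfl fun k _ ↦ (lintegral_finsetSum S fun l _ ↦ m1 k l).symm
  rw [hoff]
  refine (add_le_add hdiag (mul_le_mul' le_rfl (lintegral_kernel_mul_le hκ hAm))).trans ?_
  have hM1 : 1 ≤ M ^ ε := Real.one_le_rpow hM hε.le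
  rw [add_mul, ENNReal.ofReal_add (by positivity) (by positivity), add_mul]
  refine add_le_add (mul_le_mul' (ENNReal.ofReal_le_ofReal ?_) le_rfl) (le_of_eq ?_)
  · nlinarith [Real.pi_pos]
  · have e : ENNReal.ofReal (2 * (102 : ℝ) ^ ε * (2 * K.toReal) * M ^ ε) =
        ENNReal.ofReal (2 * (102 * M) ^ ε) * (2 * K) := by
      rw [← ENNReal.ofReal_toReal hKt, ← ENNReal.ofReal_ofNat 2,
        ← ENNReal.ofReal_mul (by norm_num), ← ENNReal.ofReal_mul (by positivity),
        ENNReal.toReal_ofReal (by positivity), Real.mul_rpow (by norm_num) hM0.le]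
      congr 1
      ring
    rw [e]
    ring

/-- Quartic estimate for a packet sum with respect to a measure. -/
theorem exists_lintegral_quartic_le {ε : ℝ} (hε : 0 < ε) (hε1 : ε ≤ 1) : ∃ C : ℝ, 0 < C ∧
    ∀ (M : ℝ), 1 ≤ M → ∀ (S : Finset ℤ) (h : ℤ → ℝ → ℂ) (a : ℤ → ℝ → ℝ≥0∞),
    IsPacketFamily M S h a →
    ∀ (ν : Measure (ℝ × ℝ)) [SFinite ν], ν {z | z.2 ∉ Set.Icc (0 : ℝ) 1} = 0 →
    ∀ w : ℝ≥0∞, (∀ z, ν (scaleBox M z) ≤ w) →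
    ∫⁻ z, ‖oscInt (sumProfile S h) z.1 z.2‖ₑ ^ 4 ∂ν ≤
      ENNReal.ofReal (C * (M ^ 3 * M ^ ε)) * w * ∫⁻ u, (∑ k ∈ S, a k u) ^ 2 := by
  obtain ⟨η, hη⟩ := exists_isBandWeight
  obtain ⟨C₀, hC₀, hdec⟩ := hη.decay
  obtain ⟨C, hC, hsum⟩ := exists_sum_lintegral_cauchyWeight_le hε hε1
  set H := ∫⁻ t, ENNReal.ofReal (η t) with hH
  have hHt : H ≠ ∞ := hη.integrable.lintegral_lt_top.ne
  refine ⟨280 ^ 2 / 2 * 107008 * (H.toReal + 1) * C₀ * C, by positivity, ?_⟩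
  intro M hM S h a hS ν _ hν w hw
  have hM0 : 0 < M := by linarith
  have hηm := hη.continuous.measurable
  have hJ := measurable_jetProd (M := M) (S := S) (T := S) hS.profile hS.profile
  set F : ℝ × ℝ → ℝ≥0∞ := fun z ↦ jetProd M S S h h z ^ 2 with hF
  have hFm : Measurable F := hJ.pow_const 2
  set B : Set (ℝ × ℝ) := Set.Icc 0 M⁻¹ ×ˢ Set.Icc 0 (M ^ 2)⁻¹ with hB
  have hBv : volume B = ENNReal.ofReal (M ^ 3)⁻¹ := by
    rw [hB, Measure.volume_eq_prod, Measure.prod_prod, Real.volume_Icc, Real.volume_Icc,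
      ← ENNReal.ofReal_mul (by rw [sub_zero]; positivity), sub_zero, sub_zero, ← mul_inv]
    congr 2
    ring
  -- Local constancy of the square of the solution, then Cauchy–Schwarz on a box of volume M⁻³,
  -- which turns the factor M⁶ into M³.
  have p1 : ∀ z : ℝ × ℝ, ‖oscInt (sumProfile S h) z.1 z.2‖ₑ ^ 4 ≤
      ENNReal.ofReal (280 ^ 2 * M ^ 3) * ∫⁻ x in B, F (z + x) := by
    intro z
    have h1 := enorm_oscInt_mul_oscInt_le_box hM0 (hS.profile.continuous_sum S)
      (hS.profile.hasCompactSupport_sum S) (hS.profile.continuous_sum S)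
      (hS.profile.hasCompactSupport_sum S) z
    have h2 := lintegral_mul_sq_le (volume.restrict B) (f := fun _ ↦ 1)
      (g := fun x ↦ jetProd M S S h h (z + x)) (by fun_prop)
      (hJ.comp (measurable_const_add z)).aemeasurable
    simp only [one_mul, lintegral_one, Measure.restrict_apply_univ, hBv] at h2
    calc _ = ‖oscInt (sumProfile S h) z.1 z.2 * oscInt (sumProfile S h) z.1 z.2‖ₑ ^ 2 := by
          rw [enorm_mul]
          ring
      _ ≤ _ := pow_le_pow_left' h1 2
      _ ≤ ENNReal.ofReal (280 * M ^ 3) ^ 2 * (ENNReal.ofReal (M ^ 3)⁻¹ *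
            ∫⁻ x in B, F (z + x)) := by
          rw [mul_pow]
          exact mul_le_mul' le_rfl h2
      _ = _ := by
          rw [← mul_assoc, ← ENNReal.ofReal_pow (by positivity), ← ENNReal.ofReal_mul (by positivity)]
          congr 2
          field_simp
  have p2 : ∫⁻ z, ‖oscInt (sumProfile S h) z.1 z.2‖ₑ ^ 4 ∂ν ≤
      ENNReal.ofReal (280 ^ 2 * M ^ 3) * (w * ∫⁻ z in Set.univ ×ˢ Set.Icc 0 2, F z) := by
    refine (lintegral_mono p1).trans ?_
    rw [lintegral_const_mul' _ _ ENNReal.ofReal_ne_top, lintegral_setLIntegral_box ν hFm,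
      lintegral_mul_measure_scaleBox hν hM, ← lintegral_const_mul _ hFm]
    refine mul_le_mul' le_rfl (lintegral_mono fun z ↦ ?_)
    rw [mul_comm]
    exact mul_le_mul' (hw z) le_rfl
  -- Integration over the centres removes the spatial localisation: the factor η((y-c)/M) integrates
  -- to MH and only the weight in time is left.
  have p3 : ENNReal.ofReal (2 * M) * ∫⁻ z in Set.univ ×ˢ Set.Icc 0 2, F z ≤
      ENNReal.ofReal (107008 * M * (H.toReal + 1) * C₀) *
        (ENNReal.ofReal (C * M ^ ε) * ∫⁻ u, (∑ k ∈ S, a k u) ^ 2) := by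
    have m1 : ∀ k l : ℤ, Measurable fun q : ℝ × (ℝ × ℝ) ↦
        ENNReal.ofReal (boxWeight η M q.1 q.2 * (1 + |q.2.2|) ^ 8) *
        (a k (q.2.1 + 4 * Real.pi * k * q.2.2) * a l (q.2.1 + 4 * Real.pi * l * q.2.2)) := by
      intro k l
      have := hS.measurable k
      have := hS.measurable l
      unfold boxWeight
      fun_prop
    rw [← lintegral_box_average hFm M]
    refine (lintegral_mono fun c ↦ lintegral_box_jetSize_le hη hM hS hS c).trans ?_
    rw [lintegral_const_mul' _ _ (by norm_num), lintegral_finsetSum S fun k _ ↦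
      Finset.measurable_fun_sum S fun l _ ↦ (m1 k l).lintegral_prod_right']
    have key : ∀ k ∈ S, ∀ l ∈ S, ∫⁻ c, ∫⁻ z : ℝ × ℝ,
        ENNReal.ofReal (boxWeight η M c z * (1 + |z.2|) ^ 8) *
        (a k (z.1 + 4 * Real.pi * k * z.2) * a l (z.1 + 4 * Real.pi * l * z.2)) ≤
        ENNReal.ofReal (M * (H.toReal + 1) * C₀) * ∫⁻ z : ℝ × ℝ, cauchyWeight z.2 *
          (a k (z.1 + 4 * Real.pi * k * z.2) * a l (z.1 + 4 * Real.pi * l * z.2)) := by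
      intro k _ l _
      rw [lintegral_lintegral_swap (m1 k l).aemeasurable,
        ← lintegral_const_mul' _ _ ENNReal.ofReal_ne_top]
      refine lintegral_mono fun z ↦ ?_
      have m2 : Measurable fun c ↦ ENNReal.ofReal (boxWeight η M c z * (1 + |z.2|) ^ 8) := by
        unfold boxWeight
        fun_prop
      rw [lintegral_mul_const _ m2, ← mul_assoc (ENNReal.ofReal (M * (H.toReal + 1) * C₀))]
      refine mul_le_mul' ?_ le_rfl
      have e : ∀ c, ENNReal.ofReal (boxWeight η M c z * (1 + |z.2|) ^ 8) =
          ENNReal.ofReal (η ((z.1 - c) / M)) * ENNReal.ofReal (η z.2 * (1 + |z.2|) ^ 8) := by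
        intro c
        rw [boxWeight, mul_assoc, ENNReal.ofReal_mul (hη.nonneg _)]
      simp_rw [e]
      rw [lintegral_mul_const _ (by fun_prop),
        lintegral_sub_left_eq_self (fun c ↦ ENNReal.ofReal (η (c / M))) z.1]
      simp_rw [div_eq_inv_mul]
      rw [lintegral_comp_mul_left_real (fun s ↦ ENNReal.ofReal (η s)) (by positivity), inv_inv,
        abs_of_pos hM0, ← hH, ← ENNReal.ofReal_toReal hHt, cauchyWeight,
        ← ENNReal.ofReal_mul hM0.le, ← ENNReal.ofReal_mul (by positivity),
        ← ENNReal.ofReal_mul (by positivity), ENNReal.toReal_ofReal (by positivity)]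
      refine ENNReal.ofReal_le_ofReal ?_
      have h1 : η z.2 * (1 + |z.2|) ^ 8 ≤ C₀ * (1 + z.2 ^ 2)⁻¹ := by
        have ht := abs_nonneg z.2
        calc _ ≤ C₀ * ((1 + |z.2|) ^ 12)⁻¹ * (1 + |z.2|) ^ 8 :=
              mul_le_mul_of_nonneg_right (hdec _) (by positivity)
          _ = C₀ * ((1 + |z.2|) ^ 4)⁻¹ := by field_simp
          _ ≤ _ := by
              refine mul_le_mul_of_nonneg_left (inv_anti₀ (by positivity) ?_) hC₀.le
              rw [← sq_abs]
              nlinarith [pow_nonneg ht 3, pow_nonneg ht 4]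
      calc _ ≤ M * H.toReal * (C₀ * (1 + z.2 ^ 2)⁻¹) :=
            mul_le_mul_of_nonneg_left h1 (by positivity)
        _ ≤ M * (H.toReal + 1) * (C₀ * (1 + z.2 ^ 2)⁻¹) := by
            refine mul_le_mul_of_nonneg_right ?_ (by positivity)
            nlinarith
        _ = _ := by ring
    calc _ ≤ 107008 * ∑ k ∈ S, ∑ l ∈ S, ENNReal.ofReal (M * (H.toReal + 1) * C₀) *
          ∫⁻ z : ℝ × ℝ, cauchyWeight z.2 *
          (a k (z.1 + 4 * Real.pi * k * z.2) * a l (z.1 + 4 * Real.pi * l * z.2)) := by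
          refine mul_le_mul' le_rfl (Finset.sum_le_sum fun k hk ↦ ?_)
          rw [lintegral_finsetSum S fun l _ ↦ (m1 k l).lintegral_prod_right']
          exact Finset.sum_le_sum fun l hl ↦ key k hk l hl
      _ ≤ 107008 * (ENNReal.ofReal (M * (H.toReal + 1) * C₀) *
          (ENNReal.ofReal (C * M ^ ε) * ∫⁻ u, (∑ k ∈ S, a k u) ^ 2)) := by
          simp only [← Finset.mul_sum]
          exact mul_le_mul' le_rfl (mul_le_mul' le_rfl (hsum M hM S hS.freq a hS.measurable))
      _ = _ := by
          rw [mul_assoc (107008 : ℝ), mul_assoc (107008 : ℝ),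
            ENNReal.ofReal_mul (by norm_num : (0 : ℝ) ≤ 107008), mul_assoc (ENNReal.ofReal 107008),
            mul_assoc M]
          simp
  refine p2.trans ?_
  have e1 : ENNReal.ofReal (280 ^ 2 * M ^ 3) =
      ENNReal.ofReal (280 ^ 2 / 2 * M ^ 2) * ENNReal.ofReal (2 * M) := by
    rw [← ENNReal.ofReal_mul (by positivity)]
    congr 1
    ring
  have e2 : ENNReal.ofReal (280 ^ 2 / 2 * 107008 * (H.toReal + 1) * C₀ * C * (M ^ 3 * M ^ ε)) =
      ENNReal.ofReal (280 ^ 2 / 2 * M ^ 2) * (ENNReal.ofReal (107008 * M * (H.toReal + 1) * C₀) *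
        ENNReal.ofReal (C * M ^ ε)) := by
    rw [← ENNReal.ofReal_mul (by positivity), ← ENNReal.ofReal_mul (by positivity)]
    congr 1
    ring
  rw [e1, e2]
  calc _ = ENNReal.ofReal (280 ^ 2 / 2 * M ^ 2) * w * (ENNReal.ofReal (2 * M) *
        ∫⁻ z in Set.univ ×ˢ Set.Icc 0 2, F z) := by ring
    _ ≤ _ := mul_le_mul' le_rfl p3
    _ = _ := by ring

/-! ### Fractal measures of sheared boxes -/

theorem measure_ball_le (α : ℝ) (μ : Measure SpaceTime) (z : SpaceTime) {ρ : ℝ} (hρ : 0 < ρ) :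
    μ (Metric.ball z ρ) ≤ ENNReal.ofReal (ρ ^ α) * ballConst α μ := by
  have h : ENNReal.ofReal (ρ ^ (-α)) * μ (Metric.ball z ρ) ≤ ballConst α μ := by
    unfold ballConst
    exact le_iSup_of_le z (le_iSup_of_le ρ (le_iSup_of_le hρ le_rfl))
  calc μ (Metric.ball z ρ) = ENNReal.ofReal (ρ ^ α) * (ENNReal.ofReal (ρ ^ (-α)) *
        μ (Metric.ball z ρ)) := by
        rw [← mul_assoc, ← ENNReal.ofReal_mul (by positivity), ← Real.rpow_add hρ, add_neg_cancel,
          Real.rpow_zero, ENNReal.ofReal_one, one_mul]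
    _ ≤ _ := mul_le_mul' le_rfl h

theorem isLocallyFiniteMeasure_of_ballConst_ne_top {α : ℝ} {μ : Measure SpaceTime}
    (h : ballConst α μ ≠ ∞) : IsLocallyFiniteMeasure μ := by
  refine ⟨fun z ↦ ⟨Metric.ball z 1, Metric.ball_mem_nhds z one_pos, ?_⟩⟩
  exact (measure_ball_le α μ z one_pos).trans_lt
    (ENNReal.mul_lt_top ENNReal.ofReal_lt_top h.lt_top)

theorem mem_ball_of_abs_sub_le {z w : SpaceTime} {ρ : ℝ} (hρ : 0 < ρ) (h0 : |z 0 - w 0| ≤ ρ)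
    (h1 : |z 1 - w 1| ≤ ρ) : z ∈ Metric.ball w (2 * ρ) := by
  rw [Metric.mem_ball, EuclideanSpace.dist_eq, Real.sqrt_lt' (by positivity), Fin.sum_univ_two,
    Real.dist_eq, Real.dist_eq]
  nlinarith [abs_nonneg (z 0 - w 0), abs_nonneg (z 1 - w 1)]

/-- The points of the time interval `[t₀, t₀ + b]` at horizontal distance at most `a` from
a line of slope `-σ`. -/
def shearedBox (σ a b y₀ t₀ : ℝ) : Set (ℝ × ℝ) :=
  {z | z.2 ∈ Set.Icc t₀ (t₀ + b) ∧ |z.1 + σ * z.2 - y₀| ≤ a}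

theorem measurableSet_shearedBox (σ a b y₀ t₀ : ℝ) : MeasurableSet (shearedBox σ a b y₀ t₀) := by
  unfold shearedBox
  exact (measurable_snd measurableSet_Icc).inter (measurableSet_le
    (f := fun z : ℝ × ℝ ↦ |z.1 + σ * z.2 - y₀|) (by fun_prop) measurable_const)

theorem volume_shearedBox (σ y₀ t₀ : ℝ) {a b : ℝ} (hb : 0 ≤ b) :
    volume (shearedBox σ a b y₀ t₀) = ENNReal.ofReal (b * (2 * a)) := by
  rw [Measure.volume_eq_prod, Measure.prod_apply_symm (measurableSet_shearedBox σ a b y₀ t₀)]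
  have e : ∀ t, volume ((fun x ↦ (x, t)) ⁻¹' shearedBox σ a b y₀ t₀) =
      (Set.Icc t₀ (t₀ + b)).indicator (fun _ ↦ ENNReal.ofReal (2 * a)) t := by
    intro t
    by_cases ht : t ∈ Set.Icc t₀ (t₀ + b)
    · rw [Set.indicator_of_mem ht]
      have : (fun x ↦ (x, t)) ⁻¹' shearedBox σ a b y₀ t₀ =
          Set.Icc (y₀ - σ * t - a) (y₀ - σ * t + a) := by
        ext x
        have h0 : x ∈ (fun x ↦ (x, t)) ⁻¹' shearedBox σ a b y₀ t₀ ↔ |x + σ * t - y₀| ≤ a :=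
          ⟨fun h ↦ h.2, fun h ↦ ⟨ht, h⟩⟩
        rw [h0, abs_le, Set.mem_Icc]
        constructor <;> rintro ⟨h1, h2⟩ <;> constructor <;> linarith
      rw [this, Real.volume_Icc]
      congr 1
      ring
    · rw [Set.indicator_of_notMem ht]
      have : (fun x ↦ (x, t)) ⁻¹' shearedBox σ a b y₀ t₀ = ∅ :=
        Set.eq_empty_of_forall_notMem fun x hx ↦ ht hx.1
      rw [this, measure_empty]
  simp_rw [e]
  rw [lintegral_indicator_const measurableSet_Icc, Real.volume_Icc,
    ENNReal.ofReal_mul hb, mul_comm]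
  congr 2
  ring

/-- The coordinates of a point of space-time. -/
def coords (z : SpaceTime) : ℝ × ℝ := (z 0, z 1)

theorem measurable_coords : Measurable coords := by
  unfold coords
  fun_prop

/-- Balls of radius ρ = a/L are used: at this scale a slope up to L displaces points horizontally by
at most a. The area is comparable to ab, so about ab/ρ² balls are needed, each of mass at most a
multiple of ρ^α. Instead of a covering, the proof averages over squares of side ρ. The enlarged box
has area 12ab and 2^α ≤ 4, whence 48. The bound is efficient for α ≥ 1. -/
theorem measure_coords_shearedBox_le_of_le_two {α : ℝ} (hα₂ : α ≤ 2)
    {μ : Measure SpaceTime} [SFinite μ] {σ a b L : ℝ} (y₀ t₀ : ℝ) (ha : 0 < a)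
    (hL : 1 ≤ L) (hab : a ≤ L * b) (hσ : |σ| ≤ L) :
    μ.map coords (shearedBox σ a b y₀ t₀) ≤
      ENNReal.ofReal (48 * (b * L ^ (2 - α) * a ^ (α - 1))) * ballConst α μ := by
  have hL0 : 0 < L := by linarith
  have hb : 0 < b := (mul_pos_iff_of_pos_left hL0).1 (ha.trans_le hab)
  set ρ := a / L with hρ
  have hρ0 : 0 < ρ := by positivity
  have hρb : ρ ≤ b := by rwa [hρ, div_le_iff₀ hL0, mul_comm]
  have hρa : ρ ≤ a := div_le_self ha.le hL
  set ν := μ.map coords with hν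
  set R := shearedBox σ a b y₀ t₀ with hR
  set R' := shearedBox σ (3 * a) (2 * b) y₀ t₀ with hR'
  have hRm : MeasurableSet R := measurableSet_shearedBox _ _ _ _ _
  have hRm' : MeasurableSet R' := measurableSet_shearedBox _ _ _ _ _
  set B : Set (ℝ × ℝ) := Set.Icc 0 ρ ×ˢ Set.Icc 0 ρ with hB
  have hBm : MeasurableSet B := measurableSet_Icc.prod measurableSet_Icc
  have hBv : volume B = ENNReal.ofReal (ρ ^ 2) := by
    rw [hB, Measure.volume_eq_prod, Measure.prod_prod, Real.volume_Icc, sub_zero, sq,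
      ENNReal.ofReal_mul hρ0.le]
  have h1 : ν R * ENNReal.ofReal (ρ ^ 2) ≤ ∫⁻ z, (∫⁻ x in B, R'.indicator 1 (z + x)) ∂ν := by
    rw [← hBv, mul_comm, ← lintegral_indicator_const hRm]
    refine lintegral_mono fun z ↦ ?_
    by_cases hz : z ∈ R
    · rw [Set.indicator_of_mem hz, ← setLIntegral_one]
      refine setLIntegral_mono' hBm fun x hx ↦ ?_
      rw [Set.indicator_of_mem]
      · rfl
      · obtain ⟨⟨h2, h3⟩, h4⟩ := hz
        obtain ⟨⟨h5, h6⟩, h7, h8⟩ := hx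
        refine ⟨⟨?_, ?_⟩, ?_⟩
        · simp only [Prod.snd_add]
          linarith
        · simp only [Prod.snd_add]
          linarith
        · simp only [Prod.fst_add, Prod.snd_add]
          have h9 : |σ * x.2| ≤ a := by
            rw [abs_mul, abs_of_nonneg h7]
            calc _ ≤ L * ρ := mul_le_mul hσ h8 h7 hL0.le
              _ = a := mul_div_cancel₀ a hL0.ne'
          have e : z.1 + x.1 + σ * (z.2 + x.2) - y₀ = (z.1 + σ * z.2 - y₀) + x.1 + σ * x.2 := by
            ring
          rw [e]
          refine (abs_add_three _ _ _).trans ?_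
          rw [abs_of_nonneg h5]
          linarith
    · rw [Set.indicator_of_notMem hz]
      exact zero_le
  have h2 : ∀ x, ν {z | x - z ∈ B} ≤ ENNReal.ofReal (4 * ρ ^ α) * ballConst α μ := by
    intro x
    have hm : MeasurableSet {z : ℝ × ℝ | x - z ∈ B} := measurableSet_preimage (by fun_prop) hBm
    rw [hν, Measure.map_apply measurable_coords hm]
    have hsub : coords ⁻¹' {z | x - z ∈ B} ⊆ Metric.ball (!₂[x.1, x.2] : SpaceTime) (2 * ρ) := by
      rintro z ⟨⟨h3, h4⟩, h5, h6⟩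
      simp only [coords, Prod.fst_sub, Prod.snd_sub] at h3 h4 h5 h6
      refine mem_ball_of_abs_sub_le hρ0 ?_ ?_
      · simp only [Matrix.cons_val_zero, abs_le]
        constructor <;> linarith
      · simp only [Matrix.cons_val_one, Matrix.cons_val_fin_one, abs_le]
        constructor <;> linarith
    refine (measure_mono hsub).trans ((measure_ball_le α μ _ (by positivity)).trans ?_)
    refine mul_le_mul' (ENNReal.ofReal_le_ofReal ?_) le_rfl
    rw [Real.mul_rpow (by norm_num) hρ0.le]
    refine mul_le_mul_of_nonneg_right ?_ (by positivity)
    calc (2 : ℝ) ^ α ≤ 2 ^ (2 : ℝ) := Real.rpow_le_rpow_of_exponent_le (by norm_num) hα₂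
      _ = 4 := by norm_num
  have h3 : ν R * ENNReal.ofReal (ρ ^ 2) ≤
      ENNReal.ofReal (2 * b * (2 * (3 * a))) * (ENNReal.ofReal (4 * ρ ^ α) * ballConst α μ) := by
    refine h1.trans ?_
    rw [lintegral_setLIntegral_translate ν (measurable_one.indicator hRm') hBm,
      ← volume_shearedBox σ y₀ t₀ (by positivity), ← hR']
    calc _ ≤ ∫⁻ x, R'.indicator 1 x * (ENNReal.ofReal (4 * ρ ^ α) * ballConst α μ) :=
          lintegral_mono fun x ↦ mul_le_mul' le_rfl (h2 x)
      _ = _ := by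
          rw [lintegral_mul_const _ (measurable_one.indicator hRm'), lintegral_indicator_one hRm']
  have hρ2 : ENNReal.ofReal (ρ ^ 2) ≠ 0 := (ENNReal.ofReal_pos.2 (by positivity)).ne'
  rw [← ENNReal.mul_le_mul_iff_left hρ2 ENNReal.ofReal_ne_top]
  refine h3.trans (le_of_eq ?_)
  rw [← mul_assoc, ← ENNReal.ofReal_mul (by positivity), mul_right_comm (ENNReal.ofReal _),
    ← ENNReal.ofReal_mul (by positivity)]
  congr 2
  have e1 : ρ ^ α = a ^ (α - 1) * a * (L ^ (2 - α) / L ^ 2) := by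
    rw [hρ, Real.div_rpow ha.le hL0.le, Real.rpow_sub hL0, Real.rpow_sub ha, Real.rpow_one,
      Real.rpow_two]
    field_simp
  rw [e1, hρ]
  field_simp
  norm_num

/-- For small α a single ball is better: the box fits into one of radius 4Lb, because Lb bounds both
its width a and its horizontal drift. The factor 48 is generous and matches the other case. -/
theorem measure_coords_shearedBox_le_of_le_one {α : ℝ} (hα₁ : α ≤ 1)
    {μ : Measure SpaceTime} {σ a b L : ℝ} (y₀ t₀ : ℝ) (ha : 0 < a)
    (hL : 1 ≤ L) (hab : a ≤ L * b) (hσ : |σ| ≤ L) :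
    μ.map coords (shearedBox σ a b y₀ t₀) ≤
      ENNReal.ofReal (48 * (L * b) ^ α) * ballConst α μ := by
  have hL0 : 0 < L := by linarith
  have hb : 0 < b := (mul_pos_iff_of_pos_left hL0).1 (ha.trans_le hab)
  rw [Measure.map_apply measurable_coords (measurableSet_shearedBox σ a b y₀ t₀)]
  have hsub : coords ⁻¹' shearedBox σ a b y₀ t₀ ⊆
      Metric.ball (!₂[y₀ - σ * t₀, t₀] : SpaceTime) (2 * (2 * (L * b))) := by
    rintro z ⟨⟨h1, h2⟩, h3⟩
    simp only [coords] at h1 h2 h3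
    have hbL : b ≤ L * b := le_mul_of_one_le_left hb.le hL
    refine mem_ball_of_abs_sub_le (by positivity) ?_ ?_
    · simp only [Matrix.cons_val_zero]
      have e : z 0 - (y₀ - σ * t₀) = (z 0 + σ * z 1 - y₀) - σ * (z 1 - t₀) := by ring
      have h4 : |σ * (z 1 - t₀)| ≤ L * b := by
        rw [abs_mul, abs_of_nonneg (by linarith : 0 ≤ z 1 - t₀)]
        exact mul_le_mul hσ (by linarith) (by linarith) hL0.le
      rw [e]
      refine (abs_sub _ _).trans ?_
      linarith
    · simp only [Matrix.cons_val_one, Matrix.cons_val_fin_one]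
      rw [abs_of_nonneg (by linarith)]
      linarith
  refine (measure_mono hsub).trans ((measure_ball_le α μ _ (by positivity)).trans ?_)
  refine mul_le_mul' (ENNReal.ofReal_le_ofReal ?_) le_rfl
  rw [← mul_assoc, Real.mul_rpow (by norm_num) (by positivity)]
  refine mul_le_mul_of_nonneg_right ?_ (by positivity)
  calc ((2 : ℝ) * 2) ^ α ≤ (2 * 2) ^ (1 : ℝ) :=
        Real.rpow_le_rpow_of_exponent_le (by norm_num) hα₁
    _ ≤ 48 := by norm_num

/-- The measure `μ` restricted to the slab, in sheared coordinates. -/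
noncomputable def shearMeasure (μ : Measure SpaceTime) (ζ : ℝ) : Measure (ℝ × ℝ) :=
  (μ.restrict unitTimeSlab).map fun z ↦ (z 0 + 4 * Real.pi * ζ * z 1, z 1)

instance (μ : Measure SpaceTime) [SFinite μ] (ζ : ℝ) : SFinite (shearMeasure μ ζ) := by
  unfold shearMeasure
  infer_instance

theorem measurableSet_unitTimeSlab : MeasurableSet unitTimeSlab :=
  measurableSet_preimage (f := fun z : SpaceTime ↦ z 1) (by fun_prop) measurableSet_Icc

theorem measurable_shear (ζ : ℝ) :
    Measurable fun z : SpaceTime ↦ (z 0 + 4 * Real.pi * ζ * z 1, z 1) := by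
  fun_prop

theorem shearMeasure_time_notMem (μ : Measure SpaceTime) (ζ : ℝ) :
    shearMeasure μ ζ {z | z.2 ∉ Set.Icc (0 : ℝ) 1} = 0 := by
  have hm : MeasurableSet {z : ℝ × ℝ | z.2 ∉ Set.Icc (0 : ℝ) 1} :=
    (measurable_snd measurableSet_Icc).compl
  rw [shearMeasure, Measure.map_apply (measurable_shear ζ) hm,
    Measure.restrict_apply (measurable_shear ζ hm)]
  refine measure_mono_null (t := ∅) ?_ measure_empty
  rintro z ⟨h1, h2⟩
  exact h1 h2

theorem shearMeasure_le (μ : Measure SpaceTime) (ζ : ℝ) {E : Set (ℝ × ℝ)} (hE : MeasurableSet E)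
    {a b y₀ t₀ : ℝ} (h : ∀ z ∈ E, z.2 ∈ Set.Icc (0 : ℝ) 1 → z.2 ∈ Set.Icc t₀ (t₀ + b) ∧
      |z.1 - y₀| ≤ a) :
    shearMeasure μ ζ E ≤ μ.map coords (shearedBox (4 * Real.pi * ζ) a b y₀ t₀) := by
  rw [shearMeasure, Measure.map_apply (measurable_shear ζ) hE,
    Measure.restrict_apply (measurable_shear ζ hE),
    Measure.map_apply measurable_coords (measurableSet_shearedBox _ _ _ _ _)]
  exact measure_mono fun z hz ↦ h _ hz.1 hz.2

theorem lintegral_shearMeasure (μ : Measure SpaceTime) (ζ : ℝ) {f : ℝ × ℝ → ℝ≥0∞}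
    (hf : Measurable f) : ∫⁻ z, f z ∂shearMeasure μ ζ =
      ∫⁻ z in unitTimeSlab, f (z 0 + 4 * Real.pi * ζ * z 1, z 1) ∂μ := by
  rw [shearMeasure, lintegral_map hf (measurable_shear ζ)]

/-- The power of the frequency in the `L²` estimate. -/
noncomputable def lossTwo (α N : ℝ) : ℝ := if 1 ≤ α then N ^ (2 - α) else N

/-- The power of the frequency in the `L⁴` estimate. -/
noncomputable def lossFour (α N : ℝ) : ℝ := if 1 ≤ α then N ^ (4 - 2 * α) else N ^ (3 - α)

theorem rpow_thirtytwo_mul_le {s N : ℝ} (hs : s ≤ 1) (hN : 0 ≤ N) :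
    (32 * N) ^ s ≤ 32 * N ^ s := by
  rw [Real.mul_rpow (by norm_num) hN]
  refine mul_le_mul_of_nonneg_right ?_ (by positivity)
  calc (32 : ℝ) ^ s ≤ 32 ^ (1 : ℝ) := Real.rpow_le_rpow_of_exponent_le (by norm_num) hs
    _ = 32 := Real.rpow_one _

theorem abs_shear_le {ζ N : ℝ} (hN : 0 ≤ N) (hζ : |ζ| ≤ 2 * N) : |4 * Real.pi * ζ| ≤ 32 * N := by
  rw [abs_mul, abs_of_pos (by positivity)]
  nlinarith [Real.pi_lt_d2, Real.pi_pos, abs_nonneg ζ]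

theorem shearMeasure_scaleBox_le (μ : Measure SpaceTime) (ζ M : ℝ) (z : ℝ × ℝ) :
    shearMeasure μ ζ (scaleBox M z) ≤
      μ.map coords (shearedBox (4 * Real.pi * ζ) M⁻¹ (M ^ 2)⁻¹ z.1 (z.2 - (M ^ 2)⁻¹)) := by
  refine shearMeasure_le μ ζ (measurableSet_scaleBox M z) fun x hx _ ↦ ⟨?_, ?_⟩
  · simpa using hx.2
  · rw [abs_le]
    constructor <;> linarith [hx.1.1, hx.1.2, inv_nonneg.1 ((sub_nonneg.2 (hx.1.1.trans hx.1.2)).trans_eq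
      (sub_sub_cancel _ _))]

theorem shearMeasure_strip_le (μ : Measure SpaceTime) (ζ M c : ℝ) :
    shearMeasure μ ζ (Set.Icc (c - 2 * M) (c + 2 * M) ×ˢ Set.univ) ≤
      μ.map coords (shearedBox (4 * Real.pi * ζ) (2 * M) 1 c 0) := by
  refine shearMeasure_le μ ζ (measurableSet_Icc.prod MeasurableSet.univ) fun x hx hx2 ↦ ⟨?_, ?_⟩
  · simpa using hx2
  · rw [abs_le]
    constructor <;> linarith [hx.1.1, hx.1.2]

/-- The crucial numerology of the L² bound. For α ≥ 1, w is of order M⁻² N^{2-α} M^{1-α} and W of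
order N^{2-α} M^{α-1}, so that M cancels in M²wW. For α < 1, M²wW is of order (M^{1-α} N^α)² ≤ N².
Every separation scale M ≤ N thus obeys the same bound. The constant 3072 = 48 · 32 · 2 has room for
a factor √2. -/
theorem exists_shearMeasure_bounds {α : ℝ} (hα₂ : α ≤ 2) (μ : Measure SpaceTime)
    [SFinite μ] {N M ζ : ℝ} (hM : 1 ≤ M) (hMN : M ≤ N) (hζ : |ζ| ≤ 2 * N) :
    ∃ w W : ℝ≥0∞, (∀ z, shearMeasure μ ζ (scaleBox M z) ≤ w) ∧
      (∀ c, shearMeasure μ ζ (Set.Icc (c - 2 * M) (c + 2 * M) ×ˢ Set.univ) ≤ W) ∧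
      ENNReal.ofReal (M ^ 2) * (w * W) ≤
        (ENNReal.ofReal (3072 * lossTwo α N) * ballConst α μ) ^ 2 := by
  have hM0 : 0 < M := by linarith
  have hN0 : 0 < N := by linarith
  have hL : 1 ≤ 32 * N := by linarith
  have hσ := abs_shear_le hN0.le hζ
  have h1 : M⁻¹ ≤ 32 * N * (M ^ 2)⁻¹ := by
    rw [← div_eq_mul_inv, le_div_iff₀ (by positivity), sq, inv_mul_cancel_left₀ hM0.ne']
    linarith
  have h2 : 2 * M ≤ 32 * N * 1 := by linarith
  by_cases hα : 1 ≤ α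
  · refine ⟨_, _, fun z ↦ (shearMeasure_scaleBox_le μ ζ M z).trans
        (measure_coords_shearedBox_le_of_le_two hα₂ _ _ (by positivity) hL h1 hσ),
      fun c ↦ (shearMeasure_strip_le μ ζ M c).trans
        (measure_coords_shearedBox_le_of_le_two hα₂ _ _ (by positivity) hL h2 hσ), ?_⟩
    rw [mul_mul_mul_comm (ENNReal.ofReal _), ← ENNReal.ofReal_mul (by positivity), ← mul_assoc,
      ← ENNReal.ofReal_mul (by positivity), mul_pow, sq (ballConst α μ), lossTwo, if_pos hα,
      ← ENNReal.ofReal_pow (by positivity)]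
    refine mul_le_mul' (ENNReal.ofReal_le_ofReal ?_) le_rfl
    have e1 := rpow_thirtytwo_mul_le (s := 2 - α) (by linarith) hN0.le
    have e2 : (2 : ℝ) ^ (α - 1) ≤ 2 := by
      calc (2 : ℝ) ^ (α - 1) ≤ 2 ^ (1 : ℝ) :=
            Real.rpow_le_rpow_of_exponent_le (by norm_num) (by linarith)
        _ = 2 := Real.rpow_one _
    have e3 : M⁻¹ ^ (α - 1) * M ^ (α - 1) = 1 := by
      rw [← Real.mul_rpow (by positivity) hM0.le, inv_mul_cancel₀ hM0.ne', Real.one_rpow]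
    set X := (32 * N) ^ (2 - α)
    have hX : 0 ≤ X := by positivity
    calc _ = 48 ^ 2 * X ^ 2 * 2 ^ (α - 1) * (M⁻¹ ^ (α - 1) * M ^ (α - 1)) * (M ^ 2 * (M ^ 2)⁻¹) := by
          rw [Real.mul_rpow (by norm_num) hM0.le]
          ring
      _ = 48 ^ 2 * X ^ 2 * 2 ^ (α - 1) := by
          rw [e3, mul_inv_cancel₀ (by positivity)]
          ring
      _ ≤ 48 ^ 2 * (32 * N ^ (2 - α)) ^ 2 * 2 := by gcongr
      _ ≤ _ := by nlinarith [sq_nonneg (N ^ (2 - α))]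
  · have hα' : α ≤ 1 := by linarith
    refine ⟨_, _, fun z ↦ (shearMeasure_scaleBox_le μ ζ M z).trans
        (measure_coords_shearedBox_le_of_le_one hα' _ _ (by positivity) hL h1 hσ),
      fun c ↦ (shearMeasure_strip_le μ ζ M c).trans
        (measure_coords_shearedBox_le_of_le_one hα' _ _ (by positivity) hL h2 hσ), ?_⟩
    rw [mul_mul_mul_comm (ENNReal.ofReal _), ← ENNReal.ofReal_mul (by positivity), ← mul_assoc,
      ← ENNReal.ofReal_mul (by positivity), mul_pow, sq (ballConst α μ), lossTwo, if_neg hα,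
      ← ENNReal.ofReal_pow (by positivity)]
    refine mul_le_mul' (ENNReal.ofReal_le_ofReal ?_) le_rfl
    have e3 : M ^ 2 * (32 * N * (M ^ 2)⁻¹) ^ α * (32 * N * 1) ^ α ≤ (32 * N) ^ 2 := by
      have e4 : M ^ 2 * (32 * N * (M ^ 2)⁻¹) ^ α * (32 * N * 1) ^ α =
          (M ^ (1 - α) * (32 * N) ^ α) ^ 2 := by
        rw [Real.mul_rpow (by positivity) (by positivity), Real.inv_rpow (by positivity), mul_one,
          Real.rpow_sub hM0, Real.rpow_one, sq M, Real.mul_rpow hM0.le hM0.le]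
        field_simp
      rw [e4]
      refine pow_le_pow_left₀ (by positivity) ?_ 2
      calc _ ≤ (32 * N) ^ (1 - α) * (32 * N) ^ α := by
            refine mul_le_mul_of_nonneg_right ?_ (by positivity)
            exact Real.rpow_le_rpow hM0.le (by linarith) (by linarith)
        _ = 32 * N := by
            rw [← Real.rpow_add (by positivity), sub_add_cancel, Real.rpow_one]
    calc _ = 48 ^ 2 * (M ^ 2 * (32 * N * (M ^ 2)⁻¹) ^ α * (32 * N * 1) ^ α) := by ring
      _ ≤ 48 ^ 2 * (32 * N) ^ 2 := by gcongr
      _ ≤ _ := by nlinarith [sq_nonneg N]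

theorem shearMeasure_unit_strip_le {α : ℝ} (hα₂ : α ≤ 2) (μ : Measure SpaceTime)
    [SFinite μ] {N ζ : ℝ} (hN : 1 ≤ N) (hζ : |ζ| ≤ 2 * N) (c : ℝ) :
    shearMeasure μ ζ (Set.Icc (c - 2) (c + 2) ×ˢ Set.univ) ≤
      ENNReal.ofReal (3072 * lossTwo α N) * ballConst α μ := by
  have hN0 : 0 < N := by linarith
  have hL : 1 ≤ 32 * N := by linarith
  have hσ := abs_shear_le hN0.le hζ
  have h2 : 2 ≤ 32 * N * 1 := by linarith
  have h0 := shearMeasure_strip_le μ ζ 1 c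
  rw [mul_one] at h0
  by_cases hα : 1 ≤ α
  · refine h0.trans ((measure_coords_shearedBox_le_of_le_two hα₂ _ _ (by positivity) hL h2 hσ).trans
      (mul_le_mul' (ENNReal.ofReal_le_ofReal ?_) le_rfl))
    rw [lossTwo, if_pos hα]
    have e1 := rpow_thirtytwo_mul_le (s := 2 - α) (by linarith) hN0.le
    have e2 : (2 : ℝ) ^ (α - 1) ≤ 2 := by
      calc (2 : ℝ) ^ (α - 1) ≤ 2 ^ (1 : ℝ) :=
            Real.rpow_le_rpow_of_exponent_le (by norm_num) (by linarith)
        _ = 2 := by norm_num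
    calc _ ≤ 48 * (1 * (32 * N ^ (2 - α)) * 2) := by gcongr
      _ = _ := by ring
  · have hα' : α ≤ 1 := by linarith
    refine h0.trans ((measure_coords_shearedBox_le_of_le_one hα' _ _ (by positivity) hL h2 hσ).trans
      (mul_le_mul' (ENNReal.ofReal_le_ofReal ?_) le_rfl))
    rw [lossTwo, if_neg hα, mul_one]
    have e1 := rpow_thirtytwo_mul_le (s := α) hα' hN0.le
    have e2 : N ^ α ≤ N := by
      calc N ^ α ≤ N ^ (1 : ℝ) := Real.rpow_le_rpow_of_exponent_le hN hα'
        _ = N := Real.rpow_one _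
    linarith

/-- No shear occurs here. The parameter L = 32N is chosen so that, for α ≥ 1, the balls have radius
comparable to the short side N⁻², and about N of them are used; for α < 1 one ball of radius
comparable to N⁻¹ suffices. -/
theorem shearMeasure_zero_scaleBox_le {α : ℝ} (hα₂ : α ≤ 2) (μ : Measure SpaceTime)
    [SFinite μ] {N : ℝ} (hN : 1 ≤ N) (z : ℝ × ℝ) :
    shearMeasure μ 0 (scaleBox N z) ≤
      ENNReal.ofReal (1536 * lossFour α N * (N ^ 3)⁻¹) * ballConst α μ := by
  have hN0 : 0 < N := by linarith
  have hL : 1 ≤ 32 * N := by linarith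
  have hσ := abs_shear_le (ζ := 0) hN0.le (by simp; linarith)
  have h1 : N⁻¹ ≤ 32 * N * (N ^ 2)⁻¹ := by
    rw [← div_eq_mul_inv, le_div_iff₀ (by positivity), sq, inv_mul_cancel_left₀ hN0.ne']
    linarith
  by_cases hα : 1 ≤ α
  · refine (shearMeasure_scaleBox_le μ 0 N z).trans
      ((measure_coords_shearedBox_le_of_le_two hα₂ _ _ (by positivity) hL h1 hσ).trans
      (mul_le_mul' (ENNReal.ofReal_le_ofReal ?_) le_rfl))
    rw [lossFour, if_pos hα]
    have e1 := rpow_thirtytwo_mul_le (s := 2 - α) (by linarith) hN0.le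
    calc _ ≤ 48 * ((N ^ 2)⁻¹ * (32 * N ^ (2 - α)) * N⁻¹ ^ (α - 1)) := by gcongr
      _ = _ := by
        rw [Real.inv_rpow hN0.le, Real.rpow_sub hN0, Real.rpow_sub hN0, Real.rpow_sub hN0,
          Real.rpow_one, Real.rpow_two, two_mul α, Real.rpow_add hN0]
        have : N ^ (4 : ℝ) = N ^ 4 := by exact_mod_cast Real.rpow_natCast N 4
        rw [this]
        field_simp
        norm_num
  · have hα' : α ≤ 1 := by linarith
    refine (shearMeasure_scaleBox_le μ 0 N z).trans
      ((measure_coords_shearedBox_le_of_le_one hα' _ _ (by positivity) hL h1 hσ).trans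
      (mul_le_mul' (ENNReal.ofReal_le_ofReal ?_) le_rfl))
    rw [lossFour, if_neg hα]
    have e0 : 32 * N * (N ^ 2)⁻¹ = 32 * N⁻¹ := by
      field_simp
    have e1 := rpow_thirtytwo_mul_le (s := α) hα' (N := N⁻¹) (by positivity)
    rw [e0]
    calc _ ≤ 48 * (32 * N⁻¹ ^ α) := by gcongr
      _ = _ := by
        rw [Real.inv_rpow hN0.le, Real.rpow_sub hN0]
        have : N ^ (3 : ℝ) = N ^ 3 := by exact_mod_cast Real.rpow_natCast N 3
        rw [this]
        field_simp
        norm_num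

/-! ### Unit frequency pieces and the pointwise square function bound -/

/-- `latticeBump` as a Schwartz function. -/
noncomputable def latticeBumpSchwartz : 𝓢(ℝ, ℂ) :=
  HasCompactSupport.toSchwartzMap (f := fun ξ : ℝ ↦ (latticeBump ξ : ℂ))
    (HasCompactSupport.intro (isCompact_Icc (a := (-1 : ℝ)) (b := 1)) fun ξ hξ ↦ by
      rw [latticeBump_eq_zero fun h ↦ hξ (Set.Ioo_subset_Icc_self h), Complex.ofReal_zero])
    (Complex.ofRealCLM.contDiff.comp contDiff_latticeBump)

theorem latticeBumpSchwartz_apply (ξ : ℝ) : latticeBumpSchwartz ξ = latticeBump ξ := rfl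

/-- The translate of `latticeBump` to the lattice point `k`. -/
noncomputable def latticeBumpAt (k : ℤ) : 𝓢(ℝ, ℂ) :=
  SchwartzMap.compSubConstCLM ℂ (k : ℝ) latticeBumpSchwartz

theorem latticeBumpAt_apply (k : ℤ) (ξ : ℝ) : latticeBumpAt k ξ = latticeBump (ξ - k) := rfl

/-- The part of `g` with frequencies near the lattice point `k`. -/
noncomputable def latticePiece (g : 𝓢(ℝ, ℂ)) (k : ℤ) : 𝓢(ℝ, ℂ) :=
  SchwartzMap.fourierMultiplierCLM ℂ (latticeBumpAt k) g

theorem fourier_latticePiece (g : 𝓢(ℝ, ℂ)) (k : ℤ) (ξ : ℝ) :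
    (𝓕 (latticePiece g k) : 𝓢(ℝ, ℂ)) ξ = (latticeBump (ξ - k) : ℂ) * (𝓕 g : 𝓢(ℝ, ℂ)) ξ := by
  rw [latticePiece, SchwartzMap.fourierMultiplierCLM_apply, FourierTransform.fourier_fourierInv_eq,
    SchwartzMap.smulLeftCLM_apply_apply (latticeBumpAt k).hasTemperateGrowth, smul_eq_mul,
    latticeBumpAt_apply]

theorem fourier_latticePiece_eq_zero (g : 𝓢(ℝ, ℂ)) (k : ℤ) {ξ : ℝ} (h : 1 < |ξ - k|) :
    (𝓕 (latticePiece g k) : 𝓢(ℝ, ℂ)) ξ = 0 := by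
  rw [fourier_latticePiece, latticeBump_eq_zero, Complex.ofReal_zero, zero_mul]
  intro h'
  exact absurd (abs_lt.2 h') (not_lt.2 h.le)

/-- The function whose Fourier coefficients at the integers are the values of the pieces. -/
noncomputable def windowed (g : 𝓢(ℝ, ℂ)) (x : ℝ) : 𝓢(ℝ, ℂ) :=
  SchwartzMap.smulLeftCLM ℂ (𝓕 latticeBumpSchwartz : 𝓢(ℝ, ℂ)) (SchwartzMap.compSubConstCLM ℂ (-x) g)

theorem windowed_apply (g : 𝓢(ℝ, ℂ)) (x u : ℝ) :
    windowed g x u = (𝓕 latticeBumpSchwartz : 𝓢(ℝ, ℂ)) u * g (x + u) := by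
  rw [windowed, SchwartzMap.smulLeftCLM_apply_apply (𝓕 latticeBumpSchwartz : 𝓢(ℝ, ℂ)).hasTemperateGrowth,
    smul_eq_mul, SchwartzMap.compSubConstCLM_apply, sub_neg_eq_add, add_comm u]

/-- The multipliers are translates of one bump, so their kernels are modulations of one kernel. For
fixed x the values of the pieces are therefore samples at the integers of the transform of a fixed
function. -/
theorem latticePiece_apply (g : 𝓢(ℝ, ℂ)) (k : ℤ) (x : ℝ) :
    latticePiece g k x = (𝓕 (windowed g x) : 𝓢(ℝ, ℂ)) k := by
  have h1 : latticePiece g k x = ∫ ξ, (unitExp (ξ * x) * latticeBump (ξ - k)) * (𝓕 g : 𝓢(ℝ, ℂ)) ξ := by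
    rw [latticePiece, SchwartzMap.fourierMultiplierCLM_apply, SchwartzMap.fourierInv_coe,
      fourierInv_eq_integral_unitExp]
    refine integral_congr_ae (ae_of_all _ fun ξ ↦ ?_)
    simp only
    rw [SchwartzMap.smulLeftCLM_apply_apply (latticeBumpAt k).hasTemperateGrowth, smul_eq_mul,
      latticeBumpAt_apply, mul_assoc]
  have hint : Integrable fun ξ : ℝ ↦ unitExp (ξ * x) * (latticeBump (ξ - k) : ℂ) := by
    refine (latticeBumpAt k).integrable.mono (Continuous.aestronglyMeasurable ?_)
      (ae_of_all _ fun ξ ↦ ?_)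
    · have := (latticeBumpAt k).continuous
      simp only [funext (latticeBumpAt_apply k)] at this
      exact (by fun_prop : Continuous fun ξ : ℝ ↦ unitExp (ξ * x)).mul this
    · rw [norm_mul, norm_unitExp, one_mul, latticeBumpAt_apply]
  have h2 : ∀ u, 𝓕 (fun ξ : ℝ ↦ unitExp (ξ * x) * (latticeBump (ξ - k) : ℂ)) (x + u) =
      unitExp (-(u * k)) * (𝓕 latticeBumpSchwartz : 𝓢(ℝ, ℂ)) u := by
    intro u
    rw [SchwartzMap.fourier_coe, fourier_eq_integral_unitExp, fourier_eq_integral_unitExp,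
      ← integral_const_mul, ← integral_add_right_eq_self _ (k : ℝ)]
    refine integral_congr_ae (ae_of_all _ fun ξ ↦ ?_)
    simp only [add_sub_cancel_right, latticeBumpSchwartz_apply]
    rw [← mul_assoc, ← mul_assoc, ← unitExp_add, ← unitExp_add]
    congr 2
    ring
  calc _ = ∫ ξ, 𝓕 (g : ℝ → ℂ) ξ * (unitExp (ξ * x) * (latticeBump (ξ - k) : ℂ)) := by
        rw [h1]
        exact integral_congr_ae (ae_of_all _ fun ξ ↦ mul_comm _ _)
    _ = ∫ u, g (x + u) * 𝓕 (fun ξ : ℝ ↦ unitExp (ξ * x) * (latticeBump (ξ - k) : ℂ)) (x + u) := by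
        rw [integral_fourier_mul_eq_of_integrable g.integrable hint, ← integral_add_left_eq_self _ x]
    _ = _ := by
        rw [SchwartzMap.fourier_coe, fourier_eq_integral_unitExp]
        refine integral_congr_ae (ae_of_all _ fun u ↦ ?_)
        simp only
        rw [h2, windowed_apply]
        ring

theorem lintegral_enorm_sq_fourier (f : 𝓢(ℝ, ℂ)) :
    ∫⁻ ξ, ‖(𝓕 f : 𝓢(ℝ, ℂ)) ξ‖ₑ ^ 2 = ∫⁻ x, ‖f x‖ₑ ^ 2 := by
  have key : ∀ f : 𝓢(ℝ, ℂ), ∫⁻ x, ‖f x‖ₑ ^ 2 = ENNReal.ofReal (∫ x, ‖f x‖ ^ 2) := by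
    intro f
    rw [ofReal_integral_eq_lintegral_ofReal _ (ae_of_all _ fun x ↦ by positivity)]
    · refine lintegral_congr fun x ↦ ?_
      rw [ENNReal.ofReal_pow (norm_nonneg _), ofReal_norm]
    · exact (f.memLp 2).integrable_norm_pow (by norm_num)
  rw [key, key, SchwartzMap.integral_norm_sq_fourier]

/-- The Schwartz function `-2πi x f(x)`, whose Fourier transform is the derivative of that
of `f`. -/
noncomputable def momentOne (f : 𝓢(ℝ, ℂ)) : 𝓢(ℝ, ℂ) :=
  SchwartzMap.smulLeftCLM ℂ (fun x : ℝ ↦ -2 * Real.pi * Complex.I * x) f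

theorem momentOne_apply (f : 𝓢(ℝ, ℂ)) (x : ℝ) :
    momentOne f x = (-2 * Real.pi * Complex.I * x) * f x := by
  rw [momentOne, SchwartzMap.smulLeftCLM_apply_apply (by fun_prop), smul_eq_mul]

theorem hasDerivAt_fourier_schwartz (f : 𝓢(ℝ, ℂ)) (ξ : ℝ) :
    HasDerivAt (𝓕 f : 𝓢(ℝ, ℂ)) ((𝓕 (momentOne f) : 𝓢(ℝ, ℂ)) ξ) ξ := by
  have h := Real.hasDerivAt_fourier f.integrable (by
    have := f.integrable_pow_mul volume 1
    rw [← integrable_norm_iff (by fun_prop)]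
    simpa [norm_smul] using this) ξ
  have e : (momentOne f : ℝ → ℂ) = fun x : ℝ ↦ (-2 * Real.pi * Complex.I * x) • f x := by
    ext x
    rw [momentOne_apply, smul_eq_mul]
  rw [SchwartzMap.fourier_coe, SchwartzMap.fourier_coe, e]
  exact h

theorem sum_setLIntegral_unit_le (S : Finset ℤ) (f : ℝ → ℝ≥0∞) :
    ∑ k ∈ S, ∫⁻ r in Set.Icc (0 : ℝ) 1, f (k + r) ≤ ∫⁻ x, f x := by
  have h1 : ∀ k : ℤ, ∫⁻ r in Set.Icc (0 : ℝ) 1, f (k + r) =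
      ∫⁻ x in Set.Ioc (k : ℝ) (k + 1), f x := by
    intro k
    rw [setLIntegral_congr Ioc_ae_eq_Icc.symm, ← lintegral_indicator measurableSet_Ioc,
      ← lintegral_indicator measurableSet_Ioc,
      ← lintegral_add_left_eq_self (fun x ↦ (Set.Ioc (k : ℝ) (k + 1)).indicator f x) (k : ℝ)]
    refine lintegral_congr fun r ↦ ?_
    have h2 : r ∈ Set.Ioc (0 : ℝ) 1 ↔ (k : ℝ) + r ∈ Set.Ioc (k : ℝ) (k + 1) := by
      simp only [Set.mem_Ioc]
      constructor <;> rintro ⟨a, b⟩ <;> constructor <;> linarith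
    by_cases hr : r ∈ Set.Ioc (0 : ℝ) 1
    · rw [Set.indicator_of_mem hr, Set.indicator_of_mem (h2.1 hr)]
    · rw [Set.indicator_of_notMem hr, Set.indicator_of_notMem (mt h2.2 hr)]
  simp_rw [h1]
  rw [← lintegral_biUnion_finset]
  · exact setLIntegral_le_lintegral _ _
  · intro k _ l _ hkl
    exact Set.pairwise_disjoint_Ioc_intCast ℝ hkl
  · exact fun k _ ↦ measurableSet_Ioc

theorem sq_add_le_two_mul (a b : ℝ≥0∞) : (a + b) ^ 2 ≤ 2 * a ^ 2 + 2 * b ^ 2 := by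
  have := ENNReal.rpow_add_le_mul_rpow_add_rpow a b (p := 2) (by norm_num)
  simp only [ENNReal.rpow_two] at this
  refine this.trans (le_of_eq ?_)
  rw [mul_add]
  norm_num

/-- Large sieve inequality at the integers. -/
theorem sum_enorm_sq_fourier_le (S : Finset ℤ) (f : 𝓢(ℝ, ℂ)) :
    ∑ k ∈ S, ‖(𝓕 f : 𝓢(ℝ, ℂ)) k‖ₑ ^ 2 ≤
      (2 * ∫⁻ u, ‖f u‖ₑ ^ 2) + 2 * ∫⁻ u, ‖momentOne f u‖ₑ ^ 2 := by
  set F := (𝓕 f : 𝓢(ℝ, ℂ))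
  set F' := (𝓕 (momentOne f) : 𝓢(ℝ, ℂ))
  -- The sample at k is controlled by F and F' on [k, k+1]. These intervals do not overlap, so
  -- Plancherel finishes the proof.
  have h1 : ∀ k : ℤ, ‖F k‖ₑ ^ 2 ≤
      ∫⁻ r in Set.Icc (0 : ℝ) 1, (2 * ‖F (k + r)‖ₑ ^ 2 + 2 * ‖F' (k + r)‖ₑ ^ 2) := by
    intro k
    have h := enorm_le_lintegral_of_hasDerivAt (hasDerivAt_fourier_schwartz f)
      (𝓕 (momentOne f) : 𝓢(ℝ, ℂ)).continuous one_pos (k : ℝ)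
    have mF := F.continuous
    have mF' := F'.continuous
    have h2 := lintegral_mul_sq_le (volume.restrict (Set.Icc (0 : ℝ) 1)) (f := fun _ ↦ 1)
      (g := fun r ↦ ENNReal.ofReal 1⁻¹ * ‖F (k + r)‖ₑ + ‖F' (k + r)‖ₑ) (by fun_prop)
      (((mF.measurable.comp (measurable_const_add _)).enorm.const_mul _).add
        (mF'.measurable.comp (measurable_const_add _)).enorm).aemeasurable
    refine (pow_le_pow_left' h 2).trans ?_
    simp only [one_mul, lintegral_one, Measure.restrict_apply_univ, Real.volume_Icc, sub_zero,
      ENNReal.ofReal_one, inv_one] at h2 ⊢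
    exact h2.trans (lintegral_mono fun r ↦ sq_add_le_two_mul _ _)
  refine (Finset.sum_le_sum fun k _ ↦ h1 k).trans ?_
  refine (sum_setLIntegral_unit_le S fun x ↦ 2 * ‖F x‖ₑ ^ 2 + 2 * ‖F' x‖ₑ ^ 2).trans (le_of_eq ?_)
  have mF := F.continuous
  have mF' := F'.continuous
  rw [lintegral_add_left (by fun_prop), lintegral_const_mul _ (by fun_prop),
    lintegral_const_mul _ (by fun_prop), lintegral_enorm_sq_fourier, lintegral_enorm_sq_fourier]

/-- The large sieve applied to `windowed g x`; the rapid decay of the window produces the Cauchy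
weight. Since the bound is pointwise in x, it serves the L² and the L⁴ estimate alike. -/
theorem exists_sum_enorm_latticePiece_sq_le : ∃ C : ℝ, 0 < C ∧ ∀ (S : Finset ℤ) (g : 𝓢(ℝ, ℂ))
    (x : ℝ), ∑ k ∈ S, ‖latticePiece g k x‖ₑ ^ 2 ≤ ENNReal.ofReal C * unitAvg g x := by
  set β := (𝓕 latticeBumpSchwartz : 𝓢(ℝ, ℂ)) with hβ
  obtain ⟨C₁, hC₁⟩ : ∃ C₁ : ℝ, ∀ u, ‖β u‖ ≤ C₁ := by
    obtain ⟨C, _, hC⟩ := β.decay 0 0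
    exact ⟨C, fun u ↦ by simpa using hC u⟩
  obtain ⟨C₂, hC₂⟩ : ∃ C₂ : ℝ, ∀ u, u ^ 2 * ‖β u‖ ≤ C₂ := by
    obtain ⟨C, _, hC⟩ := β.decay 2 0
    exact ⟨C, fun u ↦ by simpa using hC u⟩
  have hC₁0 : 0 ≤ C₁ := (norm_nonneg _).trans (hC₁ 0)
  have hC₂0 : 0 ≤ C₂ := le_trans (by positivity) (hC₂ 0)
  refine ⟨4 * (1 + 4 * Real.pi ^ 2) * (C₁ + C₂) ^ 2 + 1, by positivity, fun S g x ↦ ?_⟩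
  have e1 : unitAvg g x = ∫⁻ u, cauchyWeight u * ‖g (x + u)‖ₑ ^ 2 := by
    rw [unitAvg, ← lintegral_add_left_eq_self _ x]
    refine lintegral_congr fun u ↦ ?_
    simp [cauchyWeight]
  simp_rw [latticePiece_apply]
  refine (sum_enorm_sq_fourier_le S (windowed g x)).trans ?_
  have mW := (windowed g x).continuous
  have mM := (momentOne (windowed g x)).continuous
  rw [← lintegral_const_mul _ (by fun_prop), ← lintegral_const_mul _ (by fun_prop),
    ← lintegral_add_left (by fun_prop), e1, ← lintegral_const_mul' _ _ ENNReal.ofReal_ne_top]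
  refine lintegral_mono fun u ↦ ?_
  rw [momentOne_apply, windowed_apply, ← hβ]
  simp only [enorm_mul]
  rw [cauchyWeight, ← mul_assoc (ENNReal.ofReal _), ← ENNReal.ofReal_mul (by positivity)]
  have e2 : ∀ z : ℂ, ‖z‖ₑ = ENNReal.ofReal ‖z‖ := fun z ↦ (ofReal_norm z).symm
  have e3 : 2 * (‖β u‖ₑ * ‖g (x + u)‖ₑ) ^ 2 +
      2 * (‖(-2 : ℂ)‖ₑ * ‖(Real.pi : ℂ)‖ₑ * ‖Complex.I‖ₑ * ‖(u : ℂ)‖ₑ *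
        (‖β u‖ₑ * ‖g (x + u)‖ₑ)) ^ 2 =
      ENNReal.ofReal (2 * ‖β u‖ ^ 2 + 2 * (2 * Real.pi * |u| * ‖β u‖) ^ 2) * ‖g (x + u)‖ₑ ^ 2 := by
    simp only [e2, norm_neg, Complex.norm_ofNat, Complex.norm_real, Complex.norm_I, Real.norm_eq_abs,
      abs_of_pos Real.pi_pos, ENNReal.ofReal_one, mul_one]
    rw [ENNReal.ofReal_add (by positivity) (by positivity), ENNReal.ofReal_mul (by positivity),
      ENNReal.ofReal_mul (by positivity), ENNReal.ofReal_pow (by positivity),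
      ENNReal.ofReal_pow (by positivity), ENNReal.ofReal_mul (by positivity),
      ENNReal.ofReal_mul (by positivity), ENNReal.ofReal_mul (by positivity)]
    simp only [ENNReal.ofReal_ofNat]
    ring
  rw [e3]
  refine mul_le_mul' (ENNReal.ofReal_le_ofReal ?_) le_rfl
  rw [← div_eq_mul_inv, le_div_iff₀ (by positivity)]
  have h1 : (1 + u ^ 2) * ‖β u‖ ≤ C₁ + C₂ := by linarith [hC₁ u, hC₂ u]
  have h2 : ((1 + u ^ 2) * ‖β u‖) ^ 2 ≤ (C₁ + C₂) ^ 2 := pow_le_pow_left₀ (by positivity) h1 2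
  have h3 : (2 * ‖β u‖ ^ 2 + 2 * (2 * Real.pi * |u| * ‖β u‖) ^ 2) * (1 + u ^ 2) =
      (2 + 8 * Real.pi ^ 2 * u ^ 2) * (1 + u ^ 2) * ‖β u‖ ^ 2 := by
    rw [mul_pow, mul_pow, sq_abs]
    ring
  rw [h3]
  calc _ ≤ 4 * (1 + 4 * Real.pi ^ 2) * ((1 + u ^ 2) * ‖β u‖) ^ 2 := by
        rw [mul_pow, ← mul_assoc]
        refine mul_le_mul_of_nonneg_right ?_ (by positivity)
        rw [sq (1 + u ^ 2), ← mul_assoc]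
        refine mul_le_mul_of_nonneg_right ?_ (by positivity)
        nlinarith [sq_nonneg u, sq_nonneg Real.pi, mul_nonneg (sq_nonneg u) (sq_nonneg Real.pi)]
    _ ≤ _ := by nlinarith [sq_nonneg Real.pi, sq_nonneg (C₁ + C₂)]

/-- On the interval |ξ-ζ| ≤ 4M + 2 ≤ 6M, so powers up to the third are at most 6³ = 216; the
derivatives are smaller. -/
theorem symbolBound_scaled_pow {M : ℝ} (hM : 1 ≤ M) {ζ k : ℝ} (hk : |k - ζ| ≤ 4 * M) {i : ℕ}
    (hi : i < 4) :
    SymbolBound (fun ξ : ℝ ↦ ((((ξ - ζ) / M) ^ i : ℝ) : ℂ)) (Set.Icc (k - 2) (k + 2)) 216 := by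
  have hM0 : 0 < M := by linarith
  have d1 : ∀ ξ, HasDerivAt (fun ξ : ℝ ↦ (ξ - ζ) / M) (1 / M) ξ := fun ξ ↦
    ((hasDerivAt_id ξ).sub_const ζ).div_const M
  have d2 : ∀ (n : ℕ) ξ, HasDerivAt (fun ξ : ℝ ↦ ((((ξ - ζ) / M) ^ n : ℝ) : ℂ))
      ((n * ((ξ - ζ) / M) ^ (n - 1) * (1 / M) : ℝ) : ℂ) ξ := fun n ξ ↦
    ((d1 ξ).fun_pow n).ofReal_comp
  have d3 : ∀ ξ, HasDerivAt (fun ξ : ℝ ↦ ((i * ((ξ - ζ) / M) ^ (i - 1) * (1 / M) : ℝ) : ℂ))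
      ((i * ((i - 1 : ℕ) * ((ξ - ζ) / M) ^ (i - 1 - 1) * (1 / M)) * (1 / M) : ℝ) : ℂ) ξ :=
    fun ξ ↦ ((((d1 ξ).fun_pow (i - 1)).const_mul (i : ℝ)).mul_const (1 / M)).ofReal_comp
  have hx : ∀ ξ ∈ Set.Icc (k - 2) (k + 2), |(ξ - ζ) / M| ≤ 6 := by
    intro ξ hξ
    rw [abs_div, abs_of_pos hM0, div_le_iff₀ hM0]
    have h1 : |ξ - ζ| ≤ |ξ - k| + |k - ζ| := abs_sub_le _ _ _
    have h2 : |ξ - k| ≤ 2 := by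
      rw [abs_le]
      constructor <;> linarith [hξ.1, hξ.2]
    linarith
  have hM1 : |1 / M| ≤ 1 := by
    rw [abs_of_pos (by positivity), div_le_one hM0]
    exact hM
  refine SymbolBound.of_hasDerivAt (d2 i) d3 (by fun_prop) ?_ ?_ ?_
  · intro ξ hξ
    rw [Complex.norm_real, Real.norm_eq_abs, abs_pow]
    calc _ ≤ (6 : ℝ) ^ i := pow_le_pow_left₀ (abs_nonneg _) (hx ξ hξ) i
      _ ≤ 6 ^ 3 := pow_le_pow_right₀ (by norm_num) (by omega)
      _ = 216 := by norm_num
  · intro ξ hξ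
    rw [Complex.norm_real, Real.norm_eq_abs, abs_mul, abs_mul, abs_pow, Nat.abs_cast]
    have hi3 : (i : ℝ) ≤ 3 := by exact_mod_cast (by omega : i ≤ 3)
    calc _ ≤ 3 * 6 ^ 2 * (1 : ℝ) := by
          gcongr
          calc _ ≤ (6 : ℝ) ^ (i - 1) := pow_le_pow_left₀ (abs_nonneg _) (hx ξ hξ) _
            _ ≤ 6 ^ 2 := pow_le_pow_right₀ (by norm_num) (by omega)
      _ ≤ 216 := by norm_num
  · intro ξ hξ
    rw [Complex.norm_real, Real.norm_eq_abs]
    simp only [abs_mul, abs_pow, Nat.abs_cast]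
    have hi3 : (i : ℝ) ≤ 3 := by exact_mod_cast (by omega : i ≤ 3)
    have hi2 : ((i - 1 : ℕ) : ℝ) ≤ 2 := by exact_mod_cast (by omega : i - 1 ≤ 2)
    calc _ ≤ 3 * (2 * 6 ^ 1 * 1) * (1 : ℝ) := by
          gcongr
          calc _ ≤ (6 : ℝ) ^ (i - 1 - 1) := pow_le_pow_left₀ (abs_nonneg _) (hx ξ hξ) _
            _ ≤ 6 ^ 1 := pow_le_pow_right₀ (by norm_num) (by omega)
      _ ≤ 216 := by norm_num

/-- The frequency profile of the part of `b(D) g` near the lattice point `k`. -/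
noncomputable def pieceProfile (b : ℝ → ℂ) (g : 𝓢(ℝ, ℂ)) (k : ℤ) (ξ : ℝ) : ℂ :=
  b ξ * (𝓕 (latticePiece g k) : 𝓢(ℝ, ℂ)) ξ

theorem isLatticeProfile_pieceProfile {b : ℝ → ℂ} (hb : Continuous b) (g : 𝓢(ℝ, ℂ)) :
    IsLatticeProfile (pieceProfile b g) :=
  ⟨fun k ↦ hb.mul (𝓕 (latticePiece g k) : 𝓢(ℝ, ℂ)).continuous, fun k ξ hξ ↦ by
    rw [pieceProfile, fourier_latticePiece_eq_zero g k hξ, mul_zero]⟩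

theorem measurable_unitAvg {G : ℝ → ℂ} (hG : Measurable G) : Measurable (unitAvg G) := by
  have := measurable_cauchyWeight
  exact Measurable.lintegral_prod_right' (f := fun q : ℝ × ℝ ↦ cauchyWeight (q.1 - q.2) *
    ‖G q.2‖ₑ ^ 2) (by fun_prop)

theorem lintegral_cauchyWeight_convolution {f : ℝ → ℝ≥0∞} (hf : Measurable f) :
    ∫⁻ u, ∫⁻ y, cauchyWeight (u - y) * f y = ENNReal.ofReal Real.pi * ∫⁻ y, f y := by
  have := measurable_cauchyWeight
  rw [lintegral_lintegral_swap (by fun_prop), ← lintegral_const_mul _ hf]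
  refine lintegral_congr fun y ↦ ?_
  rw [lintegral_mul_const _ (by fun_prop), lintegral_sub_right_eq_self cauchyWeight y,
    lintegral_cauchyWeight]

theorem lintegral_unitAvg {G : ℝ → ℂ} (hG : Measurable G) :
    ∫⁻ u, unitAvg G u = ENNReal.ofReal Real.pi * ∫⁻ y, ‖G y‖ₑ ^ 2 :=
  lintegral_cauchyWeight_convolution (by fun_prop)

theorem lintegral_cauchyWeight_convolution_sq_le {f : ℝ → ℝ≥0∞} (hf : Measurable f) :
    ∫⁻ u, (∫⁻ y, cauchyWeight (u - y) * f y) ^ 2 ≤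
      ENNReal.ofReal Real.pi ^ 2 * ∫⁻ y, f y ^ 2 := by
  have := measurable_cauchyWeight
  rw [sq (ENNReal.ofReal _), mul_assoc, ← lintegral_cauchyWeight_convolution (hf.pow_const 2),
    ← lintegral_const_mul' _ _ ENNReal.ofReal_ne_top]
  refine lintegral_mono fun u ↦ ?_
  refine (lintegral_mul_sq_le volume (by fun_prop) hf.aemeasurable).trans (le_of_eq ?_)
  rw [lintegral_sub_left_eq_self cauchyWeight u, lintegral_cauchyWeight]

theorem exists_enorm_oscInt_pieceProfile_sq_le : ∃ C : ℝ, 0 < C ∧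
    ∀ (b : ℝ → ℂ) (B : ℝ) (k : ℤ), SymbolBound b (Set.Icc (k - 2 : ℝ) (k + 2)) B →
    ∀ (g : 𝓢(ℝ, ℂ)) (M : ℝ), 1 ≤ M → ∀ ζ : ℤ, |(k : ℝ) - ζ| ≤ 4 * M → ∀ i < 4, ∀ y t,
    ‖oscInt (scaledProfile M i fun ξ ↦ pieceProfile b g k (ξ + ζ)) y t‖ₑ ^ 2 ≤
      ENNReal.ofReal ((1 + |t|) ^ 4) * (ENNReal.ofReal (C * B ^ 2) *
        unitAvg (latticePiece g k) (y + 4 * Real.pi * ((k : ℝ) - ζ) * t)) := by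
  obtain ⟨C, hC, h⟩ := exists_enorm_oscInt_sq_le
  refine ⟨C * (4 * 216) ^ 2, by positivity, fun b B k hb g M hM ζ hζ i hi y t ↦ ?_⟩
  have hs := (symbolBound_scaled_pow hM hζ hi).mul hb (by norm_num)
  have h1 := h _ k _ hs (latticePiece g k) (fun ξ hξ ↦ fourier_latticePiece_eq_zero g k hξ)
    (y - 4 * Real.pi * ζ * t) t
  have e1 : ‖oscInt (scaledProfile M i fun ξ ↦ pieceProfile b g k (ξ + ζ)) y t‖ₑ =
      ‖oscInt (fun ξ ↦ ((((ξ - ζ) / M) ^ i : ℝ) : ℂ) * b ξ * (𝓕 (latticePiece g k) : 𝓢(ℝ, ℂ)) ξ)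
        (y - 4 * Real.pi * ζ * t) t‖ₑ := by
    rw [← ofReal_norm, ← ofReal_norm, norm_oscInt_shift _ ζ (y - 4 * Real.pi * ζ * t),
      sub_add_cancel]
    congr 3
    ext ξ
    simp only [scaledProfile, pieceProfile, add_sub_cancel_right, mul_assoc]
  rw [e1]
  refine h1.trans (le_of_eq ?_)
  rw [← mul_assoc (ENNReal.ofReal ((1 + |t|) ^ 4)), ← ENNReal.ofReal_mul (by positivity)]
  congr 2
  · ring
  · ring

/-- Connects the abstract packet estimates with `g`: a cluster recentred at ζ is a packet family
whose envelopes are unit averages of the pieces of `g`, each moving with relative velocity 4π(k-ζ).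
-/
theorem exists_isPacketFamily : ∃ C : ℝ, 0 < C ∧
    ∀ (b : ℝ → ℂ), Continuous b → ∀ (B : ℝ) (S : Finset ℤ),
    (∀ k ∈ S, SymbolBound b (Set.Icc (k - 2 : ℝ) (k + 2)) B) →
    ∀ (g : 𝓢(ℝ, ℂ)) (M : ℝ), 1 ≤ M → ∀ ζ : ℤ, (∀ k ∈ S, |(k : ℝ) - ζ| ≤ 4 * M) →
    IsPacketFamily M (S.image (· - ζ)) (fun j ξ ↦ pieceProfile b g (j + ζ) (ξ + ζ))
      (fun j u ↦ ENNReal.ofReal (C * B ^ 2) * unitAvg (latticePiece g (j + ζ)) u) := by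
  obtain ⟨C, hC, h⟩ := exists_enorm_oscInt_pieceProfile_sq_le
  refine ⟨C, hC, fun b hbc B S hb g M hM ζ hζ ↦ ⟨?_, ?_, ?_, ?_⟩⟩
  · exact (isLatticeProfile_pieceProfile hbc g).shift ζ
  · intro j hj
    obtain ⟨k, hk, rfl⟩ := Finset.mem_image.1 hj
    push_cast
    exact hζ k hk
  · exact fun j ↦ (measurable_unitAvg (latticePiece g (j + ζ)).continuous.measurable).const_mul _
  · intro j hj i hi y t
    obtain ⟨k, hk, rfl⟩ := Finset.mem_image.1 hj
    rw [sub_add_cancel]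
    refine (h b B k (hb k hk) g M hM ζ (hζ k hk) i hi y t).trans (le_of_eq ?_)
    push_cast
    rfl

theorem sumProfile_image_sub (S : Finset ℤ) (h : ℤ → ℝ → ℂ) (ζ : ℤ) (ξ : ℝ) :
    sumProfile (S.image (· - ζ)) (fun j ξ ↦ h (j + ζ) (ξ + ζ)) ξ = sumProfile S h (ξ + ζ) := by
  rw [sumProfile, Finset.sum_image (fun _ _ _ _ hab ↦ sub_left_injective hab)]
  simp only [sub_add_cancel]
  rfl

theorem sum_image_sub (S : Finset ℤ) (f : ℤ → ℝ≥0∞) (ζ : ℤ) :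
    ∑ j ∈ S.image (· - ζ), f (j + ζ) = ∑ k ∈ S, f k := by
  rw [Finset.sum_image (fun _ _ _ _ hab ↦ sub_left_injective hab)]
  simp only [sub_add_cancel]

/-! ### A single packet against a measure -/

/-- Dominates the weight by a superposition of indicators of intervals of length two, so that masses
of strips control its integral. The factor 3 is from r² ≤ 2s² + 2 for |s-r| ≤ 1. -/
theorem cauchyWeight_le_lintegral (s : ℝ) : cauchyWeight s ≤
    ∫⁻ r, (Set.Icc (-1 : ℝ) 1).indicator (fun _ ↦ 1) (s - r) * (3 * cauchyWeight r) := by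
  have hind : Measurable ((Set.Icc (-1 : ℝ) 1).indicator fun _ ↦ (1 : ℝ≥0∞)) :=
    measurable_const.indicator measurableSet_Icc
  calc cauchyWeight s ≤ ENNReal.ofReal 2 * cauchyWeight s :=
        le_mul_of_one_le_left' (ENNReal.one_le_ofReal.2 (by norm_num))
    _ = ∫⁻ r, (Set.Icc (-1 : ℝ) 1).indicator (fun _ ↦ 1) (s - r) * cauchyWeight s := by
        rw [lintegral_mul_const _ (by fun_prop), lintegral_sub_left_eq_self (fun r ↦
          (Set.Icc (-1 : ℝ) 1).indicator (fun _ ↦ (1 : ℝ≥0∞)) r) s,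
          lintegral_indicator_const measurableSet_Icc, Real.volume_Icc, one_mul]
        congr 2
        ring
    _ ≤ _ := by
        refine lintegral_mono fun r ↦ ?_
        by_cases hr : s - r ∈ Set.Icc (-1 : ℝ) 1
        · refine mul_le_mul' le_rfl ?_
          rw [cauchyWeight, cauchyWeight, ← ENNReal.ofReal_ofNat 3,
            ← ENNReal.ofReal_mul (by norm_num)]
          refine ENNReal.ofReal_le_ofReal ?_
          rw [← div_eq_mul_inv, le_div_iff₀ (by positivity), inv_mul_le_iff₀ (by positivity)]
          nlinarith [hr.1, hr.2, sq_nonneg (2 * s - r)]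
        · rw [Set.indicator_of_notMem hr, zero_mul, zero_mul]

theorem lintegral_cauchyWeight_measure_le {ν : Measure (ℝ × ℝ)} [SFinite ν] {W : ℝ≥0∞}
    (hW : ∀ c, ν (Set.Icc (c - 2) (c + 2) ×ˢ Set.univ) ≤ W) (v : ℝ) :
    ∫⁻ z, cauchyWeight (z.1 - v) ∂ν ≤ ENNReal.ofReal (3 * Real.pi) * W := by
  have hcm := measurable_cauchyWeight
  have hind : Measurable ((Set.Icc (-1 : ℝ) 1).indicator fun _ ↦ (1 : ℝ≥0∞)) :=
    measurable_const.indicator measurableSet_Icc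
  have h2 : ∀ r, ∫⁻ z : ℝ × ℝ, (Set.Icc (-1 : ℝ) 1).indicator (fun _ ↦ 1) (z.1 - v - r) ∂ν ≤
      W := by
    intro r
    have hm : MeasurableSet (Set.Icc (v + r - 2) (v + r + 2) ×ˢ (Set.univ : Set ℝ)) :=
      measurableSet_Icc.prod MeasurableSet.univ
    refine le_trans ?_ (hW (v + r))
    rw [← lintegral_indicator_one hm]
    refine lintegral_mono fun z ↦ ?_
    by_cases hz : z.1 - v - r ∈ Set.Icc (-1 : ℝ) 1
    · rw [Set.indicator_of_mem hz, Set.indicator_of_mem, Pi.one_apply]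
      refine ⟨⟨?_, ?_⟩, trivial⟩ <;> linarith [hz.1, hz.2]
    · rw [Set.indicator_of_notMem hz]
      exact zero_le
  calc _ ≤ ∫⁻ z, (∫⁻ r, (Set.Icc (-1 : ℝ) 1).indicator (fun _ ↦ 1) (z.1 - v - r) *
        (3 * cauchyWeight r)) ∂ν := lintegral_mono fun z ↦ cauchyWeight_le_lintegral (z.1 - v)
    _ = ∫⁻ r, (∫⁻ z, (Set.Icc (-1 : ℝ) 1).indicator (fun _ ↦ 1) (z.1 - v - r) ∂ν) *
        (3 * cauchyWeight r) := by
        rw [lintegral_lintegral_swap (by fun_prop)]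
        exact lintegral_congr fun r ↦ lintegral_mul_const _ (by fun_prop)
    _ ≤ ∫⁻ r, W * (3 * cauchyWeight r) := lintegral_mono fun r ↦ mul_le_mul' (h2 r) le_rfl
    _ = _ := by
        rw [lintegral_const_mul _ (by fun_prop), lintegral_const_mul _ hcm, lintegral_cauchyWeight,
          ENNReal.ofReal_mul (by norm_num), mul_comm, ENNReal.ofReal_ofNat]

theorem lintegral_unitAvg_measure_le {ν : Measure (ℝ × ℝ)} [SFinite ν] {W : ℝ≥0∞}
    (hW : ∀ c, ν (Set.Icc (c - 2) (c + 2) ×ˢ Set.univ) ≤ W) {G : ℝ → ℂ} (hG : Measurable G) :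
    ∫⁻ z, unitAvg G z.1 ∂ν ≤ ENNReal.ofReal (3 * Real.pi) * W * ∫⁻ y, ‖G y‖ₑ ^ 2 := by
  have hcm := measurable_cauchyWeight
  unfold unitAvg
  rw [lintegral_lintegral_swap (by fun_prop), ← lintegral_const_mul _ (by fun_prop)]
  refine lintegral_mono fun y ↦ ?_
  rw [lintegral_mul_const _ (by fun_prop)]
  exact mul_le_mul' (lintegral_cauchyWeight_measure_le hW y) le_rfl

/-! ### Whitney decomposition of the square of a sum -/

/-- The sum of `c` over the points of `S` in the dyadic interval of length `2 ^ m` with index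
`i`. -/
def dyadicSum (S : Finset ℤ) (c : ℤ → ℂ) (m : ℕ) (i : ℤ) : ℂ :=
  ∑ k ∈ S with k / 2 ^ m = i, c k

/-- The part of the square of a sum that comes from pairs in adjacent dyadic intervals. -/
def nearSum (S : Finset ℤ) (c : ℤ → ℂ) (m : ℕ) : ℂ :=
  ∑ p ∈ S ×ˢ S with |p.1 / 2 ^ m - p.2 / 2 ^ m| ≤ 1, c p.1 * c p.2

/-- Pairs of indices of nonadjacent dyadic intervals with adjacent parents. -/
def whitneyPairs (S : Finset ℤ) (m : ℕ) : Finset (ℤ × ℤ) :=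
  {q ∈ S.image (· / 2 ^ m) ×ˢ S.image (· / 2 ^ m) | |q.1 / 2 - q.2 / 2| ≤ 1 ∧ 2 ≤ |q.1 - q.2|}

/-- Intervals that are adjacent or equal have parents that are adjacent or equal. The pairs that
become near at level m+1 without being near at level m are the Whitney pairs. -/
theorem nearSum_succ (S : Finset ℤ) (c : ℤ → ℂ) (m : ℕ) :
    nearSum S c (m + 1) = nearSum S c m +
      ∑ q ∈ whitneyPairs S m, dyadicSum S c m q.1 * dyadicSum S c m q.2 := by
  have hd : ∀ k : ℤ, k / 2 ^ (m + 1) = k / 2 ^ m / 2 := fun k ↦ by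
    rw [pow_succ, Int.ediv_ediv_of_nonneg (by positivity)]
  have h1 : ∀ q : ℤ × ℤ, dyadicSum S c m q.1 * dyadicSum S c m q.2 =
      ∑ p ∈ S ×ˢ S with (p.1 / 2 ^ m, p.2 / 2 ^ m) = q, c p.1 * c p.2 := by
    rintro ⟨i, j⟩
    rw [dyadicSum, dyadicSum, Finset.sum_mul_sum, ← Finset.sum_product', ← Finset.filter_product]
    simp only [Prod.mk.injEq]
  simp_rw [h1]
  have h2 : ∑ q ∈ whitneyPairs S m, ∑ p ∈ S ×ˢ S with (p.1 / 2 ^ m, p.2 / 2 ^ m) = q,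
      c p.1 * c p.2 = ∑ p ∈ S ×ˢ S with (p.1 / 2 ^ m, p.2 / 2 ^ m) ∈ whitneyPairs S m,
        c p.1 * c p.2 := by
    simp_rw [Finset.sum_filter]
    rw [Finset.sum_comm]
    exact Finset.sum_congr rfl fun p _ ↦ Finset.sum_ite_eq _ _ _
  rw [h2, nearSum, nearSum, ← Finset.sum_union]
  · refine Finset.sum_congr ?_ fun _ _ ↦ rfl
    ext p
    simp only [whitneyPairs, Finset.mem_filter, Finset.mem_union, Finset.mem_product,
      Finset.mem_image, hd]
    constructor
    · rintro ⟨hp, h⟩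
      by_cases h3 : |p.1 / 2 ^ m - p.2 / 2 ^ m| ≤ 1
      · exact Or.inl ⟨hp, h3⟩
      · exact Or.inr ⟨hp, ⟨⟨_, hp.1, rfl⟩, ⟨_, hp.2, rfl⟩⟩, h, by omega⟩
    · rintro (⟨hp, h⟩ | ⟨hp, -, h, -⟩)
      · refine ⟨hp, ?_⟩
        rw [abs_le] at h ⊢
        omega
      · exact ⟨hp, h⟩
  · rw [Finset.disjoint_left]
    intro p hp hp'
    simp only [whitneyPairs, Finset.mem_filter] at hp hp'
    have := hp'.2.2.2
    have := hp.2
    omega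

/-- At level n only the two neighbouring intervals with indices -1 and 0 are present, so every pair
is near. -/
theorem nearSum_eq_sq {S : Finset ℤ} {n : ℕ} (hS : ∀ k ∈ S, -2 ^ n ≤ k ∧ k < 2 ^ n) (c : ℤ → ℂ) :
    nearSum S c n = (∑ k ∈ S, c k) * ∑ k ∈ S, c k := by
  rw [nearSum, Finset.sum_mul_sum, ← Finset.sum_product', Finset.filter_true_of_mem]
  have h : ∀ k ∈ S, k / 2 ^ n = 0 ∨ k / 2 ^ n = -1 := by
    intro k hk
    obtain ⟨h1, h2⟩ := hS k hk
    have hp : (0 : ℤ) < 2 ^ n := by positivity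
    have h3 : -1 ≤ k / 2 ^ n := by
      rw [Int.le_ediv_iff_mul_le hp]
      linarith
    have h4 : k / 2 ^ n < 1 := by
      rw [Int.ediv_lt_iff_lt_mul hp]
      linarith
    omega
  intro p hp
  rw [Finset.mem_product] at hp
  rw [abs_le]
  rcases h _ hp.1 with h1 | h1 <;> rcases h _ hp.2 with h2 | h2 <;> rw [h1, h2] <;> norm_num

theorem enorm_nearSum_le (S : Finset ℤ) (c : ℤ → ℂ) (n : ℕ) :
    ‖nearSum S c n‖ₑ ≤ ‖nearSum S c 0‖ₑ + ∑ m ∈ Finset.range n, ∑ q ∈ whitneyPairs S m,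
      ‖dyadicSum S c m q.1 * dyadicSum S c m q.2‖ₑ := by
  induction n with
  | zero => simp
  | succ n ih =>
    rw [nearSum_succ, Finset.sum_range_succ, ← add_assoc]
    exact (enorm_add_le _ _).trans (add_le_add ih (enorm_sum_le _ _))

/-- Each index has at most 7 partners on either side. Whitney pairs satisfy the condition, their
parents having indices at distance at most one. -/
theorem sum_near_pairs_le (I : Finset ℤ) (f : ℤ → ℝ≥0∞) :
    ∑ q ∈ I ×ˢ I with |q.1 - q.2| ≤ 3, (f q.1 + f q.2) ≤ 14 * ∑ i ∈ I, f i := by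
  have hc : ∀ i : ℤ, ({j ∈ I | |i - j| ≤ 3} : Finset ℤ).card ≤ 7 := by
    intro i
    calc _ ≤ (Finset.Icc (i - 3) (i + 3)).card := by
          refine Finset.card_le_card fun j hj ↦ ?_
          rw [Finset.mem_filter, abs_le] at hj
          rw [Finset.mem_Icc]
          omega
      _ = 7 := by
          rw [Int.card_Icc]
          omega
  have h1 : ∑ q ∈ I ×ˢ I with |q.1 - q.2| ≤ 3, f q.1 ≤ 7 * ∑ i ∈ I, f i := by
    rw [Finset.sum_filter, Finset.sum_product, Finset.mul_sum]
    refine Finset.sum_le_sum fun i _ ↦ ?_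
    rw [← Finset.sum_filter]
    change ∑ j ∈ I with |i - j| ≤ 3, f i ≤ _
    rw [Finset.sum_const, nsmul_eq_mul]
    exact mul_le_mul' (by exact_mod_cast hc i) le_rfl
  have h2 : ∑ q ∈ I ×ˢ I with |q.1 - q.2| ≤ 3, f q.2 ≤ 7 * ∑ i ∈ I, f i := by
    rw [Finset.sum_filter, Finset.sum_product_right, Finset.mul_sum]
    refine Finset.sum_le_sum fun i _ ↦ ?_
    simp_rw [abs_sub_comm _ i]
    rw [← Finset.sum_filter]
    change ∑ j ∈ I with |i - j| ≤ 3, f i ≤ _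
    rw [Finset.sum_const, nsmul_eq_mul]
    exact mul_le_mul' (by exact_mod_cast hc i) le_rfl
  rw [Finset.sum_add_distrib]
  refine (add_le_add h1 h2).trans (le_of_eq ?_)
  rw [← add_mul]
  norm_num

theorem enorm_mul_le_sq_add_sq (x y : ℂ) : ‖x * y‖ₑ ≤ ‖x‖ₑ ^ 2 + ‖y‖ₑ ^ 2 := by
  rw [enorm_mul]
  rcases le_total ‖x‖ₑ ‖y‖ₑ with h | h
  · exact (mul_le_mul' h le_rfl).trans ((sq ‖y‖ₑ).symm.le.trans le_add_self)
  · exact (mul_le_mul' le_rfl h).trans ((sq ‖x‖ₑ).symm.le.trans le_self_add)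

theorem enorm_nearSum_zero_le (S : Finset ℤ) (c : ℤ → ℂ) :
    ‖nearSum S c 0‖ₑ ≤ 14 * ∑ k ∈ S, ‖c k‖ₑ ^ 2 := by
  refine (enorm_sum_le _ _).trans (le_trans ?_ (sum_near_pairs_le S fun k ↦ ‖c k‖ₑ ^ 2))
  refine (Finset.sum_le_sum fun p _ ↦ enorm_mul_le_sq_add_sq _ _).trans ?_
  refine Finset.sum_le_sum_of_subset fun p hp ↦ ?_
  simp only [pow_zero, Int.ediv_one, Finset.mem_filter] at hp ⊢
  exact ⟨hp.1, hp.2.trans (by norm_num)⟩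

theorem abs_sub_le_three_of_mem_whitneyPairs {S : Finset ℤ} {m : ℕ} {q : ℤ × ℤ}
    (hq : q ∈ whitneyPairs S m) : |q.1 - q.2| ≤ 3 := by
  have h := (Finset.mem_filter.1 hq).2.1
  rw [abs_le] at h ⊢
  omega

theorem le_mul_add_of_sq_le {X D a b : ℝ≥0∞} (h : X ^ 2 ≤ D ^ 2 * (a * b)) : X ≤ D * (a + b) := by
  refine (ENNReal.pow_le_pow_left_iff two_ne_zero).1 (h.trans ?_)
  rw [mul_pow, sq (a + b)]
  exact mul_le_mul' le_rfl (mul_le_mul' le_self_add le_add_self)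

/-! ### The L² and L⁴ estimates for a frequency block -/

/-- The free evolution of the part of `b(D) g` with frequencies near `S`. -/
noncomputable def blockEvolution (b : ℝ → ℂ) (S : Finset ℤ) (g : 𝓢(ℝ, ℂ)) (z : SpaceTime) : ℂ :=
  oscInt (sumProfile S (pieceProfile b g)) (z 0) (z 1)

theorem blockEvolution_eq_sum {b : ℝ → ℂ} (hb : Continuous b) (S : Finset ℤ) (g : 𝓢(ℝ, ℂ))
    (z : SpaceTime) :
    blockEvolution b S g z = ∑ k ∈ S, oscInt (pieceProfile b g k) (z 0) (z 1) :=
  oscInt_sum S (fun k _ ↦ (isLatticeProfile_pieceProfile hb g).integrable k) _ _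

theorem measurable_blockEvolution {b : ℝ → ℂ} (hb : Continuous b) (S : Finset ℤ) (g : 𝓢(ℝ, ℂ)) :
    Measurable (blockEvolution b S g) := by
  have h := isLatticeProfile_pieceProfile hb g
  have hc := continuous_oscInt ((h.continuous_sum S).integrable_of_hasCompactSupport
    (h.hasCompactSupport_sum S))
  exact (hc.measurable.comp measurable_coords :)

theorem lintegral_slab_eq_shear {f : ℝ × ℝ → ℝ≥0∞} (hf : Measurable f) (μ : Measure SpaceTime)
    (ζ : ℝ) {F : SpaceTime → ℝ≥0∞} (h : ∀ z, F z = f (z 0 + 4 * Real.pi * ζ * z 1, z 1)) :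
    ∫⁻ z in unitTimeSlab, F z ∂μ = ∫⁻ z, f z ∂shearMeasure μ ζ := by
  rw [lintegral_shearMeasure μ ζ hf]
  exact lintegral_congr h

theorem enorm_blockEvolution_eq {b : ℝ → ℂ} (S : Finset ℤ) (g : 𝓢(ℝ, ℂ)) (ζ : ℤ) (z : SpaceTime) :
    ‖blockEvolution b S g z‖ₑ = ‖oscInt (sumProfile (S.image (· - ζ)) fun j ξ ↦
      pieceProfile b g (j + ζ) (ξ + ζ)) (z 0 + 4 * Real.pi * ζ * z 1) (z 1)‖ₑ := by
  rw [← ofReal_norm, ← ofReal_norm, blockEvolution, norm_oscInt_shift _ ζ]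
  congr 3
  ext ξ
  rw [sumProfile_image_sub]

theorem measurable_enorm_sumProfile {h : ℤ → ℝ → ℂ} (hh : IsLatticeProfile h) (S : Finset ℤ) :
    Measurable fun z : ℝ × ℝ ↦ ‖oscInt (sumProfile S h) z.1 z.2‖ₑ :=
  measurable_enorm_oscInt ((hh.continuous_sum S).integrable_of_hasCompactSupport
    (hh.hasCompactSupport_sum S))

/-- The `L²` mass of the part of `g` near the lattice point `k`. -/
noncomputable def pieceMass (g : 𝓢(ℝ, ℂ)) (k : ℤ) : ℝ≥0∞ := ∫⁻ y, ‖latticePiece g k y‖ₑ ^ 2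

theorem exists_sum_pieceMass_le : ∃ C : ℝ, 0 < C ∧ ∀ (S : Finset ℤ) (g : 𝓢(ℝ, ℂ)),
    ∑ k ∈ S, pieceMass g k ≤ ENNReal.ofReal C * ∫⁻ y, ‖g y‖ₑ ^ 2 := by
  obtain ⟨C, hC, h⟩ := exists_sum_enorm_latticePiece_sq_le
  refine ⟨C * Real.pi, by positivity, fun S g ↦ ?_⟩
  have hm : ∀ k, Measurable fun y ↦ ‖latticePiece g k y‖ₑ ^ 2 := fun k ↦ by
    have := (latticePiece g k).continuous
    fun_prop
  unfold pieceMass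
  rw [← lintegral_finsetSum S fun k _ ↦ hm k]
  refine (lintegral_mono fun x ↦ h S g x).trans (le_of_eq ?_)
  rw [lintegral_const_mul' _ _ ENNReal.ofReal_ne_top, lintegral_unitAvg g.continuous.measurable,
    ← mul_assoc, ENNReal.ofReal_mul hC.le]

/-- After recentring at k the packet is at rest: on [0, 1] its square is bounded by a unit average
depending on x alone. Only the sheared measure of strips of unit width matters. This treats the
diagonal of the Whitney decomposition. -/
theorem exists_lintegral_single_le : ∃ C : ℝ, 0 < C ∧ ∀ (α : ℝ), α ≤ 2 → ∀ (N : ℝ), 1 ≤ N →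
    ∀ (b : ℝ → ℂ), Continuous b → ∀ (B : ℝ) (k : ℤ), |(k : ℝ)| ≤ 2 * N →
    SymbolBound b (Set.Icc (k - 2 : ℝ) (k + 2)) B → ∀ (g : 𝓢(ℝ, ℂ)) (μ : Measure SpaceTime)
    [SFinite μ],
    ∫⁻ z in unitTimeSlab, ‖oscInt (pieceProfile b g k) (z 0) (z 1)‖ₑ ^ 2 ∂μ ≤
      ENNReal.ofReal (C * lossTwo α N * B ^ 2) * ballConst α μ * pieceMass g k := by
  obtain ⟨C, hC, h⟩ := exists_enorm_oscInt_pieceProfile_sq_le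
  refine ⟨2 ^ 4 * C * (3 * Real.pi) * 3072, by positivity, ?_⟩
  intro α hα N hN b hbc B k hk hb g μ _
  have hl : 0 ≤ lossTwo α N := by
    unfold lossTwo
    split_ifs <;> positivity
  have hm := measurable_unitAvg (latticePiece g k).continuous.measurable
  calc _ ≤ ∫⁻ z in unitTimeSlab, ENNReal.ofReal (2 ^ 4) * (ENNReal.ofReal (C * B ^ 2) *
        unitAvg (latticePiece g k) (z 0 + 4 * Real.pi * k * z 1)) ∂μ := by
        refine setLIntegral_mono' measurableSet_unitTimeSlab fun z hz ↦ ?_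
        have h1 := h b B k hb g 1 le_rfl k (by simp) 0 (by norm_num) (z 0 + 4 * Real.pi * k * z 1)
          (z 1)
        rw [scaledProfile_zero, sub_self, mul_zero, zero_mul, add_zero] at h1
        rw [← ofReal_norm, norm_oscInt_shift _ k, ofReal_norm]
        refine h1.trans (mul_le_mul' (ENNReal.ofReal_le_ofReal ?_) le_rfl)
        have hz1 : |z 1| ≤ 1 := by
          rw [abs_of_nonneg hz.1]
          exact hz.2
        exact pow_le_pow_left₀ (by positivity) (by linarith) 4
    _ = ENNReal.ofReal (2 ^ 4) * (ENNReal.ofReal (C * B ^ 2) *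
        ∫⁻ z, unitAvg (latticePiece g k) z.1 ∂shearMeasure μ k) := by
        rw [lintegral_const_mul' _ _ ENNReal.ofReal_ne_top,
          lintegral_const_mul' _ _ ENNReal.ofReal_ne_top,
          ← lintegral_slab_eq_shear (f := fun z ↦ unitAvg (latticePiece g k) z.1)
            (hm.comp measurable_fst) μ k fun z ↦ rfl]
    _ ≤ ENNReal.ofReal (2 ^ 4) * (ENNReal.ofReal (C * B ^ 2) * (ENNReal.ofReal (3 * Real.pi) *
        (ENNReal.ofReal (3072 * lossTwo α N) * ballConst α μ) * pieceMass g k)) := by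
        refine mul_le_mul' le_rfl (mul_le_mul' le_rfl ?_)
        exact lintegral_unitAvg_measure_le (fun c ↦ shearMeasure_unit_strip_le hα μ hN hk c)
          (latticePiece g k).continuous.measurable
    _ = _ := by
        have e : ENNReal.ofReal (2 ^ 4 * C * (3 * Real.pi) * 3072 * lossTwo α N * B ^ 2) =
            ENNReal.ofReal (2 ^ 4) * (ENNReal.ofReal (C * B ^ 2) * (ENNReal.ofReal (3 * Real.pi) *
              ENNReal.ofReal (3072 * lossTwo α N))) := by
          rw [← ENNReal.ofReal_mul (by positivity), ← ENNReal.ofReal_mul (by positivity),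
            ← ENNReal.ofReal_mul (by positivity)]
          congr 1
          ring
        rw [e]
        ring

theorem lossTwo_nonneg {α N : ℝ} (hN : 0 ≤ N) : 0 ≤ lossTwo α N := by
  unfold lossTwo
  split_ifs <;> positivity

theorem lossFour_nonneg {α N : ℝ} (hN : 0 ≤ N) : 0 ≤ lossFour α N := by
  unfold lossFour
  split_ifs <;> positivity

/-- Estimate for the product of the contributions of two sets of frequencies separated by
their common scale. -/
theorem exists_lintegral_pair_le : ∃ C : ℝ, 0 < C ∧ ∀ (α : ℝ), α ≤ 2 → ∀ (N M : ℝ), 1 ≤ M →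
    M ≤ N → ∀ (b : ℝ → ℂ), Continuous b → ∀ (B : ℝ) (S T : Finset ℤ) (ζ : ℤ), |(ζ : ℝ)| ≤ 2 * N →
    (∀ k ∈ S, SymbolBound b (Set.Icc (k - 2 : ℝ) (k + 2)) B) →
    (∀ k ∈ T, SymbolBound b (Set.Icc (k - 2 : ℝ) (k + 2)) B) →
    (∀ k ∈ S, |(k : ℝ) - ζ| ≤ 4 * M) → (∀ k ∈ T, |(k : ℝ) - ζ| ≤ 4 * M) →
    (∀ k ∈ S, ∀ l ∈ T, M ≤ |(k : ℝ) - l|) → ∀ (g : 𝓢(ℝ, ℂ)) (μ : Measure SpaceTime) [SFinite μ],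
    ∫⁻ z in unitTimeSlab, ‖blockEvolution b S g z * blockEvolution b T g z‖ₑ ∂μ ≤
      ENNReal.ofReal (C * lossTwo α N * B ^ 2) * ballConst α μ *
        ((∑ k ∈ S, pieceMass g k) + ∑ k ∈ T, pieceMass g k) := by
  obtain ⟨C₁, hC₁, h₁⟩ := exists_isPacketFamily
  obtain ⟨C₂, hC₂, h₂⟩ := exists_lintegral_bilinear_sq_le
  refine ⟨(C₂ + 1) * 3072 * (C₁ * Real.pi), by positivity, ?_⟩
  intro α hα N M hM hMN b hbc B S T ζ hζ hbS hbT hS hT hsep g μ _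
  have hl : 0 ≤ lossTwo α N := lossTwo_nonneg (by linarith)
  have fS := h₁ b hbc B S hbS g M hM ζ hS
  have fT := h₁ b hbc B T hbT g M hM ζ hT
  -- Both clusters lie within 4M of ζ. In the frame moving with ζ the bilinear estimate at scale M
  -- applies, with the sheared measure in place of μ.
  obtain ⟨w, W, hw, hW, hwW⟩ := exists_shearMeasure_bounds hα μ hM hMN hζ
  have hsep' : ∀ k ∈ S.image (· - ζ), ∀ l ∈ T.image (· - ζ), M ≤ |(k : ℝ) - l| := by
    intro k hk l hl
    obtain ⟨k', hk', rfl⟩ := Finset.mem_image.1 hk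
    obtain ⟨l', hl', rfl⟩ := Finset.mem_image.1 hl
    push_cast
    rw [sub_sub_sub_cancel_right]
    exact hsep k' hk' l' hl'
  have key := h₂ M hM _ _ _ _ _ _ fS fT hsep' (shearMeasure μ ζ) (shearMeasure_time_notMem μ ζ)
    w W hw hW
  have hmass : ∀ U : Finset ℤ, ∑ j ∈ U.image (· - ζ), ∫⁻ u, ENNReal.ofReal (C₁ * B ^ 2) *
      unitAvg (latticePiece g (j + ζ)) u =
      ENNReal.ofReal (C₁ * B ^ 2 * Real.pi) * ∑ k ∈ U, pieceMass g k := by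
    intro U
    rw [sum_image_sub U (fun k ↦ ∫⁻ u, ENNReal.ofReal (C₁ * B ^ 2) *
      unitAvg (latticePiece g k) u) ζ, Finset.mul_sum]
    refine Finset.sum_congr rfl fun k _ ↦ ?_
    rw [lintegral_const_mul' _ _ ENNReal.ofReal_ne_top,
      lintegral_unitAvg (latticePiece g k).continuous.measurable, ← mul_assoc,
      ← ENNReal.ofReal_mul (by positivity)]
    rfl
  rw [hmass, hmass] at key
  have hI : ∫⁻ z in unitTimeSlab, ‖blockEvolution b S g z * blockEvolution b T g z‖ₑ ∂μ =
      ∫⁻ z, ‖oscInt (sumProfile (S.image (· - ζ)) fun j ξ ↦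
        pieceProfile b g (j + ζ) (ξ + ζ)) z.1 z.2 * oscInt (sumProfile (T.image (· - ζ)) fun j ξ ↦
        pieceProfile b g (j + ζ) (ξ + ζ)) z.1 z.2‖ₑ ∂shearMeasure μ ζ := by
    simp only [enorm_mul]
    refine lintegral_slab_eq_shear ((measurable_enorm_sumProfile fS.profile _).mul
      (measurable_enorm_sumProfile fT.profile _)) μ ζ fun z ↦ ?_
    rw [enorm_blockEvolution_eq S g ζ, enorm_blockEvolution_eq T g ζ]
    rfl
  rw [hI]
  refine le_mul_add_of_sq_le (key.trans ?_)
  rw [ENNReal.ofReal_mul hC₂.le, mul_assoc (ENNReal.ofReal C₂)]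
  refine (mul_le_mul' (mul_le_mul' le_rfl hwW) le_rfl).trans ?_
  have e : (ENNReal.ofReal ((C₂ + 1) * 3072 * (C₁ * Real.pi) * lossTwo α N * B ^ 2) *
      ballConst α μ) ^ 2 = ENNReal.ofReal ((C₂ + 1) ^ 2) * (ENNReal.ofReal (3072 * lossTwo α N) *
        ballConst α μ) ^ 2 * ENNReal.ofReal (C₁ * B ^ 2 * Real.pi) ^ 2 := by
    have : ENNReal.ofReal ((C₂ + 1) * 3072 * (C₁ * Real.pi) * lossTwo α N * B ^ 2) =
        ENNReal.ofReal (C₂ + 1) * ENNReal.ofReal (3072 * lossTwo α N) *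
          ENNReal.ofReal (C₁ * B ^ 2 * Real.pi) := by
      rw [← ENNReal.ofReal_mul (by positivity), ← ENNReal.ofReal_mul (by positivity)]
      congr 1
      ring
    rw [this, ENNReal.ofReal_pow (by positivity)]
    ring
  rw [e, mul_mul_mul_comm (ENNReal.ofReal (C₁ * B ^ 2 * Real.pi)), ← sq, ← mul_assoc]
  refine mul_le_mul' (mul_le_mul' (mul_le_mul' (ENNReal.ofReal_le_ofReal ?_) le_rfl) le_rfl) le_rfl
  nlinarith

theorem dyadicSum_eq_blockEvolution {b : ℝ → ℂ} (hb : Continuous b) (S : Finset ℤ) (g : 𝓢(ℝ, ℂ))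
    (m : ℕ) (i : ℤ) (z : SpaceTime) :
    dyadicSum S (fun k ↦ oscInt (pieceProfile b g k) (z 0) (z 1)) m i =
      blockEvolution b {k ∈ S | k / 2 ^ m = i} g z :=
  (blockEvolution_eq_sum hb _ g z).symm

/-- The `L²` estimate for a frequency block. -/
theorem exists_lintegral_blockEvolution_sq_le : ∃ C : ℝ, 0 < C ∧ ∀ (α : ℝ), α ≤ 2 → ∀ (n : ℕ)
    (b : ℝ → ℂ), Continuous b → ∀ (B : ℝ) (S : Finset ℤ), (∀ k ∈ S, -2 ^ n ≤ k ∧ k < 2 ^ n) →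
    (∀ k ∈ S, SymbolBound b (Set.Icc (k - 2 : ℝ) (k + 2)) B) →
    ∀ (g : 𝓢(ℝ, ℂ)) (μ : Measure SpaceTime) [SFinite μ],
    ∫⁻ z in unitTimeSlab, ‖blockEvolution b S g z‖ₑ ^ 2 ∂μ ≤
      ENNReal.ofReal (C * (n + 1) * lossTwo α (2 ^ n) * B ^ 2) * ballConst α μ *
        ∫⁻ y, ‖g y‖ₑ ^ 2 := by
  obtain ⟨C₁, hC₁, h₁⟩ := exists_lintegral_single_le
  obtain ⟨C₂, hC₂, h₂⟩ := exists_lintegral_pair_le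
  obtain ⟨C₃, hC₃, h₃⟩ := exists_sum_pieceMass_le
  refine ⟨14 * (C₁ + C₂) * C₃, by positivity, ?_⟩
  intro α hα n b hbc B S hS hb g μ _
  have hN1 : (1 : ℝ) ≤ 2 ^ n := one_le_pow₀ (by norm_num)
  have hl : 0 ≤ lossTwo α (2 ^ n) := lossTwo_nonneg (by positivity)
  have hSabs : ∀ k ∈ S, |(k : ℝ)| ≤ 2 ^ n := by
    intro k hk
    obtain ⟨h4, h5⟩ := hS k hk
    rw [abs_le]
    constructor
    · exact_mod_cast h4
    · exact_mod_cast h5.le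
  set K := ballConst α μ
  set m₀ := ∑ k ∈ S, pieceMass g k with hm₀
  -- The square is expanded into a near-diagonal part and Whitney products at the n scales below
  -- 2^n.
  have hpt : ∀ z, ‖blockEvolution b S g z‖ₑ ^ 2 ≤
      14 * ∑ k ∈ S, ‖oscInt (pieceProfile b g k) (z 0) (z 1)‖ₑ ^ 2 +
      ∑ m ∈ Finset.range n, ∑ q ∈ whitneyPairs S m,
        ‖blockEvolution b {k ∈ S | k / 2 ^ m = q.1} g z *
          blockEvolution b {k ∈ S | k / 2 ^ m = q.2} g z‖ₑ := by
    intro z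
    have h4 := enorm_nearSum_le S (fun k ↦ oscInt (pieceProfile b g k) (z 0) (z 1)) n
    rw [nearSum_eq_sq hS, ← blockEvolution_eq_sum hbc, enorm_mul, ← sq] at h4
    simp only [dyadicSum_eq_blockEvolution hbc] at h4
    exact h4.trans (add_le_add (enorm_nearSum_zero_le S _) le_rfl)
  have mT : ∀ T, Measurable (blockEvolution b T g) := fun T ↦ measurable_blockEvolution hbc T g
  have mk : ∀ k, Measurable fun z : SpaceTime ↦ ‖oscInt (pieceProfile b g k) (z 0) (z 1)‖ₑ ^ 2 := by
    intro k
    have h4 := measurable_enorm_oscInt ((isLatticeProfile_pieceProfile hbc g).integrable k)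
    exact ((h4.comp measurable_coords).pow_const 2 :)
  have hpair : ∀ m ∈ Finset.range n, ∀ q ∈ whitneyPairs S m,
      ∫⁻ z in unitTimeSlab, ‖blockEvolution b {k ∈ S | k / 2 ^ m = q.1} g z *
          blockEvolution b {k ∈ S | k / 2 ^ m = q.2} g z‖ₑ ∂μ ≤
      ENNReal.ofReal (C₂ * lossTwo α (2 ^ n) * B ^ 2) * K *
        ((∑ k ∈ S with k / 2 ^ m = q.1, pieceMass g k) +
          ∑ k ∈ S with k / 2 ^ m = q.2, pieceMass g k) := by
    intro m hm q hq
    have hq3 := abs_sub_le_three_of_mem_whitneyPairs hq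
    simp only [whitneyPairs, Finset.mem_filter, Finset.mem_product, Finset.mem_image] at hq
    obtain ⟨⟨⟨k₀, hk₀, hkq⟩, -⟩, -, hq2⟩ := hq
    have hpos : (0 : ℤ) < 2 ^ m := by positivity
    have hdiv : ∀ k i : ℤ, k / 2 ^ m = i → (i * 2 ^ m : ℤ) ≤ k ∧ k < (i + 1) * 2 ^ m := by
      rintro k i rfl
      exact ⟨Int.ediv_mul_le k hpos.ne', Int.lt_ediv_add_one_mul_self k hpos⟩
    have hmn : (2 : ℝ) ^ m ≤ 2 ^ n :=
      pow_le_pow_right₀ (by norm_num) (Finset.mem_range.1 hm).le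
    have hM1 : (1 : ℝ) ≤ 2 ^ m := one_le_pow₀ (by norm_num)
    have hb' : ∀ i, ∀ k ∈ ({k ∈ S | k / 2 ^ m = i} : Finset ℤ),
        SymbolBound b (Set.Icc (k - 2 : ℝ) (k + 2)) B :=
      fun i k hk ↦ hb k (Finset.mem_filter.1 hk).1
    have hdiv' : ∀ i, ∀ k ∈ ({k ∈ S | k / 2 ^ m = i} : Finset ℤ),
        (i * 2 ^ m : ℝ) ≤ k ∧ (k : ℝ) < (i + 1) * 2 ^ m := by
      intro i k hk
      obtain ⟨h4, h5⟩ := hdiv k i (Finset.mem_filter.1 hk).2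
      constructor
      · exact_mod_cast h4
      · exact_mod_cast h5
    have hq3' : |(q.1 : ℝ) - q.2| ≤ 3 := by exact_mod_cast hq3
    have hq2' : (2 : ℝ) ≤ |(q.1 : ℝ) - q.2| := by exact_mod_cast hq2
    -- The frame is centred at the left end of the first interval. Indices differ by at most 3, so
    -- both intervals lie within 4 · 2^m of it; they differ by at least 2, so a full interval of
    -- length 2^m separates them.
    refine h₂ α hα (2 ^ n) (2 ^ m) hM1 hmn b hbc B _ _ (q.1 * 2 ^ m) ?_ (hb' q.1) (hb' q.2)
      ?_ ?_ ?_ g μ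
    · have h4 := hdiv' q.1 k₀ (Finset.mem_filter.2 ⟨hk₀, hkq⟩)
      have h5 := abs_le.1 (hSabs k₀ hk₀)
      push_cast
      rw [abs_le]
      constructor <;> linarith [h4.1, h4.2, h5.1, h5.2]
    · intro k hk
      obtain ⟨h4, h5⟩ := hdiv' q.1 k hk
      push_cast
      rw [abs_le]
      constructor <;> linarith
    · intro k hk
      obtain ⟨h4, h5⟩ := hdiv' q.2 k hk
      push_cast
      rw [abs_le] at hq3' ⊢
      constructor <;> nlinarith [hq3'.1, hq3'.2]
    · intro k hk l hl
      obtain ⟨h4, h5⟩ := hdiv' q.1 k hk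
      obtain ⟨h6, h7⟩ := hdiv' q.2 l hl
      rw [le_abs] at hq2' ⊢
      rcases hq2' with h8 | h8
      · left
        nlinarith
      · right
        nlinarith
  -- The intervals of one level partition S, and each belongs to boundedly many pairs. The total for
  -- a level is independent of m; this is the reason for the mere factor n+1.
  have hpairs : ∀ m ∈ Finset.range n, ∑ q ∈ whitneyPairs S m,
      ∫⁻ z in unitTimeSlab, ‖blockEvolution b {k ∈ S | k / 2 ^ m = q.1} g z *
          blockEvolution b {k ∈ S | k / 2 ^ m = q.2} g z‖ₑ ∂μ ≤
      ENNReal.ofReal (C₂ * lossTwo α (2 ^ n) * B ^ 2) * K * (14 * m₀) := by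
    intro m hm
    refine (Finset.sum_le_sum fun q hq ↦ hpair m hm q hq).trans ?_
    rw [← Finset.mul_sum]
    refine mul_le_mul' le_rfl ?_
    have hfib : ∑ i ∈ S.image (· / 2 ^ m), ∑ k ∈ S with k / 2 ^ m = i, pieceMass g k = m₀ :=
      Finset.sum_fiberwise_of_maps_to (fun k hk ↦ Finset.mem_image_of_mem _ hk) _
    rw [← hfib]
    refine le_trans ?_ (sum_near_pairs_le _ _)
    exact Finset.sum_le_sum_of_subset fun q hq ↦ Finset.mem_filter.2
      ⟨(Finset.mem_filter.1 hq).1, abs_sub_le_three_of_mem_whitneyPairs hq⟩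
  calc _ ≤ ∫⁻ z in unitTimeSlab, (14 * ∑ k ∈ S, ‖oscInt (pieceProfile b g k) (z 0) (z 1)‖ₑ ^ 2 +
      ∑ m ∈ Finset.range n, ∑ q ∈ whitneyPairs S m,
        ‖blockEvolution b {k ∈ S | k / 2 ^ m = q.1} g z *
          blockEvolution b {k ∈ S | k / 2 ^ m = q.2} g z‖ₑ) ∂μ := lintegral_mono hpt
    _ = 14 * (∑ k ∈ S, ∫⁻ z in unitTimeSlab,
          ‖oscInt (pieceProfile b g k) (z 0) (z 1)‖ₑ ^ 2 ∂μ) +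
        ∑ m ∈ Finset.range n, ∑ q ∈ whitneyPairs S m, ∫⁻ z in unitTimeSlab,
          ‖blockEvolution b {k ∈ S | k / 2 ^ m = q.1} g z *
            blockEvolution b {k ∈ S | k / 2 ^ m = q.2} g z‖ₑ ∂μ := by
        have mq : ∀ m (q : ℤ × ℤ), Measurable fun z ↦ ‖blockEvolution b {k ∈ S | k / 2 ^ m = q.1} g z *
            blockEvolution b {k ∈ S | k / 2 ^ m = q.2} g z‖ₑ := fun m q ↦
          ((mT _).mul (mT _)).enorm
        rw [lintegral_add_left ((Finset.measurable_fun_sum S fun k _ ↦ mk k).const_mul _),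
          lintegral_const_mul _ (Finset.measurable_fun_sum S fun k _ ↦ mk k),
          lintegral_finsetSum S fun k _ ↦ mk k, lintegral_finsetSum _ fun m _ ↦
            Finset.measurable_fun_sum _ fun q _ ↦ mq m q]
        congr 1
        exact Finset.sum_congr rfl fun m _ ↦ lintegral_finsetSum _ fun q _ ↦ mq m q
    _ ≤ 14 * (∑ k ∈ S, ENNReal.ofReal (C₁ * lossTwo α (2 ^ n) * B ^ 2) * K * pieceMass g k) +
        ∑ m ∈ Finset.range n, ENNReal.ofReal (C₂ * lossTwo α (2 ^ n) * B ^ 2) * K * (14 * m₀) :=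
        add_le_add (mul_le_mul' le_rfl (Finset.sum_le_sum fun k hk ↦
          h₁ α hα (2 ^ n) hN1 b hbc B k ((hSabs k hk).trans (by linarith)) (hb k hk) g μ))
          (Finset.sum_le_sum hpairs)
    _ = ENNReal.ofReal (14 * (C₁ + n * C₂) * lossTwo α (2 ^ n) * B ^ 2) * K * m₀ := by
        have e : ENNReal.ofReal (14 * (C₁ + n * C₂) * lossTwo α (2 ^ n) * B ^ 2) =
            14 * ENNReal.ofReal (C₁ * lossTwo α (2 ^ n) * B ^ 2) +
              n * (14 * ENNReal.ofReal (C₂ * lossTwo α (2 ^ n) * B ^ 2)) := by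
          rw [← ENNReal.ofReal_ofNat 14, ← ENNReal.ofReal_natCast n,
            ← ENNReal.ofReal_mul (by positivity), ← ENNReal.ofReal_mul (by positivity),
            ← ENNReal.ofReal_mul (by positivity), ← ENNReal.ofReal_add (by positivity)
              (by positivity)]
          congr 1
          ring
        rw [← Finset.mul_sum, ← hm₀, Finset.sum_const, Finset.card_range, nsmul_eq_mul, e]
        ring
    _ ≤ ENNReal.ofReal (14 * (C₁ + n * C₂) * lossTwo α (2 ^ n) * B ^ 2) * K *
        (ENNReal.ofReal C₃ * ∫⁻ y, ‖g y‖ₑ ^ 2) := mul_le_mul' le_rfl (h₃ S g)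
    _ = ENNReal.ofReal (14 * (C₁ + n * C₂) * lossTwo α (2 ^ n) * B ^ 2 * C₃) * K *
        ∫⁻ y, ‖g y‖ₑ ^ 2 := by
        rw [ENNReal.ofReal_mul (by positivity : 0 ≤ 14 * (C₁ + n * C₂) * lossTwo α (2 ^ n) * B ^ 2)]
        ring
    _ ≤ _ := by
        refine mul_le_mul' (mul_le_mul' (ENNReal.ofReal_le_ofReal ?_) le_rfl) le_rfl
        have hn : (0 : ℝ) ≤ n := Nat.cast_nonneg n
        have h4 : C₁ + n * C₂ ≤ (C₁ + C₂) * (n + 1) := by nlinarith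
        calc _ = 14 * C₃ * lossTwo α (2 ^ n) * B ^ 2 * (C₁ + n * C₂) := by ring
          _ ≤ 14 * C₃ * lossTwo α (2 ^ n) * B ^ 2 * ((C₁ + C₂) * (n + 1)) := by gcongr
          _ = _ := by ring

/-- The `L⁴` estimate for a frequency block. -/
theorem exists_lintegral_blockEvolution_pow_four_le {ε : ℝ} (hε : 0 < ε) (hε1 : ε ≤ 1) :
    ∃ C : ℝ, 0 < C ∧ ∀ (α : ℝ), α ≤ 2 → ∀ (n : ℕ)
    (b : ℝ → ℂ), Continuous b → ∀ (B : ℝ) (S : Finset ℤ), (∀ k ∈ S, -2 ^ n ≤ k ∧ k < 2 ^ n) →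
    (∀ k ∈ S, SymbolBound b (Set.Icc (k - 2 : ℝ) (k + 2)) B) →
    ∀ (g : 𝓢(ℝ, ℂ)) (μ : Measure SpaceTime) [SFinite μ],
    ∫⁻ z in unitTimeSlab, ‖blockEvolution b S g z‖ₑ ^ 4 ∂μ ≤
      ENNReal.ofReal (C * (2 ^ n) ^ ε * lossFour α (2 ^ n) * B ^ 4) * ballConst α μ *
        ∫⁻ y, ‖g y‖ₑ ^ 4 := by
  obtain ⟨C₁, hC₁, h₁⟩ := exists_isPacketFamily
  obtain ⟨C₂, hC₂, h₂⟩ := exists_lintegral_quartic_le hε hε1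
  obtain ⟨C₃, hC₃, h₃⟩ := exists_sum_enorm_latticePiece_sq_le
  refine ⟨C₂ * 1536 * (C₁ * C₃) ^ 2 * Real.pi ^ 4, by positivity, ?_⟩
  intro α hα n b hbc B S hS hb g μ _
  set N : ℝ := 2 ^ n with hN
  have hN1 : (1 : ℝ) ≤ N := one_le_pow₀ (by norm_num)
  have hN0 : 0 < N := by linarith
  have hl : 0 ≤ lossFour α N := lossFour_nonneg hN0.le
  have hSabs : ∀ k ∈ S, |(k : ℝ) - (0 : ℤ)| ≤ 4 * N := by
    intro k hk
    obtain ⟨h4, h5⟩ := hS k hk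
    have h6 : -N ≤ k := by
      rw [hN]
      exact_mod_cast h4
    have h7 : (k : ℝ) < N := by
      rw [hN]
      exact_mod_cast h5
    rw [Int.cast_zero, sub_zero, abs_le]
    constructor <;> linarith
  have fS := h₁ b hbc B S hb g N hN1 0 hSabs
  have key := h₂ N hN1 _ _ _ fS (shearMeasure μ 0) (shearMeasure_time_notMem μ 0) _
    (shearMeasure_zero_scaleBox_le hα μ hN1)
  have hI : ∫⁻ z in unitTimeSlab, ‖blockEvolution b S g z‖ₑ ^ 4 ∂μ =
      ∫⁻ z, ‖oscInt (sumProfile (S.image (· - 0)) fun j ξ ↦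
        pieceProfile b g (j + 0) (ξ + (0 : ℤ))) z.1 z.2‖ₑ ^ 4 ∂shearMeasure μ 0 := by
    refine lintegral_slab_eq_shear ((measurable_enorm_sumProfile fS.profile _).pow_const 4) μ 0
      fun z ↦ ?_
    rw [enorm_blockEvolution_eq S g 0, Int.cast_zero]
  have hcm := measurable_cauchyWeight
  have hg := g.continuous.measurable
  -- The pointwise square function bound is applied inside the unit average. The total envelope is
  -- then |g|² averaged twice, and convolution with the Cauchy weight is bounded on L², which leaves
  -- the fourth power of the L⁴ norm of `g`.
  have hA : ∀ u, ∑ k ∈ S, unitAvg (latticePiece g k) u ≤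
      ENNReal.ofReal C₃ * ∫⁻ y, cauchyWeight (u - y) * unitAvg g y := by
    intro u
    unfold unitAvg
    rw [← lintegral_finsetSum S, ← lintegral_const_mul' _ _ ENNReal.ofReal_ne_top]
    · refine lintegral_mono fun y ↦ ?_
      rw [← Finset.mul_sum, mul_left_comm]
      exact mul_le_mul' le_rfl (h₃ S g y)
    · intro k _
      have := (latticePiece g k).continuous.measurable
      fun_prop
  have hsum : ∫⁻ u, (∑ j ∈ S.image (· - 0), ENNReal.ofReal (C₁ * B ^ 2) *
      unitAvg (latticePiece g (j + 0)) u) ^ 2 ≤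
      ENNReal.ofReal ((C₁ * C₃) ^ 2 * B ^ 4 * Real.pi ^ 4) * ∫⁻ y, ‖g y‖ₑ ^ 4 := by
    calc _ ≤ ∫⁻ u, ENNReal.ofReal (C₁ * B ^ 2 * C₃) ^ 2 *
          (∫⁻ y, cauchyWeight (u - y) * unitAvg g y) ^ 2 := by
          refine lintegral_mono fun u ↦ ?_
          rw [← mul_pow]
          refine pow_le_pow_left' ?_ 2
          rw [sum_image_sub S (fun k ↦ ENNReal.ofReal (C₁ * B ^ 2) *
            unitAvg (latticePiece g k) u) 0, ← Finset.mul_sum,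
            ENNReal.ofReal_mul (q := C₃) (by positivity), mul_assoc]
          exact mul_le_mul' le_rfl (hA u)
      _ ≤ ENNReal.ofReal (C₁ * B ^ 2 * C₃) ^ 2 * (ENNReal.ofReal Real.pi ^ 2 *
          (ENNReal.ofReal Real.pi ^ 2 * ∫⁻ y, (‖g y‖ₑ ^ 2) ^ 2)) := by
          rw [lintegral_const_mul' _ _ (by simp)]
          refine mul_le_mul' le_rfl ((lintegral_cauchyWeight_convolution_sq_le
            (measurable_unitAvg hg)).trans (mul_le_mul' le_rfl ?_))
          exact lintegral_cauchyWeight_convolution_sq_le (by fun_prop)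
      _ = _ := by
          simp only [← pow_mul]
          rw [← ENNReal.ofReal_pow (by positivity), ← ENNReal.ofReal_pow (by positivity),
            ← mul_assoc, ← mul_assoc, ← ENNReal.ofReal_mul (by positivity),
            ← ENNReal.ofReal_mul (by positivity)]
          congr 2
          ring
  rw [hI]
  refine key.trans ((mul_le_mul' le_rfl hsum).trans (le_of_eq ?_))
  have e : ENNReal.ofReal (C₂ * 1536 * (C₁ * C₃) ^ 2 * Real.pi ^ 4 * N ^ ε * lossFour α N * B ^ 4) =
      ENNReal.ofReal (C₂ * (N ^ 3 * N ^ ε)) * ENNReal.ofReal (1536 * lossFour α N * (N ^ 3)⁻¹) *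
        ENNReal.ofReal ((C₁ * C₃) ^ 2 * B ^ 4 * Real.pi ^ 4) := by
    rw [← ENNReal.ofReal_mul (by positivity), ← ENNReal.ofReal_mul (by positivity)]
    congr 1
    field_simp
  rw [e]
  ring

/-! ### Marcinkiewicz interpolation between L² and L⁴ -/

/-- The part of a Schwartz function where it is larger than `r`, cut off smoothly. -/
noncomputable def largePart (g : 𝓢(ℝ, ℂ)) {r : ℝ} (hr : 0 < r) : 𝓢(ℝ, ℂ) :=
  HasCompactSupport.toSchwartzMap
    (f := fun x ↦ (Real.smoothTransition (‖g x‖ ^ 2 / r ^ 2 - 1) : ℂ) * g x)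
    (by
      -- Decay of `g` confines the set where it exceeds r. Smoothness of the cut-off keeps the
      -- truncation a Schwartz function, as the operators are defined only on these.
      obtain ⟨C, -, hC⟩ := g.decay 1 0
      refine HasCompactSupport.intro (isCompact_Icc (a := -(C / r)) (b := C / r)) fun x hx ↦ ?_
      have hx' : C / r < |x| := by
        by_contra h
        exact hx (abs_le.1 (not_lt.1 h))
      have h1 : |x| * ‖g x‖ ≤ C := by simpa using hC x
      rw [div_lt_iff₀ hr] at hx'
      have h2 : ‖g x‖ ≤ r := by
        by_contra h
        have h3 : |x| * r ≤ |x| * ‖g x‖ := by gcongr; exact (not_le.1 h).le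
        linarith
      rw [Real.smoothTransition.zero_of_nonpos, Complex.ofReal_zero, zero_mul]
      rw [sub_nonpos, div_le_one (by positivity)]
      exact pow_le_pow_left₀ (norm_nonneg _) h2 2)
    (by
      have hg := g.smooth ⊤
      have h1 : ContDiff ℝ (⊤ : ℕ∞) fun x ↦ ‖g x‖ ^ 2 / r ^ 2 - 1 :=
        ((hg.norm_sq ℝ).div_const _).sub contDiff_const
      exact (Complex.ofRealCLM.contDiff.comp (Real.smoothTransition.contDiff.comp h1)).mul hg)

theorem largePart_apply (g : 𝓢(ℝ, ℂ)) {r : ℝ} (hr : 0 < r) (x : ℝ) :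
    largePart g hr x = (Real.smoothTransition (‖g x‖ ^ 2 / r ^ 2 - 1) : ℂ) * g x := rfl

theorem enorm_largePart_le (g : 𝓢(ℝ, ℂ)) {r : ℝ} (hr : 0 < r) (x : ℝ) :
    ‖largePart g hr x‖ₑ ≤ {x | r ≤ ‖g x‖}.indicator (fun x ↦ ‖g x‖ₑ) x := by
  by_cases hx : r ≤ ‖g x‖
  · rw [Set.indicator_of_mem (by exact hx), largePart_apply, ← ofReal_norm, ← ofReal_norm, norm_mul]
    refine ENNReal.ofReal_le_ofReal (mul_le_of_le_one_left (norm_nonneg _) ?_)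
    rw [Complex.norm_real, Real.norm_of_nonneg (Real.smoothTransition.nonneg _)]
    exact Real.smoothTransition.le_one _
  · rw [largePart_apply, Real.smoothTransition.zero_of_nonpos]
    · simp
    · rw [sub_nonpos, div_le_one (by positivity)]
      exact pow_le_pow_left₀ (norm_nonneg _) (not_le.1 hx).le 2

theorem enorm_sub_largePart_le (g : 𝓢(ℝ, ℂ)) {r : ℝ} (hr : 0 < r) (x : ℝ) :
    ‖(g - largePart g hr) x‖ₑ ≤ {x | ‖g x‖ ≤ 2 * r}.indicator (fun x ↦ ‖g x‖ₑ) x := by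
  rw [sub_apply, largePart_apply]
  by_cases hx : ‖g x‖ ≤ 2 * r
  · rw [Set.indicator_of_mem (by exact hx), ← ofReal_norm, ← ofReal_norm, ← one_sub_mul, norm_mul]
    refine ENNReal.ofReal_le_ofReal (mul_le_of_le_one_left (norm_nonneg _) ?_)
    rw [← Complex.ofReal_one, ← Complex.ofReal_sub, Complex.norm_real, Real.norm_of_nonneg
      (sub_nonneg.2 (Real.smoothTransition.le_one _))]
    linarith [Real.smoothTransition.nonneg (‖g x‖ ^ 2 / r ^ 2 - 1)]
  · rw [Real.smoothTransition.one_of_one_le]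
    · simp
    · rw [le_sub_iff_add_le, le_div_iff₀ (by positivity)]
      nlinarith [not_le.1 hx]

theorem lintegral_Ioc_rpow {q x : ℝ} (hq : 0 < q) (hx : 0 ≤ x) :
    ∫⁻ s in Set.Ioc 0 x, ENNReal.ofReal (s ^ (q - 1)) = ENNReal.ofReal (x ^ q / q) := by
  rw [← ofReal_integral_eq_lintegral_ofReal]
  · rw [← intervalIntegral.integral_of_le hx, integral_rpow (Or.inl (by linarith)), sub_add_cancel,
      Real.zero_rpow hq.ne', sub_zero]
  · exact (intervalIntegrable_iff_integrableOn_Ioc_of_le hx).1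
      (intervalIntegral.intervalIntegrable_rpow' (by linarith))
  · filter_upwards [ae_restrict_mem measurableSet_Ioc] with s hs
    exact Real.rpow_nonneg hs.1.le _

theorem lintegral_Ici_rpow {q x : ℝ} (hq : 0 < q) (hx : 0 < x) :
    ∫⁻ s in Set.Ici x, ENNReal.ofReal (s ^ (-q - 1)) = ENNReal.ofReal (x ^ (-q) / q) := by
  rw [setLIntegral_congr Ioi_ae_eq_Ici.symm, ← ofReal_integral_eq_lintegral_ofReal]
  · rw [integral_Ioi_rpow_of_lt (by linarith) hx, sub_add_cancel, neg_div_neg_eq]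
  · exact integrableOn_Ioi_rpow_of_lt (by linarith) hx
  · filter_upwards [ae_restrict_mem measurableSet_Ioi] with s hs
    exact Real.rpow_nonneg (hx.trans hs).le _

theorem measure_lt_norm_le {X : Type*} [MeasurableSpace X] {ν : Measure X} {f : X → ℂ}
    (hf : Measurable f) {s : ℝ} (hs : 0 < s) (n : ℕ) :
    ν {z | s < ‖f z‖} ≤ ENNReal.ofReal ((s ^ n)⁻¹) * ∫⁻ z, ‖f z‖ₑ ^ n ∂ν := by
  have h1 := mul_meas_ge_le_lintegral (μ := ν) (hf.enorm.pow_const n) (ENNReal.ofReal (s ^ n))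
  have h2 : ν {z | s < ‖f z‖} ≤ ν {z | ENNReal.ofReal (s ^ n) ≤ ‖f z‖ₑ ^ n} := by
    refine measure_mono fun z hz ↦ ?_
    change ENNReal.ofReal (s ^ n) ≤ ‖f z‖ₑ ^ n
    rw [ENNReal.ofReal_pow hs.le, ← ofReal_norm]
    exact pow_le_pow_left' (ENNReal.ofReal_le_ofReal (le_of_lt hz)) n
  calc _ ≤ ENNReal.ofReal ((s ^ n)⁻¹) * (ENNReal.ofReal (s ^ n) * ν {z | s < ‖f z‖}) := by
        rw [← mul_assoc, ← ENNReal.ofReal_mul (by positivity), inv_mul_cancel₀ (by positivity),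
          ENNReal.ofReal_one, one_mul]
    _ ≤ _ := mul_le_mul' le_rfl ((mul_le_mul' le_rfl h2).trans h1)

/-- Marcinkiewicz interpolation between `L²` and `L⁴` for linear operators on Schwartz
functions. -/
theorem exists_lintegral_rpow_le_of_two_of_four {p : ℝ} (hp₂ : 2 < p) (hp₄ : p < 4) :
    ∃ C : ℝ, 0 < C ∧ ∀ {X : Type} [MeasurableSpace X] (ν : Measure X) (T : 𝓢(ℝ, ℂ) → X → ℂ),
    (∀ g, Measurable (T g)) → (∀ g h z, T (g + h) z = T g z + T h z) →
    ∀ (a c : ℝ), 0 < a → 0 < c → ∀ K : ℝ≥0∞,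
    (∀ g, ∫⁻ z, ‖T g z‖ₑ ^ 2 ∂ν ≤ ENNReal.ofReal a * K * ∫⁻ y, ‖g y‖ₑ ^ 2) →
    (∀ g, ∫⁻ z, ‖T g z‖ₑ ^ 4 ∂ν ≤ ENNReal.ofReal c * K * ∫⁻ y, ‖g y‖ₑ ^ 4) →
    ∀ g, ∫⁻ z, ‖T g z‖ₑ ^ p ∂ν ≤
      ENNReal.ofReal (C * (a ^ ((4 - p) / 2) * c ^ ((p - 2) / 2))) * K * ∫⁻ y, ‖g y‖ₑ ^ p := by
  refine ⟨p * (4 / (p - 2) + 16 * 2 ^ (4 - p) / (4 - p)), by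
    have : 0 < p - 2 := by linarith
    have : 0 < 4 - p := by linarith
    positivity, ?_⟩
  intro X _ ν T hT hadd a c ha hc K h2 h4 g
  have hq2 : 0 < p - 2 := by linarith
  have hq4 : 0 < 4 - p := by linarith
  have hgm : Measurable g := g.continuous.measurable
  -- At height s the function is truncated at s/D. This D balances the two contributions: a D^{p-2}
  -- and c D^{p-4} both equal a^{(4-p)/2} c^{(p-2)/2}.
  set D : ℝ := (c / a) ^ (1 / 2 : ℝ) with hD
  have hD0 : 0 < D := by positivity
  -- Chebyshev, with the L² bound for the large part and the L⁴ bound for the rest. The indicators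
  -- record, for each y, the heights s at which `g y` belongs to either part.
  have hdist : ∀ s, 0 < s → ν {z | s < ‖T g z‖} * ENNReal.ofReal (s ^ (p - 1)) ≤
      K * (∫⁻ y, ENNReal.ofReal (4 * a) * (‖g y‖ₑ ^ 2 *
          (Set.Ioc 0 (D * ‖g y‖)).indicator (fun s ↦ ENNReal.ofReal (s ^ (p - 2 - 1))) s)) +
      K * (∫⁻ y, ENNReal.ofReal (16 * c) * (‖g y‖ₑ ^ 4 *
          (Set.Ici (D * ‖g y‖ / 2)).indicator (fun s ↦ ENNReal.ofReal (s ^ (-(4 - p) - 1))) s)) := by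
    intro s hs
    have hr : 0 < s / D := by positivity
    set g₁ := largePart g hr
    set g₂ := g - largePart g hr
    have hsplit : ν {z | s < ‖T g z‖} ≤ ν {z | s / 2 < ‖T g₁ z‖} + ν {z | s / 2 < ‖T g₂ z‖} := by
      refine (measure_mono fun z hz ↦ ?_).trans (measure_union_le _ _)
      have e : T g z = T g₁ z + T g₂ z := by
        rw [← hadd]
        congr 1
        exact (add_sub_cancel _ _).symm
      by_contra hn
      rw [Set.mem_union, not_or] at hn
      have h5 : ‖T g₁ z‖ ≤ s / 2 := not_lt.1 hn.1
      have h6 : ‖T g₂ z‖ ≤ s / 2 := not_lt.1 hn.2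
      have h7 : s < ‖T g z‖ := hz
      rw [e] at h7
      linarith [norm_add_le (T g₁ z) (T g₂ z)]
    have e1 : ν {z | s / 2 < ‖T g₁ z‖} * ENNReal.ofReal (s ^ (p - 1)) ≤
        K * (∫⁻ y, ENNReal.ofReal (4 * a) * (‖g y‖ₑ ^ 2 *
          (Set.Ioc 0 (D * ‖g y‖)).indicator (fun s ↦ ENNReal.ofReal (s ^ (p - 2 - 1))) s)) := by
      calc _ ≤ ENNReal.ofReal (((s / 2) ^ 2)⁻¹) * (ENNReal.ofReal a * K * ∫⁻ y, ‖g₁ y‖ₑ ^ 2) *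
            ENNReal.ofReal (s ^ (p - 1)) := by
            refine mul_le_mul' ((measure_lt_norm_le (hT g₁) (by positivity) 2).trans ?_) le_rfl
            exact mul_le_mul' le_rfl (h2 g₁)
        _ = K * ∫⁻ y, ENNReal.ofReal (4 * a * s ^ (p - 2 - 1)) * ‖g₁ y‖ₑ ^ 2 := by
            have e : ENNReal.ofReal (4 * a * s ^ (p - 2 - 1)) = ENNReal.ofReal (((s / 2) ^ 2)⁻¹) *
                ENNReal.ofReal a * ENNReal.ofReal (s ^ (p - 1)) := by
              rw [← ENNReal.ofReal_mul (by positivity), ← ENNReal.ofReal_mul (by positivity)]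
              congr 1
              rw [show p - 2 - 1 = (p - 1) - 2 by ring, Real.rpow_sub hs, Real.rpow_two]
              field_simp
              norm_num
            rw [lintegral_const_mul' _ _ ENNReal.ofReal_ne_top, e]
            ring
        _ ≤ _ := by
            refine mul_le_mul' le_rfl (lintegral_mono fun y ↦ ?_)
            rw [ENNReal.ofReal_mul (by positivity), mul_assoc]
            refine mul_le_mul' le_rfl ?_
            have h5 := enorm_largePart_le g hr y
            by_cases hy : s / D ≤ ‖g y‖
            · rw [Set.indicator_of_mem (by exact hy)] at h5
              rw [Set.indicator_of_mem, mul_comm]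
              · exact mul_le_mul' (pow_le_pow_left' h5 2) le_rfl
              · refine ⟨hs, ?_⟩
                rwa [div_le_iff₀ hD0, mul_comm] at hy
            · rw [Set.indicator_of_notMem (by exact hy)] at h5
              rw [le_antisymm h5 zero_le]
              simp
    have e2 : ν {z | s / 2 < ‖T g₂ z‖} * ENNReal.ofReal (s ^ (p - 1)) ≤
        K * (∫⁻ y, ENNReal.ofReal (16 * c) * (‖g y‖ₑ ^ 4 *
          (Set.Ici (D * ‖g y‖ / 2)).indicator (fun s ↦ ENNReal.ofReal (s ^ (-(4 - p) - 1))) s)) := by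
      calc _ ≤ ENNReal.ofReal (((s / 2) ^ 4)⁻¹) * (ENNReal.ofReal c * K * ∫⁻ y, ‖g₂ y‖ₑ ^ 4) *
            ENNReal.ofReal (s ^ (p - 1)) := by
            refine mul_le_mul' ((measure_lt_norm_le (hT g₂) (by positivity) 4).trans ?_) le_rfl
            exact mul_le_mul' le_rfl (h4 g₂)
        _ = K * ∫⁻ y, ENNReal.ofReal (16 * c * s ^ (-(4 - p) - 1)) * ‖g₂ y‖ₑ ^ 4 := by
            have e : ENNReal.ofReal (16 * c * s ^ (-(4 - p) - 1)) =
                ENNReal.ofReal (((s / 2) ^ 4)⁻¹) *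
                ENNReal.ofReal c * ENNReal.ofReal (s ^ (p - 1)) := by
              rw [← ENNReal.ofReal_mul (by positivity), ← ENNReal.ofReal_mul (by positivity)]
              congr 1
              have : s ^ (4 : ℝ) = s ^ 4 := by exact_mod_cast Real.rpow_natCast s 4
              rw [show -(4 - p) - 1 = (p - 1) - 4 by ring, Real.rpow_sub hs, this]
              field_simp
              norm_num
            rw [lintegral_const_mul' _ _ ENNReal.ofReal_ne_top, e]
            ring
        _ ≤ _ := by
            refine mul_le_mul' le_rfl (lintegral_mono fun y ↦ ?_)
            rw [ENNReal.ofReal_mul (by positivity), mul_assoc]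
            refine mul_le_mul' le_rfl ?_
            have h5 := enorm_sub_largePart_le g hr y
            by_cases hy : ‖g y‖ ≤ 2 * (s / D)
            · rw [Set.indicator_of_mem (by exact hy)] at h5
              rw [Set.indicator_of_mem, mul_comm]
              · exact mul_le_mul' (pow_le_pow_left' h5 4) le_rfl
              · rw [Set.mem_Ici]
                rw [← mul_div_assoc, le_div_iff₀ hD0] at hy
                linarith
            · rw [Set.indicator_of_notMem (by exact hy)] at h5
              rw [le_antisymm h5 zero_le]
              simp
    calc _ ≤ (ν {z | s / 2 < ‖T g₁ z‖} + ν {z | s / 2 < ‖T g₂ z‖}) * ENNReal.ofReal (s ^ (p - 1)) :=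
          mul_le_mul' hsplit le_rfl
      _ ≤ _ := by
          rw [add_mul]
          exact add_le_add e1 e2
  have hm1 : Measurable fun q : ℝ × ℝ ↦ (Set.Ioc 0 (D * ‖g q.2‖)).indicator
      (fun s ↦ ENNReal.ofReal (s ^ (p - 2 - 1))) q.1 := by
    have hs : MeasurableSet {q : ℝ × ℝ | q.1 ∈ Set.Ioc 0 (D * ‖g q.2‖)} :=
      (measurableSet_lt measurable_const measurable_fst).inter
        (measurableSet_le measurable_fst (by fun_prop))
    exact Measurable.indicator (f := fun q : ℝ × ℝ ↦ ENNReal.ofReal (q.1 ^ (p - 2 - 1)))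
      (by fun_prop) hs
  have hm2 : Measurable fun q : ℝ × ℝ ↦ (Set.Ici (D * ‖g q.2‖ / 2)).indicator
      (fun s ↦ ENNReal.ofReal (s ^ (-(4 - p) - 1))) q.1 := by
    have hs : MeasurableSet {q : ℝ × ℝ | q.1 ∈ Set.Ici (D * ‖g q.2‖ / 2)} :=
      measurableSet_le (by fun_prop) measurable_fst
    exact Measurable.indicator (f := fun q : ℝ × ℝ ↦ ENNReal.ofReal (q.1 ^ (-(4 - p) - 1)))
      (by fun_prop) hs
  have hM1 : Measurable fun s ↦ ∫⁻ y, ENNReal.ofReal (4 * a) * (‖g y‖ₑ ^ 2 *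
      (Set.Ioc 0 (D * ‖g y‖)).indicator (fun s ↦ ENNReal.ofReal (s ^ (p - 2 - 1))) s) :=
    Measurable.lintegral_prod_right' (f := fun q : ℝ × ℝ ↦ ENNReal.ofReal (4 * a) *
      (‖g q.2‖ₑ ^ 2 * (Set.Ioc 0 (D * ‖g q.2‖)).indicator
        (fun s ↦ ENNReal.ofReal (s ^ (p - 2 - 1))) q.1)) (by fun_prop)
  have hM2 : Measurable fun s ↦ ∫⁻ y, ENNReal.ofReal (16 * c) * (‖g y‖ₑ ^ 4 *
      (Set.Ici (D * ‖g y‖ / 2)).indicator (fun s ↦ ENNReal.ofReal (s ^ (-(4 - p) - 1))) s) :=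
    Measurable.lintegral_prod_right' (f := fun q : ℝ × ℝ ↦ ENNReal.ofReal (16 * c) *
      (‖g q.2‖ₑ ^ 4 * (Set.Ici (D * ‖g q.2‖ / 2)).indicator
        (fun s ↦ ENNReal.ofReal (s ^ (-(4 - p) - 1))) q.1)) (by fun_prop)
  have hF1 : ∫⁻ s in Set.Ioi 0, (∫⁻ y, ENNReal.ofReal (4 * a) * (‖g y‖ₑ ^ 2 *
      (Set.Ioc 0 (D * ‖g y‖)).indicator (fun s ↦ ENNReal.ofReal (s ^ (p - 2 - 1))) s)) ≤
      ENNReal.ofReal (4 * (a * D ^ (p - 2)) / (p - 2)) * ∫⁻ y, ‖g y‖ₑ ^ p := by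
    refine (setLIntegral_le_lintegral _ _).trans ?_
    rw [lintegral_lintegral_swap (by fun_prop), ← lintegral_const_mul _ (by fun_prop)]
    refine lintegral_mono fun y ↦ ?_
    rw [lintegral_const_mul' _ _ ENNReal.ofReal_ne_top, lintegral_const_mul' _ _ (by simp),
      lintegral_indicator measurableSet_Ioc, lintegral_Ioc_rpow hq2 (by positivity),
      ← ofReal_norm, ENNReal.ofReal_rpow_of_nonneg (norm_nonneg _) (by linarith),
      ← ENNReal.ofReal_pow (norm_nonneg _), ← ENNReal.ofReal_mul (by positivity),
      ← ENNReal.ofReal_mul (by positivity), ← ENNReal.ofReal_mul (by positivity)]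
    refine ENNReal.ofReal_le_ofReal (le_of_eq ?_)
    have e : ‖g y‖ ^ p = ‖g y‖ ^ 2 * ‖g y‖ ^ (p - 2) := by
      rw [← Real.rpow_two, ← Real.rpow_add_of_nonneg (norm_nonneg _) (by norm_num) hq2.le]
      congr 1
      ring
    rw [e, Real.mul_rpow hD0.le (norm_nonneg _)]
    ring
  have hF2 : ∫⁻ s in Set.Ioi 0, (∫⁻ y, ENNReal.ofReal (16 * c) * (‖g y‖ₑ ^ 4 *
      (Set.Ici (D * ‖g y‖ / 2)).indicator (fun s ↦ ENNReal.ofReal (s ^ (-(4 - p) - 1))) s)) ≤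
      ENNReal.ofReal (16 * 2 ^ (4 - p) * (c * D ^ (p - 4)) / (4 - p)) * ∫⁻ y, ‖g y‖ₑ ^ p := by
    refine (setLIntegral_le_lintegral _ _).trans ?_
    rw [lintegral_lintegral_swap (by fun_prop), ← lintegral_const_mul _ (by fun_prop)]
    refine lintegral_mono fun y ↦ ?_
    rw [lintegral_const_mul' _ _ ENNReal.ofReal_ne_top, lintegral_const_mul' _ _ (by simp),
      lintegral_indicator measurableSet_Ici]
    rcases (norm_nonneg (g y)).eq_or_lt with hy | hy
    · rw [← ofReal_norm, ← hy]
      simp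
    rw [lintegral_Ici_rpow hq4 (by positivity),
      ← ofReal_norm, ENNReal.ofReal_rpow_of_nonneg (norm_nonneg _) (by linarith),
      ← ENNReal.ofReal_pow (norm_nonneg _), ← ENNReal.ofReal_mul (by positivity),
      ← ENNReal.ofReal_mul (by positivity), ← ENNReal.ofReal_mul (by positivity)]
    refine ENNReal.ofReal_le_ofReal (le_of_eq ?_)
    have e : ‖g y‖ ^ p = ‖g y‖ ^ 4 * ‖g y‖ ^ (-(4 - p)) := by
      have h5 : ‖g y‖ ^ (4 : ℝ) = ‖g y‖ ^ 4 := by exact_mod_cast Real.rpow_natCast (‖g y‖) 4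
      rw [← h5, ← Real.rpow_add hy]
      congr 1
      ring
    rw [e, Real.div_rpow (by positivity) (by norm_num), Real.mul_rpow hD0.le hy.le,
      Real.rpow_neg (by norm_num : (0 : ℝ) ≤ 2), show p - 4 = -(4 - p) by ring]
    field_simp
  have hD2 : a * D ^ (p - 2) = a ^ ((4 - p) / 2) * c ^ ((p - 2) / 2) := by
    rw [hD, ← Real.rpow_mul (by positivity), Real.div_rpow hc.le ha.le,
      show (4 - p) / 2 = 1 - 1 / 2 * (p - 2) by ring, Real.rpow_sub ha, Real.rpow_one,
      show (p - 2) / 2 = 1 / 2 * (p - 2) by ring]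
    field_simp
  have hD4 : c * D ^ (p - 4) = a ^ ((4 - p) / 2) * c ^ ((p - 2) / 2) := by
    rw [hD, ← Real.rpow_mul (by positivity), Real.div_rpow hc.le ha.le,
      show (p - 2) / 2 = 1 + 1 / 2 * (p - 4) by ring, Real.rpow_add hc, Real.rpow_one,
      show (4 - p) / 2 = -(1 / 2 * (p - 4)) by ring, Real.rpow_neg ha.le]
    field_simp
  rw [hD2] at hF1
  rw [hD4] at hF2
  set E := a ^ ((4 - p) / 2) * c ^ ((p - 2) / 2) with hE
  have hE0 : 0 ≤ E := by positivity
  set I := ∫⁻ y, ‖g y‖ₑ ^ p with hI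
  calc _ = ∫⁻ z, ENNReal.ofReal (‖T g z‖ ^ p) ∂ν := by
        refine lintegral_congr fun z ↦ ?_
        rw [← ofReal_norm, ENNReal.ofReal_rpow_of_nonneg (norm_nonneg _) (by linarith)]
    _ = ENNReal.ofReal p * ∫⁻ s in Set.Ioi 0, ν {z | s < ‖T g z‖} * ENNReal.ofReal (s ^ (p - 1)) :=
        lintegral_rpow_eq_lintegral_meas_lt_mul ν (ae_of_all _ fun z ↦ norm_nonneg _)
          (hT g).norm.aemeasurable (by linarith)
    _ ≤ ENNReal.ofReal p * ∫⁻ s in Set.Ioi 0, (K * (∫⁻ y, ENNReal.ofReal (4 * a) * (‖g y‖ₑ ^ 2 *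
          (Set.Ioc 0 (D * ‖g y‖)).indicator (fun s ↦ ENNReal.ofReal (s ^ (p - 2 - 1))) s)) +
        K * (∫⁻ y, ENNReal.ofReal (16 * c) * (‖g y‖ₑ ^ 4 *
          (Set.Ici (D * ‖g y‖ / 2)).indicator (fun s ↦ ENNReal.ofReal (s ^ (-(4 - p) - 1))) s))) :=
        mul_le_mul' le_rfl (setLIntegral_mono' measurableSet_Ioi hdist)
    _ ≤ ENNReal.ofReal p * (K * (ENNReal.ofReal (4 * E / (p - 2)) * I) +
        K * (ENNReal.ofReal (16 * 2 ^ (4 - p) * E / (4 - p)) * I)) := by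
        refine mul_le_mul' le_rfl ?_
        rw [lintegral_add_left (hM1.const_mul K), lintegral_const_mul _ hM1,
          lintegral_const_mul _ hM2]
        exact add_le_add (mul_le_mul' le_rfl hF1) (mul_le_mul' le_rfl hF2)
    _ = _ := by
        have e : ENNReal.ofReal (p * (4 / (p - 2) + 16 * 2 ^ (4 - p) / (4 - p)) * E) =
            ENNReal.ofReal p * (ENNReal.ofReal (4 * E / (p - 2)) +
              ENNReal.ofReal (16 * 2 ^ (4 - p) * E / (4 - p))) := by
          rw [← ENNReal.ofReal_add (by positivity) (by positivity),
            ← ENNReal.ofReal_mul (by linarith)]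
          congr 1
          ring
        rw [e]
        ring

theorem blockEvolution_add {b : ℝ → ℂ} (hb : Continuous b) (S : Finset ℤ) (g h : 𝓢(ℝ, ℂ))
    (z : SpaceTime) :
    blockEvolution b S (g + h) z = blockEvolution b S g z + blockEvolution b S h z := by
  simp_rw [blockEvolution_eq_sum hb]
  rw [← Finset.sum_add_distrib]
  refine Finset.sum_congr rfl fun k _ ↦ ?_
  rw [← oscInt_add ((isLatticeProfile_pieceProfile hb g).integrable k)
    ((isLatticeProfile_pieceProfile hb h).integrable k)]
  congr 1
  ext ξ
  rw [Pi.add_apply, pieceProfile, pieceProfile, pieceProfile, fourier_latticePiece,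
    fourier_latticePiece, fourier_latticePiece, FourierTransform.fourier_add, add_apply]
  ring

/-- The regularity that is sufficient for the fractal local smoothing estimate, up to the
endpoint. -/
noncomputable def criticalExponent (α p : ℝ) : ℝ :=
  if 1 ≤ α then (2 - α) / 2 else (2 - α) / 2 + (α - 1) / p

/-- Absorbs the number of Whitney scales into an arbitrarily small power of 2^n. -/
theorem natCast_add_one_le_rpow {ε : ℝ} (hε : 0 < ε) (n : ℕ) :
    (n + 1 : ℝ) ≤ (1 + 1 / (ε * Real.log 2)) * (2 ^ n) ^ ε := by
  have hl : 0 < Real.log 2 := Real.log_pos (by norm_num)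
  have h1 : ((2 : ℝ) ^ n) ^ ε = Real.exp (n * (ε * Real.log 2)) := by
    rw [Real.rpow_def_of_pos (by positivity), Real.log_pow]
    ring_nf
  have h2 := Real.add_one_le_exp (n * (ε * Real.log 2))
  have h3 : (1 : ℝ) ≤ Real.exp (n * (ε * Real.log 2)) := Real.one_le_exp (by positivity)
  rw [h1, add_mul, one_mul, add_comm]
  refine add_le_add h3 ?_
  rw [div_mul_eq_mul_div, one_mul, le_div_iff₀ (by positivity)]
  linarith

/-- The origin of `criticalExponent`: the endpoint losses, weighted with the interpolation exponents
(4-p)/2 and (p-2)/2. -/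
theorem lossTwo_rpow_mul_lossFour_rpow {α p N : ℝ} (hp : 0 < p) (hN : 0 < N) :
    lossTwo α N ^ ((4 - p) / 2) * lossFour α N ^ ((p - 2) / 2) =
      N ^ (p * criticalExponent α p) := by
  unfold lossTwo lossFour criticalExponent
  split_ifs
  · rw [← Real.rpow_mul hN.le, ← Real.rpow_mul hN.le, ← Real.rpow_add hN]
    congr 1
    ring
  · rw [← Real.rpow_mul hN.le, ← Real.rpow_add hN]
    congr 1
    field_simp
    ring

/-- The interpolation is used for 2 < p < 4 and the endpoints are taken directly. The interpolation
exponents add up to one, so a common factor of the two bounds, in particular the power of 2^n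
allotted to δ, survives unchanged. -/
theorem exists_lintegral_blockEvolution_rpow_le {α p δ : ℝ} (hα : α ≤ 2) (hp₂ : 2 ≤ p)
    (hp₄ : p ≤ 4) (hδ : 0 < δ) :
    ∃ C : ℝ, 0 < C ∧ ∀ (n : ℕ) (b : ℝ → ℂ), Continuous b → ∀ (B : ℝ), 0 < B → ∀ (S : Finset ℤ),
    (∀ k ∈ S, -2 ^ n ≤ k ∧ k < 2 ^ n) →
    (∀ k ∈ S, SymbolBound b (Set.Icc (k - 2 : ℝ) (k + 2)) B) →
    ∀ (g : 𝓢(ℝ, ℂ)) (μ : Measure SpaceTime) [SFinite μ],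
    ∫⁻ z in unitTimeSlab, ‖blockEvolution b S g z‖ₑ ^ p ∂μ ≤
      ENNReal.ofReal (C * (2 ^ n) ^ (p * criticalExponent α p + δ) * B ^ p) * ballConst α μ *
        ∫⁻ y, ‖g y‖ₑ ^ p := by
  set ε := min δ 1 with hε
  have hε0 : 0 < ε := lt_min hδ one_pos
  obtain ⟨C₂, hC₂, h₂⟩ := exists_lintegral_blockEvolution_sq_le
  obtain ⟨C₄, hC₄, h₄⟩ := exists_lintegral_blockEvolution_pow_four_le hε0 (min_le_right _ _)
  have hl : 0 < Real.log 2 := Real.log_pos (by norm_num)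
  set M := max (C₂ * (1 + 1 / (ε * Real.log 2))) C₄ with hM
  have hM0 : 0 < M := lt_max_of_lt_right hC₄
  have key : ∃ C : ℝ, 0 < C ∧ ∀ (n : ℕ) (b : ℝ → ℂ), Continuous b → ∀ (B : ℝ), 0 < B →
      ∀ (S : Finset ℤ), (∀ k ∈ S, -2 ^ n ≤ k ∧ k < 2 ^ n) →
      (∀ k ∈ S, SymbolBound b (Set.Icc (k - 2 : ℝ) (k + 2)) B) →
      ∀ (g : 𝓢(ℝ, ℂ)) (μ : Measure SpaceTime) [SFinite μ],
      ∫⁻ z in unitTimeSlab, ‖blockEvolution b S g z‖ₑ ^ p ∂μ ≤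
        ENNReal.ofReal (C * ((M * (2 ^ n) ^ ε * lossTwo α (2 ^ n) * B ^ 2) ^ ((4 - p) / 2) *
          (M * (2 ^ n) ^ ε * lossFour α (2 ^ n) * B ^ 4) ^ ((p - 2) / 2))) * ballConst α μ *
          ∫⁻ y, ‖g y‖ₑ ^ p := by
    have hL2 : ∀ (n : ℕ) (b : ℝ → ℂ), Continuous b → ∀ (B : ℝ), 0 < B → ∀ (S : Finset ℤ),
        (∀ k ∈ S, -2 ^ n ≤ k ∧ k < 2 ^ n) →
        (∀ k ∈ S, SymbolBound b (Set.Icc (k - 2 : ℝ) (k + 2)) B) →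
        ∀ (g : 𝓢(ℝ, ℂ)) (μ : Measure SpaceTime) [SFinite μ],
        ∫⁻ z in unitTimeSlab, ‖blockEvolution b S g z‖ₑ ^ 2 ∂μ ≤
          ENNReal.ofReal (M * (2 ^ n) ^ ε * lossTwo α (2 ^ n) * B ^ 2) * ballConst α μ *
          ∫⁻ y, ‖g y‖ₑ ^ 2 := by
      intro n b hb B hB S hS hbd g μ _
      refine (h₂ α hα n b hb B S hS hbd g μ).trans ?_
      refine mul_le_mul' (mul_le_mul' (ENNReal.ofReal_le_ofReal ?_) le_rfl) le_rfl
      have h0 : 0 ≤ lossTwo α (2 ^ n) := lossTwo_nonneg (by positivity)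
      refine mul_le_mul_of_nonneg_right (mul_le_mul_of_nonneg_right ?_ h0) (by positivity)
      calc C₂ * (n + 1) ≤ C₂ * ((1 + 1 / (ε * Real.log 2)) * (2 ^ n) ^ ε) :=
            mul_le_mul_of_nonneg_left (natCast_add_one_le_rpow hε0 n) hC₂.le
        _ = C₂ * (1 + 1 / (ε * Real.log 2)) * (2 ^ n) ^ ε := by ring
        _ ≤ _ := mul_le_mul_of_nonneg_right (le_max_left _ _) (by positivity)
    have hL4 : ∀ (n : ℕ) (b : ℝ → ℂ), Continuous b → ∀ (B : ℝ), 0 < B → ∀ (S : Finset ℤ),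
        (∀ k ∈ S, -2 ^ n ≤ k ∧ k < 2 ^ n) →
        (∀ k ∈ S, SymbolBound b (Set.Icc (k - 2 : ℝ) (k + 2)) B) →
        ∀ (g : 𝓢(ℝ, ℂ)) (μ : Measure SpaceTime) [SFinite μ],
        ∫⁻ z in unitTimeSlab, ‖blockEvolution b S g z‖ₑ ^ 4 ∂μ ≤
          ENNReal.ofReal (M * (2 ^ n) ^ ε * lossFour α (2 ^ n) * B ^ 4) * ballConst α μ *
          ∫⁻ y, ‖g y‖ₑ ^ 4 := by
      intro n b hb B hB S hS hbd g μ _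
      refine (h₄ α hα n b hb B S hS hbd g μ).trans ?_
      refine mul_le_mul' (mul_le_mul' (ENNReal.ofReal_le_ofReal ?_) le_rfl) le_rfl
      have h0 : 0 ≤ lossFour α (2 ^ n) := lossFour_nonneg (by positivity)
      refine mul_le_mul_of_nonneg_right (mul_le_mul_of_nonneg_right ?_ h0) (by positivity)
      exact mul_le_mul_of_nonneg_right (le_max_right _ _) (by positivity)
    rcases hp₂.eq_or_lt with rfl | hp₂'
    · refine ⟨1, one_pos, ?_⟩
      intro n b hb B hB S hS hbd g μ _
      have := hL2 n b hb B hB S hS hbd g μ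
      norm_num
      exact this
    rcases hp₄.eq_or_lt with rfl | hp₄'
    · refine ⟨1, one_pos, ?_⟩
      intro n b hb B hB S hS hbd g μ _
      have := hL4 n b hb B hB S hS hbd g μ
      norm_num
      exact_mod_cast this
    obtain ⟨C, hC, h⟩ := exists_lintegral_rpow_le_of_two_of_four hp₂' hp₄'
    refine ⟨C, hC, ?_⟩
    intro n b hb B hB S hS hbd g μ _
    have hl2 : 0 < lossTwo α (2 ^ n) := by unfold lossTwo; positivity
    have hl4 : 0 < lossFour α (2 ^ n) := by unfold lossFour; positivity
    exact h (μ.restrict unitTimeSlab) (blockEvolution b S) (measurable_blockEvolution hb S)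
      (blockEvolution_add hb S) _ _ (by positivity) (by positivity) (ballConst α μ)
      (fun g ↦ hL2 n b hb B hB S hS hbd g μ) (fun g ↦ hL4 n b hb B hB S hS hbd g μ) g
  obtain ⟨C, hC, h⟩ := key
  refine ⟨C * M, by positivity, ?_⟩
  intro n b hb B hB S hS hbd g μ _
  refine (h n b hb B hB S hS hbd g μ).trans ?_
  refine mul_le_mul' (mul_le_mul' (ENNReal.ofReal_le_ofReal ?_) le_rfl) le_rfl
  have hl2 : 0 < lossTwo α (2 ^ n) := by unfold lossTwo; positivity
  have hl4 : 0 < lossFour α (2 ^ n) := by unfold lossFour; positivity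
  have hN : (0 : ℝ) < 2 ^ n := by positivity
  have e : (M * (2 ^ n) ^ ε * lossTwo α (2 ^ n) * B ^ 2) ^ ((4 - p) / 2) *
      (M * (2 ^ n) ^ ε * lossFour α (2 ^ n) * B ^ 4) ^ ((p - 2) / 2) =
      M * (2 ^ n) ^ ε * (2 ^ n) ^ (p * criticalExponent α p) * B ^ p := by
    rw [← lossTwo_rpow_mul_lossFour_rpow (by linarith) hN]
    have hA : 0 < M * (2 ^ n) ^ ε := by positivity
    set A := M * (2 ^ n) ^ ε
    have e1 : A ^ ((4 - p) / 2) * A ^ ((p - 2) / 2) = A := by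
      rw [← Real.rpow_add hA]
      ring_nf
      exact Real.rpow_one _
    have e2 : (B ^ 2) ^ ((4 - p) / 2) * (B ^ 4) ^ ((p - 2) / 2) = B ^ p := by
      rw [← Real.rpow_natCast B 2, ← Real.rpow_natCast B 4, ← Real.rpow_mul hB.le,
        ← Real.rpow_mul hB.le, ← Real.rpow_add hB]
      congr 1
      push_cast
      ring
    rw [Real.mul_rpow (mul_pos hA hl2).le (by positivity), Real.mul_rpow hA.le hl2.le,
      Real.mul_rpow (mul_pos hA hl4).le (by positivity), Real.mul_rpow hA.le hl4.le, ← e2]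
    conv_rhs => rw [← e1]
    ring
  rw [e, ← mul_assoc, ← mul_assoc, Real.rpow_add hN]
  have h1 : ((2 : ℝ) ^ n) ^ ε ≤ (2 ^ n) ^ δ :=
    Real.rpow_le_rpow_of_exponent_le (one_le_pow₀ (by norm_num)) (min_le_left _ _)
  have h2 : 0 ≤ C * M * (2 ^ n) ^ (p * criticalExponent α p) * B ^ p := by positivity
  calc _ = C * M * (2 ^ n) ^ (p * criticalExponent α p) * B ^ p * (2 ^ n) ^ ε := by ring
    _ ≤ C * M * (2 ^ n) ^ (p * criticalExponent α p) * B ^ p * (2 ^ n) ^ δ := by gcongr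
    _ = _ := by ring

/-! ### Bessel potentials, the Sobolev norm and extension by density -/

theorem besselSymbol_pos (γ ξ : ℝ) : 0 < besselSymbol γ ξ :=
  Real.rpow_pos_of_pos (by positivity) _

theorem besselSymbol_mul_neg (γ ξ : ℝ) : besselSymbol γ ξ * besselSymbol (-γ) ξ = 1 := by
  rw [besselSymbol, besselSymbol, ← Real.rpow_add (by positivity)]
  ring_nf
  exact Real.rpow_zero _

theorem besselSymbol_neg_mul (γ ξ : ℝ) : besselSymbol (-γ) ξ * besselSymbol γ ξ = 1 := by
  rw [mul_comm, besselSymbol_mul_neg]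

/-- `(1 - ∂_x²)^{γ/2}` on Schwartz functions. -/
noncomputable def schwartzBessel (γ : ℝ) : 𝓢(ℝ, ℂ) →L[ℂ] 𝓢(ℝ, ℂ) :=
  SchwartzMap.fourierMultiplierCLM ℂ (fun ξ ↦ (besselSymbol γ ξ : ℂ))

theorem fourier_schwartzBessel (γ : ℝ) (φ : 𝓢(ℝ, ℂ)) (ξ : ℝ) :
    (𝓕 (schwartzBessel γ φ) : 𝓢(ℝ, ℂ)) ξ = besselSymbol γ ξ * (𝓕 φ : 𝓢(ℝ, ℂ)) ξ := by
  rw [schwartzBessel, SchwartzMap.fourierMultiplierCLM_apply,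
    FourierTransform.fourier_fourierInv_eq,
    SchwartzMap.smulLeftCLM_apply_apply (besselSymbol_hasTemperateGrowth γ), smul_eq_mul]

theorem schwartzBessel_neg_schwartzBessel (γ : ℝ) (φ : 𝓢(ℝ, ℂ)) :
    schwartzBessel (-γ) (schwartzBessel γ φ) = φ := by
  rw [schwartzBessel, schwartzBessel, SchwartzMap.fourierMultiplierCLM_fourierMultiplierCLM_apply
    (besselSymbol_hasTemperateGrowth _) (besselSymbol_hasTemperateGrowth _)]
  have : ((fun ξ ↦ (besselSymbol (-γ) ξ : ℂ)) * fun ξ ↦ (besselSymbol γ ξ : ℂ)) =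
      fun _ ↦ (1 : ℂ) := by
    ext ξ
    rw [Pi.mul_apply, ← Complex.ofReal_mul, besselSymbol_neg_mul, Complex.ofReal_one]
  rw [this]
  simp

theorem schwartzBessel_schwartzBessel_neg (γ : ℝ) (φ : 𝓢(ℝ, ℂ)) :
    schwartzBessel γ (schwartzBessel (-γ) φ) = φ := by
  simpa using schwartzBessel_neg_schwartzBessel (-γ) φ

theorem bessel_coe (γ : ℝ) (φ : 𝓢(ℝ, ℂ)) :
    bessel γ (φ : 𝓢'(ℝ, ℂ)) = (schwartzBessel γ φ : 𝓢'(ℝ, ℂ)) :=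
  fourierMultiplierCLM_toTemperedDistributionCLM_eq (besselSymbol_hasTemperateGrowth γ) φ

/-- L^p embeds injectively into the tempered distributions, so the infimum runs over a single
element. -/
theorem sobolevNorm_eq {p : ℝ≥0∞} [Fact (1 ≤ p)] {γ : ℝ} {f : 𝓢'(ℝ, ℂ)}
    {g : Lp ℂ p (volume : Measure ℝ)} (h : bessel γ f = (g : 𝓢'(ℝ, ℂ))) :
    sobolevNorm p γ f = ‖g‖ₑ := by
  refine le_antisymm (iInf₂_le g h) (le_iInf₂ fun g' hg' ↦ ?_)
  have h1 : Lp.toTemperedDistributionCLM ℂ (volume : Measure ℝ) p (g' - g) = 0 := by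
    rw [map_sub, Lp.toTemperedDistributionCLM_apply, Lp.toTemperedDistributionCLM_apply, ← h, ← hg',
      sub_self]
  have h2 : g' - g ∈ (Lp.toTemperedDistributionCLM ℂ (volume : Measure ℝ) p).ker := h1
  rw [Lp.ker_toTemperedDistributionCLM_eq_bot, Submodule.mem_bot, sub_eq_zero] at h2
  rw [h2]

theorem exists_bessel_eq {p : ℝ≥0∞} [Fact (1 ≤ p)] {γ : ℝ} {f : 𝓢'(ℝ, ℂ)}
    (h : sobolevNorm p γ f < ∞) :
    ∃ g : Lp ℂ p (volume : Measure ℝ), bessel γ f = (g : 𝓢'(ℝ, ℂ)) := by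
  by_contra hn
  push Not at hn
  refine h.ne (top_le_iff.1 (le_iInf₂ fun g hg ↦ absurd hg (hn g)))

theorem bessel_sub_coe {p : ℝ≥0∞} [Fact (1 ≤ p)] {γ : ℝ} {f : 𝓢'(ℝ, ℂ)}
    {g : Lp ℂ p (volume : Measure ℝ)} (h : bessel γ f = (g : 𝓢'(ℝ, ℂ))) (φ : 𝓢(ℝ, ℂ)) :
    bessel γ (f - (φ : 𝓢'(ℝ, ℂ))) = ((g - (schwartzBessel γ φ).toLp p volume : Lp ℂ p volume) :
      𝓢'(ℝ, ℂ)) := by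
  rw [map_sub, h, bessel_coe, ← Lp.toTemperedDistribution_toLp_eq (p := p)]
  exact (map_sub (Lp.toTemperedDistributionCLM ℂ (volume : Measure ℝ) p) _ _).symm

theorem enorm_toLp_schwartz (p : ℝ≥0∞) (φ : 𝓢(ℝ, ℂ)) :
    ‖(φ.toLp p volume : Lp ℂ p (volume : Measure ℝ))‖ₑ = eLpNorm φ p := by
  rw [Lp.enorm_def, eLpNorm_congr_ae (φ.coeFn_toLp p volume)]

theorem sobolevNorm_coe {p : ℝ≥0∞} [Fact (1 ≤ p)] (γ : ℝ) (φ : 𝓢(ℝ, ℂ)) :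
    sobolevNorm p γ (φ : 𝓢'(ℝ, ℂ)) = eLpNorm (schwartzBessel γ φ) p := by
  have h : bessel γ (φ : 𝓢'(ℝ, ℂ)) =
      (((schwartzBessel γ φ).toLp p volume : Lp ℂ p (volume : Measure ℝ)) : 𝓢'(ℝ, ℂ)) := by
    rw [bessel_coe, Lp.toTemperedDistribution_toLp_eq]
  rw [sobolevNorm_eq h, enorm_toLp_schwartz]

theorem continuous_freeEvolution (φ : 𝓢(ℝ, ℂ)) : Continuous (freeEvolution φ) := by
  have h := continuous_oscInt (𝓕 φ : 𝓢(ℝ, ℂ)).integrable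
  have : freeEvolution φ = fun z ↦ oscInt (𝓕 φ : 𝓢(ℝ, ℂ)) (z 0) (z 1) :=
    funext (freeEvolution_eq_oscInt φ)
  rw [this]
  fun_prop

theorem freeEvolution_sub (φ ψ : 𝓢(ℝ, ℂ)) :
    freeEvolution (φ - ψ) = freeEvolution φ - freeEvolution ψ := by
  have h : ∀ z, freeEvolution φ z = freeEvolution (φ - ψ) z + freeEvolution ψ z := by
    intro z
    rw [freeEvolution_eq_oscInt, freeEvolution_eq_oscInt, freeEvolution_eq_oscInt,
      ← oscInt_add (𝓕 (φ - ψ) : 𝓢(ℝ, ℂ)).integrable (𝓕 ψ : 𝓢(ℝ, ℂ)).integrable]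
    congr 1
    ext ξ
    rw [Pi.add_apply, ← add_apply, ← FourierTransform.fourier_add, sub_add_cancel]
  ext z
  rw [Pi.sub_apply, h z, add_sub_cancel_right]

theorem exists_tendsto_sobolevNorm {p : ℝ≥0∞} [Fact (1 ≤ p)] (hp : p ≠ ∞) {γ : ℝ} {f : 𝓢'(ℝ, ℂ)}
    (hf : sobolevNorm p γ f < ∞) : ∃ φ : ℕ → 𝓢(ℝ, ℂ),
    Tendsto (fun n ↦ sobolevNorm p γ (f - (φ n : 𝓢'(ℝ, ℂ)))) atTop (𝓝 0) := by
  obtain ⟨g, hg⟩ := exists_bessel_eq hf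
  have hd := SchwartzMap.denseRange_toLpCLM (E := ℝ) (F := ℂ) (μ := volume) hp
  obtain ⟨x, hx, hlim⟩ := mem_closure_iff_seq_limit.1 (hd g)
  choose G hG using hx
  refine ⟨fun n ↦ schwartzBessel (-γ) (G n), ?_⟩
  have e : ∀ n, sobolevNorm p γ (f - (schwartzBessel (-γ) (G n) : 𝓢'(ℝ, ℂ))) =
      ‖g - x n‖ₑ := by
    intro n
    rw [sobolevNorm_eq (bessel_sub_coe hg _), schwartzBessel_schwartzBessel_neg, ← hG n,
      SchwartzMap.toLpCLM_apply]
  simp_rw [e]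
  have h1 : Tendsto (fun n ↦ g - x n) atTop (𝓝 (g - g)) := tendsto_const_nhds.sub hlim
  rw [sub_self] at h1
  simpa using h1.enorm

theorem sobolevNorm_coe_le {p : ℝ≥0∞} [Fact (1 ≤ p)] {γ : ℝ} {f : 𝓢'(ℝ, ℂ)}
    (hf : sobolevNorm p γ f < ∞) (φ : 𝓢(ℝ, ℂ)) :
    eLpNorm (schwartzBessel γ φ) p ≤
      sobolevNorm p γ f + sobolevNorm p γ (f - (φ : 𝓢'(ℝ, ℂ))) := by
  obtain ⟨g, hg⟩ := exists_bessel_eq hf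
  rw [sobolevNorm_eq hg, sobolevNorm_eq (bessel_sub_coe hg _), ← enorm_toLp_schwartz]
  calc _ = ‖g - (g - ((schwartzBessel γ φ).toLp p volume : Lp ℂ p volume))‖ₑ := by
        rw [sub_sub_cancel]
    _ ≤ _ := enorm_sub_le

theorem eLpNorm_schwartzBessel_sub_le {p : ℝ≥0∞} [Fact (1 ≤ p)] {γ : ℝ} {f : 𝓢'(ℝ, ℂ)}
    (hf : sobolevNorm p γ f < ∞) (φ ψ : 𝓢(ℝ, ℂ)) :
    eLpNorm (schwartzBessel γ (φ - ψ)) p ≤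
      sobolevNorm p γ (f - (φ : 𝓢'(ℝ, ℂ))) + sobolevNorm p γ (f - (ψ : 𝓢'(ℝ, ℂ))) := by
  obtain ⟨g, hg⟩ := exists_bessel_eq hf
  rw [sobolevNorm_eq (bessel_sub_coe hg φ), sobolevNorm_eq (bessel_sub_coe hg ψ),
    ← enorm_toLp_schwartz]
  have e : ((schwartzBessel γ (φ - ψ)).toLp p volume : Lp ℂ p (volume : Measure ℝ)) =
      (g - (schwartzBessel γ ψ).toLp p volume) - (g - (schwartzBessel γ φ).toLp p volume) := by
    rw [sub_sub_sub_cancel_left, map_sub]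
    exact map_sub (SchwartzMap.toLpCLM ℝ ℂ p (volume : Measure ℝ)) _ _
  rw [e, add_comm]
  exact enorm_sub_le

theorem exists_memLp_tendsto_eLpNorm_sub {X : Type*} [MeasurableSpace X] {ν : Measure X} {p : ℝ≥0∞}
    [Fact (1 ≤ p)] {F : ℕ → X → ℂ} (hF : ∀ n, MemLp (F n) p ν) {a : ℕ → ℝ≥0∞}
    (ha : Tendsto a atTop (𝓝 0)) (h : ∀ m n, eLpNorm (F m - F n) p ν ≤ a m + a n) :
    ∃ u : X → ℂ, MemLp u p ν ∧ Tendsto (fun n ↦ eLpNorm (u - F n) p ν) atTop (𝓝 0) := by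
  obtain ⟨U, hU⟩ : ∃ U : Lp ℂ p ν, Tendsto (fun n ↦ (hF n).toLp) atTop (𝓝 U) := by
    refine cauchySeq_tendsto_of_complete (EMetric.cauchySeq_iff.2 fun ε hε ↦ ?_)
    obtain ⟨N, hN⟩ := eventually_atTop.1 (ha.eventually_lt_const (ENNReal.half_pos hε.ne'))
    refine ⟨N, fun m hm n hn ↦ ?_⟩
    rw [Lp.edist_toLp_toLp]
    refine (h m n).trans_lt ?_
    rw [← ENNReal.add_halves ε]
    exact ENNReal.add_lt_add (hN m hm) (hN n hn)
  refine ⟨U, Lp.memLp U, ?_⟩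
  have h1 : Tendsto (fun n ↦ U - (hF n).toLp) atTop (𝓝 (U - U)) := tendsto_const_nhds.sub hU
  rw [sub_self] at h1
  have h2 := h1.enorm
  rw [enorm_zero] at h2
  refine h2.congr fun n ↦ ?_
  rw [Lp.enorm_def]
  refine eLpNorm_congr_ae ?_
  filter_upwards [Lp.coeFn_sub U (hF n).toLp, (hF n).coeFn_toLp] with z h3 h4
  rw [h3, Pi.sub_apply, Pi.sub_apply, h4]

/-- An estimate for the free evolution of Schwartz functions extends to `L^p_γ` by density. -/
theorem exists_isFreeEvolution {p : ℝ≥0∞} [Fact (1 ≤ p)] (hp : p ≠ ∞) {γ : ℝ}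
    {ν : Measure SpaceTime} {A : ℝ≥0∞} (hA : A ≠ ∞)
    (h : ∀ φ : 𝓢(ℝ, ℂ), eLpNorm (freeEvolution φ) p ν ≤ A * eLpNorm (schwartzBessel γ φ) p)
    {f : 𝓢'(ℝ, ℂ)} (hf : sobolevNorm p γ f < ∞) :
    ∃ u : SpaceTime → ℂ, IsFreeEvolution p γ ν f u ∧ eLpNorm u p ν ≤ A * sobolevNorm p γ f := by
  have hp1 : 1 ≤ p := Fact.out
  have hdiff : ∀ φ ψ : 𝓢(ℝ, ℂ), eLpNorm (freeEvolution φ - freeEvolution ψ) p ν ≤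
      A * (sobolevNorm p γ (f - (φ : 𝓢'(ℝ, ℂ))) + sobolevNorm p γ (f - (ψ : 𝓢'(ℝ, ℂ)))) := by
    intro φ ψ
    rw [← freeEvolution_sub]
    exact (h _).trans (mul_le_mul' le_rfl (eLpNorm_schwartzBessel_sub_le hf φ ψ))
  have hT : ∀ φ : 𝓢(ℝ, ℂ), MemLp (freeEvolution φ) p ν := by
    intro φ
    refine ⟨(continuous_freeEvolution φ).aestronglyMeasurable, (h φ).trans_lt ?_⟩
    have h1 : MemLp (schwartzBessel γ φ) p volume := (schwartzBessel γ φ).memLp p volume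
    exact ENNReal.mul_lt_top hA.lt_top h1.2
  obtain ⟨φ, hφ⟩ := exists_tendsto_sobolevNorm hp hf
  obtain ⟨U, hUm', hUlim⟩ := exists_memLp_tendsto_eLpNorm_sub (fun n ↦ hT (φ n))
    (a := fun n ↦ A * sobolevNorm p γ (f - (φ n : 𝓢'(ℝ, ℂ))))
    (by simpa using ENNReal.Tendsto.const_mul hφ (Or.inr hA))
    (fun m n ↦ (hdiff _ _).trans_eq (mul_add _ _ _))
  have hUm := hUm'.1
  -- Independence of the approximating sequence: evolutions of two approximations of `f` differ, by
  -- linearity and the a priori bound, by at most A times the sum of their errors.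
  have htend : ∀ ψ : ℕ → 𝓢(ℝ, ℂ),
      Tendsto (fun n ↦ sobolevNorm p γ (f - (ψ n : 𝓢'(ℝ, ℂ)))) atTop (𝓝 0) →
      Tendsto (fun n ↦ eLpNorm (U - freeEvolution (ψ n)) p ν) atTop (𝓝 0) := by
    intro ψ hψ
    have h1 : Tendsto (fun n ↦ eLpNorm (U - freeEvolution (φ n)) p ν +
        A * (sobolevNorm p γ (f - (φ n : 𝓢'(ℝ, ℂ))) + sobolevNorm p γ (f - (ψ n : 𝓢'(ℝ, ℂ)))))
        atTop (𝓝 0) := by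
      simpa using hUlim.add (ENNReal.Tendsto.const_mul (hφ.add hψ) (Or.inr hA))
    refine tendsto_of_tendsto_of_tendsto_of_le_of_le tendsto_const_nhds h1 (fun _ ↦ zero_le)
      fun n ↦ ?_
    have e : (U - freeEvolution (ψ n) : SpaceTime → ℂ) = (U - freeEvolution (φ n)) +
        (freeEvolution (φ n) - freeEvolution (ψ n)) := by abel
    change eLpNorm (U - freeEvolution (ψ n)) p ν ≤ _
    rw [e]
    exact (eLpNorm_add_le (hUm.sub (hT _).1) ((hT _).1.sub (hT _).1) hp1).trans
      (add_le_add le_rfl (hdiff _ _))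
  refine ⟨U, ⟨hUm', ⟨φ, hφ⟩, htend⟩, ?_⟩
  have h1 : Tendsto (fun n ↦ eLpNorm (U - freeEvolution (φ n)) p ν +
      A * (sobolevNorm p γ f + sobolevNorm p γ (f - (φ n : 𝓢'(ℝ, ℂ))))) atTop
      (𝓝 (A * sobolevNorm p γ f)) := by
    simpa using hUlim.add (ENNReal.Tendsto.const_mul (tendsto_const_nhds.add hφ) (Or.inr hA))
  refine ge_of_tendsto' h1 fun n ↦ ?_
  have e : (U : SpaceTime → ℂ) = (U - freeEvolution (φ n)) + freeEvolution (φ n) := by abel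
  conv_lhs => rw [e]
  refine (eLpNorm_add_le (hUm.sub (hT _).1) (hT _).1 hp1).trans (add_le_add le_rfl ?_)
  exact (h _).trans (mul_le_mul' le_rfl (sobolevNorm_coe_le hf _))

/-! ### Dyadic summation and the sufficient condition -/

theorem rpow_le_of_comparable {u r A : ℝ} (s : ℝ) (hr : 0 < r) (hA : 1 ≤ A)
    (h₁ : r / A ≤ u) (h₂ : u ≤ A * r) : u ^ s ≤ A ^ |s| * r ^ s := by
  have hA0 : 0 < A := by linarith
  have hu : 0 < u := lt_of_lt_of_le (by positivity) h₁
  rcases le_total 0 s with hs | hs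
  · rw [abs_of_nonneg hs, ← Real.mul_rpow hA0.le hr.le]
    exact Real.rpow_le_rpow hu.le h₂ hs
  · rw [abs_of_nonpos hs, Real.rpow_neg hA0.le, ← div_eq_inv_mul, ← Real.div_rpow hr.le hA0.le]
    exact Real.rpow_le_rpow_of_nonpos (by positivity) h₁ hs

/-- With u = 1 + (2πξ)² the symbol is a power of u, and |u'| ≤ 2πu because 2|y| ≤ 1 + y².
Derivatives are thus dominated by the symbol itself. -/
theorem symbolBound_besselSymbol (γ : ℝ) {s : Set ℝ} {B : ℝ} (hB : ∀ ξ ∈ s, besselSymbol γ ξ ≤ B) :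
    SymbolBound (fun ξ ↦ (besselSymbol γ ξ : ℂ)) s
      ((1 + 80 * |γ / 2| + 40 * (|γ / 2| * |γ / 2 - 1|)) * B) := by
  set σ := γ / 2 with hσ
  set u : ℝ → ℝ := fun ξ ↦ 1 + (2 * Real.pi * ξ) ^ 2 with hu
  have hu0 : ∀ ξ, 0 < u ξ := fun ξ ↦ by positivity
  have hm : ∀ ξ, besselSymbol γ ξ = u ξ ^ σ := fun ξ ↦ by
    rw [besselSymbol, Real.norm_eq_abs, sq_abs]
  have hdu : ∀ ξ, HasDerivAt u (8 * Real.pi ^ 2 * ξ) ξ := fun ξ ↦ by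
    have h := (((hasDerivAt_id ξ).const_mul (2 * Real.pi)).pow 2).const_add 1
    refine h.congr_deriv ?_
    simp
    ring
  have hd1 : ∀ ξ, HasDerivAt (fun ξ ↦ (besselSymbol γ ξ : ℂ))
      ((8 * Real.pi ^ 2 * ξ * σ * u ξ ^ (σ - 1) : ℝ) : ℂ) ξ := fun ξ ↦ by
    have h := (hdu ξ).rpow_const (p := σ) (Or.inl (hu0 ξ).ne')
    simp_rw [hm]
    exact h.ofReal_comp
  have hd2 : ∀ ξ, HasDerivAt (fun ξ ↦ ((8 * Real.pi ^ 2 * ξ * σ * u ξ ^ (σ - 1) : ℝ) : ℂ))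
      ((8 * Real.pi ^ 2 * σ * u ξ ^ (σ - 1) + 8 * Real.pi ^ 2 * ξ * σ *
        (8 * Real.pi ^ 2 * ξ * (σ - 1) * u ξ ^ (σ - 1 - 1)) : ℝ) : ℂ) ξ := fun ξ ↦ by
    have h := (hdu ξ).rpow_const (p := σ - 1) (Or.inl (hu0 ξ).ne')
    have h2 := (((hasDerivAt_id ξ).const_mul (8 * Real.pi ^ 2)).mul_const σ).mul h
    refine (h2.ofReal_comp).congr_deriv ?_
    simp
  have hpi : Real.pi ≤ 3.15 := Real.pi_lt_d2.le
  have hpi0 := Real.pi_pos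
  have hpi2 : 8 * Real.pi ^ 2 ≤ 80 := by nlinarith
  have hξ : ∀ ξ, |8 * Real.pi ^ 2 * ξ| ≤ 2 * Real.pi * u ξ := fun ξ ↦ by
    rw [abs_le]
    constructor
    · nlinarith [sq_nonneg (2 * Real.pi * ξ + 1)]
    · nlinarith [sq_nonneg (2 * Real.pi * ξ - 1)]
  have h1u : ∀ ξ, 1 ≤ u ξ := fun ξ ↦ by
    simp only [hu]
    nlinarith [sq_nonneg (2 * Real.pi * ξ)]
  have e1 : ∀ ξ, u ξ ^ (σ - 1) = u ξ ^ σ / u ξ := fun ξ ↦ Real.rpow_sub_one (hu0 ξ).ne' _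
  have e2 : ∀ ξ, u ξ ^ (σ - 1 - 1) = u ξ ^ σ / u ξ / u ξ := fun ξ ↦ by
    rw [Real.rpow_sub_one (hu0 ξ).ne', e1]
  have hc : Continuous fun ξ ↦ ((8 * Real.pi ^ 2 * σ * u ξ ^ (σ - 1) + 8 * Real.pi ^ 2 * ξ * σ *
        (8 * Real.pi ^ 2 * ξ * (σ - 1) * u ξ ^ (σ - 1 - 1)) : ℝ) : ℂ) := by
    have h1 : ∀ q : ℝ, Continuous fun ξ ↦ u ξ ^ q := fun q ↦
      Continuous.rpow_const (by fun_prop) fun ξ ↦ Or.inl (hu0 ξ).ne'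
    have h2 := h1 (σ - 1)
    have h3 := h1 (σ - 1 - 1)
    fun_prop
  have hK : ∀ ξ ∈ s, ∀ c, c ≤ 1 + 80 * |σ| + 40 * (|σ| * |σ - 1|) →
      c * u ξ ^ σ ≤ (1 + 80 * |σ| + 40 * (|σ| * |σ - 1|)) * B := by
    intro ξ hξs c hcle
    refine mul_le_mul hcle ((hm ξ).symm.trans_le (hB ξ hξs)) (Real.rpow_nonneg (hu0 ξ).le _)
      (by positivity)
  have hσ0 := abs_nonneg σ
  have hσ1 := mul_nonneg hσ0 (abs_nonneg (σ - 1))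
  have hb1 : ∀ ξ, |8 * Real.pi ^ 2 * ξ * σ * u ξ ^ (σ - 1)| ≤ 7 * |σ| * u ξ ^ σ := fun ξ ↦ by
    rw [e1, abs_mul, abs_mul, abs_of_nonneg (div_nonneg (Real.rpow_nonneg (hu0 ξ).le _) (hu0 ξ).le)]
    have hnn := Real.rpow_nonneg (hu0 ξ).le σ
    calc _ ≤ 2 * Real.pi * u ξ * |σ| * (u ξ ^ σ / u ξ) := by
          refine mul_le_mul_of_nonneg_right (mul_le_mul_of_nonneg_right (hξ ξ) hσ0)
            (div_nonneg hnn (hu0 ξ).le)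
      _ = 2 * Real.pi * |σ| * u ξ ^ σ := by
          have := (hu0 ξ).ne'
          field_simp
      _ ≤ _ := by
          refine mul_le_mul_of_nonneg_right (mul_le_mul_of_nonneg_right ?_ hσ0) hnn
          linarith
  have hb2 : ∀ ξ, |8 * Real.pi ^ 2 * σ * u ξ ^ (σ - 1) + 8 * Real.pi ^ 2 * ξ * σ *
        (8 * Real.pi ^ 2 * ξ * (σ - 1) * u ξ ^ (σ - 1 - 1))| ≤
        (80 * |σ| + 40 * (|σ| * |σ - 1|)) * u ξ ^ σ := fun ξ ↦ by
    have hnn := Real.rpow_nonneg (hu0 ξ).le σ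
    have hne := (hu0 ξ).ne'
    refine (abs_add_le _ _).trans ?_
    rw [add_mul]
    refine add_le_add ?_ ?_
    · rw [abs_mul, abs_mul, abs_of_nonneg (by positivity : 0 ≤ 8 * Real.pi ^ 2), e1,
        abs_of_nonneg (div_nonneg hnn (hu0 ξ).le)]
      exact mul_le_mul (mul_le_mul_of_nonneg_right hpi2 hσ0) (div_le_self hnn (h1u ξ))
        (div_nonneg hnn (hu0 ξ).le) (by positivity)
    · rw [e2]
      have e : 8 * Real.pi ^ 2 * ξ * σ * (8 * Real.pi ^ 2 * ξ * (σ - 1) * (u ξ ^ σ / u ξ / u ξ)) =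
          (8 * Real.pi ^ 2 * ξ / u ξ) ^ 2 * (σ * (σ - 1)) * u ξ ^ σ := by
        field_simp
      rw [e, abs_mul, abs_mul, abs_mul σ, abs_of_nonneg hnn, abs_pow]
      refine mul_le_mul_of_nonneg_right (mul_le_mul_of_nonneg_right ?_ hσ1) hnn
      have h3 : |8 * Real.pi ^ 2 * ξ / u ξ| ≤ 2 * Real.pi := by
        rw [abs_div, abs_of_pos (hu0 ξ), div_le_iff₀ (hu0 ξ)]
        exact hξ ξ
      calc _ ≤ (2 * Real.pi) ^ 2 := pow_le_pow_left₀ (abs_nonneg _) h3 2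
        _ ≤ 40 := by nlinarith
  refine SymbolBound.of_hasDerivAt hd1 hd2 hc (fun ξ h ↦ ?_) (fun ξ h ↦ ?_) (fun ξ h ↦ ?_)
  · rw [Complex.norm_real, Real.norm_of_nonneg (besselSymbol_pos γ ξ).le, hm, ← one_mul (u ξ ^ σ)]
    exact hK ξ h 1 (by linarith)
  · rw [Complex.norm_real]
    exact (hb1 ξ).trans (hK ξ h _ (by linarith))
  · rw [Complex.norm_real]
    exact (hb2 ξ).trans (hK ξ h _ (by linarith))

/-- Near a point of the shell, 1 + (2πξ)² is comparable to N² within a factor 400. For N ≤ 20 the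
lower bound N²/400 ≤ 1 is trivial; for larger N, removing 2 from |k| ≥ N/2 still leaves N/20. The
upper bound needs 1 + 40 · 9. -/
theorem besselSymbol_le (γ : ℝ) {n : ℕ} {k : ℤ} (hk : |(k : ℝ)| ≤ 2 ^ n)
    (hk' : n = 0 ∨ (2 : ℝ) ^ n ≤ 2 * |(k : ℝ)|) {ξ : ℝ} (hξ : ξ ∈ Set.Icc (k - 2 : ℝ) (k + 2)) :
    besselSymbol γ ξ ≤ 400 ^ |γ / 2| * (2 ^ n) ^ γ := by
  have hN1 : (1 : ℝ) ≤ 2 ^ n := one_le_pow₀ (by norm_num)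
  set N : ℝ := 2 ^ n with hN
  have hpi : Real.pi ≤ 3.15 := Real.pi_lt_d2.le
  have hpi3 : 3 < Real.pi := Real.pi_gt_three
  have hxk : |ξ - k| ≤ 2 := abs_le.2 ⟨by linarith [hξ.1], by linarith [hξ.2]⟩
  have h1 : |ξ| ≤ 3 * N := by
    have := abs_add_le (ξ - k) k
    rw [sub_add_cancel] at this
    linarith
  have h2 : N / 20 ≤ 1 ∨ N / 20 ≤ |ξ| := by
    rcases hk' with h | h
    · left
      rw [hN, h]
      norm_num
    · rcases le_total N 20 with h3 | h3
      · left
        linarith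
      · right
        have := abs_sub_abs_le_abs_sub (k : ℝ) ξ
        rw [abs_sub_comm] at this
        linarith
  have e : ((2 : ℝ) ^ n) ^ γ = (N ^ 2) ^ (γ / 2) := by
    rw [← Real.rpow_natCast N 2, ← Real.rpow_mul (by positivity)]
    congr 1
    push_cast
    ring
  rw [besselSymbol, e, Real.norm_eq_abs, sq_abs]
  refine rpow_le_of_comparable _ (by positivity) (by norm_num) ?_ ?_
  · rcases h2 with h2 | h2
    · nlinarith [sq_nonneg (2 * Real.pi * ξ)]
    · have h4 : (N / 20) ^ 2 ≤ ξ ^ 2 := by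
        rw [← sq_abs ξ]
        exact pow_le_pow_left₀ (by positivity) h2 2
      have h5 : ξ ^ 2 ≤ (2 * Real.pi * ξ) ^ 2 := by
        rw [mul_pow]
        exact le_mul_of_one_le_left (sq_nonneg _) (by nlinarith)
      nlinarith
  · have h4 : ξ ^ 2 ≤ (3 * N) ^ 2 := by
      rw [← sq_abs ξ]
      exact pow_le_pow_left₀ (abs_nonneg _) h1 2
    have h5 : (2 * Real.pi) ^ 2 ≤ 40 := by nlinarith
    have h6 : (2 * Real.pi * ξ) ^ 2 ≤ 40 * (3 * N) ^ 2 := by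
      rw [mul_pow]
      exact mul_le_mul h5 h4 (sq_nonneg _) (by norm_num)
    nlinarith

/-- The integers of absolute value comparable to `2 ^ n`. -/
noncomputable def dyadicShell : ℕ → Finset ℤ
  | 0 => Finset.Ico (-1) 1
  | n + 1 => Finset.Ico (-2 ^ (n + 1)) (2 ^ (n + 1)) \ Finset.Ico (-2 ^ n) (2 ^ n)

theorem bounds_of_mem_dyadicShell {n : ℕ} {k : ℤ} (hk : k ∈ dyadicShell n) :
    (-2 ^ n ≤ k ∧ k < 2 ^ n) ∧ (n = 0 ∨ (2 : ℝ) ^ n ≤ 2 * |(k : ℝ)|) := by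
  cases n with
  | zero =>
    rw [dyadicShell, Finset.mem_Ico] at hk
    exact ⟨by simpa using hk, Or.inl rfl⟩
  | succ n =>
    rw [dyadicShell, Finset.mem_sdiff, Finset.mem_Ico, Finset.mem_Ico] at hk
    refine ⟨hk.1, Or.inr ?_⟩
    have h : (2 : ℤ) ^ n ≤ |k| := by
      rw [le_abs]
      by_contra hn
      push Not at hn
      exact hk.2 ⟨by linarith, hn.1⟩
    have h' : (2 : ℝ) ^ n ≤ |(k : ℝ)| := by exact_mod_cast h
    rw [pow_succ]
    linarith

theorem sum_blockEvolution_dyadicShell {b : ℝ → ℂ} (hb : Continuous b) (g : 𝓢(ℝ, ℂ))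
    (z : SpaceTime) (n : ℕ) :
    ∑ m ∈ Finset.range (n + 1), blockEvolution b (dyadicShell m) g z =
      blockEvolution b (Finset.Ico (-2 ^ n) (2 ^ n)) g z := by
  induction n with
  | zero => simp [dyadicShell]
  | succ n ih =>
    rw [Finset.sum_range_succ, ih, blockEvolution_eq_sum hb, blockEvolution_eq_sum hb,
      blockEvolution_eq_sum hb, dyadicShell, add_comm, Finset.sum_sdiff]
    refine Finset.Ico_subset_Ico ?_ ?_ <;> rw [pow_succ] <;>
      linarith [pow_pos (two_pos (α := ℤ)) n]

theorem sum_latticeBump_Ico (ξ : ℝ) (n : ℕ) :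
    ∑ k ∈ Finset.Ico (-n : ℤ) n, latticeBump (ξ - k) =
      Real.smoothTransition (ξ + n + 1) - Real.smoothTransition (ξ - n + 1) := by
  have h := sum_latticeBump ξ (-n) (2 * n)
  have e : ∑ k ∈ Finset.Ico (-n : ℤ) n, latticeBump (ξ - k) =
      ∑ j ∈ Finset.range (2 * n), latticeBump (ξ - (-n + j : ℤ)) := by
    refine Finset.sum_nbij' (fun k ↦ (k + n).toNat) (fun j ↦ -n + j) ?_ ?_ ?_ ?_ ?_
    · intro k hk
      rw [Finset.mem_Ico] at hk
      rw [Finset.mem_range]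
      omega
    · intro j hj
      rw [Finset.mem_range] at hj
      rw [Finset.mem_Ico]
      omega
    · intro k hk
      rw [Finset.mem_Ico] at hk
      omega
    · intro j hj
      omega
    · intro k hk
      rw [Finset.mem_Ico] at hk
      congr 3
      omega
  rw [e, h]
  push_cast
  ring_nf

/-- The partial sums of the partition of unity telescope to cut-offs between 0 and 1, each frequency
eventually having value 1; dominated convergence applies. -/
theorem tendsto_blockEvolution_Ico (γ : ℝ) (g : 𝓢(ℝ, ℂ)) (z : SpaceTime) :
    Tendsto (fun n : ℕ ↦ blockEvolution (fun ξ ↦ (besselSymbol γ ξ : ℂ))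
      (Finset.Ico (-2 ^ n) (2 ^ n)) g z) atTop (𝓝 (freeEvolution (schwartzBessel γ g) z)) := by
  rw [freeEvolution_eq_oscInt]
  set G : 𝓢(ℝ, ℂ) := 𝓕 (schwartzBessel γ g) with hG
  have hsum : ∀ (n : ℕ) ξ, sumProfile (Finset.Ico (-2 ^ n) (2 ^ n))
      (pieceProfile (fun ξ ↦ (besselSymbol γ ξ : ℂ)) g) ξ =
      ((Real.smoothTransition (ξ + (2 ^ n : ℕ) + 1) -
        Real.smoothTransition (ξ - (2 ^ n : ℕ) + 1) : ℝ) : ℂ) * G ξ := by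
    intro n ξ
    rw [← sum_latticeBump_Ico, hG, fourier_schwartzBessel, sumProfile, Complex.ofReal_sum,
      Finset.sum_mul]
    push_cast
    refine Finset.sum_congr rfl fun k _ ↦ ?_
    rw [pieceProfile, fourier_latticePiece]
    ring
  unfold blockEvolution oscInt
  refine tendsto_integral_of_dominated_convergence (fun ξ ↦ ‖G ξ‖) ?_ G.integrable.norm ?_ ?_
  · intro n
    simp_rw [hsum n]
    refine Continuous.aestronglyMeasurable ?_
    have h1 := continuous_unitExp
    have h2 : Continuous Real.smoothTransition := Real.smoothTransition.continuous
    have h3 := G.continuous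
    fun_prop
  · intro n
    refine ae_of_all _ fun ξ ↦ ?_
    rw [norm_mul, norm_unitExp, one_mul, hsum, norm_mul, Complex.norm_real]
    refine mul_le_of_le_one_left (norm_nonneg _) ?_
    rw [Real.norm_eq_abs, abs_le]
    have h1 := Real.smoothTransition.nonneg (ξ + (2 ^ n : ℕ) + 1)
    have h2 := Real.smoothTransition.le_one (ξ + (2 ^ n : ℕ) + 1)
    have h3 := Real.smoothTransition.nonneg (ξ - (2 ^ n : ℕ) + 1)
    have h4 := Real.smoothTransition.le_one (ξ - (2 ^ n : ℕ) + 1)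
    constructor <;> linarith
  · refine ae_of_all _ fun ξ ↦ ?_
    refine tendsto_const_nhds.congr' ?_
    have h1 : Tendsto (fun n : ℕ ↦ (2 : ℝ) ^ n) atTop atTop :=
      tendsto_pow_atTop_atTop_of_one_lt (by norm_num)
    filter_upwards [h1.eventually_ge_atTop (|ξ| + 1)] with n hn
    have h2 := neg_abs_le ξ
    have h3 := le_abs_self ξ
    rw [hsum, Real.smoothTransition.one_of_one_le (by push_cast; linarith),
      Real.smoothTransition.zero_of_nonpos (by push_cast; linarith)]
    simp

theorem exists_eLpNorm_blockEvolution_dyadicShell_le {α γ : ℝ} {p : ℝ≥0∞} (hα : α ≤ 2)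
    (hp₂ : 2 ≤ p) (hp₄ : p ≤ 4) (hγ : criticalExponent α p.toReal < γ) :
    ∃ C r : ℝ, 0 < C ∧ 0 < r ∧ r < 1 ∧ ∀ (μ : Measure SpaceTime) [SFinite μ] (g : 𝓢(ℝ, ℂ)) (n : ℕ),
    eLpNorm (blockEvolution (fun ξ ↦ (besselSymbol (-γ) ξ : ℂ)) (dyadicShell n) g) p
      (μ.restrict unitTimeSlab) ≤
      ENNReal.ofReal (C * r ^ n) * (ballConst α μ ^ (1 / p.toReal) * eLpNorm g p) := by
  have hptop : p ≠ ∞ := ne_top_of_le_ne_top (by norm_num) hp₄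
  have hp0 : p ≠ 0 := (lt_of_lt_of_le (by norm_num) hp₂).ne'
  set q := p.toReal with hq
  have hq2 : 2 ≤ q := by
    have := ENNReal.toReal_mono hptop hp₂
    simpa using this
  have hq4 : q ≤ 4 := by
    have := ENNReal.toReal_mono (by norm_num) hp₄
    simpa using this
  have hq0 : 0 < q := by linarith
  -- Half of the gap in γ is spent on the loss δ = qσ of the block estimate; the other half leaves
  -- the ratio r = 2^{-σ}.
  set σ := (γ - criticalExponent α q) / 2 with hσ
  have hσ0 : 0 < σ := by rw [hσ]; linarith
  obtain ⟨C, hC, h⟩ := exists_lintegral_blockEvolution_rpow_le hα hq2 hq4 (mul_pos hq0 hσ0)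
  set D : ℝ := (1 + 80 * |-γ / 2| + 40 * (|-γ / 2| * |-γ / 2 - 1|)) * 400 ^ |-γ / 2| with hD
  have hD0 : 0 < D := by positivity
  refine ⟨C ^ (1 / q) * D, 2 ^ (-σ), by positivity, by positivity,
    Real.rpow_lt_one_of_one_lt_of_neg (by norm_num) (by linarith), ?_⟩
  intro μ _ g n
  have hb : Continuous fun ξ ↦ (besselSymbol (-γ) ξ : ℂ) :=
    (besselSymbol_hasTemperateGrowth (-γ)).1.continuous
  have hN : (0 : ℝ) < 2 ^ n := by positivity
  have h1 := h n _ hb (D * (2 ^ n) ^ (-γ)) (by positivity) (dyadicShell n)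
    (fun k hk ↦ (bounds_of_mem_dyadicShell hk).1) (fun k hk ↦ by
      obtain ⟨⟨h2, h3⟩, h4⟩ := bounds_of_mem_dyadicShell hk
      have h5 : |(k : ℝ)| ≤ 2 ^ n := abs_le.2 ⟨by exact_mod_cast h2, by exact_mod_cast h3.le⟩
      rw [hD, mul_assoc]
      exact symbolBound_besselSymbol (-γ) fun ξ hξ ↦ besselSymbol_le (-γ) h5 h4 hξ) g μ
  rw [eLpNorm_eq_lintegral_rpow_enorm_toReal hp0 hptop,
    eLpNorm_eq_lintegral_rpow_enorm_toReal hp0 hptop]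
  refine (ENNReal.rpow_le_rpow h1 (by positivity)).trans_eq ?_
  rw [ENNReal.mul_rpow_of_nonneg _ _ (by positivity), ENNReal.mul_rpow_of_nonneg _ _ (by positivity),
    ENNReal.ofReal_rpow_of_nonneg (by positivity) (by positivity), mul_assoc]
  congr 2
  have e : C * ((2 : ℝ) ^ n) ^ (q * criticalExponent α q + q * σ) * (D * (2 ^ n) ^ (-γ)) ^ q =
      C * (D * (2 ^ n) ^ (-σ)) ^ q := by
    rw [Real.mul_rpow hD0.le (by positivity), Real.mul_rpow hD0.le (by positivity),
      ← Real.rpow_mul hN.le, ← Real.rpow_mul hN.le]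
    have e1 : ((2 : ℝ) ^ n) ^ (-σ * q) = (2 ^ n) ^ (q * criticalExponent α q + q * σ) *
        (2 ^ n) ^ (-γ * q) := by
      rw [← Real.rpow_add hN]
      congr 1
      rw [hσ]
      ring
    rw [e1]
    ring
  rw [e, Real.mul_rpow hC.le (by positivity), ← Real.rpow_mul (by positivity),
    mul_one_div_cancel hq0.ne', Real.rpow_one, ← Real.rpow_natCast, ← Real.rpow_natCast,
    ← Real.rpow_mul (by norm_num), ← Real.rpow_mul (by norm_num), mul_comm (n : ℝ)]
  ring

theorem exists_eLpNorm_freeEvolution_le {α γ : ℝ} {p : ℝ≥0∞} (hα : α ≤ 2)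
    (hp₂ : 2 ≤ p) (hp₄ : p ≤ 4) (hγ : criticalExponent α p.toReal < γ) :
    ∃ C : ℝ≥0, ∀ (μ : Measure SpaceTime) [SFinite μ] (φ : 𝓢(ℝ, ℂ)),
    eLpNorm (freeEvolution φ) p (μ.restrict unitTimeSlab) ≤
      C * ballConst α μ ^ (1 / p.toReal) * eLpNorm (schwartzBessel γ φ) p := by
  obtain ⟨C, r, hC, hr0, hr1, h⟩ := exists_eLpNorm_blockEvolution_dyadicShell_le hα hp₂ hp₄ hγ
  refine ⟨(C * (1 - r)⁻¹).toNNReal, ?_⟩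
  intro μ _ φ
  set g := schwartzBessel γ φ with hg
  have hφ : φ = schwartzBessel (-γ) g := (schwartzBessel_neg_schwartzBessel γ φ).symm
  have hb : Continuous fun ξ ↦ (besselSymbol (-γ) ξ : ℂ) :=
    (besselSymbol_hasTemperateGrowth (-γ)).1.continuous
  have hm := fun m ↦ (measurable_blockEvolution hb (dyadicShell m) g).aestronglyMeasurable
    (μ := μ.restrict unitTimeSlab)
  have hlim : ∀ z, Tendsto (fun n : ℕ ↦ (∑ m ∈ Finset.range (n + 1),
      blockEvolution (fun ξ ↦ (besselSymbol (-γ) ξ : ℂ)) (dyadicShell m) g) z) atTop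
      (𝓝 (freeEvolution φ z)) := by
    intro z
    rw [hφ]
    refine (tendsto_blockEvolution_Ico (-γ) g z).congr fun n ↦ ?_
    rw [Finset.sum_apply, sum_blockEvolution_dyadicShell hb]
  -- Fatou for the pointwise convergent partial sums over shells; the triangle inequality and the
  -- geometric series bound all of them.
  refine (Lp.eLpNorm_lim_le_liminf_eLpNorm (fun n ↦ Finset.aestronglyMeasurable_sum _ fun m _ ↦
    hm m) _ (ae_of_all _ hlim)).trans ?_
  refine liminf_le_of_le (by isBoundedDefault) fun b hb' ↦ ?_
  obtain ⟨n, hn⟩ := hb'.exists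
  refine hn.trans ((eLpNorm_sum_le (fun m _ ↦ hm m) ?_).trans ?_)
  · exact le_trans (by norm_num) hp₂
  have hgeom : ∑ m ∈ Finset.range (n + 1), C * r ^ m ≤ C * (1 - r)⁻¹ := by
    rw [← Finset.mul_sum, ← tsum_geometric_of_lt_one hr0.le hr1]
    exact mul_le_mul_of_nonneg_left ((summable_geometric_of_lt_one hr0.le hr1).sum_le_tsum _
      fun m _ ↦ by positivity) hC.le
  refine (Finset.sum_le_sum fun m _ ↦ h μ g m).trans ?_
  rw [← Finset.sum_mul, ← ENNReal.ofReal_sum_of_nonneg fun m _ ↦ by positivity, mul_assoc]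
  exact mul_le_mul' (ENNReal.ofReal_le_ofReal hgeom) le_rfl

theorem fractalLocalSmoothing_of_lt {α γ : ℝ} {p : ℝ≥0∞} [Fact (1 ≤ p)] (hα : α ≤ 2)
    (hp₂ : 2 ≤ p) (hp₄ : p ≤ 4) (hγ : criticalExponent α p.toReal < γ) :
    FractalLocalSmoothing α p γ := by
  obtain ⟨C, hC⟩ := exists_eLpNorm_freeEvolution_le hα hp₂ hp₄ hγ
  refine ⟨C, fun μ hμ f hf ↦ ?_⟩
  have hfin : ballConst α μ ≠ ∞ := ne_top_of_le_ne_top ENNReal.one_ne_top hμ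
  have := isLocallyFiniteMeasure_of_ballConst_ne_top hfin
  exact exists_isFreeEvolution (ne_top_of_le_ne_top (by norm_num) hp₄)
    (ENNReal.mul_ne_top ENNReal.coe_ne_top (ENNReal.rpow_ne_top_of_nonneg (by positivity) hfin))
    (fun φ ↦ hC μ φ) hf

/-! ### Necessity: plates as test measures -/

theorem measurePreserving_coords : MeasurePreserving coords volume volume :=
  (volume_preserving_finTwoArrow ℝ).comp (PiLp.volume_preserving_ofLp (Fin 2))

/-- A density for which Lebesgue measure on a plate with dimensions `a` and `b` is a fractal
measure of dimension `α`. -/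
noncomputable def plateDensity (α a b : ℝ) : ℝ :=
  if 1 ≤ α then b ^ (α - 2) else b⁻¹ * a ^ (α - 1)

theorem plateDensity_pos (α : ℝ) {a b : ℝ} (ha : 0 < a) (hb : 0 < b) : 0 < plateDensity α a b := by
  unfold plateDensity
  split_ifs <;> positivity

theorem plateDensity_le {α a b : ℝ} (hb : 0 < b) (hba : b ≤ a) :
    plateDensity α a b ≤ b ^ (α - 2) ∧ plateDensity α a b ≤ b⁻¹ * a ^ (α - 1) := by
  have ha : 0 < a := hb.trans_le hba
  have e : b ^ (α - 2) = b⁻¹ * b ^ (α - 1) := by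
    rw [show α - 2 = α - 1 - 1 by ring, Real.rpow_sub_one hb.ne', div_eq_inv_mul]
  unfold plateDensity
  split_ifs with h
  · refine ⟨le_rfl, ?_⟩
    rw [e]
    exact mul_le_mul_of_nonneg_left (Real.rpow_le_rpow hb.le hba (by linarith)) (by positivity)
  · refine ⟨?_, le_rfl⟩
    rw [e]
    exact mul_le_mul_of_nonneg_left (Real.rpow_le_rpow_of_nonpos hb hba (by linarith))
      (by positivity)

/-- The volume in a ball is of order ρ², ρb or ab in the ranges ρ ≤ b, b ≤ ρ ≤ a and ρ ≥ a. The
ratio of ρ^α to it is least at ρ = b when α ≥ 1 and at ρ = a when α ≤ 1; these minima are the two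
values of the density. -/
theorem plateDensity_mul_le {α a b ρ V : ℝ} (hα₀ : 0 ≤ α) (hα₂ : α ≤ 2) (hb : 0 < b) (hba : b ≤ a)
    (hρ : 0 < ρ) (h1 : V ≤ ρ * ρ) (h2 : V ≤ ρ * b) (h3 : V ≤ a * b) :
    plateDensity α a b * V ≤ ρ ^ α := by
  have ha : 0 < a := hb.trans_le hba
  obtain ⟨hd1, hd2⟩ := plateDensity_le (α := α) hb hba
  have hd0 := (plateDensity_pos α ha hb).le
  rcases le_total ρ b with hρb | hρb
  · calc plateDensity α a b * V ≤ b ^ (α - 2) * (ρ * ρ) := by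
          refine (mul_le_mul_of_nonneg_left h1 hd0).trans ?_
          exact mul_le_mul_of_nonneg_right hd1 (by positivity)
      _ ≤ ρ ^ (α - 2) * (ρ * ρ) := mul_le_mul_of_nonneg_right
          (Real.rpow_le_rpow_of_nonpos hρ hρb (by linarith)) (by positivity)
      _ = ρ ^ α := by
          rw [Real.rpow_sub hρ, Real.rpow_two]
          field_simp
  rcases le_total a ρ with hρa | hρa
  · calc plateDensity α a b * V ≤ b⁻¹ * a ^ (α - 1) * (a * b) := by
          refine (mul_le_mul_of_nonneg_left h3 hd0).trans ?_
          exact mul_le_mul_of_nonneg_right hd2 (by positivity)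
      _ = a ^ α := by
          rw [Real.rpow_sub_one ha.ne']
          field_simp
      _ ≤ ρ ^ α := Real.rpow_le_rpow ha.le hρa hα₀
  have hkey : plateDensity α a b ≤ b⁻¹ * ρ ^ (α - 1) := by
    rcases le_total 1 α with h | h
    · refine hd1.trans ?_
      rw [show α - 2 = α - 1 - 1 by ring, Real.rpow_sub_one hb.ne', div_eq_inv_mul]
      exact mul_le_mul_of_nonneg_left (Real.rpow_le_rpow hb.le hρb (by linarith)) (by positivity)
    · refine hd2.trans ?_
      exact mul_le_mul_of_nonneg_left (Real.rpow_le_rpow_of_nonpos hρ hρa (by linarith))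
        (by positivity)
  calc plateDensity α a b * V ≤ b⁻¹ * ρ ^ (α - 1) * (ρ * b) := by
        refine (mul_le_mul_of_nonneg_left h2 hd0).trans ?_
        exact mul_le_mul_of_nonneg_right hkey (by positivity)
    _ = ρ ^ α := by
        rw [Real.rpow_sub_one hρ.ne']
        field_simp

theorem volume_le_of_slices {S : Set (ℝ × ℝ)} (hS : MeasurableSet S) {I : Set ℝ}
    (hI : ∀ z ∈ S, z.1 ∈ I) {w : ℝ≥0∞} (hw : ∀ x, volume {t | (x, t) ∈ S} ≤ w) :
    volume S ≤ w * volume I := by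
  rw [Measure.volume_eq_prod, Measure.prod_apply hS]
  calc ∫⁻ x, volume (Prod.mk x ⁻¹' S) ≤ ∫⁻ x, I.indicator (fun _ ↦ w) x := by
        refine lintegral_mono fun x ↦ ?_
        by_cases hx : x ∈ I
        · rw [Set.indicator_of_mem hx]
          exact hw x
        · have : Prod.mk x ⁻¹' S = ∅ := by
            ext t
            simp only [Set.mem_preimage, Set.mem_empty_iff_false, iff_false]
            exact fun h ↦ hx (hI _ h)
          rw [this, measure_empty]
          exact zero_le
    _ ≤ _ := lintegral_indicator_const_le _ _

/-- Only the horizontal extent and the lengths of time slices enter, so tilted plates are allowed.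
The interval |x| ≤ 14a has length 28a, which is the factor 28. -/
theorem volume_inter_box_le {S : Set (ℝ × ℝ)} (hS : MeasurableSet S) {a b : ℝ}
    (hb : 0 < b)
    (hx : ∀ z ∈ S, |z.1| ≤ 14 * a) (ht : ∀ x, volume {t | (x, t) ∈ S} ≤ ENNReal.ofReal b)
    (z : ℝ × ℝ) {ρ : ℝ} (hρ : 0 < ρ) :
    ∃ V, V ≤ ρ * ρ ∧ V ≤ ρ * b ∧ V ≤ a * b ∧
      volume (S ∩ {y | |y.1 - z.1| ≤ ρ ∧ |y.2 - z.2| ≤ ρ}) ≤ ENNReal.ofReal (28 * V) := by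
  set S' := S ∩ {y | |y.1 - z.1| ≤ ρ ∧ |y.2 - z.2| ≤ ρ} with hS'
  have hm : MeasurableSet S' := hS.inter
    ((measurableSet_le (f := fun y : ℝ × ℝ ↦ |y.1 - z.1|) (by fun_prop) measurable_const).inter
      (measurableSet_le (f := fun y : ℝ × ℝ ↦ |y.2 - z.2|) (by fun_prop) measurable_const))
  have hsl : ∀ x, volume {t | (x, t) ∈ S'} ≤ ENNReal.ofReal b := fun x ↦
    (measure_mono fun t ht ↦ ht.1).trans (ht x)
  have hIcc : ∀ c r : ℝ, volume {t : ℝ | |t - c| ≤ r} = ENNReal.ofReal (2 * r) := fun c r ↦ by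
    have : {t : ℝ | |t - c| ≤ r} = Metric.closedBall c r := by
      ext t
      rw [Metric.mem_closedBall, Real.dist_eq]
      rfl
    rw [this, Real.volume_closedBall]
  have hsl' : ∀ x, volume {t | (x, t) ∈ S'} ≤ ENNReal.ofReal (2 * ρ) := fun x ↦ by
    rw [← hIcc z.2 ρ]
    exact measure_mono fun t ht ↦ ht.2.2
  have h1 := volume_le_of_slices hm (I := {t | |t - z.1| ≤ ρ}) (fun y hy ↦ hy.2.1) hsl'
  have h2 := volume_le_of_slices hm (I := {t | |t - z.1| ≤ ρ}) (fun y hy ↦ hy.2.1) hsl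
  have h3 := volume_le_of_slices hm (I := {t | |t - 0| ≤ 14 * a})
    (fun y hy ↦ by change |y.1 - 0| ≤ _; rw [sub_zero]; exact hx y hy.1) hsl
  rw [hIcc, ← ENNReal.ofReal_mul (by positivity)] at h1 h2 h3
  refine ⟨min (ρ * ρ) (min (ρ * b) (a * b)), min_le_left _ _,
    (min_le_right _ _).trans (min_le_left _ _), (min_le_right _ _).trans (min_le_right _ _), ?_⟩
  rw [mul_min_of_nonneg _ _ (by norm_num), mul_min_of_nonneg _ _ (by norm_num)]
  rw [ENNReal.ofReal_min, ENNReal.ofReal_min]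
  refine le_min (h1.trans (ENNReal.ofReal_le_ofReal ?_)) (le_min
    (h2.trans (ENNReal.ofReal_le_ofReal ?_)) (h3.trans (ENNReal.ofReal_le_ofReal ?_)))
  · nlinarith [mul_pos hρ hρ]
  · nlinarith [mul_pos hρ hb]
  · nlinarith

/-- Lebesgue measure on a plate, normalized to be a fractal measure. -/
noncomputable def plateMeasure (α a b : ℝ) (S : Set (ℝ × ℝ)) : Measure SpaceTime :=
  ENNReal.ofReal (plateDensity α a b / 28) • volume.restrict (coords ⁻¹' S)

theorem ballConst_plateMeasure_le {α a b : ℝ} (hα₀ : 0 ≤ α) (hα₂ : α ≤ 2) (hb : 0 < b)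
    (hba : b ≤ a) {S : Set (ℝ × ℝ)} (hS : MeasurableSet S)
    (hx : ∀ z ∈ S, |z.1| ≤ 14 * a) (ht : ∀ x, volume {t | (x, t) ∈ S} ≤ ENNReal.ofReal b) :
    ballConst α (plateMeasure α a b S) ≤ 1 := by
  have ha : 0 < a := hb.trans_le hba
  refine iSup_le fun z ↦ iSup₂_le fun ρ hρ ↦ ?_
  obtain ⟨V, h1, h2, h3, h4⟩ := volume_inter_box_le hS hb hx ht (coords z) hρ
  have hd := plateDensity_pos α ha hb
  have h5 : plateMeasure α a b S (Metric.ball z ρ) ≤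
      ENNReal.ofReal (plateDensity α a b / 28) * ENNReal.ofReal (28 * V) := by
    rw [plateMeasure, Measure.smul_apply, smul_eq_mul, Measure.restrict_apply measurableSet_ball]
    refine mul_le_mul' le_rfl (le_trans ?_ h4)
    have hm : MeasurableSet (S ∩ {y | |y.1 - (coords z).1| ≤ ρ ∧ |y.2 - (coords z).2| ≤ ρ}) :=
      hS.inter ((measurableSet_le (f := fun y : ℝ × ℝ ↦ |y.1 - (coords z).1|) (by fun_prop)
        measurable_const).inter (measurableSet_le (f := fun y : ℝ × ℝ ↦ |y.2 - (coords z).2|)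
          (by fun_prop) measurable_const))
    rw [← measurePreserving_coords.measure_preimage hm.nullMeasurableSet]
    refine measure_mono fun y hy ↦ ⟨hy.2, ?_, ?_⟩
    · have := PiLp.norm_apply_le (y - z) 0
      exact this.trans (mem_ball_iff_norm.1 hy.1).le
    · have := PiLp.norm_apply_le (y - z) 1
      exact this.trans (mem_ball_iff_norm.1 hy.1).le
  calc _ ≤ ENNReal.ofReal (ρ ^ (-α)) *
        (ENNReal.ofReal (plateDensity α a b / 28) * ENNReal.ofReal (28 * V)) :=
        mul_le_mul' le_rfl h5
    _ = ENNReal.ofReal (ρ ^ (-α) * (plateDensity α a b * V)) := by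
        rw [← ENNReal.ofReal_mul (by positivity), ← ENNReal.ofReal_mul (by positivity)]
        ring_nf
    _ ≤ ENNReal.ofReal (ρ ^ (-α) * ρ ^ α) := ENNReal.ofReal_le_ofReal
        (mul_le_mul_of_nonneg_left (plateDensity_mul_le hα₀ hα₂ hb hba hρ h1 h2 h3)
          (by positivity))
    _ = 1 := by
        rw [← Real.rpow_add hρ, neg_add_cancel, Real.rpow_zero, ENNReal.ofReal_one]

/-- The local smoothing estimate, tested on a plate where the evolution is large. -/
theorem FractalLocalSmoothingSchwartz.exists_le_lintegral {α γ : ℝ} (hα₀ : 0 ≤ α) (hα₂ : α ≤ 2)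
    {p : ℝ≥0∞} [Fact (1 ≤ p)] (hp : p ≠ ∞) (h : FractalLocalSmoothingSchwartz α p γ) :
    ∃ C : ℝ, 0 < C ∧ ∀ (a b : ℝ), 0 < b → b ≤ a → ∀ S : Set (ℝ × ℝ), MeasurableSet S →
    (∀ z ∈ S, |z.1| ≤ 14 * a) → (∀ x, volume {t | (x, t) ∈ S} ≤ ENNReal.ofReal b) →
    (∀ z ∈ S, z.2 ∈ Set.Icc (0 : ℝ) 1) → ∀ (g : 𝓢(ℝ, ℂ)) (L : ℝ), 0 ≤ L →
    (∀ z ∈ S, L ≤ ‖oscInt (fun ξ ↦ besselSymbol (-γ) ξ * (𝓕 g : 𝓢(ℝ, ℂ)) ξ) z.1 z.2‖) →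
    ENNReal.ofReal (L ^ p.toReal * plateDensity α a b) * volume S ≤
      ENNReal.ofReal C * ∫⁻ y, ‖g y‖ₑ ^ p.toReal := by
  have hp1 : (1 : ℝ≥0∞) ≤ p := Fact.out
  have hp0 : p ≠ 0 := (lt_of_lt_of_le (by norm_num) hp1).ne'
  obtain ⟨C, hC⟩ := h
  set q := p.toReal with hq
  have hq0 : 0 < q := ENNReal.toReal_pos hp0 hp
  refine ⟨28 * ((C : ℝ) + 1) ^ q, by positivity, ?_⟩
  intro a b hb hba S hS hx ht hslab g L hL hLS
  have ha : 0 < a := hb.trans_le hba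
  have hd := plateDensity_pos α ha hb
  have hK := ballConst_plateMeasure_le hα₀ hα₂ hb hba hS hx ht
  set μ := plateMeasure α a b S with hμ
  -- For this datum the Sobolev norm is the L^p norm of `g`, and the power of the frequency moves
  -- into the profile.
  have h1 := hC μ hK (schwartzBessel (-γ) g)
  rw [sobolevNorm_coe, schwartzBessel_schwartzBessel_neg] at h1
  have h2 : eLpNorm (freeEvolution (schwartzBessel (-γ) g)) p (μ.restrict unitTimeSlab) ≤
      C * eLpNorm g p volume := by
    refine h1.trans (mul_le_mul' ?_ le_rfl)
    calc _ ≤ (C : ℝ≥0∞) * 1 :=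
          mul_le_mul' le_rfl (ENNReal.rpow_le_one hK (by positivity))
      _ = _ := mul_one _
  rw [eLpNorm_eq_lintegral_rpow_enorm_toReal hp0 hp,
    eLpNorm_eq_lintegral_rpow_enorm_toReal hp0 hp, ← hq] at h2
  have h3 := ENNReal.rpow_le_rpow h2 hq0.le
  rw [ENNReal.mul_rpow_of_nonneg _ _ hq0.le, ← ENNReal.rpow_mul, ← ENNReal.rpow_mul,
    one_div_mul_cancel hq0.ne', ENNReal.rpow_one, ENNReal.rpow_one] at h3
  have h4 : ENNReal.ofReal (L ^ q) * μ (coords ⁻¹' S) ≤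
      ∫⁻ z in unitTimeSlab, ‖freeEvolution (schwartzBessel (-γ) g) z‖ₑ ^ q ∂μ := by
    have hSm : MeasurableSet (coords ⁻¹' S) := measurable_coords hS
    calc _ = ∫⁻ z in coords ⁻¹' S, ENNReal.ofReal (L ^ q) ∂μ := by rw [setLIntegral_const]
      _ ≤ ∫⁻ z in coords ⁻¹' S, ‖freeEvolution (schwartzBessel (-γ) g) z‖ₑ ^ q ∂μ := by
          refine setLIntegral_mono' hSm fun z hz ↦ ?_
          rw [← ENNReal.ofReal_rpow_of_nonneg hL hq0.le, ← ofReal_norm]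
          refine ENNReal.rpow_le_rpow (ENNReal.ofReal_le_ofReal ?_) hq0.le
          have e : (fun ξ ↦ besselSymbol (-γ) ξ * (𝓕 g : 𝓢(ℝ, ℂ)) ξ) =
              (𝓕 (schwartzBessel (-γ) g) : 𝓢(ℝ, ℂ)) :=
            funext fun ξ ↦ (fourier_schwartzBessel (-γ) g ξ).symm
          have h5 := hLS _ hz
          rw [e] at h5
          rw [freeEvolution_eq_oscInt]
          exact h5
      _ ≤ _ := lintegral_mono_set fun z hz ↦ hslab _ hz
  have h5 : μ (coords ⁻¹' S) = ENNReal.ofReal (plateDensity α a b / 28) * volume S := by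
    rw [hμ, plateMeasure, Measure.smul_apply, smul_eq_mul,
      Measure.restrict_apply (measurable_coords hS), Set.inter_self,
      measurePreserving_coords.measure_preimage hS.nullMeasurableSet]
  have h6 : (C : ℝ≥0∞) ^ q ≤ ENNReal.ofReal (((C : ℝ) + 1) ^ q) := by
    rw [← ENNReal.ofReal_rpow_of_nonneg (by positivity) hq0.le]
    refine ENNReal.rpow_le_rpow ?_ hq0.le
    rw [← ENNReal.ofReal_coe_nnreal]
    exact ENNReal.ofReal_le_ofReal (by linarith)
  rw [h5] at h4
  have h7 := (h4.trans h3).trans (mul_le_mul' h6 le_rfl)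
  calc _ = ENNReal.ofReal 28 * (ENNReal.ofReal (L ^ q) *
        (ENNReal.ofReal (plateDensity α a b / 28) * volume S)) := by
        rw [← mul_assoc, ← mul_assoc, ← ENNReal.ofReal_mul (by norm_num),
          ← ENNReal.ofReal_mul (by positivity)]
        ring_nf
    _ ≤ ENNReal.ofReal 28 * (ENNReal.ofReal (((C : ℝ) + 1) ^ q) * ∫⁻ y, ‖g y‖ₑ ^ q) :=
        mul_le_mul' le_rfl h7
    _ = _ := by rw [← mul_assoc, ← ENNReal.ofReal_mul (by norm_num)]

/-! ### Necessity: a wave packet along its ray -/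

theorem le_of_forall_natCast_rpow_le {a b C : ℝ}
    (h : ∀ n : ℕ, 1 ≤ n → (n : ℝ) ^ a ≤ C * (n : ℝ) ^ b) : a ≤ b := by
  by_contra! hab
  have h1 : Tendsto (fun n : ℕ ↦ (n : ℝ) ^ (a - b)) atTop atTop :=
    (tendsto_rpow_atTop (by linarith)).comp tendsto_natCast_atTop_atTop
  obtain ⟨n, hn, hn1⟩ := ((h1.eventually_gt_atTop C).and (eventually_ge_atTop 1)).exists
  have hn0 : (0 : ℝ) < n := by exact_mod_cast hn1
  have h2 := h n hn1
  rw [Real.rpow_sub hn0, lt_div_iff₀ (by positivity)] at hn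
  linarith

theorem continuous_besselSymbol (γ : ℝ) : Continuous (besselSymbol γ) :=
  Continuous.rpow_const (by fun_prop) fun ξ ↦ Or.inl (by positivity)

/-- A lower bound for an oscillatory integral with small phase. -/
theorem integral_le_norm_integral_unitExp {r w u : ℝ → ℝ} (hr : Continuous r) (hw : Integrable w)
    (hu : Integrable u) (h : ∀ ξ, u ξ ≤ (1 - (2 * Real.pi * r ξ) ^ 2 / 2) * w ξ) (hw0 : ∀ ξ, 0 ≤ w ξ) :
    ∫ ξ, u ξ ≤ ‖∫ ξ, unitExp (r ξ) * w ξ‖ := by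
  have hi : Integrable fun ξ ↦ unitExp (r ξ) * (w ξ : ℂ) :=
    hw.ofReal.bdd_mul (c := 1) (continuous_unitExp.comp hr).aestronglyMeasurable
      (ae_of_all _ fun ξ ↦ (norm_unitExp _).le)
  refine le_trans ?_ (Complex.re_le_norm _)
  have e : (∫ ξ, unitExp (r ξ) * (w ξ : ℂ)).re = ∫ ξ, (unitExp (r ξ) * (w ξ : ℂ)).re :=
    (integral_re hi).symm
  rw [e]
  refine integral_mono hu hi.re fun ξ ↦ ?_
  refine (h ξ).trans ?_
  change _ ≤ (unitExp (r ξ) * (w ξ : ℂ)).re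
  rw [Complex.re_mul_ofReal, re_unitExp]
  exact mul_le_mul_of_nonneg_right (Real.one_sub_sq_div_two_le_cos) (hw0 ξ)

/-- A neighbourhood of a light ray, during a time interval. -/
def rayTube (ζ r s₀ s₁ : ℝ) : Set (ℝ × ℝ) := {z | |z.1 + ζ * z.2| ≤ r ∧ z.2 ∈ Set.Icc s₀ s₁}

theorem measurableSet_rayTube (ζ r s₀ s₁ : ℝ) : MeasurableSet (rayTube ζ r s₀ s₁) :=
  (measurableSet_le (f := fun z : ℝ × ℝ ↦ |z.1 + ζ * z.2|) (by fun_prop) measurable_const).inter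
    (measurableSet_Icc.preimage measurable_snd)

theorem volume_rayTube (ζ r s₀ s₁ : ℝ) :
    volume (rayTube ζ r s₀ s₁) = ENNReal.ofReal (2 * r) * ENNReal.ofReal (s₁ - s₀) := by
  rw [Measure.volume_eq_prod, Measure.prod_apply_symm (measurableSet_rayTube _ _ _ _)]
  have h : ∀ t, volume ((fun x ↦ (x, t)) ⁻¹' rayTube ζ r s₀ s₁) =
      (Set.Icc s₀ s₁).indicator (fun _ ↦ ENNReal.ofReal (2 * r)) t := by
    intro t
    by_cases ht : t ∈ Set.Icc s₀ s₁
    · rw [Set.indicator_of_mem ht, ← Real.volume_closedBall (-(ζ * t)) r]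
      congr 1
      ext x
      rw [Metric.mem_closedBall, Real.dist_eq, sub_neg_eq_add]
      exact ⟨fun h ↦ h.1, fun h ↦ ⟨h, ht⟩⟩
    · rw [Set.indicator_of_notMem ht]
      convert measure_empty (μ := (volume : Measure ℝ))
      ext x
      simp only [Set.mem_preimage, Set.mem_empty_iff_false, iff_false]
      exact fun h ↦ ht h.2
  simp_rw [h]
  rw [lintegral_indicator_const measurableSet_Icc, Real.volume_Icc]

theorem le_besselSymbol_neg (γ : ℝ) {n ξ : ℝ} (hn : 0 < n) (h₁ : n ^ 2 / 161 ≤ 1 + (2 * Real.pi * ξ) ^ 2)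
    (h₂ : 1 + (2 * Real.pi * ξ) ^ 2 ≤ 161 * n ^ 2) :
    (161 ^ |γ / 2|)⁻¹ * n ^ (-γ) ≤ besselSymbol (-γ) ξ := by
  have h : besselSymbol γ ξ ≤ 161 ^ |γ / 2| * n ^ γ := by
    have e : n ^ γ = (n ^ 2) ^ (γ / 2) := by
      rw [← Real.rpow_natCast n 2, ← Real.rpow_mul hn.le]
      congr 1
      push_cast
      ring
    rw [besselSymbol, e, Real.norm_eq_abs, sq_abs]
    exact rpow_le_of_comparable _ (by positivity) (by norm_num) h₁ h₂
  have hA : (0 : ℝ) < 161 ^ |γ / 2| := by positivity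
  have h3 := besselSymbol_mul_neg γ ξ
  have h4 := besselSymbol_pos (-γ) ξ
  have h5 : 1 ≤ 161 ^ |γ / 2| * n ^ γ * besselSymbol (-γ) ξ := by
    rw [← h3]
    exact mul_le_mul_of_nonneg_right h h4.le
  rw [Real.rpow_neg hn.le, ← mul_inv, inv_le_iff_one_le_mul₀ (by positivity)]
  linarith

theorem le_besselSymbol_neg_of_near (γ : ℝ) {n ξ : ℝ} (hn : 1 ≤ n) (hξ : |ξ - n| ≤ 1) :
    (161 ^ |γ / 2|)⁻¹ * n ^ (-γ) ≤ besselSymbol (-γ) ξ := by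
  have hpi : Real.pi ≤ 3.15 := Real.pi_lt_d2.le
  have hpi3 : 3 < Real.pi := Real.pi_gt_three
  obtain ⟨h1, h2⟩ := abs_le.1 hξ
  refine le_besselSymbol_neg γ (by linarith) ?_ ?_
  · have h3 : (n - 1) ^ 2 ≤ (2 * Real.pi * ξ) ^ 2 := by
      refine pow_le_pow_left₀ (by linarith) ?_ 2
      nlinarith
    nlinarith [sq_nonneg (n - 1)]
  · have h3 : (2 * Real.pi * ξ) ^ 2 ≤ (6.3 * (2 * n)) ^ 2 := by
      refine pow_le_pow_left₀ (by nlinarith) ?_ 2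
      nlinarith
    nlinarith

theorem integral_latticeBump_pos : 0 < ∫ ξ, latticeBump ξ := by
  refine Continuous.integral_pos_of_hasCompactSupport_nonneg_nonzero
    (contDiff_latticeBump (n := 0)).continuous ?_ latticeBump_nonneg (x := 0) ?_
  · exact HasCompactSupport.intro (isCompact_Icc (a := (-1 : ℝ)) (b := 1)) fun ξ hξ ↦
      latticeBump_eq_zero fun h ↦ hξ (Set.Ioo_subset_Icc_self h)
  · rw [latticeBump, zero_add, Real.smoothTransition.one, Real.smoothTransition.zero]
    norm_num

/-- The function with frequencies near the lattice point `k`. -/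
noncomputable def latticeWave (k : ℤ) : 𝓢(ℝ, ℂ) := 𝓕⁻ (latticeBumpAt k)

theorem fourier_latticeWave (k : ℤ) : (𝓕 (latticeWave k) : 𝓢(ℝ, ℂ)) = latticeBumpAt k :=
  FourierTransform.fourier_fourierInv_eq _

/-- All these waves are modulations of one function, so their L^p norms do not depend on k. -/
theorem norm_latticeWave (k : ℤ) (x : ℝ) : ‖latticeWave k x‖ = ‖latticeWave 0 x‖ := by
  have h : ∀ k, latticeWave k x = oscInt (latticeBumpAt k) x 0 := fun k ↦ by
    rw [latticeWave, SchwartzMap.fourierInv_coe, fourierInv_eq_integral_unitExp, oscInt]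
    refine integral_congr_ae (ae_of_all _ fun ξ ↦ ?_)
    ring_nf
  rw [h, h, norm_oscInt_shift _ k]
  congr 2
  · ext ξ
    simp [latticeBumpAt_apply]
  · ring

/-- In the frame of the packet |y| ≤ 1/20, 0 ≤ t ≤ 1/100 and |ξ| ≤ 1, so the angle is at most
2π(1/20 + 2π/100) < 1. The cosine is then at least 1/2 and nothing cancels. -/
theorem le_norm_oscInt_latticeWave (γ : ℝ) {n : ℕ} (hn : 1 ≤ n) {z : ℝ × ℝ}
    (hz : z ∈ rayTube (4 * Real.pi * n) (1 / 20) 0 (1 / 100)) :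
    (161 ^ |γ / 2|)⁻¹ / 2 * (∫ ξ, latticeBump ξ) * (n : ℝ) ^ (-γ) ≤
      ‖oscInt (fun ξ ↦ besselSymbol (-γ) ξ * (𝓕 (latticeWave n) : 𝓢(ℝ, ℂ)) ξ) z.1 z.2‖ := by
  have hn1 : (1 : ℝ) ≤ n := by exact_mod_cast hn
  obtain ⟨hz1, hz2, hz3⟩ := hz
  have hsupp : HasCompactSupport latticeBump :=
    HasCompactSupport.intro (isCompact_Icc (a := (-1 : ℝ)) (b := 1)) fun ξ hξ ↦
      latticeBump_eq_zero fun h ↦ hξ (Set.Ioo_subset_Icc_self h)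
  have hlc : Continuous latticeBump := (contDiff_latticeBump (n := 0)).continuous
  have hbc := continuous_besselSymbol (-γ)
  rw [norm_oscInt_shift _ n, fourier_latticeWave]
  set y := z.1 + 4 * Real.pi * n * z.2
  have e : oscInt (fun ξ ↦ (besselSymbol (-γ) (ξ + n) : ℂ) * latticeBumpAt n (ξ + n)) y z.2 =
      ∫ ξ, unitExp (y * ξ + 2 * Real.pi * z.2 * ξ ^ 2) *
        ((besselSymbol (-γ) (ξ + n) * latticeBump ξ : ℝ) : ℂ) := by
    rw [oscInt]
    refine integral_congr_ae (ae_of_all _ fun ξ ↦ ?_)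
    simp [latticeBumpAt_apply]
  rw [e, mul_right_comm, ← integral_const_mul]
  refine integral_le_norm_integral_unitExp (by fun_prop) ?_ ?_ ?_ ?_
  · exact Continuous.integrable_of_hasCompactSupport (by fun_prop) hsupp.mul_left
  · exact (hlc.integrable_of_hasCompactSupport hsupp).const_mul _
  · intro ξ
    by_cases hξ : ξ ∈ Set.Ioo (-1 : ℝ) 1
    · have hξ1 : |ξ| ≤ 1 := abs_le.2 ⟨hξ.1.le, hξ.2.le⟩
      have h1 : |y * ξ + 2 * Real.pi * z.2 * ξ ^ 2| ≤ 1 / 20 + 2 * Real.pi * (1 / 100) := by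
        refine (abs_add_le _ _).trans (add_le_add ?_ ?_)
        · rw [abs_mul]
          calc _ ≤ 1 / 20 * (1 : ℝ) := mul_le_mul hz1 hξ1 (abs_nonneg _) (by norm_num)
            _ = _ := mul_one _
        · rw [abs_mul, abs_mul, abs_of_pos (by positivity : 0 < 2 * Real.pi), abs_of_nonneg hz2,
            abs_pow]
          calc _ ≤ 2 * Real.pi * (1 / 100) * 1 := by
                refine mul_le_mul (mul_le_mul_of_nonneg_left hz3 (by positivity))
                  (pow_le_one₀ (abs_nonneg _) hξ1) (by positivity) (by positivity)
            _ = _ := mul_one _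
      have hpi : Real.pi ≤ 3.15 := Real.pi_lt_d2.le
      have h2 : (2 * Real.pi * (y * ξ + 2 * Real.pi * z.2 * ξ ^ 2)) ^ 2 ≤ 1 := by
        rw [← sq_abs, abs_mul, abs_of_pos (by positivity : 0 < 2 * Real.pi)]
        refine pow_le_one₀ (by positivity) ?_
        calc _ ≤ 2 * Real.pi * (1 / 20 + 2 * Real.pi * (1 / 100)) :=
              mul_le_mul_of_nonneg_left h1 (by positivity)
          _ ≤ 1 := by nlinarith [Real.pi_pos]
      have h3 := le_besselSymbol_neg_of_near γ hn1 (ξ := ξ + n) (by rwa [add_sub_cancel_right])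
      have h4 := latticeBump_nonneg ξ
      calc _ = 1 / 2 * ((161 ^ |γ / 2|)⁻¹ * (n : ℝ) ^ (-γ) * latticeBump ξ) := by ring
        _ ≤ (1 - (2 * Real.pi * (y * ξ + 2 * Real.pi * z.2 * ξ ^ 2)) ^ 2 / 2) *
            (besselSymbol (-γ) (ξ + n) * latticeBump ξ) := by
            refine mul_le_mul (by linarith) (mul_le_mul_of_nonneg_right h3 h4) (by positivity)
              (by linarith)
    · rw [latticeBump_eq_zero hξ]
      simp
  · intro ξ
    exact mul_nonneg (besselSymbol_pos _ _).le (latticeBump_nonneg ξ)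

theorem volume_slice_rayTube_le {ζ : ℝ} (hζ : 0 < ζ) (r s₀ s₁ x : ℝ) :
    volume {t | (x, t) ∈ rayTube ζ r s₀ s₁} ≤ ENNReal.ofReal (2 * (r / ζ)) := by
  rw [← Real.volume_closedBall (-(x / ζ)) (r / ζ)]
  refine measure_mono fun t ht ↦ ?_
  rw [Metric.mem_closedBall, Real.dist_eq, sub_neg_eq_add, le_div_iff₀ hζ]
  have h : |x + ζ * t| ≤ r := ht.1
  calc |t + x / ζ| * ζ = |(t + x / ζ) * ζ| := by rw [abs_mul, abs_of_pos hζ]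
    _ = |x + ζ * t| := by
        congr 1
        field_simp
        ring
    _ ≤ r := h

/-- Moving with speed 4πn, the tube extends to |x| ≤ 14n and has time slices shorter than 1/n: it is
a plate with a = n and b = 1/n, of fixed volume 1/1000. The amplitude is of order n^{-γ}, the norm
of the datum is constant, and the density is n^{2-α} or n^α; letting n grow gives the condition. -/
theorem FractalLocalSmoothingSchwartz.tube_le {α γ : ℝ} (hα₀ : 0 ≤ α) (hα₂ : α ≤ 2)
    {p : ℝ≥0∞} [Fact (1 ≤ p)] (hp : p ≠ ∞) (h : FractalLocalSmoothingSchwartz α p γ) :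
    (if 1 ≤ α then (2 - α) / p.toReal else α / p.toReal) ≤ γ := by
  have hp1 : (1 : ℝ≥0∞) ≤ p := Fact.out
  have hp0 : p ≠ 0 := (lt_of_lt_of_le (by norm_num) hp1).ne'
  obtain ⟨C, hC, hmain⟩ := h.exists_le_lintegral hα₀ hα₂ hp
  set q := p.toReal with hq
  have hq0 : 0 < q := ENNReal.toReal_pos hp0 hp
  set c := (161 ^ |γ / 2|)⁻¹ / 2 * (∫ ξ, latticeBump ξ) with hc
  have hc0 : 0 < c := mul_pos (by positivity) integral_latticeBump_pos
  have hfin : ∫⁻ y, ‖latticeWave 0 y‖ₑ ^ q ≠ ∞ :=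
    (lintegral_rpow_enorm_lt_top_of_eLpNorm_lt_top hp0 hp ((latticeWave 0).memLp p volume).2).ne
  set G := (∫⁻ y, ‖latticeWave 0 y‖ₑ ^ q).toReal with hG
  have hkey : ∀ n : ℕ, 1 ≤ n → (n : ℝ) ^ (if 1 ≤ α then 2 - α else α) ≤
      1000 * C * G / c ^ q * (n : ℝ) ^ (γ * q) := by
    intro n hn
    have hn1 : (1 : ℝ) ≤ n := by exact_mod_cast hn
    have hn0 : (0 : ℝ) < n := by linarith
    have hpi3 : 3 < Real.pi := Real.pi_gt_three
    have hpi : Real.pi ≤ 3.15 := Real.pi_lt_d2.le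
    have h1 := hmain n (n : ℝ)⁻¹ (by positivity) ((inv_le_one_of_one_le₀ hn1).trans hn1)
      (rayTube (4 * Real.pi * n) (1 / 20) 0 (1 / 100)) (measurableSet_rayTube _ _ _ _)
      (fun z hz ↦ by
        obtain ⟨h1, h2, h3⟩ := hz
        obtain ⟨h4, h5⟩ := abs_le.1 h1
        have h6 : 0 ≤ 4 * Real.pi * n * z.2 := by positivity
        have h7 : 4 * Real.pi * n * z.2 ≤ 4 * 3.15 * n * 1 := by
          refine mul_le_mul (by gcongr) (by linarith) h2 (by positivity)
        exact abs_le.2 ⟨by linarith, by linarith⟩)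
      (fun x ↦ (volume_slice_rayTube_le (by positivity) _ _ _ _).trans
        (ENNReal.ofReal_le_ofReal (by
          rw [← one_div, ← mul_div_assoc, div_le_div_iff₀ (by positivity) hn0]
          nlinarith)))
      (fun z hz ↦ ⟨hz.2.1, hz.2.2.trans (by norm_num)⟩) (latticeWave n) (c * (n : ℝ) ^ (-γ))
      (by positivity) (fun z hz ↦ le_norm_oscInt_latticeWave γ hn hz)
    have e : ∫⁻ y, ‖latticeWave n y‖ₑ ^ q = ENNReal.ofReal G := by
      rw [hG, ENNReal.ofReal_toReal hfin]
      refine lintegral_congr fun y ↦ ?_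
      rw [← ofReal_norm, norm_latticeWave, ofReal_norm]
    have hd := plateDensity_pos α hn0 (inv_pos.2 hn0)
    rw [e, volume_rayTube, ← ENNReal.ofReal_mul (by norm_num), ← ENNReal.ofReal_mul (by positivity),
      ← ENNReal.ofReal_mul hC.le, ENNReal.ofReal_le_ofReal_iff
        (mul_nonneg hC.le ENNReal.toReal_nonneg), Real.mul_rpow hc0.le (by positivity),
      ← Real.rpow_mul hn0.le] at h1
    have e2 : plateDensity α n (n : ℝ)⁻¹ = (n : ℝ) ^ (if 1 ≤ α then 2 - α else α) := by
      unfold plateDensity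
      split_ifs
      · rw [Real.inv_rpow hn0.le, ← Real.rpow_neg hn0.le, neg_sub]
      · rw [inv_inv, Real.rpow_sub_one hn0.ne']
        field_simp
    rw [e2, neg_mul, Real.rpow_neg hn0.le] at h1
    rw [div_mul_eq_mul_div, le_div_iff₀ (by positivity)]
    have hx : 0 < (n : ℝ) ^ (γ * q) := by positivity
    have h2 := mul_le_mul_of_nonneg_right h1 hx.le
    have e3 : c ^ q * ((n : ℝ) ^ (γ * q))⁻¹ * (n : ℝ) ^ (if 1 ≤ α then 2 - α else α) *
        (2 * (1 / 20) * (1 / 100 - 0)) * (n : ℝ) ^ (γ * q) =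
        c ^ q * (n : ℝ) ^ (if 1 ≤ α then 2 - α else α) / 1000 := by
      field_simp
      norm_num
    rw [e3] at h2
    linarith
  have h2 := le_of_forall_natCast_rpow_le hkey
  split_ifs at h2 ⊢ <;> rwa [div_le_iff₀ hq0]

/-! ### Necessity: a Gaussian focusing at time one -/

theorem exists_pow_mul_exp_neg_le {a : ℝ} (ha : 0 < a) (m : ℕ) :
    ∃ C : ℝ, ∀ x : ℝ, |x| ^ m * Real.exp (-(a * x ^ 2)) ≤ C := by
  refine ⟨1 + m.factorial / a ^ m, fun x ↦ ?_⟩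
  have h1 : |x| ^ m ≤ 1 + x ^ (2 * m) := by
    rw [pow_mul, ← sq_abs, ← pow_mul, mul_comm 2 m, pow_mul]
    nlinarith [sq_nonneg (|x| ^ m - 1)]
  have h2 := Real.pow_div_factorial_le_exp (a * x ^ 2) (by positivity) m
  have h3 : (1 : ℝ) ≤ Real.exp (a * x ^ 2) := Real.one_le_exp (by positivity)
  have hf : (0 : ℝ) < m.factorial := by exact_mod_cast m.factorial_pos
  have h4 : x ^ (2 * m) ≤ m.factorial / a ^ m * Real.exp (a * x ^ 2) := by
    rw [div_le_iff₀ hf, mul_pow, ← pow_mul] at h2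
    rw [div_mul_eq_mul_div, le_div_iff₀ (by positivity)]
    linarith
  rw [Real.exp_neg, ← div_eq_mul_inv, div_le_iff₀ (Real.exp_pos _), add_mul, one_mul]
  linarith

theorem exists_norm_eval_mul_exp_neg_le {a : ℝ} (ha : 0 < a) (P : Polynomial ℂ) :
    ∃ C : ℝ, ∀ x : ℝ, ‖P.eval (x : ℂ)‖ * Real.exp (-(a * x ^ 2)) ≤ C := by
  induction P using Polynomial.induction_on' with
  | add p q hp hq =>
    obtain ⟨C₁, h₁⟩ := hp
    obtain ⟨C₂, h₂⟩ := hq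
    refine ⟨C₁ + C₂, fun x ↦ ?_⟩
    rw [Polynomial.eval_add]
    have h3 := mul_le_mul_of_nonneg_right (norm_add_le (p.eval (x : ℂ)) (q.eval (x : ℂ)))
      (Real.exp_pos (-(a * x ^ 2))).le
    linarith [h₁ x, h₂ x]
  | monomial m c =>
    obtain ⟨C, h⟩ := exists_pow_mul_exp_neg_le ha m
    refine ⟨‖c‖ * C, fun x ↦ ?_⟩
    rw [Polynomial.eval_monomial, norm_mul, norm_pow, Complex.norm_real, Real.norm_eq_abs, mul_assoc]
    exact mul_le_mul_of_nonneg_left (h x) (norm_nonneg _)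

theorem norm_cexp_neg_pi_mul_sq (b : ℂ) (x : ℝ) :
    ‖Complex.exp (-Real.pi * b * x ^ 2)‖ = Real.exp (-(Real.pi * b.re * x ^ 2)) := by
  rw [Complex.norm_exp]
  congr 1
  have : (-Real.pi * b * x ^ 2 : ℂ) = ((-Real.pi * x ^ 2 : ℝ) : ℂ) * b := by
    push_cast
    ring
  rw [this, Complex.re_ofReal_mul]
  ring

theorem exists_iteratedDeriv_gaussian (b : ℂ) (n : ℕ) : ∃ P : Polynomial ℂ, ∀ x : ℝ,
    iteratedDeriv n (fun x : ℝ ↦ Complex.exp (-Real.pi * b * x ^ 2)) x =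
      P.eval (x : ℂ) * Complex.exp (-Real.pi * b * x ^ 2) := by
  induction n with
  | zero => exact ⟨1, fun x ↦ by simp⟩
  | succ n ih =>
    obtain ⟨P, hP⟩ := ih
    refine ⟨P.derivative + P * (Polynomial.C (-2 * Real.pi * b) * Polynomial.X), fun x ↦ ?_⟩
    rw [iteratedDeriv_succ, funext hP]
    have h1 : HasDerivAt (fun x : ℝ ↦ P.eval (x : ℂ)) (P.derivative.eval (x : ℂ)) x :=
      (P.hasDerivAt (x : ℂ)).comp_ofReal
    have h2 : HasDerivAt (fun x : ℝ ↦ Complex.exp (-Real.pi * b * x ^ 2))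
        (Complex.exp (-Real.pi * b * x ^ 2) * (-Real.pi * b * (2 * x))) x := by
      have h3 : HasDerivAt (fun x : ℂ ↦ -Real.pi * b * x ^ 2) (-Real.pi * b * (2 * x)) (x : ℂ) := by
        have := (hasDerivAt_pow 2 (x : ℂ)).const_mul (-Real.pi * b)
        simpa using this
      exact h3.cexp.comp_ofReal
    refine (HasDerivAt.deriv (h1.mul h2)).trans ?_
    simp only [Polynomial.eval_add, Polynomial.eval_mul, Polynomial.eval_C, Polynomial.eval_X]
    ring

/-- The Gaussian `exp (-π b x²)` as a Schwartz function. -/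
noncomputable def gaussianSchwartz (b : ℂ) (hb : 0 < b.re) : 𝓢(ℝ, ℂ) where
  toFun x := Complex.exp (-Real.pi * b * x ^ 2)
  smooth' := by
    apply ContDiff.cexp
    exact contDiff_const.mul (Complex.ofRealCLM.contDiff.pow 2)
  decay' k n := by
    obtain ⟨P, hP⟩ := exists_iteratedDeriv_gaussian b n
    obtain ⟨C, hC⟩ := exists_norm_eval_mul_exp_neg_le (mul_pos Real.pi_pos hb)
      (Polynomial.X ^ k * P)
    refine ⟨C, fun x ↦ ?_⟩
    rw [norm_iteratedFDeriv_eq_norm_iteratedDeriv, hP, norm_mul, norm_cexp_neg_pi_mul_sq, ← mul_assoc,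
      ← Complex.norm_real x, ← norm_pow, ← norm_mul]
    simpa using hC x

theorem gaussianSchwartz_apply (b : ℂ) (hb : 0 < b.re) (x : ℝ) :
    gaussianSchwartz b hb x = Complex.exp (-Real.pi * b * x ^ 2) := rfl

theorem integrable_besselSymbol_mul_exp (κ : ℝ) {a : ℝ} (ha : 0 < a) :
    Integrable fun ξ ↦ besselSymbol κ ξ * Real.exp (-(Real.pi * a * ξ ^ 2)) := by
  have hb : 0 < (a : ℂ).re := by simpa using ha
  have h := (𝓕 (schwartzBessel κ (𝓕⁻ (gaussianSchwartz a hb))) : 𝓢(ℝ, ℂ)).integrable (μ := volume)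
  refine h.norm.congr (ae_of_all _ fun ξ ↦ ?_)
  simp only
  rw [fourier_schwartzBessel, FourierTransform.fourier_fourierInv_eq, norm_mul, Complex.norm_real,
    Real.norm_of_nonneg (besselSymbol_pos κ ξ).le, gaussianSchwartz_apply, norm_cexp_neg_pi_mul_sq,
    Complex.ofReal_re]

theorem norm_fourierInv_gaussianSchwartz_le {b : ℂ} (hb : 0 < b.re) (hb1 : 1 ≤ ‖b‖) (x : ℝ) :
    ‖(𝓕⁻ (gaussianSchwartz b hb) : 𝓢(ℝ, ℂ)) x‖ ≤ Real.exp (-(Real.pi * b⁻¹.re * x ^ 2)) := by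
  have h := congrFun (fourier_gaussian_pi hb) (-x)
  have e : (𝓕⁻ (gaussianSchwartz b hb) : 𝓢(ℝ, ℂ)) x =
      1 / b ^ (1 / 2 : ℂ) * Complex.exp (-Real.pi * b⁻¹ * x ^ 2) := by
    rw [SchwartzMap.fourierInv_coe, Real.fourierInv_eq_fourier_neg]
    refine h.trans ?_
    congr 2
    push_cast
    ring
  have h1 : 1 ≤ ‖b ^ (1 / 2 : ℂ)‖ := by
    have h3 : ‖b ^ (1 / 2 : ℂ)‖ ^ 2 = ‖b‖ := by
      rw [← norm_pow]
      congr 1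
      simp
    by_contra! h4
    have : ‖b ^ (1 / 2 : ℂ)‖ ^ 2 < 1 := pow_lt_one₀ (norm_nonneg _) h4 two_ne_zero
    linarith
  rw [e, norm_mul, norm_cexp_neg_pi_mul_sq, norm_div, norm_one]
  exact mul_le_of_le_one_left (Real.exp_pos _).le (div_le_one_of_le₀ h1 (norm_nonneg _))

/-- The parameter of a Gaussian that focuses at time one. -/
noncomputable def focusParam (n : ℝ) : ℂ := ⟨(n ^ 2)⁻¹, 4 * Real.pi⟩

theorem focusParam_re_pos {n : ℝ} (hn : 0 < n) : 0 < (focusParam n).re := by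
  change 0 < (n ^ 2)⁻¹
  positivity

/-- The function whose evolution focuses at time one. -/
noncomputable def focusWave {n : ℝ} (hn : 0 < n) : 𝓢(ℝ, ℂ) :=
  𝓕⁻ (gaussianSchwartz (focusParam n) (focusParam_re_pos hn))

/-- The imaginary part 4π of the parameter yields precisely the inverse of the propagator at time
one; the real part n⁻² is a cut-off at frequency n. -/
theorem fourier_focusWave {n : ℝ} (hn : 0 < n) (ξ : ℝ) : (𝓕 (focusWave hn) : 𝓢(ℝ, ℂ)) ξ =
    unitExp (-(2 * Real.pi * ξ ^ 2)) * (Real.exp (-(Real.pi * (n ^ 2)⁻¹ * ξ ^ 2)) : ℝ) := by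
  rw [focusWave, FourierTransform.fourier_fourierInv_eq, gaussianSchwartz_apply, unitExp,
    Complex.ofReal_exp, ← Complex.exp_add]
  congr 1
  apply Complex.ext <;> simp [focusParam, sq]; ring

/-- At time zero the wave has height at most one and spreads over |y| of order n. Indeed Re b⁻¹ =
n⁻²/|b|² with |b|² ≤ 1 + 16π² ≤ 161, and √161 ≤ 13. -/
theorem lintegral_focusWave_rpow_le {n q : ℝ} (hn : 1 ≤ n) (hq : 1 ≤ q) :
    ∫⁻ y, ‖focusWave (by linarith : 0 < n) y‖ₑ ^ q ≤ ENNReal.ofReal (13 * n) := by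
  have hn0 : 0 < n := by linarith
  have hpi3 : 3 < Real.pi := Real.pi_gt_three
  have hpi : Real.pi ≤ 3.15 := Real.pi_lt_d2.le
  have hinv : (n ^ 2)⁻¹ ≤ 1 := inv_le_one_of_one_le₀ (one_le_pow₀ hn)
  have hinv0 : 0 < (n ^ 2)⁻¹ := by positivity
  have hns : Complex.normSq (focusParam n) = ((n ^ 2)⁻¹) ^ 2 + (4 * Real.pi) ^ 2 := by
    rw [Complex.normSq_apply]
    change (n ^ 2)⁻¹ * (n ^ 2)⁻¹ + 4 * Real.pi * (4 * Real.pi) = _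
    ring
  have hb1 : 1 ≤ ‖focusParam n‖ := by
    have := Complex.abs_im_le_norm (focusParam n)
    have h2 : |(focusParam n).im| = 4 * Real.pi := abs_of_pos (by positivity : 0 < 4 * Real.pi)
    linarith
  have hre : (161 * n ^ 2)⁻¹ ≤ (focusParam n)⁻¹.re := by
    rw [Complex.inv_re, hns, mul_inv]
    change _ ≤ (n ^ 2)⁻¹ / _
    rw [div_eq_inv_mul]
    refine mul_le_mul_of_nonneg_right (inv_anti₀ (by positivity) ?_) hinv0.le
    nlinarith
  have hpt : ∀ y, ‖focusWave hn0 y‖ₑ ^ q ≤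
      ENNReal.ofReal (Real.exp (-(q * Real.pi * (161 * n ^ 2)⁻¹) * y ^ 2)) := fun y ↦ by
    rw [← ofReal_norm, ENNReal.ofReal_rpow_of_nonneg (norm_nonneg _) (by linarith)]
    refine ENNReal.ofReal_le_ofReal ?_
    calc _ ≤ Real.exp (-(Real.pi * (161 * n ^ 2)⁻¹ * y ^ 2)) ^ q := by
          refine Real.rpow_le_rpow (norm_nonneg _)
            ((norm_fourierInv_gaussianSchwartz_le _ hb1 y).trans (Real.exp_le_exp.2 ?_))
            (by linarith)
          rw [neg_le_neg_iff]
          gcongr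
      _ = _ := by
          rw [← Real.exp_mul]
          congr 1
          ring
  refine (lintegral_mono hpt).trans ?_
  have hc : 0 < q * Real.pi * (161 * n ^ 2)⁻¹ := by positivity
  rw [← ofReal_integral_eq_lintegral_ofReal (integrable_exp_neg_mul_sq hc)
    (ae_of_all _ fun y ↦ (Real.exp_pos _).le), integral_gaussian]
  refine ENNReal.ofReal_le_ofReal (Real.sqrt_le_iff.2 ⟨by positivity, ?_⟩)
  have e : Real.pi / (q * Real.pi * (161 * n ^ 2)⁻¹) = 161 * n ^ 2 / q := by
    field_simp
  rw [e, div_le_iff₀ (by linarith)]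
  nlinarith [sq_nonneg n]

theorem besselSymbol_neg_eq (γ : ℝ) {n : ℝ} (hn : 0 < n) (ξ : ℝ) :
    besselSymbol (-γ) ξ =
      n ^ (-γ) * ((n ^ 2)⁻¹ + (2 * Real.pi * (ξ / n)) ^ 2) ^ (-γ / 2) := by
  have e : n ^ (-γ) = (n ^ 2) ^ (-γ / 2) := by
    rw [← Real.rpow_natCast n 2, ← Real.rpow_mul hn.le]
    congr 1
    push_cast
    ring
  rw [e, ← Real.mul_rpow (by positivity) (by positivity), besselSymbol, Real.norm_eq_abs, sq_abs]
  congr 1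
  field_simp

/-- Controls the phase error uniformly in n. In the variable η = ξ/n the symbol for γ > 0 becomes
singular at η = 0 as n grows; the factor η² of the squared phase compensates, since -γ/2 + 1 ≥ 0. -/
theorem besselSymbol_neg_mul_sq_le {γ : ℝ} (hγ : γ ≤ 1) {n : ℝ} (hn : 1 ≤ n) (ξ : ℝ) :
    besselSymbol (-γ) ξ * ((ξ / n) ^ 2 * (1 + (ξ / n) ^ 2)) ≤
      n ^ (-γ) * besselSymbol (|γ| + 4) (ξ / n) := by
  have hn0 : 0 < n := by linarith
  have hpi3 : 3 < Real.pi := Real.pi_gt_three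
  have hinv : (n ^ 2)⁻¹ ≤ 1 := inv_le_one_of_one_le₀ (one_le_pow₀ hn)
  have hinv0 : 0 < (n ^ 2)⁻¹ := by positivity
  rw [besselSymbol_neg_eq γ hn0, mul_assoc]
  refine mul_le_mul_of_nonneg_left ?_ (by positivity)
  set η := ξ / n
  have hY : η ^ 2 ≤ (2 * Real.pi * η) ^ 2 := by
    rw [mul_pow]
    exact le_mul_of_one_le_left (sq_nonneg _) (by nlinarith)
  rw [besselSymbol, Real.norm_eq_abs, sq_abs]
  set Y := (2 * Real.pi * η) ^ 2
  have hη0 : 0 ≤ η ^ 2 := sq_nonneg _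
  have hY0 : 0 ≤ Y := sq_nonneg _
  have hv0 : 0 < (n ^ 2)⁻¹ + Y := by positivity
  have e : (1 + Y) ^ ((|γ| + 4) / 2) = (1 + Y) ^ (|γ| / 2 + 1) * (1 + Y) := by
    rw [show (|γ| + 4) / 2 = |γ| / 2 + 1 + 1 by ring, Real.rpow_add_one (by positivity)]
  rw [e, ← mul_assoc]
  refine mul_le_mul ?_ (by linarith) (by positivity) (by positivity)
  rcases le_total γ 0 with h | h
  · rw [abs_of_nonpos h, Real.rpow_add_one (by positivity)]
    refine mul_le_mul (Real.rpow_le_rpow hv0.le (by linarith) (by linarith)) (by linarith)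
      hη0 (by positivity)
  · rw [abs_of_nonneg h]
    calc _ ≤ ((n ^ 2)⁻¹ + Y) ^ (-γ / 2) * ((n ^ 2)⁻¹ + Y) :=
          mul_le_mul_of_nonneg_left (by linarith) (by positivity)
      _ = ((n ^ 2)⁻¹ + Y) ^ (-γ / 2 + 1) := (Real.rpow_add_one hv0.ne' _).symm
      _ ≤ (1 + Y) ^ (-γ / 2 + 1) := Real.rpow_le_rpow hv0.le (by linarith) (by linarith)
      _ ≤ (1 + Y) ^ (γ / 2 + 1) := Real.rpow_le_rpow_of_exponent_le (by linarith) (by linarith)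

/-- A lower bound, in rescaled frequency, for the real part of the focusing integrand. -/
noncomputable def focusMinorant (γ c η : ℝ) : ℝ :=
  (161 ^ |γ / 2|)⁻¹ * Real.exp (-Real.pi) * (Set.Icc (1 / 2 : ℝ) 1).indicator (fun _ ↦ 1) η -
    1640 * c ^ 2 * (besselSymbol (|γ| + 4) η * Real.exp (-(Real.pi * 1 * η ^ 2)))

theorem integrable_focusMinorant (γ c : ℝ) : Integrable (focusMinorant γ c) := by
  unfold focusMinorant
  refine Integrable.sub (Integrable.const_mul ?_ _)
    ((integrable_besselSymbol_mul_exp _ one_pos).const_mul _)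
  exact (integrable_indicator_iff measurableSet_Icc).2 (integrableOn_const (by simp))

/-- The main term is independent of c and the phase error is O(c²), so a small c leaves a positive
integral. -/
theorem exists_integral_focusMinorant_pos (γ : ℝ) :
    ∃ c, 0 < c ∧ c ≤ 1 ∧ 0 < ∫ η, focusMinorant γ c η := by
  set a := (161 ^ |γ / 2|)⁻¹ * Real.exp (-Real.pi) with ha
  have ha0 : 0 < a := by positivity
  set J := ∫ η, besselSymbol (|γ| + 4) η * Real.exp (-(Real.pi * 1 * η ^ 2)) with hJ
  have h : ∀ c, ∫ η, focusMinorant γ c η = a / 2 - 1640 * c ^ 2 * J := fun c ↦ by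
    unfold focusMinorant
    rw [integral_sub, integral_const_mul, integral_const_mul, integral_indicator measurableSet_Icc,
      setIntegral_const, Real.volume_real_Icc_of_le (by norm_num), ← ha, ← hJ, smul_eq_mul]
    · ring
    · refine Integrable.const_mul ?_ _
      exact (integrable_indicator_iff measurableSet_Icc).2 (integrableOn_const (by simp))
    · exact (integrable_besselSymbol_mul_exp _ one_pos).const_mul _
  have hlim : Tendsto (fun c : ℝ ↦ a / 2 - 1640 * c ^ 2 * J) (𝓝[>] 0) (𝓝 (a / 2)) := by
    have : Continuous fun c : ℝ ↦ a / 2 - 1640 * c ^ 2 * J := by fun_prop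
    have h2 := this.tendsto 0
    simp only [ne_eq, OfNat.ofNat_ne_zero, not_false_eq_true, zero_pow, mul_zero, zero_mul,
      sub_zero] at h2
    exact h2.mono_left nhdsWithin_le_nhds
  obtain ⟨c, hc, hc1, hc2⟩ := ((hlim.eventually_const_lt (half_pos ha0)).and
    (Ioo_mem_nhdsGT one_pos)).exists
  exact ⟨c, hc1, hc2.le, by rwa [h]⟩

/-- For |x| ≤ c/n and |t-1| ≤ c/n² the phase is O(c) at frequencies of order n. About n such
frequencies add up coherently, each with symbol of order n^{-γ}. -/
theorem le_norm_oscInt_focusWave {γ : ℝ} (hγ : γ ≤ 1) {c : ℝ} (hc0 : 0 < c) {n : ℝ} (hn : 1 ≤ n)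
    {z : ℝ × ℝ} (hz : z ∈ rayTube 0 (c / n) (1 - c / n ^ 2) 1) :
    n ^ (1 - γ) * (∫ η, focusMinorant γ c η) ≤
      ‖oscInt (fun ξ ↦ besselSymbol (-γ) ξ *
        (𝓕 (focusWave (by linarith : 0 < n)) : 𝓢(ℝ, ℂ)) ξ) z.1 z.2‖ := by
  have hn0 : 0 < n := by linarith
  have hpi3 : 3 < Real.pi := Real.pi_gt_three
  have hpi : Real.pi ≤ 3.15 := Real.pi_lt_d2.le
  obtain ⟨hz1, hz2, hz3⟩ := hz
  rw [zero_mul, add_zero] at hz1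
  have hs : |z.2 - 1| ≤ c / n ^ 2 := abs_le.2 ⟨by linarith, by
    have : 0 ≤ c / n ^ 2 := by positivity
    linarith⟩
  have e : oscInt (fun ξ ↦ besselSymbol (-γ) ξ * (𝓕 (focusWave hn0) : 𝓢(ℝ, ℂ)) ξ) z.1 z.2 =
      ∫ ξ, unitExp (z.1 * ξ + 2 * Real.pi * (z.2 - 1) * ξ ^ 2) *
        ((besselSymbol (-γ) ξ * Real.exp (-(Real.pi * (n ^ 2)⁻¹ * ξ ^ 2)) : ℝ) : ℂ) := by
    rw [oscInt]
    refine integral_congr_ae (ae_of_all _ fun ξ ↦ ?_)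
    simp only
    rw [fourier_focusWave, show z.1 * ξ + 2 * Real.pi * (z.2 - 1) * ξ ^ 2 =
      (z.1 * ξ + 2 * Real.pi * z.2 * ξ ^ 2) + -(2 * Real.pi * ξ ^ 2) by ring,
      unitExp_add (z.1 * ξ + 2 * Real.pi * z.2 * ξ ^ 2)]
    push_cast
    ring
  have e2 : n ^ (1 - γ) * (∫ η, focusMinorant γ c η) =
      ∫ ξ, n ^ (-γ) * focusMinorant γ c (ξ / n) := by
    rw [integral_const_mul, Measure.integral_comp_div (focusMinorant γ c) n, abs_of_pos hn0,
      smul_eq_mul, ← mul_assoc, ← Real.rpow_add_one hn0.ne']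
    ring_nf
  rw [e, e2]
  refine integral_le_norm_integral_unitExp (by fun_prop)
    (integrable_besselSymbol_mul_exp _ (by positivity))
    (((integrable_focusMinorant γ c).comp_div hn0.ne').const_mul _) ?_
    (fun ξ ↦ mul_nonneg (besselSymbol_pos _ _).le (Real.exp_pos _).le)
  intro ξ
  set η := ξ / n with hη
  have hξ : ξ = n * η := by rw [hη]; field_simp
  have hexp : Real.exp (-(Real.pi * (n ^ 2)⁻¹ * ξ ^ 2)) = Real.exp (-(Real.pi * 1 * η ^ 2)) := by
    rw [hξ]
    congr 2
    field_simp
  rw [hexp]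
  set E := Real.exp (-(Real.pi * 1 * η ^ 2)) with hE
  have hE0 : 0 < E := Real.exp_pos _
  -- By (x+y)²/2 ≤ x² + y², with (2π)² ≤ 40 and (2π)⁴ ≤ 1600; their sum is 1640.
  have hphase : (2 * Real.pi * (z.1 * ξ + 2 * Real.pi * (z.2 - 1) * ξ ^ 2)) ^ 2 / 2 ≤
      1640 * c ^ 2 * (η ^ 2 * (1 + η ^ 2)) := by
    have h1 : (2 * Real.pi * (z.1 * ξ)) ^ 2 ≤ 40 * (c ^ 2 * η ^ 2) := by
      have h2 : (z.1 * n) ^ 2 ≤ c ^ 2 := by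
        rw [← sq_abs, abs_mul, abs_of_pos hn0]
        refine pow_le_pow_left₀ (by positivity) ?_ 2
        rwa [le_div_iff₀ hn0] at hz1
      have h3 : (2 * Real.pi) ^ 2 ≤ 40 := by nlinarith
      calc _ = (2 * Real.pi) ^ 2 * ((z.1 * n) ^ 2 * η ^ 2) := by rw [hξ]; ring
        _ ≤ _ := mul_le_mul h3 (mul_le_mul_of_nonneg_right h2 (sq_nonneg _)) (by positivity)
          (by norm_num)
    have h4 : (2 * Real.pi * (2 * Real.pi * (z.2 - 1) * ξ ^ 2)) ^ 2 ≤
        1600 * (c ^ 2 * (η ^ 2) ^ 2) := by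
      have h2 : ((z.2 - 1) * n ^ 2) ^ 2 ≤ c ^ 2 := by
        rw [← sq_abs, abs_mul, abs_of_pos (by positivity : 0 < n ^ 2)]
        refine pow_le_pow_left₀ (by positivity) ?_ 2
        rwa [le_div_iff₀ (by positivity)] at hs
      have h3 : ((2 * Real.pi) ^ 2) ^ 2 ≤ 1600 := by
        have : (2 * Real.pi) ^ 2 ≤ 40 := by nlinarith
        calc _ ≤ (40 : ℝ) ^ 2 := pow_le_pow_left₀ (by positivity) this 2
          _ = _ := by norm_num
      calc _ = ((2 * Real.pi) ^ 2) ^ 2 * (((z.2 - 1) * n ^ 2) ^ 2 * (η ^ 2) ^ 2) := by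
            rw [hξ]; ring
        _ ≤ _ := mul_le_mul h3 (mul_le_mul_of_nonneg_right h2 (sq_nonneg _)) (by positivity)
          (by norm_num)
    rw [mul_add]
    have h5 : 0 ≤ c ^ 2 * η ^ 2 := by positivity
    have h6 : 0 ≤ c ^ 2 * (η ^ 2) ^ 2 := by positivity
    nlinarith [sq_nonneg (2 * Real.pi * (z.1 * ξ) -
      2 * Real.pi * (2 * Real.pi * (z.2 - 1) * ξ ^ 2))]
  have hb := besselSymbol_pos (-γ) ξ
  have hI : n ^ (-γ) * ((161 ^ |γ / 2|)⁻¹ * Real.exp (-Real.pi) *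
      (Set.Icc (1 / 2 : ℝ) 1).indicator (fun _ ↦ 1) η) ≤ besselSymbol (-γ) ξ * E := by
    by_cases h : η ∈ Set.Icc (1 / 2 : ℝ) 1
    · rw [Set.indicator_of_mem h, mul_one, ← mul_assoc, mul_comm (n ^ (-γ))]
      have hη1 : η ^ 2 ≤ 1 := by nlinarith [h.1, h.2]
      have hη2 : 1 / 4 ≤ η ^ 2 := by nlinarith [h.1]
      have hpi2 : (2 * Real.pi) ^ 2 ≤ 40 := by nlinarith
      have hpi4 : 36 ≤ (2 * Real.pi) ^ 2 := by nlinarith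
      have e3 : (2 * Real.pi * ξ) ^ 2 = (2 * Real.pi) ^ 2 * (n ^ 2 * η ^ 2) := by
        rw [hξ]; ring
      have hn2 : 1 ≤ n ^ 2 := one_le_pow₀ hn
      refine mul_le_mul (le_besselSymbol_neg γ hn0 ?_ ?_) ?_ (Real.exp_pos _).le hb.le
      · rw [e3]
        have : 36 * (n ^ 2 * (1 / 4)) ≤ (2 * Real.pi) ^ 2 * (n ^ 2 * η ^ 2) := by gcongr
        linarith
      · rw [e3]
        have : (2 * Real.pi) ^ 2 * (n ^ 2 * η ^ 2) ≤ 40 * (n ^ 2 * 1) := by gcongr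
        linarith
      · rw [hE]
        refine Real.exp_le_exp.2 (neg_le_neg ?_)
        nlinarith
    · rw [Set.indicator_of_notMem h, mul_zero, mul_zero]
      positivity
  have hII := mul_le_mul_of_nonneg_right (besselSymbol_neg_mul_sq_le hγ hn ξ)
    (by positivity : 0 ≤ 1640 * c ^ 2 * E)
  rw [← hη] at hII
  have hIII := mul_le_mul_of_nonneg_right hphase (mul_pos hb hE0).le
  unfold focusMinorant
  rw [← hE, sub_mul, mul_sub, one_mul]
  linarith

/-- The plate has a = n⁻¹ and b = n⁻², volume of order n⁻³ and density n^{4-2α} or n^{3-α}. The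
amplitude n^{1-γ} to the power q, times these, must not exceed a multiple of n, the size of the
datum. -/
theorem FractalLocalSmoothingSchwartz.focus_le {α γ : ℝ} (hα₀ : 0 ≤ α) (hα₂ : α ≤ 2)
    {p : ℝ≥0∞} [Fact (1 ≤ p)] (hp : p ≠ ∞) (h : FractalLocalSmoothingSchwartz α p γ) :
    (if 1 ≤ α then 1 - 2 * α / p.toReal else 1 - (α + 1) / p.toReal) ≤ γ := by
  have hp1 : (1 : ℝ≥0∞) ≤ p := Fact.out
  have hp0 : p ≠ 0 := (lt_of_lt_of_le (by norm_num) hp1).ne'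
  obtain ⟨C, hC, hmain⟩ := h.exists_le_lintegral hα₀ hα₂ hp
  set q := p.toReal with hq
  have hq0 : 0 < q := ENNReal.toReal_pos hp0 hp
  have hq1 : 1 ≤ q := by
    have := ENNReal.toReal_mono hp hp1
    simpa using this
  -- The claimed lower bound is at most one, so γ > 1 is immediate; the focusing bound is available
  -- for γ ≤ 1.
  rcases lt_or_ge 1 γ with hγ | hγ
  · refine le_trans ?_ hγ.le
    split_ifs
    · have : 0 ≤ 2 * α / q := by positivity
      linarith
    · have : 0 ≤ (α + 1) / q := by positivity
      linarith
  obtain ⟨c, hc0, hc1, hI⟩ := exists_integral_focusMinorant_pos γ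
  set I := ∫ η, focusMinorant γ c η
  have hkey : ∀ n : ℕ, 1 ≤ n →
      (n : ℝ) ^ ((1 - γ) * q + (if 1 ≤ α then 4 - 2 * α else 3 - α)) ≤
      13 * C / (2 * c ^ 2 * I ^ q) * (n : ℝ) ^ (4 : ℝ) := by
    intro n hn
    have hn1 : (1 : ℝ) ≤ n := by exact_mod_cast hn
    have hn0 : (0 : ℝ) < n := by linarith
    have hc2 : c / (n : ℝ) ^ 2 ≤ 1 := div_le_one_of_le₀ (hc1.trans (one_le_pow₀ hn1)) (by positivity)
    have h1 := hmain (n : ℝ)⁻¹ ((n : ℝ) ^ 2)⁻¹ (by positivity)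
      (inv_anti₀ hn0 (by nlinarith))
      (rayTube 0 (c / n) (1 - c / (n : ℝ) ^ 2) 1) (measurableSet_rayTube _ _ _ _)
      (fun z hz ↦ by
        have h1 := hz.1
        rw [zero_mul, add_zero, div_eq_mul_inv] at h1
        refine h1.trans ?_
        exact mul_le_mul_of_nonneg_right (by linarith) (by positivity))
      (fun x ↦ by
        calc _ ≤ volume (Set.Icc (1 - c / (n : ℝ) ^ 2) 1) := measure_mono fun t ht ↦ ht.2
          _ = ENNReal.ofReal (c / (n : ℝ) ^ 2) := by rw [Real.volume_Icc, sub_sub_cancel]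
          _ ≤ _ := by
            rw [div_eq_mul_inv]
            exact ENNReal.ofReal_le_ofReal (mul_le_of_le_one_left (by positivity) hc1))
      (fun z hz ↦ ⟨by linarith [hz.2.1], hz.2.2⟩) (focusWave hn0) ((n : ℝ) ^ (1 - γ) * I)
      (by positivity) (fun z hz ↦ le_norm_oscInt_focusWave hγ hc0 hn1 hz)
    have h2 := h1.trans (mul_le_mul' le_rfl (lintegral_focusWave_rpow_le hn1 hq1))
    have hd := plateDensity_pos α (inv_pos.2 hn0) (inv_pos.2 (pow_pos hn0 2))
    rw [volume_rayTube, sub_sub_cancel, ← ENNReal.ofReal_mul (by positivity),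
      ← ENNReal.ofReal_mul (by positivity), ← ENNReal.ofReal_mul hC.le,
      ENNReal.ofReal_le_ofReal_iff (by positivity), Real.mul_rpow (by positivity) hI.le,
      ← Real.rpow_mul hn0.le] at h2
    have e2 : plateDensity α (n : ℝ)⁻¹ ((n : ℝ) ^ 2)⁻¹ =
        (n : ℝ) ^ (if 1 ≤ α then 4 - 2 * α else 3 - α) := by
      unfold plateDensity
      split_ifs
      · rw [Real.inv_rpow (by positivity), ← Real.rpow_neg (by positivity), ← Real.rpow_natCast,
          ← Real.rpow_mul hn0.le]
        congr 1
        push_cast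
        ring
      · rw [inv_inv, Real.inv_rpow hn0.le, ← Real.rpow_neg hn0.le, ← Real.rpow_natCast,
          ← Real.rpow_add hn0]
        congr 1
        push_cast
        ring
    rw [e2] at h2
    have h4 : (n : ℝ) ^ (4 : ℝ) = (n : ℝ) ^ 4 := by exact_mod_cast Real.rpow_natCast (n : ℝ) 4
    rw [Real.rpow_add hn0, h4, div_mul_eq_mul_div, le_div_iff₀ (by positivity)]
    have h5 := mul_le_mul_of_nonneg_right h2 (by positivity : 0 ≤ (n : ℝ) ^ 3)
    calc _ = (n : ℝ) ^ ((1 - γ) * q) * I ^ q * (n : ℝ) ^ (if 1 ≤ α then 4 - 2 * α else 3 - α) *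
          (2 * (c / n) * (c / (n : ℝ) ^ 2)) * (n : ℝ) ^ 3 := by
          field_simp
      _ ≤ _ := h5
      _ = _ := by ring
  have h2 := le_of_forall_natCast_rpow_le hkey
  split_ifs at h2 ⊢
  · rw [sub_le_comm, le_div_iff₀ hq0]
    linarith
  · rw [sub_le_comm, le_div_iff₀ hq0]
    linarith

theorem mainTheorem3 (α : ℝ) (hα₀ : 0 ≤ α) (hα₂ : α ≤ 2) (p : ℝ≥0∞) [Fact (1 ≤ p)]
    (hp : p ≠ ∞) (γ : ℝ) :
    (2 ≤ p → p ≤ 4 →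
      (if 1 ≤ α then (2 - α) / 2 else (2 - α) / 2 + (α - 1) / p.toReal) < γ →
      FractalLocalSmoothing α p γ) ∧
    (FractalLocalSmoothingSchwartz α p γ →
      (if 1 ≤ α then max (1 - 2 * α / p.toReal) ((2 - α) / p.toReal)
        else max (1 - (α + 1) / p.toReal) (α / p.toReal)) ≤ γ) := by
  refine ⟨fun hp₂ hp₄ hγ ↦ fractalLocalSmoothing_of_lt hα₂ hp₂ hp₄ hγ, fun h ↦ ?_⟩
  have h1 := h.tube_le hα₀ hα₂ hp
  have h2 := h.focus_le hα₀ hα₂ hp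
  split_ifs at h1 h2 ⊢
  · exact max_le h2 h1
  · exact max_le h2 h1
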